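/- **Setting.** Let $\varepsilon_{ijk}$ ($0\le i,j,k\le 3$) be the totally antisymmetric symbol on $\{1,2,3\}$ with $\varepsilon_{123}=1$, extended by $0$ if an index is $0$. Let $\mathfrak g\oplus\mathfrak t^2$ be the 8-dimensional real Lie algebra with basis $\beta_i,\alpha^i$ ($0\le i\le 3$), only non-zero brackets $[\beta_i,\beta_j]=\varepsilon_{ijk}\alpha^k$, and invariant pairing $(\beta_i,\alpha^j)=\delta_i^j$, $(\alpha^i,\alpha^j)=(\beta_i,\beta_j)=0$. *Targets.* $Y=\mathbb Z^4\backslash\mathbb R^4$ is the torus with flux $H=dx^1dx^2dx^3$, and $TY\oplus T^*Y$ is framed by $\beta_i=\partial_{x^i}$, $\alpha^i=dx^i$. On $\mathbb R\times \mathrm{Heis}=\mathbb R^4$ use coordinates $y^0,\dots,y^3$ in which the product is addition, except that $(y\tilde y)^2=y^2+\tilde y^2+\frac12(y^1\tilde y^3-y^3\tilde y^1)$; let $\mathrm{Heis}(\mathbb Z)=\{y^1,y^3,\,y^2+\frac12y^1y^3\in\mathbb Z\}$ (integer unitriangular matrices) and $N=(\mathbb Z\times \mathrm{Heis}(\mathbb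 Z))\backslash(\mathbb R\times \mathrm{Heis})$, with flux $H=0$. $TN\oplus T^*N$ is framed by $\beta_0=\partial_{y^0}$, $\beta_1=\partial_{y^1}-\frac12y^3\partial_{y^2}$, $\beta_2=-(dy^2-\frac12y^1dy^3+\frac12y^3dy^1)$, $\beta_3=\partial_{y^3}+\frac12y^1\partial_{y^2}$, $\alpha^0=dy^0$, $\alpha^1=dy^1$, $\alpha^2=-\partial_{y^2}$, $\alpha^3=dy^3$. *Generalized Calabi–Yau structures.* An equivariant generalized complex structure on a target is an endomorphism field $\mathscr J$ of $T\oplus T^*$, induced by a left-invariant one on the group $\mathbb R^4$ (for $Y$) or $\mathbb R\times\mathrm{Heis}$ (for $N$), which is orthogonal for the natural pairing, satisfies $\mathscr J^2=-1$, and whose $\sqrt{-1}$-eigenbundle is involutive for the $H$-twisted Dorfman bracket $[X+\xi,X'+\xi']=[X,X']+L_X\xi'-\iota_{X'}d\xi+H(X,X',\cdot)$. It is generalized Calabi–Yau if there is a nowhere vanishing invariant complex form $\rho$, annihilated by the $\sqrt{-1}$-eigenbundle under Clifford action, with $d\rho+H\wedge\rho=0$. In the frame, the $\pm\sqrt{-1}$-eigenspaces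 are subspaces $\mathfrak l,\bar{\mathfrak l}$ of $(\mathfrak g\oplus\mathfrak t^2)\otimes\mathbb C$. *Zero modes.* For $Y$: families $f=(f_\omega)_{\omega\in\mathbb Z^4}$ of functions on $\mathbb R^4$ with $$f_\omega(x+\lambda)=e^{\pi\sqrt{-1}\,(\omega^1\lambda^2\lambda^3+\omega^2\lambda^1\lambda^3+\omega^3\lambda^1\lambda^2+\varepsilon_{ijk}\lambda^ix^j\omega^k)}f_\omega(x),\qquad\lambda\in\mathbb Z^4,$$ i.e. sections of a line bundle $L_\omega$ on $Y$ with first Chern class $\iota_\omega H$; $\beta_i$ acts as $\partial_{x^i}+\pi\sqrt{-1}\,\varepsilon_{ijk}x^j\omega^k$ and $\alpha^i$ as $-2\pi\sqrt{-1}\,\omega^i$. For $N$: families $f=(f_\gamma)_{\gamma\in\pi_1(N)}$ of functions on $\mathbb R\times \mathrm{Heis}$ with $f_{\delta\gamma\delta^{-1}}(\delta y)=f_\gamma(y)$ for $\delta\in\pi_1(N)=\mathbb Z\times \mathrm{Heis}(\mathbb Z)$, so that for each conjugacy class one has a function on the quotient of $\mathbb R\times\mathrm{Heis}$ by a centralizer;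 the left-invariant vector fields in the frame act as derivations, and a left-invariant form with value $\sum_i\xi_idy^i$ at the identity acts as multiplication by $-2\pi\sqrt{-1}\sum_i\xi_i\,m_i(y^{-1}\gamma y)$, where $m(y)=(y^0,y^1,y^2+\frac12y^1y^3,y^3)$. In both cases the inner product is $\sum\int_{[0,1]^4}\bar f g$ (sum over $\omega$, resp. $\gamma$), and $\mathcal Z_Y,\mathcal Z_N$ are the spaces of smooth vectors: those families which, after application of any product of basis vectors of $\mathfrak g\oplus\mathfrak t^2$, are smooth, equivariant, bounded and square integrable. *State spaces.* Let $\mathcal A$ be the associative algebra generated by $u_n$ ($n\in\mathbb Z$) and $\bar u_r$ ($r\in\frac12+\mathbb Z$), linear in $u\in(\mathfrak g\oplus\mathfrak t^2)\otimes\mathbb C$, with relations $[u_m,v_n]=[u,v]_{m+n}+m(u,v)\delta_{m+n,0}$, $[u_m,\bar v_r]=\overline{[u,v]}_{m+r}$, $\{\bar u_r,\bar v_s\}=(u,v)\delta_{r+s,0}$ (the modes of the currents of $V((\mathfrak g\oplus\mathfrak t^2)_{\rm super})$). Let $\mathscr H_Y$, $\mathscr H_N$ be the $\mathcal A$-modules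 induced from $\mathcal Z_Y$, $\mathcal Z_N$, where modes of positive degree act by zero and $u_0$ acts by the action of $u$ above. They are $\mathbb Z/2$-graded by the number of fermionic modes. Fix the ordering on pairs (degree, basis vector) under which a mode of degree closer to $0$ comes first, and at equal degree $\beta_0,\dots,\beta_3,\alpha^0,\dots,\alpha^3$. In the Hermitian inner product the ordered monomials in the modes of negative degree of the basis vectors (bosons, then fermions), applied to zero modes, are orthogonal, a monomial containing $k$ times a boson of degree $-n$ multiplying the squared norm of the zero mode by $n^kk!$ for each boson. $\overline{\mathscr H}_Y$, $\overline{\mathscr H}_N$ are the Hilbert space completions. *$N=2$ structures.* An $N=2$ super-conformal structure of central charge $c$ on a vector space consists of endomorphisms $L_n,J_n$ ($n\in\mathbb Z$), $G^\pm_r$ ($r\in\frac12+\mathbb Z$), each vector being annihilated by all modes of sufficiently large degree, with $[L_m,L_n]=(m-n)L_{m+n}+\frac c{12}(m^3-m)\delta_{m+n,0}$, $[L_m,J_n]=-nJ_{m+n}$, $[L_m,G^\pm_r]=(\frac m2-r)G^\pm_{m+r}$, $[J_m,J_n]=\frac c3m\,\delta_{m+n,0}$, $[J_m,G^\pm_r]=\pm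 G^\pm_{m+r}$, $\{G^\pm_r,G^\pm_s\}=0$, $\{G^+_r,G^-_s\}=L_{r+s}+\frac{r-s}2J_{r+s}+\frac c6(r^2-\frac14)\delta_{r+s,0}$. For $\mathscr J$ as above, the attached structure on $\mathscr H_Y$ (resp. $\mathscr H_N$) is the one of central charge $12$ generated by the super-field $J(z)+\theta(G^-(z)-G^+(z))=\sum_i\bar e^i\bar e_i$, where $e_i$, $e^i$ are dual bases of $\mathfrak l$, $\bar{\mathfrak l}$; that is, $J(z)=\sum_i{:}\bar e^i(z)\bar e_i(z){:}$ and $G^-(z)-G^+(z)=\sum_i\big({:}e^i(z)\bar e_i(z){:}-{:}\bar e^i(z)e_i(z){:}\big)$, for all such dual bases. **Theorem.** (a) There is an $\mathcal A$-linear, parity preserving isomorphism $T:\mathscr H_Y\to\mathscr H_N$ that extends to a unitary isomorphism $\overline{\mathscr H}_Y\to\overline{\mathscr H}_N$ and restricts to a $(\mathfrak g\oplus\mathfrak t^2)\otimes\mathbb C$-equivariant isomorphism $\mathcal Z_Y\to\mathcal Z_N$ preserving inner products. (b) There is a bijection $\Phi$ from the set of $\mathbb R^4$-equivariant generalized Calabi–Yau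 structures on $Y$ to the set of $(\mathbb R\times\mathrm{Heis})$-equivariant generalized Calabi–Yau structures on $N$, such that $\mathscr J$ and $\Phi(\mathscr J)$ have the same matrix in the frames above. (c) For every $\mathbb R^4$-equivariant generalized Calabi–Yau structure $\mathscr J$ on $Y$, there are $N=2$ super-conformal structures of central charge $12$ attached to $\mathscr J$ on $\mathscr H_Y$ and to $\Phi(\mathscr J)$ on $\mathscr H_N$, and $T$ intertwines them. -/

import Mathlib

open scoped ContDiff Matrix TensorProduct ENNReal
open MeasureTheory

noncomputable section

namespace MirrorKT

/-! ## The Lie algebra of the doubled geometry -/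

/-- Coordinates on the universal covers of both targets. -/
abbrev R4 := Fin 4 → ℝ

/-- Labels of winding sectors. -/
abbrev Z4 := Fin 4 → ℤ

/-- Index set of the basis: `inl i` stands for `β_i`, `inr i` stands for `α^i`.  The same index set
labels coordinates on `T ⊕ T^*`: `inl i` for `∂_i` and `inr i` for `dx^i`. -/
abbrev Ix := Fin 4 ⊕ Fin 4

/-- The complexification of the 8-dimensional real Lie algebra `g ⊕ t²`. -/
abbrev GC := Ix → ℂ

/-- The totally antisymmetric symbol on `{1,2,3}`, extended by `0` when an index is `0`. -/
def eps (i j k : Fin 4) : ℤ :=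
  if (i, j, k) = (1, 2, 3) ∨ (i, j, k) = (2, 3, 1) ∨ (i, j, k) = (3, 1, 2) then 1
  else if (i, j, k) = (2, 1, 3) ∨ (i, j, k) = (3, 2, 1) ∨ (i, j, k) = (1, 3, 2) then -1
  else 0

/-- The Lie bracket of `g ⊕ t²`: `[β_i, β_j] = ε_{ijk} α^k`, all other brackets vanish. -/
def br (u v : GC) : GC :=
  Sum.elim (fun _ => 0) fun k => ∑ i, ∑ j, (eps i j k : ℂ) * u (.inl i) * v (.inl j)

/-- The invariant symmetric pairing `(β_i, α^j) = δ_i^j`. -/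
def pairing (u v : GC) : ℂ :=
  ∑ i, (u (.inl i) * v (.inr i) + u (.inr i) * v (.inl i))

/-! ## Generalized geometry on a quotient of a 4-dimensional group

Tensors on a quotient `Γ \ G` are `Γ`-invariant tensors on `G`; the equivariant ones are those coming
from left-invariant tensors on `G`.  `G` is `R4` with a multiplication in global coordinates. -/

/-- A target: a group law on `R4`, the coefficient `h` of the background 3-form `h dx¹∧dx²∧dx³`, and a
left-invariant frame of `T ⊕ T^*` (columns of a matrix in the coordinate frame `∂_i, dx^i`). -/
structure Target where
  mul : R4 → R4 → R4
  flux : ℝ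
  frame : R4 → Matrix Ix Ix ℝ

/-- Partial derivative in the direction of the `i`-th coordinate. -/
def pd {E : Type*} [NormedAddCommGroup E] [NormedSpace ℝ E] (i : Fin 4) (f : R4 → E) (p : R4) : E :=
  fderiv ℝ f p (Pi.single i 1)

/-- The twisted Dorfman bracket of complex sections of `T ⊕ T^*`,
`[X + ξ, Y + η] = [X, Y] + L_X η - ι_Y dξ + H(X, Y, ·)` with `H = h dx¹∧dx²∧dx³`. -/
def dorfman (h : ℝ) (s t : R4 → GC) (p : R4) : GC :=
  Sum.elim
    (fun j => ∑ i, (s p (.inl i) * pd i (fun q => t q (.inl j)) p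
      - t p (.inl i) * pd i (fun q => s q (.inl j)) p))
    (fun j => ∑ i, (s p (.inl i) * pd i (fun q => t q (.inr j)) p
        + t p (.inr i) * pd j (fun q => s q (.inl i)) p)
      - ∑ i, t p (.inl i) * (pd i (fun q => s q (.inr j)) p - pd j (fun q => s q (.inr i)) p)
      + h * ∑ a, ∑ b, (eps a b j : ℂ) * s p (.inl a) * t p (.inl b))

/-- Complex exterior forms at a point, by their coefficients on `dx^I`, with `I` increasing. -/
abbrev Form := Finset (Fin 4) → ℂ

/-- The sign of moving `dx^i` to its place in `dx^I`. -/
def sgn (i : Fin 4) (I : Finset (Fin 4)) : ℂ := (-1) ^ (I.filter (· < i)).card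

/-- `φ ↦ dx^i ∧ φ`. -/
def wedge (i : Fin 4) (φ : Form) : Form := fun I => if i ∈ I then sgn i I * φ (I.erase i) else 0

/-- Contraction with `∂_i`. -/
def contract (i : Fin 4) (φ : Form) : Form :=
  fun I => if i ∈ I then 0 else sgn i I * φ (insert i I)

/-- The Clifford action `(X + ξ) · φ = ι_X φ + ξ ∧ φ`. -/
def clifford (v : GC) (φ : Form) : Form :=
  ∑ i, (v (.inl i) • contract i φ + v (.inr i) • wedge i φ)

/-- The twisted de Rham differential `d + H ∧`. -/
def twistedD (h : ℝ) (φ : R4 → Form) (p : R4) : Form :=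
  ∑ i, wedge i (pd i φ p) + (h : ℂ) • wedge 1 (wedge 2 (wedge 3 (φ p)))

/-- The wedge product of a list of covectors. -/
def wedgeList (l : List R4) : Form :=
  l.foldr (fun ξ φ => ∑ j, (ξ j : ℂ) • wedge j φ) (Pi.single ∅ 1)

/-- Pull-back of a form along a linear map with matrix `D`. -/
def pullForm (D : Matrix (Fin 4) (Fin 4) ℝ) (φ : Form) : Form :=
  ∑ I : Finset (Fin 4), φ I • wedgeList ((I.sort (· ≤ ·)).map fun i => D i)

/-- The Jacobian matrix at `p` of left translation by `g`. -/
def Target.jac (M : Target) (g p : R4) : Matrix (Fin 4) (Fin 4) ℝ :=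
  Matrix.of fun i j => fderiv ℝ (M.mul g) p (Pi.single j 1) i

/-- The action of left translation by `g` from `(T ⊕ T^*)_p` to `(T ⊕ T^*)_{gp}`. -/
def Target.push (M : Target) (g p : R4) : Matrix Ix Ix ℝ :=
  Matrix.fromBlocks (M.jac g p) 0 0 ((M.jac g p)⁻¹)ᵀ

/-- The complex-linear extension of an endomorphism of `T ⊕ T^*`. -/
def cplx (A : Matrix Ix Ix ℝ) : Matrix Ix Ix ℂ := A.map fun x => (x : ℂ)

/-- Equivariant generalized complex structures.  (Smoothness follows from equivariance.) -/
structure IsEquivariantGC (M : Target) (𝒥 : R4 → Matrix Ix Ix ℝ) : Prop where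
  sq : ∀ p, 𝒥 p * 𝒥 p = -1
  orthogonal : ∀ p, (𝒥 p)ᵀ * Matrix.fromBlocks 0 1 1 0 * 𝒥 p = Matrix.fromBlocks 0 1 1 0
  equivariant : ∀ g p, 𝒥 (M.mul g p) * M.push g p = M.push g p * 𝒥 p
  /-- The `√-1`-eigenbundle is involutive. -/
  integrable : ∀ s t : R4 → GC, ContDiff ℝ ∞ s → ContDiff ℝ ∞ t →
    (∀ p, cplx (𝒥 p) *ᵥ s p = Complex.I • s p) → (∀ p, cplx (𝒥 p) *ᵥ t p = Complex.I • t p) →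
    ∀ p, cplx (𝒥 p) *ᵥ dorfman M.flux s t p = Complex.I • dorfman M.flux s t p

/-- Equivariant generalized Calabi-Yau structures: the canonical line bundle (forms annihilated by the
`√-1`-eigenbundle) has a nowhere vanishing equivariant section closed under `d + H ∧`. -/
structure IsEquivariantGCY (M : Target) (𝒥 : R4 → Matrix Ix Ix ℝ) : Prop
    extends IsEquivariantGC M 𝒥 where
  spinor : ∃ ρ : R4 → Form, ContDiff ℝ ∞ ρ ∧ (∀ p, ρ p ≠ 0) ∧
    (∀ p v, cplx (𝒥 p) *ᵥ v = Complex.I • v → clifford v (ρ p) = 0) ∧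
    (∀ g p, pullForm (M.jac g p) (ρ (M.mul g p)) = ρ p) ∧
    ∀ p, twistedD M.flux ρ p = 0

/-- The set of equivariant generalized Calabi-Yau structures on a target. -/
def GCY (M : Target) : Type := {𝒥 : R4 → Matrix Ix Ix ℝ // IsEquivariantGCY M 𝒥}

/-- `𝒥` has the constant matrix `A` in the frame of the target. -/
def HasFrameMatrix (M : Target) (𝒥 : R4 → Matrix Ix Ix ℝ) (A : Matrix Ix Ix ℝ) : Prop :=
  ∀ p, 𝒥 p * M.frame p = M.frame p * A

/-- `e` and `e'` are dual bases of the `√-1`-eigenspace `𝔩` and the `-√-1`-eigenspace `𝔩̄` of `𝒥` on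
`(g ⊕ t²) ⊗ ℂ`, which is identified with the fibres of `(T ⊕ T^*) ⊗ ℂ` by the frame. -/
structure IsDualBasis (M : Target) (𝒥 : R4 → Matrix Ix Ix ℝ) (e e' : Fin 4 → GC) : Prop where
  mem : ∀ i p, cplx (𝒥 p) *ᵥ (cplx (M.frame p) *ᵥ e i) = Complex.I • (cplx (M.frame p) *ᵥ e i)
  mem' : ∀ i p, cplx (𝒥 p) *ᵥ (cplx (M.frame p) *ᵥ e' i)
    = -(Complex.I • (cplx (M.frame p) *ᵥ e' i))
  dual : ∀ i j, pairing (e' i) (e j) = if i = j then 1 else 0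

/-- The torus `Y = ℤ⁴ \ ℝ⁴` with flux `dx¹∧dx²∧dx³` and the frame `β_i = ∂_i`, `α^i = dx^i`. -/
def targetY : Target where
  mul := fun g p => g + p
  flux := 1
  frame := fun _ => 1

/-- Multiplication of `ℝ × Heis`; the inverse of `y` is `-y`. -/
def kmul (y z : R4) : R4 :=
  ![y 0 + z 0, y 1 + z 1, y 2 + z 2 + (y 1 * z 3 - y 3 * z 1) / 2, y 3 + z 3]

/-- The frame of `(T ⊕ T^*)N`:
`β_0 = ∂_0`, `β_1 = ∂_1 - y³∂_2/2`, `β_2 = -(dy² - y¹dy³/2 + y³dy¹/2)`, `β_3 = ∂_3 + y¹∂_2/2`,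
`α^0 = dy⁰`, `α^1 = dy¹`, `α^2 = -∂_2`, `α^3 = dy³`. -/
def frameN (y : R4) : Matrix Ix Ix ℝ := Matrix.of fun a b =>
  Sum.elim
    (![Sum.elim ![1, 0, 0, 0] ![0, 0, 0, 0],
       Sum.elim ![0, 1, -(y 3) / 2, 0] ![0, 0, 0, 0],
       Sum.elim ![0, 0, 0, 0] ![0, -(y 3) / 2, -1, y 1 / 2],
       Sum.elim ![0, 0, y 1 / 2, 1] ![0, 0, 0, 0]] : Fin 4 → Ix → ℝ)
    (![Sum.elim ![0, 0, 0, 0] ![1, 0, 0, 0],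
       Sum.elim ![0, 0, 0, 0] ![0, 1, 0, 0],
       Sum.elim ![0, 0, -1, 0] ![0, 0, 0, 0],
       Sum.elim ![0, 0, 0, 0] ![0, 0, 0, 1]] : Fin 4 → Ix → ℝ) b a

/-- The nilmanifold `N = (ℤ × Heis(ℤ)) \ (ℝ × Heis)`, without flux. -/
def targetN : Target where
  mul := kmul
  flux := 0
  frame := frameN

/-! ## Zero modes

A zero mode is a family of functions on `R4` indexed by the winding, with an equivariance property
under the lattice. -/

abbrev Amb := Z4 → R4 → ℂ

/-- `conj`, `act`, `phase`: the lattice acts on windings and on points, and zero modes satisfy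
`f_{conj δ γ}(act δ p) = phase δ γ p * f_γ(p)`.  `vec`, `pot`: the basis vector `b` of `g ⊕ t²` acts as
the derivative along the vector field `vec b` plus multiplication by `pot b`. -/
structure ZeroModeData where
  conj : Z4 → Z4 → Z4
  act : Z4 → R4 → R4
  phase : Z4 → Z4 → R4 → ℂ
  vec : Ix → R4 → R4
  pot : Ix → Z4 → R4 → ℂ

/-- The action of a basis vector. -/
def ZeroModeData.op (D : ZeroModeData) (b : Ix) (f : Amb) : Amb :=
  fun γ p => fderiv ℝ (f γ) p (D.vec b p) + D.pot b γ p * f γ p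

/-- The measure on pairs (winding, point): counting measure times Lebesgue measure on the unit cube,
a fundamental domain for the lattice of each of the two targets. -/
def zmMeasure : Measure (Z4 × R4) :=
  (Measure.count : Measure Z4).prod ((volume : Measure R4).restrict (Set.Icc 0 1))

/-- Smooth, equivariant, bounded and square integrable families. -/
structure ZeroModeData.Good (D : ZeroModeData) (f : Amb) : Prop where
  smooth : ∀ γ, ContDiff ℝ ∞ (f γ)
  equivariant : ∀ δ γ p, f (D.conj δ γ) (D.act δ p) = D.phase δ γ p * f γ p
  bounded : ∃ C : ℝ, ∀ γ p, ‖f γ p‖ ≤ C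
  memLp : MemLp (fun x : Z4 × R4 => f x.1 x.2) 2 zmMeasure

/-- A product of basis vectors acting on a family. -/
def ZeroModeData.word (D : ZeroModeData) (w : List Ix) (f : Amb) : Amb := w.foldr D.op f

variable (D : ZeroModeData)

theorem ZeroModeData.op_add {f g : Amb} (hf : D.Good f) (hg : D.Good g) (b : Ix) :
    D.op b (f + g) = D.op b f + D.op b g := by
  funext γ p
  have h1 : DifferentiableAt ℝ (f γ) p := ((hf.smooth γ).differentiable (by simp)).differentiableAt
  have h2 : DifferentiableAt ℝ (g γ) p := ((hg.smooth γ).differentiable (by simp)).differentiableAt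
  have : fderiv ℝ ((f + g) γ) p = fderiv ℝ (f γ) p + fderiv ℝ (g γ) p := fderiv_add h1 h2
  change fderiv ℝ ((f + g) γ) p (D.vec b p) + D.pot b γ p * (f γ p + g γ p) =
    (fderiv ℝ (f γ) p (D.vec b p) + D.pot b γ p * f γ p)
      + (fderiv ℝ (g γ) p (D.vec b p) + D.pot b γ p * g γ p)
  rw [this, add_apply]
  ring

theorem ZeroModeData.op_smul {f : Amb} (hf : D.Good f) (c : ℂ) (b : Ix) :
    D.op b (c • f) = c • D.op b f := by
  funext γ p
  have h1 : DifferentiableAt ℝ (f γ) p := ((hf.smooth γ).differentiable (by simp)).differentiableAt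
  have : fderiv ℝ ((c • f) γ) p = c • fderiv ℝ (f γ) p := fderiv_const_smul h1 c
  change fderiv ℝ ((c • f) γ) p (D.vec b p) + D.pot b γ p * (c * f γ p) =
    c * (fderiv ℝ (f γ) p (D.vec b p) + D.pot b γ p * f γ p)
  rw [this, smul_apply, smul_eq_mul]
  ring

theorem ZeroModeData.word_add {f g : Amb} (hf : ∀ w, D.Good (D.word w f))
    (hg : ∀ w, D.Good (D.word w g)) (w : List Ix) :
    D.word w (f + g) = D.word w f + D.word w g := by
  induction w with
  | nil => rfl
  | cons b w ih =>
    change D.op b (D.word w (f + g)) = _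
    rw [ih, D.op_add (hf w) (hg w)]
    rfl

theorem ZeroModeData.word_smul {f : Amb} (hf : ∀ w, D.Good (D.word w f)) (c : ℂ) (w : List Ix) :
    D.word w (c • f) = c • D.word w f := by
  induction w with
  | nil => rfl
  | cons b w ih =>
    change D.op b (D.word w (c • f)) = _
    rw [ih, D.op_smul (hf w)]
    rfl

/-- The smooth vectors: every product of basis vectors maps the family to a smooth, equivariant,
bounded and square integrable one. -/
def ZeroModes : Submodule ℂ Amb where
  carrier := {f | ∀ w, D.Good (D.word w f)}
  zero_mem' := by
    intro w
    have h0 : D.word w 0 = 0 := by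
      induction w with
      | nil => rfl
      | cons b w ih =>
        change D.op b (D.word w 0) = 0
        rw [ih]
        funext γ p
        simp [ZeroModeData.op]
    rw [h0]
    exact ⟨fun _ => contDiff_const, fun _ _ _ => by simp, ⟨0, fun _ _ => by simp⟩, MemLp.zero⟩
  add_mem' := by
    intro f g hf hg w
    rw [D.word_add hf hg]
    obtain ⟨C, hC⟩ := (hf w).bounded
    obtain ⟨C', hC'⟩ := (hg w).bounded
    refine ⟨fun γ => ((hf w).smooth γ).add ((hg w).smooth γ), fun δ γ p => ?_,
      ⟨C + C', fun γ p => (norm_add_le _ _).trans (add_le_add (hC γ p) (hC' γ p))⟩,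
      (hf w).memLp.add (hg w).memLp⟩
    simp only [Pi.add_apply, (hf w).equivariant, (hg w).equivariant]
    ring
  smul_mem' := by
    intro c f hf w
    rw [D.word_smul hf]
    obtain ⟨C, hC⟩ := (hf w).bounded
    refine ⟨fun γ => ((hf w).smooth γ).const_smul c, fun δ γ p => ?_,
      ⟨‖c‖ * C, fun γ p => ?_⟩, (hf w).memLp.const_smul c⟩
    · simp only [Pi.smul_apply, (hf w).equivariant, smul_eq_mul]
      ring
    · simp only [Pi.smul_apply, smul_eq_mul, norm_mul]
      exact mul_le_mul_of_nonneg_left (hC γ p) (norm_nonneg _)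

/-- The action of a basis vector on smooth vectors. -/
def rhoBasis (b : Ix) : ZeroModes D →ₗ[ℂ] ZeroModes D where
  toFun f := ⟨D.op b f.1, fun w => by
    have h := f.2 (w ++ [b])
    simpa [ZeroModeData.word, List.foldr_append] using h⟩
  map_add' f g := Subtype.ext (D.op_add (f.2 []) (g.2 []) b)
  map_smul' c f := Subtype.ext (D.op_smul (f.2 []) c b)

/-- The representation of `(g ⊕ t²) ⊗ ℂ` on zero modes. -/
def rho (u : GC) : ZeroModes D →ₗ[ℂ] ZeroModes D := ∑ b, u b • rhoBasis D b

/-- The inclusion of the smooth vectors in the Hilbert space of square integrable zero modes. -/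
def zmToLp : ZeroModes D →ₗ[ℂ] Lp ℂ 2 zmMeasure where
  toFun f := (f.2 []).memLp.toLp _
  map_add' f g := MemLp.toLp_add (f.2 []).memLp (g.2 []).memLp
  map_smul' c f := MemLp.toLp_const_smul c (f.2 []).memLp

/-! ### The zero modes of `Y`

For the winding `ω ∈ ℤ⁴ = π₁(Y)` these are the sections of the line bundle `L_ω` with first Chern class
`ι_ω (dx¹∧dx²∧dx³)`, described as quasi-periodic functions on `ℝ⁴`; `∂_i` acts as the covariant
derivative `∂_i + π√-1 ε_{ijk} x^j ω^k` and `dx^i` as multiplication by `-2π√-1 ω^i`. -/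

def dataY : ZeroModeData where
  conj := fun _ w => w
  act := fun lam x => fun i => lam i + x i
  phase := fun lam w x => Complex.exp (Real.pi * Complex.I *
    (w 1 * lam 2 * lam 3 + w 2 * lam 1 * lam 3 + w 3 * lam 1 * lam 2
      + ∑ i, ∑ j, ∑ k, (eps i j k : ℂ) * lam i * x j * w k))
  vec := fun b x => fun i => targetY.frame x (.inl i) b
  pot := fun b w x =>
    Real.pi * Complex.I * (∑ i, ∑ j, ∑ k, (eps i j k : ℂ) * targetY.frame x (.inl i) b * x j * w k)
      - 2 * Real.pi * Complex.I * ∑ i, (targetY.frame x (.inr i) b : ℂ) * w i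

/-! ### The zero modes of `N` -/

/-- The lattice `ℤ × Heis(ℤ)`: the quadruple `k` stands for `k 0 ∈ ℤ` and the upper unitriangular
matrix with entries `k 1` (1,2), `k 3` (2,3) and `k 2` (1,3), written in the coordinates of
`ℝ × Heis`. -/
def latN (k : Z4) : R4 := ![k 0, k 1, k 2 - (k 1 : ℝ) * k 3 / 2, k 3]

/-- The `ℝ`-component and the matrix entries of an element of `ℝ × Heis`. -/
def entries (y : R4) : R4 := ![y 0, y 1, y 2 + y 1 * y 3 / 2, y 3]

/-- A zero mode of `N` is a function `f_γ(y)` on `π₁(N) × (ℝ × Heis)` with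
`f_{δγδ⁻¹}(δ y) = f_γ(y)`: for each conjugacy class it is a function on the quotient of `ℝ × Heis` by
the centralizer of a representative.  Vectors act by left-invariant vector fields; the left-invariant
form with value `ξ` at the identity acts as multiplication by `-2π√-1 ⟨ξ, entries (y⁻¹γy)⟩`. -/
def dataN : ZeroModeData where
  conj := fun δ γ => ![γ 0, γ 1, γ 2 + (δ 1 * γ 3 - δ 3 * γ 1), γ 3]
  act := fun δ y => kmul (latN δ) y
  phase := fun _ _ _ => 1
  vec := fun b y => fun i => frameN y (.inl i) b
  pot := fun b γ y => -(2 * Real.pi * Complex.I *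
    ∑ i, (frameN 0 (.inr i) b : ℂ) * (entries (kmul (-y) (kmul (latN γ) y)) i : ℂ))

/-! ## The modes of the currents and the induced module -/

/-- `even u n` is the mode `u_n`; `odd u k` is the fermionic mode `ū_{k+1/2}`. -/
inductive Gen
  | even (u : GC) (n : ℤ)
  | odd (u : GC) (k : ℤ)

def Gen.isOdd : Gen → Bool
  | .even _ _ => false
  | .odd _ _ => true

abbrev FreeModes := FreeAlgebra ℂ Gen

def fev (u : GC) (n : ℤ) : FreeModes := FreeAlgebra.ι ℂ (Gen.even u n)
def fod (u : GC) (k : ℤ) : FreeModes := FreeAlgebra.ι ℂ (Gen.odd u k)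

/-- The super-commutators of the modes of the currents of `V((g ⊕ t²)_super)` at level one:
`[u_m, v_n] = [u,v]_{m+n} + m (u,v) δ_{m+n,0}`, `[u_m, v̄_s]` is the mode `m + s` of the fermion of
`[u,v]`, and `{ū_r, v̄_s} = (u,v) δ_{r+s,0}`. -/
inductive ModeRel : FreeModes → FreeModes → Prop
  | even_add (u v : GC) (n : ℤ) : ModeRel (fev (u + v) n) (fev u n + fev v n)
  | even_smul (c : ℂ) (u : GC) (n : ℤ) : ModeRel (fev (c • u) n) (c • fev u n)
  | odd_add (u v : GC) (k : ℤ) : ModeRel (fod (u + v) k) (fod u k + fod v k)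
  | odd_smul (c : ℂ) (u : GC) (k : ℤ) : ModeRel (fod (c • u) k) (c • fod u k)
  | even_even (u v : GC) (m n : ℤ) : ModeRel (fev u m * fev v n - fev v n * fev u m)
      (fev (br u v) (m + n) + algebraMap ℂ FreeModes (if m + n = 0 then m * pairing u v else 0))
  | even_odd (u v : GC) (m k : ℤ) :
      ModeRel (fev u m * fod v k - fod v k * fev u m) (fod (br u v) (m + k))
  | odd_odd (u v : GC) (k l : ℤ) : ModeRel (fod u k * fod v l + fod v l * fod u k)
      (algebraMap ℂ FreeModes (if k + l + 1 = 0 then pairing u v else 0))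

/-- The enveloping algebra of the mode Lie super-algebra, with the central element equal to `1`. -/
def ModeAlg : Type := RingQuot ModeRel

instance : Ring ModeAlg := inferInstanceAs (Ring (RingQuot ModeRel))

instance : Algebra ℂ ModeAlg := inferInstanceAs (Algebra ℂ (RingQuot ModeRel))

def Gen.mode (x : Gen) : ModeAlg := RingQuot.mkAlgHom ℂ ModeRel (FreeAlgebra.ι ℂ x)

/-- The mode `u_n`. -/
def ev (u : GC) (n : ℤ) : ModeAlg := (Gen.even u n).mode

/-- The fermionic mode `ū_{k+1/2}`. -/
def od (u : GC) (k : ℤ) : ModeAlg := (Gen.odd u k).mode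

/-- Modes of positive degree annihilate the zero modes, modes of degree zero act by `rho`. -/
inductive IndRel : ModeAlg ⊗[ℂ] ZeroModes D → Prop
  | even_pos (u : GC) (n : ℤ) (hn : 0 < n) (f : ZeroModes D) : IndRel (ev u n ⊗ₜ f)
  | odd_pos (u : GC) (k : ℤ) (hk : 0 ≤ k) (f : ZeroModes D) : IndRel (od u k ⊗ₜ f)
  | even_zero (u : GC) (f : ZeroModes D) : IndRel (ev u 0 ⊗ₜ f - 1 ⊗ₜ rho D u f)

/-- The module induced from the zero modes. -/
abbrev Ind : Type :=
  (ModeAlg ⊗[ℂ] ZeroModes D) ⧸ Submodule.span ModeAlg {x | IndRel D x}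

/-- A zero mode, as a vector of the induced module. -/
def vac (f : ZeroModes D) : Ind D := Submodule.Quotient.mk (1 ⊗ₜ f)

/-- The even (`0`) and odd (`1`) parts of the induced module. -/
def parityPart (a : ZMod 2) : Submodule ℂ (Ind D) :=
  Submodule.span ℂ {v | ∃ (l : List Gen) (f : ZeroModes D),
    (((l.filter Gen.isOdd).length : ℕ) : ZMod 2) = a ∧ v = (l.map Gen.mode).prod • vac D f}

/-! ## The Hilbert space of states

By the Poincaré-Birkhoff-Witt theorem the induced module has the ordered monomials in the modes of
negative degree as a basis over the zero modes.  They are orthogonal, with the norms of the free Fock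
space: in the absence of brackets the creation operator `α^i_{-n}` is adjoint to `β_{i,n}` and
`β_{i,-n}` to `α^i_n`, and likewise for the fermions. -/

/-- `(n, b)` labels the mode of degree `-(n+1)`, or `-(n+1/2)` for a fermion, of the basis vector `b`. -/
abbrev CMode := ℕ ×ₗ (Fin 4 ⊕ₗ Fin 4)

def CMode.level (c : CMode) : ℕ := (ofLex c).1

def CMode.vector (c : CMode) : GC := Pi.single (ofLex (ofLex c).2) 1

/-- Occupation numbers of the bosonic and of the fermionic modes. -/
abbrev Occ := (CMode →₀ ℕ) × Finset CMode

/-- The ordered monomial with given occupation numbers. -/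
def Occ.monomial (s : Occ) : ModeAlg :=
  ((s.1.support.sort (· ≤ ·)).map fun c => ev c.vector (-((c.level : ℤ) + 1)) ^ s.1 c).prod
    * ((s.2.sort (· ≤ ·)).map fun c => od c.vector (-((c.level : ℤ) + 1))).prod

/-- The squared norm of an ordered monomial: a factor `n ^ k * k!` for `k` bosons in degree `-n`. -/
def Occ.weight (s : Occ) : ℝ :=
  s.1.prod fun c k => ((c.level : ℝ) + 1) ^ k * (k.factorial : ℝ)

/-- `∑ s ⊗ f_s ↦ ∑ s · f_s`. -/
def pbw : (Occ →₀ ZeroModes D) →ₗ[ℂ] Ind D :=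
  Finsupp.lsum ℂ fun s =>
    { toFun := fun f => s.monomial • vac D f
      map_add' := fun f g => by
        have : vac D (f + g) = vac D f + vac D g := by
          simp only [vac, TensorProduct.tmul_add, Submodule.Quotient.mk_add]
        rw [this, smul_add]
      map_smul' := fun c f => by
        have : vac D (c • f) = c • vac D f := by
          simp only [vac, TensorProduct.tmul_smul, Submodule.Quotient.mk_smul]
        rw [this, smul_comm]
        rfl }

open Classical in
/-- Coordinates in the Poincaré-Birkhoff-Witt basis. -/
def pbwCoord : Ind D →ₗ[ℂ] (Occ →₀ ZeroModes D) :=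
  if h : Function.Bijective (pbw D) then (LinearEquiv.ofBijective (pbw D) h).symm.toLinearMap else 0

/-- The Hilbert sum of copies of the square integrable zero modes over the ordered monomials. -/
abbrev FockL2 := lp (fun _ : Occ => Lp ℂ 2 zmMeasure) 2

open Classical in
/-- The isometric embedding of the induced module. -/
def toFock : Ind D →ₗ[ℂ] FockL2 :=
  (Finsupp.lsum ℂ fun s : Occ =>
    ((Real.sqrt s.weight : ℝ) : ℂ) •
      (lp.lsingle (E := fun _ : Occ => Lp ℂ 2 zmMeasure) (𝕜 := ℂ) 2 s ∘ₗ zmToLp D)) ∘ₗ pbwCoord D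

/-- The Hilbert space of states: the completion of the induced module. -/
abbrev StateSpace : Submodule ℂ FockL2 := (LinearMap.range (toFock D)).topologicalClosure

/-- The induced module as a dense subspace of the Hilbert space of states. -/
def toState (v : Ind D) : StateSpace D :=
  ⟨toFock D v, Submodule.le_topologicalClosure _ (LinearMap.mem_range_self _ v)⟩

/-! ## `N = 2` super-conformal structures -/

/-- An `N = 2` super-conformal structure of central charge `c`: modes of fields `L`, `J`, `G⁺`, `G⁻`
satisfying the commutators equivalent to the operator product expansions of the `N = 2` algebra.
`Gp k` and `Gm k` are the modes `k + 1/2`. -/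
structure N2Structure (c : ℂ) (V : Type*) [AddCommGroup V] [Module ℂ V] where
  L : ℤ → Module.End ℂ V
  J : ℤ → Module.End ℂ V
  Gp : ℤ → Module.End ℂ V
  Gm : ℤ → Module.End ℂ V
  truncated : ∀ v, ∃ M : ℤ, ∀ n, M ≤ n → L n v = 0 ∧ J n v = 0 ∧ Gp n v = 0 ∧ Gm n v = 0
  LL : ∀ m n, L m * L n - L n * L m = ((m : ℂ) - n) • L (m + n)
    + (if m + n = 0 then c / 12 * ((m : ℂ) ^ 3 - m) else 0) • 1
  LJ : ∀ m n, L m * J n - J n * L m = (-(n : ℂ)) • J (m + n)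
  LGp : ∀ m k, L m * Gp k - Gp k * L m = ((m : ℂ) / 2 - (k + 1 / 2)) • Gp (m + k)
  LGm : ∀ m k, L m * Gm k - Gm k * L m = ((m : ℂ) / 2 - (k + 1 / 2)) • Gm (m + k)
  JJ : ∀ m n, J m * J n - J n * J m = (if m + n = 0 then c / 3 * m else 0) • 1
  JGp : ∀ m k, J m * Gp k - Gp k * J m = Gp (m + k)
  JGm : ∀ m k, J m * Gm k - Gm k * J m = -Gm (m + k)
  GpGp : ∀ k l, Gp k * Gp l + Gp l * Gp k = 0
  GmGm : ∀ k l, Gm k * Gm l + Gm l * Gm k = 0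
  GpGm : ∀ k l, Gp k * Gm l + Gm l * Gp k = L (k + l + 1) + (((k : ℂ) - l) / 2) • J (k + l + 1)
    + (if k + l + 1 = 0 then c / 6 * (((k : ℂ) + 1 / 2) ^ 2 - 1 / 4) else 0) • 1

variable {D}

/-- The modes of the even component `∑ :ē^i(z) ē_i(z):` of the super-field `J = ∑ ē^i ē_i`. -/
def superJ (e e' : Fin 4 → GC) (n : ℤ) (v : Ind D) : Ind D :=
  ∑ i, ∑ᶠ k : ℤ, if k < 0 then od (e' i) k • od (e i) (n - 1 - k) • v
    else -(od (e i) (n - 1 - k) • od (e' i) k • v)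

/-- The modes (`k + 1/2`) of the coefficient `∑ :e^i(z) ē_i(z): - :ē^i(z) e_i(z):` of `θ` in the
super-field `J = ∑ ē^i ē_i`. -/
def superJodd (e e' : Fin 4 → GC) (k : ℤ) (v : Ind D) : Ind D :=
  ∑ i, ((∑ᶠ m : ℤ, if m < 0 then ev (e' i) m • od (e i) (k - m) • v
      else od (e i) (k - m) • ev (e' i) m • v)
    - ∑ᶠ l : ℤ, if l < 0 then od (e' i) l • ev (e i) (k - l) • v
      else ev (e i) (k - l) • od (e' i) l • v)

/-- The structure is generated by the super-field `J(z) + θ (G⁻(z) - G⁺(z)) = ∑ ē^i ē_i`. -/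
def N2Structure.GeneratedBy {c : ℂ} (S : N2Structure c (Ind D)) (e e' : Fin 4 → GC) : Prop :=
  (∀ n v, S.J n v = superJ e e' n v) ∧ ∀ k v, S.Gm k v - S.Gp k v = superJodd e e' k v

/-- The `N = 2` structure of central charge `12` attached to `𝒥` through the Manin triple
`(g ⊕ t², 𝔩, 𝔩̄)`, on the module induced from the zero modes of `D`. -/
def IsAttached (M : Target) (𝒥 : R4 → Matrix Ix Ix ℝ) (S : N2Structure 12 (Ind D)) : Prop :=
  (∃ e e', IsDualBasis M 𝒥 e e') ∧ ∀ e e', IsDualBasis M 𝒥 e e' → S.GeneratedBy e e'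

end MirrorKT

end

noncomputable section

namespace MirrorKT

/-! The two targets are T-dual along the circle of the coordinate 2. The theorem holds because three
kinds of data agree on both sides: the Lie algebra with its pairing, the zero modes as a
representation, and the matrix of the generalized complex structure in the frame.

Zero modes. The isomorphism is `partialFourier`: Fourier coefficients in the coordinate 2 and
Fourier summation over the winding 2, so that momentum and winding are exchanged. Put a = (y³γ¹ -
y¹γ³)/2 (`areaForm`). A zero mode of Y is multiplied by exp(2π√-1 a) when the coordinate 2 grows by
1, and α² acts by a multiple of γ². A zero mode of N is periodic in that coordinate, and β_2 acts by
a multiple of γ² + 2a. One transform with two parameters, (1, 0) for Y and (0, 1) for N, therefore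
serves both directions. Powers of the multiplication operator are bounded on smooth vectors, which
gives rapid decay in the winding (`IsRegular.decay`). Integration by parts and termwise
differentiation then show that the transform intertwines the basis vectors
(`dataN_op_partialFourier`, `dataY_op_partialFourier`). Smoothness of the transform follows by
bootstrapping from this (`contDiff_of_intertwine`), invertibility from Fourier inversion, and
preservation of norms from Parseval's identity.

State spaces. The induced module depends only on the representation on zero modes, so T is the
identity on modes tensored with the transform (`indEquiv`). It respects ordered monomials, hence
parity and norms, and extends to the completions.

Geometry. In a left-invariant orthogonal frame an equivariant structure is a constant matrix. Both
frames have the Dorfman brackets of the same Lie algebra: through H on Y, and through the Heisenberg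
commutator on N. Invariant spinors on N correspond to constant forms by exchanging ∂_2 with dx² and
then shearing, and closedness becomes the same condition dx¹∧dx²∧dx³∧φ = 0 on both sides. Hence
`IsModel.isFrameCY_iff` reduces both sets of structures to one algebraic set of matrices.

N = 2 structures. Multiplying the matrix by √-1 gives an involution K whose eigenspaces are
Lagrangian subalgebras with dual bases; they are unimodular because the Lie algebra is two-step
nilpotent. Let G be the N = 1 generator `superG`, J the fermion bilinear `manJ`, and Q = [G, J_0].
All N = 2 relations follow formally from those of `IsSuperTriple`. The hard one is [J_0, Q_r] = -G_r
(`manJ_manQ_zero`): the operator [J_0, Q_r] + G_r supercommutes with all modes and has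
half-integral, hence non-zero, degree, so it vanishes by `odd_eq_zero`. This replaces explicit
computations with cubic terms. On N the structure is obtained by conjugating with T; it is attached
to the corresponding 𝒥 because dual bases only see the matrix in the frame. -/

/-! ## Normally ordered products of fields -/

section Fields

variable {V : Type*} [AddCommGroup V] [Module ℂ V]

/-- A sequence of endomorphisms is a field if each vector is annihilated by all modes of
sufficiently large degree. -/
def IsField (A : ℤ → Module.End ℂ V) : Prop := ∀ v, ∃ M : ℤ, ∀ n, M ≤ n → A n v = 0

theorem IsField.add {A B : ℤ → Module.End ℂ V} (hA : IsField A) (hB : IsField B) :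
    IsField (fun n => A n + B n) := by
  intro v
  obtain ⟨M, hM⟩ := hA v
  obtain ⟨M', hM'⟩ := hB v
  exact ⟨max M M', fun n hn => by
    rw [LinearMap.add_apply, hM n (le_trans (le_max_left _ _) hn),
      hM' n (le_trans (le_max_right _ _) hn), add_zero]⟩

theorem IsField.wsmul {A : ℤ → Module.End ℂ V} (hA : IsField A) (w : ℤ → ℂ) :
    IsField (fun n => w n • A n) := by
  intro v
  obtain ⟨M, hM⟩ := hA v
  exact ⟨M, fun n hn => by rw [LinearMap.smul_apply, hM n hn, smul_zero]⟩

theorem IsField.smul {A : ℤ → Module.End ℂ V} (hA : IsField A) (c : ℂ) :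
    IsField (fun n => c • A n) := hA.wsmul fun _ => c

theorem IsField.neg {A : ℤ → Module.End ℂ V} (hA : IsField A) : IsField (fun n => -A n) := by
  simpa using hA.smul (-1)

theorem IsField.sub {A B : ℤ → Module.End ℂ V} (hA : IsField A) (hB : IsField B) :
    IsField (fun n => A n - B n) := by
  simpa [sub_eq_add_neg] using hA.add hB.neg

theorem IsField.sum {ι : Type*} (s : Finset ι) {A : ι → ℤ → Module.End ℂ V}
    (hA : ∀ i, IsField (A i)) : IsField (fun n => ∑ i ∈ s, A i n) := by
  classical
  induction s using Finset.induction_on with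
  | empty => exact fun v => ⟨0, fun n _ => by simp⟩
  | insert i s hi ih => simpa [Finset.sum_insert hi] using (hA i).add ih

theorem isField_zero : IsField (fun _ => (0 : Module.End ℂ V)) := fun _ => ⟨0, fun _ _ => rfl⟩

theorem isField_delta (m : ℤ) (c : ℂ) :
    IsField (fun n => (if n + m = 0 then c else 0) • (1 : Module.End ℂ V)) := by
  intro v
  refine ⟨1 - m, fun n hn => ?_⟩
  simp only [if_neg (show ¬ n + m = 0 by omega), zero_smul, LinearMap.zero_apply]

theorem IsField.shift {A : ℤ → Module.End ℂ V} (hA : IsField A) (m : ℤ) :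
    IsField (fun n => A (n + m)) := by
  intro v
  obtain ⟨M, hM⟩ := hA v
  exact ⟨M - m, fun n hn => hM _ (by omega)⟩

/-- The summands of a normally ordered product, with the ordering changing at `c`. -/
def nterm (ε : ℂ) (c : ℤ) (A B : ℤ → Module.End ℂ V) (n k : ℤ) : Module.End ℂ V :=
  if k < c then A k * B (n - k) else ε • (B (n - k) * A k)

/-- Far to the left of `c` the factor `B (n - k)` kills `v`, and far to the right `A k` does. -/
theorem nterm_finite {A B : ℤ → Module.End ℂ V} (hA : IsField A) (hB : IsField B)
    (ε : ℂ) (c n : ℤ) (v : V) : (Function.support fun k => nterm ε c A B n k v).Finite := by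
  obtain ⟨M, hM⟩ := hA v
  obtain ⟨M', hM'⟩ := hB v
  refine (Set.finite_Icc (min c (n - M')) (max c M)).subset fun k hk => ?_
  by_contra h
  apply hk
  simp only [nterm]
  rw [Set.mem_Icc, not_and_or, not_le, not_le, lt_min_iff, max_lt_iff] at h
  split_ifs with hc
  · rw [Module.End.mul_apply, hM' _ (by omega), map_zero]
  · rw [LinearMap.smul_apply, Module.End.mul_apply, hM _ (by omega), map_zero, smul_zero]

open Classical in
/-- The normally ordered product `∑_{k<c} A_k B_{n-k} + ε ∑_{k≥c} B_{n-k} A_k`. -/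
def nprod (ε : ℂ) (c : ℤ) (A B : ℤ → Module.End ℂ V) (n : ℤ) : Module.End ℂ V :=
  -- The sum is known to be finite on each vector only for two fields; otherwise the product is `0`
  -- by convention.
  if h : IsField A ∧ IsField B then
    { toFun := fun v => ∑ᶠ k, nterm ε c A B n k v
      map_add' := fun v w => by
        simp only [map_add]
        exact finsum_add_distrib (nterm_finite h.1 h.2 ε c n v) (nterm_finite h.1 h.2 ε c n w)
      map_smul' := fun a v => by
        simp only [map_smul, RingHom.id_apply]
        exact (smul_finsum a _).symm }
  else 0

section
variable {A B : ℤ → Module.End ℂ V} (hA : IsField A) (hB : IsField B)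
include hA hB

theorem nprod_apply (ε : ℂ) (c n : ℤ) (v : V) :
    nprod ε c A B n v = ∑ᶠ k, nterm ε c A B n k v := by
  rw [nprod, dif_pos ⟨hA, hB⟩]
  rfl

/-- For large `n` the terms with k < c vanish since `B (n - k)` kills `v`, and those with k ≥ M
since `A k` does. Only finitely many k remain, and each vector `A k v` has its own truncation bound.
-/
theorem isField_nprod (ε : ℂ) (c : ℤ) : IsField (nprod ε c A B) := by
  intro v
  obtain ⟨M, hM⟩ := hA v
  obtain ⟨M', hM'⟩ := hB v
  choose N hN using fun k => hB (A k v)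
  obtain ⟨R, hR⟩ := ((Finset.Ico c M).image fun k => N k + k).bddAbove
  refine ⟨max R (M' + c), fun n hn => ?_⟩
  rw [nprod_apply hA hB]
  refine finsum_eq_zero_of_forall_eq_zero fun k => ?_
  rw [nterm]
  split_ifs with hc
  · rw [Module.End.mul_apply, hM' _ (by have := le_of_max_le_right hn; omega), map_zero]
  · rw [LinearMap.smul_apply, Module.End.mul_apply]
    by_cases hk : M ≤ k
    · rw [hM _ hk, map_zero, smul_zero]
    · have : N k + k ≤ R := hR (by
        simp only [Finset.coe_image, Set.mem_image, Finset.coe_Ico, Set.mem_Ico]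
        exact ⟨k, ⟨by omega, by omega⟩, rfl⟩)
      rw [hN k _ (by have := le_of_max_le_left hn; omega), smul_zero]

end

theorem sum_nprod_apply {ι : Type*} (s : Finset ι) (a ε : ι → ℂ) (c : ι → ℤ)
    (A B : ι → ℤ → Module.End ℂ V) (n : ι → ℤ) (hA : ∀ i, IsField (A i))
    (hB : ∀ i, IsField (B i)) (v : V) :
    (∑ i ∈ s, a i • nprod (ε i) (c i) (A i) (B i) (n i)) v
      = ∑ᶠ k, (∑ i ∈ s, a i • nterm (ε i) (c i) (A i) (B i) (n i) k) v := by
  simp only [LinearMap.sum_apply, LinearMap.smul_apply]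
  rw [finsum_sum_comm]
  · refine Finset.sum_congr rfl fun i _ => ?_
    rw [nprod_apply (hA i) (hB i), smul_finsum]
  · intro i _
    exact (nterm_finite (hA i) (hB i) (ε i) (c i) (n i) v).subset fun k hk hk' =>
      hk (by simp only at hk' ⊢; rw [hk', smul_zero])

/-- Two combinations of normally ordered products agree if their summands do. -/
theorem nprod_sum_congr {ι κ : Type*} (s : Finset ι) (t : Finset κ)
    (a : ι → ℂ) (ε : ι → ℂ) (c : ι → ℤ) (A B : ι → ℤ → Module.End ℂ V) (n : ι → ℤ)
    (a' : κ → ℂ) (ε' : κ → ℂ) (c' : κ → ℤ) (A' B' : κ → ℤ → Module.End ℂ V) (n' : κ → ℤ)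
    (hA : ∀ i, IsField (A i)) (hB : ∀ i, IsField (B i))
    (hA' : ∀ i, IsField (A' i)) (hB' : ∀ i, IsField (B' i))
    (h : ∀ k, ∑ i ∈ s, a i • nterm (ε i) (c i) (A i) (B i) (n i) k
      = ∑ j ∈ t, a' j • nterm (ε' j) (c' j) (A' j) (B' j) (n' j) k) :
    ∑ i ∈ s, a i • nprod (ε i) (c i) (A i) (B i) (n i)
      = ∑ j ∈ t, a' j • nprod (ε' j) (c' j) (A' j) (B' j) (n' j) := by
  ext v
  rw [sum_nprod_apply s a ε c A B n hA hB, sum_nprod_apply t a' ε' c' A' B' n' hA' hB']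
  simp only [h]

section
variable {A B A' B' : ℤ → Module.End ℂ V} (hA : IsField A) (hB : IsField B) (hA' : IsField A')
  (hB' : IsField B')
include hA hB

theorem nprod_add_left (hA' : IsField A') (ε : ℂ) (c n : ℤ) :
    nprod ε c (fun k => A k + A' k) B n = nprod ε c A B n + nprod ε c A' B n := by
  ext v
  rw [LinearMap.add_apply, nprod_apply (hA.add hA') hB, nprod_apply hA hB, nprod_apply hA' hB,
    ← finsum_add_distrib (nterm_finite hA hB _ _ _ v) (nterm_finite hA' hB _ _ _ v)]
  refine finsum_congr fun k => ?_
  simp only [nterm]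
  split_ifs <;> simp [add_mul, mul_add]

theorem nprod_add_right (hB' : IsField B') (ε : ℂ) (c n : ℤ) :
    nprod ε c A (fun k => B k + B' k) n = nprod ε c A B n + nprod ε c A B' n := by
  ext v
  rw [LinearMap.add_apply, nprod_apply hA (hB.add hB'), nprod_apply hA hB, nprod_apply hA hB',
    ← finsum_add_distrib (nterm_finite hA hB _ _ _ v) (nterm_finite hA hB' _ _ _ v)]
  refine finsum_congr fun k => ?_
  simp only [nterm]
  split_ifs <;> simp [add_mul, mul_add]

theorem nprod_smul_left (ε : ℂ) (c n : ℤ) (a : ℂ) :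
    nprod ε c (fun k => a • A k) B n = a • nprod ε c A B n := by
  ext v
  rw [LinearMap.smul_apply, nprod_apply (hA.smul a) hB, nprod_apply hA hB, smul_finsum]
  refine finsum_congr fun k => ?_
  simp only [nterm]
  split_ifs <;> simp [smul_comm ε a]

theorem nprod_smul_right (ε : ℂ) (c n : ℤ) (a : ℂ) :
    nprod ε c A (fun k => a • B k) n = a • nprod ε c A B n := by
  ext v
  rw [LinearMap.smul_apply, nprod_apply hA (hB.smul a), nprod_apply hA hB, smul_finsum]
  refine finsum_congr fun k => ?_
  simp only [nterm]
  split_ifs <;> simp [smul_comm ε a]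

/-- The commutator of an operator with a normally ordered product. -/
theorem comm_nprod (hA' : IsField A') (hB' : IsField B') {D : Module.End ℂ V} {σA σB ε : ℂ}
    {m m' : ℤ} (hσ : σA * σA = 1) (h1 : ∀ k, D * A k = σA • (A k * D) + A' (k + m))
    (h2 : ∀ k, D * B k = σB • (B k * D) + B' (k + m')) (n : ℤ) :
    D * nprod ε 0 A B n = (σA * σB) • (nprod ε 0 A B n * D)
      + nprod (ε * σB) m A' B (n + m) + σA • nprod (ε * σA) 0 A B' (n + m') := by
  ext v
  simp only [LinearMap.add_apply, LinearMap.smul_apply, Module.End.mul_apply]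
  -- Shifting the summation index by `m` turns the condition k < 0 into k < m. The product with `A'`
  -- is therefore ordered at `m`, and moving this point back to 0 is the source of the central terms
  -- later on.
  rw [nprod_apply hA hB, nprod_apply hA hB, nprod_apply hA' hB, nprod_apply hA hB',
    smul_finsum, smul_finsum,
    ← finsum_comp_equiv (Equiv.addRight m) (f := fun k => nterm (ε * σB) m A' B (n + m) k v)]
  have f1 := nterm_finite hA hB ε 0 n (D v)
  have f2 := (nterm_finite hA' hB (ε * σB) m (n + m) v).preimage
    (f := Equiv.addRight m) (Equiv.injective _).injOn
  have f3 := nterm_finite hA hB' (ε * σA) 0 (n + m') v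
  rw [← finsum_add_distrib (f1.subset fun k hk hk' => hk (by simp only [hk', smul_zero])) f2,
    ← finsum_add_distrib _ (f3.subset fun k hk hk' => hk (by simp only [hk', smul_zero]))]
  · have e := AddMonoidHom.map_finsum D.toAddMonoidHom (nterm_finite hA hB ε 0 n v)
    simp only [LinearMap.toAddMonoidHom_coe] at e
    rw [e]
    refine finsum_congr fun k => ?_
    have e1 := fun w => LinearMap.congr_fun (h1 k) w
    have e2 := fun w => LinearMap.congr_fun (h2 (n - k)) w
    simp only [LinearMap.add_apply, LinearMap.smul_apply, Module.End.mul_apply] at e1 e2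
    simp only [nterm, Equiv.coe_addRight, add_lt_iff_neg_right]
    rw [show n + m - (k + m) = n - k by ring, show n + m' - k = n - k + m' by ring]
    split_ifs
    · simp only [LinearMap.add_apply, LinearMap.smul_apply, Module.End.mul_apply, e1, e2, map_add,
        map_smul, smul_add, smul_smul]
      abel
    · simp only [LinearMap.add_apply, LinearMap.smul_apply, Module.End.mul_apply, e1, e2, map_add,
        map_smul, smul_add, smul_smul]
      -- In the reversed ordering `D` passes `B` first; `σA * σA = 1` restores the coefficients of
      -- the other branch.
      rw [show σA * (ε * σA) = ε by linear_combination ε * hσ,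
        show σA * σB * ε = ε * (σB * σA) by ring]
  · exact ((f1.union f2).subset fun k hk => by
      by_contra hk'
      simp only [Set.mem_union, not_or, Function.mem_support, Set.mem_preimage, not_not] at hk'
      exact hk (by simp only [hk'.1, smul_zero, zero_add]; exact hk'.2))

/-- Only the term k = c changes its ordering, so the difference is one supercommutator. -/
theorem nprod_succ (ε : ℂ) (c n : ℤ) :
    nprod ε (c + 1) A B n
      = nprod ε c A B n + (A c * B (n - c) - ε • (B (n - c) * A c)) := by
  ext v
  rw [LinearMap.add_apply, nprod_apply hA hB, nprod_apply hA hB]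
  have e : (A c * B (n - c) - ε • (B (n - c) * A c)) v
      = ∑ᶠ k, if k = c then (A c * B (n - c) - ε • (B (n - c) * A c)) v else 0 := by
    rw [finsum_eq_single _ c fun k hk => if_neg hk, if_pos rfl]
  rw [e, ← finsum_add_distrib (nterm_finite hA hB _ _ _ v)]
  · refine finsum_congr fun k => ?_
    simp only [nterm]
    by_cases hk : k = c
    · subst hk
      simp
    · by_cases hk' : k < c
      · rw [if_pos (by omega), if_pos hk', if_neg hk, add_zero]
      · rw [if_neg (by omega), if_neg hk', if_neg hk, add_zero]
  · exact (Set.finite_singleton c).subset fun k hk => by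
      by_contra h
      exact hk (if_neg h)

/-- Reversing the factors of a normally ordered product. -/
theorem nprod_swap {ε : ℂ} (hε : ε * ε = 1) (c n : ℤ) :
    nprod ε c A B n = ε • nprod ε (n + 1 - c) B A n := by
  ext v
  rw [LinearMap.smul_apply, nprod_apply hA hB, nprod_apply hB hA, smul_finsum,
    ← finsum_comp_equiv (Equiv.subLeft n)]
  refine finsum_congr fun k => ?_
  simp only [nterm, Equiv.subLeft_apply, sub_sub_cancel]
  by_cases hk : n - k < c
  · rw [if_pos hk, if_neg (by omega), LinearMap.smul_apply, smul_smul, hε, one_smul]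
  · rw [if_neg hk, if_pos (by omega), LinearMap.smul_apply]

omit hB in
/-- The product with a multiple of the identity in a single degree. -/
theorem nprod_delta_right (c n m : ℤ) (a : ℂ) :
    nprod 1 c A (fun k => (if k + m = 0 then a else 0) • 1) n = a • A (n + m) := by
  ext v
  rw [nprod_apply hA (isField_delta m a), finsum_eq_single _ (n + m)]
  · simp [nterm]
  · intro k hk
    have : ¬ n - k + m = 0 := by omega
    simp [nterm, this]

omit hB in
theorem nprod_delta_left (c n m : ℤ) (a : ℂ) :
    nprod 1 c (fun k => (if k + m = 0 then a else 0) • 1) A n = a • A (n + m) := by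
  rw [nprod_swap (isField_delta m a) hA (one_mul 1), one_smul, nprod_delta_right hA]

end

/-- Moving the point where the ordering changes in a sum of normally ordered products. -/
theorem sum_nprod_split {ι : Type*} (s : Finset ι) {A B : ι → ℤ → Module.End ℂ V}
    (hA : ∀ i, IsField (A i)) (hB : ∀ i, IsField (B i)) {ε : ℂ} {n : ℤ}
    (S : ℤ → Module.End ℂ V) (h0 : S 0 = 0)
    (hS : ∀ k, ∑ i ∈ s, (A i k * B i (n - k) - ε • (B i (n - k) * A i k)) = S (k + 1) - S k)
    (m : ℤ) : ∑ i ∈ s, nprod ε m (A i) (B i) n = ∑ i ∈ s, nprod ε 0 (A i) (B i) n + S m := by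
  have step : ∀ k, ∑ i ∈ s, nprod ε (k + 1) (A i) (B i) n
      = ∑ i ∈ s, nprod ε k (A i) (B i) n + (S (k + 1) - S k) := fun k => by
    rw [← hS, ← Finset.sum_add_distrib]
    exact Finset.sum_congr rfl fun i _ => nprod_succ (hA i) (hB i) _ _ _
  -- `S` is a discrete primitive of the supercommutators, normalised at 0, so one telescoping
  -- argument works in both directions.
  induction m using Int.induction_on with
  | zero => rw [h0, add_zero]
  | succ k ih => rw [step, ih]; abel
  | pred k ih =>
    have := step (-(k : ℤ) - 1)
    rw [sub_add_cancel, ih] at this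
    rw [add_sub_assoc', eq_sub_iff_add_eq, add_right_comm] at this
    exact (add_right_cancel this).symm

theorem nprod_split {A B : ℤ → Module.End ℂ V} (hA : IsField A) (hB : IsField B) {ε : ℂ} {n : ℤ}
    (S : ℤ → Module.End ℂ V) (h0 : S 0 = 0)
    (hS : ∀ k, A k * B (n - k) - ε • (B (n - k) * A k) = S (k + 1) - S k) (m : ℤ) :
    nprod ε m A B n = nprod ε 0 A B n + S m := by
  simpa using sum_nprod_split {()} (fun _ => hA) (fun _ => hB) S h0 (by simpa using hS) m

end Fields

/-! ## Smooth representations of the mode algebra -/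

section Commutators

variable {V : Type*} [AddCommGroup V] [Module ℂ V] {A B A' B' : ℤ → Module.End ℂ V}
  (hA : IsField A) (hB : IsField B) (hA' : IsField A') (hB' : IsField B') {D : Module.End ℂ V}
  {ε : ℂ} {m m' : ℤ}
include hA hB hA' hB'

theorem comm_nprod_even (h1 : ∀ k, D * A k = A k * D + A' (k + m))
    (h2 : ∀ k, D * B k = B k * D + B' (k + m')) (n : ℤ) :
    D * nprod ε 0 A B n = nprod ε 0 A B n * D + nprod ε m A' B (n + m)
      + nprod ε 0 A B' (n + m') := by
  simpa using comm_nprod (σA := 1) (σB := 1) (ε := ε) hA hB hA' hB' (by simp)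
    (by simpa using h1) (by simpa using h2) n

theorem comm_nprod_odd_odd (h1 : ∀ k, D * A k = -(A k * D) + A' (k + m))
    (h2 : ∀ k, D * B k = -(B k * D) + B' (k + m')) (n : ℤ) :
    D * nprod (-1) 0 A B n = nprod (-1) 0 A B n * D + nprod 1 m A' B (n + m)
      - nprod 1 0 A B' (n + m') := by
  simpa [sub_eq_add_neg] using comm_nprod (σA := -1) (σB := -1) (ε := -1) hA hB hA' hB' (by simp)
    (by simpa using h1) (by simpa using h2) n

theorem comm_nprod_even_odd (h1 : ∀ k, D * A k = A k * D + A' (k + m))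
    (h2 : ∀ k, D * B k = -(B k * D) + B' (k + m')) (n : ℤ) :
    D * nprod 1 0 A B n = -(nprod 1 0 A B n * D) + nprod (-1) m A' B (n + m)
      + nprod 1 0 A B' (n + m') := by
  simpa using comm_nprod (σA := 1) (σB := -1) (ε := 1) hA hB hA' hB' (by simp)
    (by simpa using h1) (by simpa using h2) n

theorem comm_nprod_odd_even (h1 : ∀ k, D * A k = -(A k * D) + A' (k + m))
    (h2 : ∀ k, D * B k = B k * D + B' (k + m')) (n : ℤ) :
    D * nprod 1 0 A B n = -(nprod 1 0 A B n * D) + nprod 1 m A' B (n + m)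
      - nprod (-1) 0 A B' (n + m') := by
  simpa [sub_eq_add_neg] using comm_nprod (σA := -1) (σB := 1) (ε := 1) hA hB hA' hB' (by simp)
    (by simpa using h1) (by simpa using h2) n

end Commutators

/-- Operators `E u n`, `O u k` satisfying the relations of the modes `u_n`, `ū_{k+1/2}`, and
forming fields. -/
structure ModeRep {V : Type*} [AddCommGroup V] [Module ℂ V] (E O : GC → ℤ → Module.End ℂ V) :
    Prop where
  E_add : ∀ u v n, E (u + v) n = E u n + E v n
  E_smul : ∀ (c : ℂ) u n, E (c • u) n = c • E u n
  O_add : ∀ u v n, O (u + v) n = O u n + O v n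
  O_smul : ∀ (c : ℂ) u n, O (c • u) n = c • O u n
  EE : ∀ u v m n, E u m * E v n = E v n * E u m + E (br u v) (m + n)
    + (if m + n = 0 then m * pairing u v else 0) • 1
  EO : ∀ u v m k, E u m * O v k = O v k * E u m + O (br u v) (m + k)
  OO : ∀ u v k l, O u k * O v l = -(O v l * O u k)
    + (if k + l + 1 = 0 then pairing u v else 0) • 1
  fE : ∀ u, IsField (E u)
  fO : ∀ u, IsField (O u)

/-- The basis vector `β_i`. -/
def bb (i : Fin 4) : GC := Pi.single (.inl i) 1

/-- The basis vector `α^i`. -/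
def aa (i : Fin 4) : GC := Pi.single (.inr i) 1

theorem gc_decomp (u : GC) : u = ∑ i, (u (.inl i) • bb i + u (.inr i) • aa i) := by
  funext x
  rcases x with x | x <;> simp [bb, aa, Finset.sum_apply, Pi.single_apply]

theorem br_add_left (u u' v : GC) : br (u + u') v = br u v + br u' v := by
  funext x
  rcases x with x | x <;>
    simp [br, mul_add, add_mul, Finset.sum_add_distrib]

theorem br_add_right (u v v' : GC) : br u (v + v') = br u v + br u v' := by
  funext x
  rcases x with x | x <;>
    simp [br, mul_add, Finset.sum_add_distrib]

theorem br_smul_left (c : ℂ) (u v : GC) : br (c • u) v = c • br u v := by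
  funext x
  rcases x with x | x
  · simp [br]
  · simp only [br, Sum.elim_inr, Pi.smul_apply, smul_eq_mul, Finset.mul_sum]
    exact Finset.sum_congr rfl fun _ _ => Finset.sum_congr rfl fun _ _ => by ring

theorem br_smul_right (c : ℂ) (u v : GC) : br u (c • v) = c • br u v := by
  funext x
  rcases x with x | x
  · simp [br]
  · simp only [br, Sum.elim_inr, Pi.smul_apply, smul_eq_mul, Finset.mul_sum]
    exact Finset.sum_congr rfl fun _ _ => Finset.sum_congr rfl fun _ _ => by ring

theorem eps_swap (i j k : Fin 4) : eps j i k = -eps i j k := by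
  revert i j k; decide

theorem eps_swap' (i j k : Fin 4) : eps i k j = -eps i j k := by
  revert i j k; decide

theorem br_swap (u v : GC) : br v u = -br u v := by
  funext x
  rcases x with x | x
  · simp [br]
  · simp only [br, Sum.elim_inr, Pi.neg_apply]
    rw [Finset.sum_comm, ← Finset.sum_neg_distrib]
    refine Finset.sum_congr rfl fun i _ => ?_
    rw [← Finset.sum_neg_distrib]
    refine Finset.sum_congr rfl fun j _ => ?_
    rw [eps_swap i j]
    push_cast
    ring

theorem br_aa_left (i : Fin 4) (v : GC) : br (aa i) v = 0 := by
  funext x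
  rcases x with x | x <;> simp [br, aa]

theorem br_aa_right (i : Fin 4) (v : GC) : br v (aa i) = 0 := by
  rw [br_swap, br_aa_left, neg_zero]

theorem br_bb (i j : Fin 4) : br (bb i) (bb j) = ∑ l, (eps i j l : ℂ) • aa l := by
  funext x
  rcases x with x | x <;> simp [br, bb, aa, Finset.sum_apply, Pi.single_apply]

theorem pairing_comm (u v : GC) : pairing u v = pairing v u := by
  simp only [pairing]
  exact Finset.sum_congr rfl fun _ _ => by ring

theorem pairing_add_left (u u' v : GC) : pairing (u + u') v = pairing u v + pairing u' v := by
  simp only [pairing, Pi.add_apply, ← Finset.sum_add_distrib]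
  exact Finset.sum_congr rfl fun _ _ => by ring

theorem pairing_smul_left (c : ℂ) (u v : GC) : pairing (c • u) v = c * pairing u v := by
  simp only [pairing, Pi.smul_apply, smul_eq_mul, Finset.mul_sum]
  exact Finset.sum_congr rfl fun _ _ => by ring

theorem pairing_bb_bb (i j : Fin 4) : pairing (bb i) (bb j) = 0 := by
  simp [pairing, bb]

theorem pairing_aa_aa (i j : Fin 4) : pairing (aa i) (aa j) = 0 := by
  simp [pairing, aa]

theorem pairing_bb_aa (i j : Fin 4) : pairing (bb i) (aa j) = if i = j then 1 else 0 := by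
  simp [pairing, bb, aa, Pi.single_apply, eq_comm]

theorem pairing_aa_bb (i j : Fin 4) : pairing (aa i) (bb j) = if i = j then 1 else 0 := by
  rw [pairing_comm, pairing_bb_aa]
  simp [eq_comm]

namespace ModeRep

variable {V : Type*} [AddCommGroup V] [Module ℂ V] {E O : GC → ℤ → Module.End ℂ V}
  (R : ModeRep E O)
include R

theorem E_zero (n : ℤ) : E 0 n = 0 := by simpa using R.E_smul 0 0 n

theorem O_zero (n : ℤ) : O 0 n = 0 := by simpa using R.O_smul 0 0 n

theorem O_neg (u : GC) (n : ℤ) : O (-u) n = -O u n := by simpa using R.O_smul (-1) u n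

theorem O_sub (u v : GC) (n : ℤ) : O (u - v) n = O u n - O v n := by
  rw [sub_eq_add_neg, R.O_add, R.O_neg, sub_eq_add_neg]

theorem E_sum {ι : Type*} (s : Finset ι) (f : ι → GC) (n : ℤ) :
    E (∑ i ∈ s, f i) n = ∑ i ∈ s, E (f i) n := by
  classical
  induction s using Finset.induction_on with
  | empty => simpa using R.E_zero n
  | insert i s hi ih => rw [Finset.sum_insert hi, Finset.sum_insert hi, R.E_add, ih]

theorem O_sum {ι : Type*} (s : Finset ι) (f : ι → GC) (n : ℤ) :
    O (∑ i ∈ s, f i) n = ∑ i ∈ s, O (f i) n := by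
  classical
  induction s using Finset.induction_on with
  | empty => simpa using R.O_zero n
  | insert i s hi ih => rw [Finset.sum_insert hi, Finset.sum_insert hi, R.O_add, ih]

theorem OE (u v : GC) (m k : ℤ) : O v k * E u m = E u m * O v k + O (br v u) (m + k) := by
  rw [R.EO, br_swap u v, R.O_neg]
  abel

end ModeRep

/-! ## The `N = 1` super-conformal generator -/

section NOne

variable {V : Type*} [AddCommGroup V] [Module ℂ V]

/-- The modes of `:ᾱ^1(z) ᾱ^2(z):`. -/
def cc (O : GC → ℤ → Module.End ℂ V) (n : ℤ) : Module.End ℂ V :=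
  nprod (-1) 0 (O (aa 1)) (O (aa 2)) (n - 1)

/-- The currents `β_i`, corrected by a bilinear in the fermions. -/
def bt (E O : GC → ℤ → Module.End ℂ V) (i : Fin 4) (n : ℤ) : Module.End ℂ V :=
  E (bb i) n + (if i = 3 then 2 else 0 : ℂ) • cc O n

/-- The modes (`r + 1/2`) of the generator
`∑ (:β_i(z) ᾱ^i(z): + :α^i(z) β̄_i(z):) + 2 ᾱ^1(z) ᾱ^2(z) ᾱ^3(z)` of the `N = 1` algebra. -/
def superG (E O : GC → ℤ → Module.End ℂ V) (r : ℤ) : Module.End ℂ V :=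
  ∑ i, (nprod 1 0 (bt E O i) (O (aa i)) r + nprod 1 0 (E (aa i)) (O (bb i)) r)

theorem nprod_zero_left {B : ℤ → Module.End ℂ V} (ε : ℂ) (c n : ℤ) :
    nprod ε c (fun _ => 0) B n = 0 := by
  rw [nprod]
  split_ifs with h
  · ext v
    simp [nterm]
  · rfl

theorem nprod_zero_right {B : ℤ → Module.End ℂ V} (ε : ℂ) (c n : ℤ) :
    nprod ε c B (fun _ => 0) n = 0 := by
  rw [nprod]
  split_ifs with h
  · ext v
    simp [nterm]
  · rfl

/-- The ordering of factors that commute does not matter. -/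
theorem nprod_split_zero {A B : ℤ → Module.End ℂ V} (hA : IsField A) (hB : IsField B) {ε : ℂ}
    {n : ℤ} (h : ∀ k l, A k * B l = ε • (B l * A k)) (m : ℤ) :
    nprod ε m A B n = nprod ε 0 A B n := by
  rw [nprod_split hA hB (fun _ => 0) rfl (fun k => by simp [h])]
  simp

namespace ModeRep

variable {E O : GC → ℤ → Module.End ℂ V} (R : ModeRep E O)
include R

theorem fcc : IsField (cc O) := by
  exact (isField_nprod (R.fO (aa 1)) (R.fO (aa 2)) (-1) 0).shift (-1)

theorem fbt (i : Fin 4) : IsField (bt E O i) := (R.fE _).add (R.fcc.smul _)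

theorem OO_aa (i j : Fin 4) (k l : ℤ) :
    O (aa i) k * O (aa j) l = -(O (aa j) l * O (aa i) k) := by
  rw [R.OO, pairing_aa_aa]
  simp

/-- Normally ordered products of the fermions `ᾱ^i` are antisymmetric. -/
theorem nprod_aa_swap (i j : Fin 4) (c n : ℤ) :
    nprod (-1) c (O (aa i)) (O (aa j)) n = -nprod (-1) 0 (O (aa j)) (O (aa i)) n := by
  rw [nprod_swap (R.fO _) (R.fO _) (by norm_num),
    nprod_split_zero (R.fO _) (R.fO _) (fun k l => by simpa using R.OO_aa j i k l)]
  simp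

theorem O_aa_cc (i : Fin 4) (k n : ℤ) : O (aa i) k * cc O n = cc O n * O (aa i) k := by
  have := comm_nprod_odd_odd (m := 0) (m' := 0) (D := O (aa i) k) (R.fO (aa 1)) (R.fO (aa 2))
    isField_zero isField_zero (fun l => by rw [R.OO_aa, add_zero]) (fun l => by rw [R.OO_aa, add_zero]) (n - 1)
  simpa [cc, nprod_zero_left, nprod_zero_right] using this

theorem E_cc (u : GC) (k n : ℤ) : E u k * cc O n = cc O n * E u k := by
  have := comm_nprod_even (ε := -1) (m := 0) (m' := 0) (D := E u k) (R.fO (aa 1)) (R.fO (aa 2))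
    isField_zero isField_zero (fun l => by simp [R.EO, br_aa_right, R.O_zero])
    (fun l => by simp [R.EO, br_aa_right, R.O_zero]) (n - 1)
  simpa [cc, nprod_zero_left, nprod_zero_right] using this

theorem O_bb_cc (j : Fin 4) (k n : ℤ) : O (bb j) k * cc O n = cc O n * O (bb j) k
    + ((if j = 1 then 1 else 0 : ℂ) • O (aa 2) (n + k)
      - (if j = 2 then 1 else 0 : ℂ) • O (aa 1) (n + k)) := by
  have := comm_nprod_odd_odd (m := 0) (m' := 0) (D := O (bb j) k) (R.fO (aa 1)) (R.fO (aa 2))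
    (isField_delta (k + 1) (if j = 1 then 1 else 0))
    (isField_delta (k + 1) (if j = 2 then 1 else 0))
    (fun l => by rw [R.OO, pairing_bb_aa, add_zero, show k + l + 1 = l + (k + 1) by ring])
    (fun l => by rw [R.OO, pairing_bb_aa, add_zero, show k + l + 1 = l + (k + 1) by ring]) (n - 1)
  rw [nprod_delta_left (R.fO _), nprod_delta_right (R.fO _)] at this
  rw [cc, this]
  ring_nf
  abel

/-- The brackets of a basis vector with the corrected currents. -/
theorem O_bb_bt (i j : Fin 4) (k n : ℤ) : O (bb j) k * bt E O i n = bt E O i n * O (bb j) k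
    + ((∑ l, (eps j i l : ℂ) • O (aa l) (n + k)) + (if i = 3 then 2 else 0 : ℂ) •
      ((if j = 1 then 1 else 0 : ℂ) • O (aa 2) (n + k)
      - (if j = 2 then 1 else 0 : ℂ) • O (aa 1) (n + k))) := by
  rw [bt, mul_add, add_mul, R.OE, br_bb, R.O_sum, mul_smul_comm, R.O_bb_cc, smul_mul_assoc,
    smul_add]
  simp only [R.O_smul]
  abel

/-- `{G_r, ū_k} = u_{r+k+1}` for the basis vectors `α^j`. -/
theorem O_aa_superG (j : Fin 4) (k r : ℤ) : O (aa j) k * superG E O r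
    = -(superG E O r * O (aa j) k) + E (aa j) (r + k + 1) := by
  have h1 : ∀ i, O (aa j) k * nprod 1 0 (bt E O i) (O (aa i)) r
      = -(nprod 1 0 (bt E O i) (O (aa i)) r * O (aa j) k) := fun i => by
    -- The fermions `ᾱ` commute with all currents involved and anticommute with one another, so only
    -- the contraction with `β̄_j` in `h2` contributes.
    have := comm_nprod_even_odd (m := 0) (m' := 0) (D := O (aa j) k) (R.fbt i) (R.fO (aa i))
      isField_zero isField_zero (fun l => by
        rw [bt, mul_add, R.OE, br_aa_left, R.O_zero, mul_smul_comm, R.O_aa_cc, add_mul,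
          smul_mul_assoc]
        simp) (fun l => by rw [R.OO_aa, add_zero]) r
    simpa [nprod_zero_left, nprod_zero_right] using this
  have h2 : ∀ i, O (aa j) k * nprod 1 0 (E (aa i)) (O (bb i)) r
      = -(nprod 1 0 (E (aa i)) (O (bb i)) r * O (aa j) k)
        + (if j = i then 1 else 0 : ℂ) • E (aa i) (r + k + 1) := fun i => by
    have := comm_nprod_even_odd (m := 0) (m' := 0) (D := O (aa j) k) (R.fE (aa i)) (R.fO (bb i))
      isField_zero (isField_delta (k + 1) (if j = i then 1 else 0)) (fun l => by
        rw [R.OE, br_aa_left, R.O_zero])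
      (fun l => by rw [R.OO, pairing_aa_bb, add_zero, show k + l + 1 = l + (k + 1) by ring]) r
    rw [nprod_delta_right (R.fE _), nprod_zero_left] at this
    rw [this, add_zero]
    ring_nf
  simp only [superG, Finset.mul_sum, Finset.sum_mul, mul_add, add_mul, h1, h2,
    Finset.sum_add_distrib, ite_smul, one_smul, zero_smul, Finset.sum_ite_eq, Finset.mem_univ,
    if_true, Finset.sum_neg_distrib]
  abel

/-- Contracting `β̄_j` with `ᾱ^j` leaves the corrected current `bt`. The brackets of `β̄_j` with the
currents `β_i` produce bilinears in the `ᾱ`, and the cubic term of the generator is there to cancel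
them. That term is stored entirely in the index 3, so that only products of two fields need to be
ordered. -/
theorem O_bb_superG (j : Fin 4) (k r : ℤ) : O (bb j) k * superG E O r
    = -(superG E O r * O (bb j) k) + E (bb j) (r + k + 1) := by
  have fX : ∀ i, IsField (fun n => (∑ l, (eps j i l : ℂ) • O (aa l) n)
      + (if i = 3 then 2 else 0 : ℂ) • ((if j = 1 then 1 else 0 : ℂ) • O (aa 2) n
      - (if j = 2 then 1 else 0 : ℂ) • O (aa 1) n)) := fun i =>
    (IsField.sum _ fun l => (R.fO (aa l)).smul _).add
      ((((R.fO (aa 2)).smul _).sub ((R.fO (aa 1)).smul _)).smul _)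
  have h1 : ∀ i, O (bb j) k * nprod 1 0 (bt E O i) (O (aa i)) r
      = -(nprod 1 0 (bt E O i) (O (aa i)) r * O (bb j) k)
        + nprod (-1) k (fun n => (∑ l, (eps j i l : ℂ) • O (aa l) n)
      + (if i = 3 then 2 else 0 : ℂ) • ((if j = 1 then 1 else 0 : ℂ) • O (aa 2) n
      - (if j = 2 then 1 else 0 : ℂ) • O (aa 1) n)) (O (aa i)) (r + k)
        + (if j = i then 1 else 0 : ℂ) • bt E O i (r + k + 1) := fun i => by
    have := comm_nprod_even_odd (m := k) (m' := 0) (D := O (bb j) k) (R.fbt i) (R.fO (aa i))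
      (fX i) (isField_delta (k + 1) (if j = i then 1 else 0)) (fun l => R.O_bb_bt i j k l)
      (fun l => by rw [R.OO, pairing_bb_aa, add_zero, show k + l + 1 = l + (k + 1) by ring]) r
    rw [nprod_delta_right (R.fbt _)] at this
    rw [this]
    ring_nf
  have h2 : ∀ i, O (bb j) k * nprod 1 0 (E (aa i)) (O (bb i)) r
      = -(nprod 1 0 (E (aa i)) (O (bb i)) r * O (bb j) k) := fun i => by
    have := comm_nprod_even_odd (m := 0) (m' := 0) (D := O (bb j) k) (R.fE (aa i)) (R.fO (bb i))
      isField_zero isField_zero (fun l => by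
        rw [R.OE, br_aa_right, R.O_zero]) (fun l => by rw [R.OO, pairing_bb_bb]; simp) r
    simpa [nprod_zero_left, nprod_zero_right] using this
  -- The `ᾱ` anticommute without central term, so the point `k` where the ordering changes can be
  -- moved to 0 freely.
  have hs : ∀ i l : Fin 4, ∀ a : ℂ, nprod (-1) k (fun n => a • O (aa i) n) (O (aa l)) (r + k)
      = a • nprod (-1) 0 (O (aa i)) (O (aa l)) (r + k) := fun i l a => by
    rw [nprod_smul_left (R.fO _) (R.fO _), nprod_split_zero (R.fO _) (R.fO _)
      (fun k' l' => by simpa using R.OO_aa i l k' l')]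
  have hc : ∀ n, cc O (n + 1) = nprod (-1) 0 (O (aa 1)) (O (aa 2)) n := fun n => by
    rw [cc, add_sub_cancel_right]
  -- This fixes the coefficient 2. For j = 3 the brackets give -2 `:ᾱ^1 ᾱ^2:`, cancelled by the
  -- correction in `bt`; for j = 1, 2 the correction reverses the sign of one of two bilinears that
  -- would otherwise add up.
  have key : ∑ i, (nprod (-1) k (fun n => (∑ l, (eps j i l : ℂ) • O (aa l) n)
      + (if i = 3 then 2 else 0 : ℂ) • ((if j = 1 then 1 else 0 : ℂ) • O (aa 2) n
      - (if j = 2 then 1 else 0 : ℂ) • O (aa 1) n)) (O (aa i)) (r + k)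
        + (if j = i then 1 else 0 : ℂ) • bt E O i (r + k + 1)) = E (bb j) (r + k + 1) := by
    fin_cases j
    · simp [Fin.sum_univ_four, eps, bt, nprod_zero_left]
    · simp [Fin.sum_univ_four, eps, bt, nprod_zero_left]
      rw [show (fun n => O (aa 3) n) = fun n => (1 : ℂ) • O (aa 3) n by funext; module,
        show (fun n => -O (aa 2) n + (2 : ℂ) • O (aa 2) n) = fun n => (1 : ℂ) • O (aa 2) n by
          funext; module, hs, hs, R.nprod_aa_swap 3 2]
      module
    · simp [Fin.sum_univ_four, eps, bt, nprod_zero_left]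
      rw [show (fun n => -O (aa 3) n) = fun n => (-1 : ℂ) • O (aa 3) n by funext; module,
        show (fun n => O (aa 1) n + -((2 : ℂ) • O (aa 1) n)) = fun n => (-1 : ℂ) • O (aa 1) n by
          funext; module, hs, hs, R.nprod_aa_swap 3 1]
      module
    · simp [Fin.sum_univ_four, eps, bt, nprod_zero_left]
      rw [show (fun n => O (aa 2) n) = fun n => (1 : ℂ) • O (aa 2) n by funext; module,
        show (fun n => -O (aa 1) n) = fun n => (-1 : ℂ) • O (aa 1) n by funext; module,
        hs, hs, hc, R.nprod_aa_swap 2 1]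
      module
  have := Finset.sum_congr (s₁ := Finset.univ) rfl fun i _ => congrArg₂ (· + ·) (h1 i) (h2 i)
  simp only [add_assoc, Finset.sum_add_distrib, Finset.sum_neg_distrib] at this key
  simp only [superG, Finset.mul_sum, Finset.sum_mul, mul_add, add_mul, Finset.sum_add_distrib,
    neg_add, ← add_assoc] at this key ⊢
  rw [this, ← key]
  abel

/-- `{G_r, ū_k} = u_{r+k+1}`. -/
theorem O_superG (u : GC) (k r : ℤ) : O u k * superG E O r
    = -(superG E O r * O u k) + E u (r + k + 1) := by
  have h := R.O_sum Finset.univ (fun i => u (.inl i) • bb i + u (.inr i) • aa i) k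
  have h' := R.E_sum Finset.univ (fun i => u (.inl i) • bb i + u (.inr i) • aa i) (r + k + 1)
  rw [← gc_decomp] at h h'
  rw [h, h', Finset.sum_mul, Finset.mul_sum, ← Finset.sum_neg_distrib, ← Finset.sum_add_distrib]
  refine Finset.sum_congr rfl fun i _ => ?_
  simp only [R.O_add, R.O_smul, R.E_add, R.E_smul, add_mul, mul_add, smul_mul_assoc,
    mul_smul_comm, R.O_aa_superG, R.O_bb_superG]
  module

/-- `[u_n, G_r] = n ū_{r+n}` for the basis vectors `α^j`. -/
theorem E_aa_superG (j : Fin 4) (n r : ℤ) : E (aa j) n * superG E O r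
    = superG E O r * E (aa j) n + (n : ℂ) • O (aa j) (r + n) := by
  have h1 : ∀ i, E (aa j) n * nprod 1 0 (bt E O i) (O (aa i)) r
      = nprod 1 0 (bt E O i) (O (aa i)) r * E (aa j) n
        + (if j = i then n else 0 : ℂ) • O (aa i) (r + n) := fun i => by
    have := comm_nprod_even (ε := 1) (m := 0) (m' := 0) (D := E (aa j) n) (R.fbt i) (R.fO (aa i))
      (isField_delta n (if j = i then (n : ℂ) else 0)) isField_zero (fun l => by
        rw [bt, mul_add, R.EE, br_aa_left, R.E_zero, mul_smul_comm, R.E_cc, add_mul,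
          smul_mul_assoc, pairing_aa_bb, add_comm n l]
        simp only [add_zero, mul_ite, mul_one, mul_zero]
        abel) (fun l => by rw [R.EO, br_aa_left, R.O_zero, add_zero]) r
    rw [nprod_zero_right, nprod_delta_left (R.fO _)] at this
    simpa using this
  have h2 : ∀ i, E (aa j) n * nprod 1 0 (E (aa i)) (O (bb i)) r
      = nprod 1 0 (E (aa i)) (O (bb i)) r * E (aa j) n := fun i => by
    have := comm_nprod_even (ε := 1) (m := 0) (m' := 0) (D := E (aa j) n) (R.fE (aa i))
      (R.fO (bb i)) isField_zero isField_zero (fun l => by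
        rw [R.EE, br_aa_left, R.E_zero, pairing_aa_aa]
        simp)
      (fun l => by rw [R.EO, br_aa_left, R.O_zero, add_zero]) r
    simpa [nprod_zero_left, nprod_zero_right] using this
  simp only [superG, Finset.mul_sum, Finset.sum_mul, mul_add, add_mul, h1, h2,
    Finset.sum_add_distrib, ite_smul, zero_smul, Finset.sum_ite_eq, Finset.mem_univ,
    if_true]
  abel

/-- The pairing with `α^j` gives the term `n β̄_j`. The bracket terms form the sum of ε_{jil} (`:α^l
ᾱ^i:` + `:α^i ᾱ^l:`), which vanishes by antisymmetry of ε. -/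
theorem E_bb_superG (j : Fin 4) (n r : ℤ) : E (bb j) n * superG E O r
    = superG E O r * E (bb j) n + (n : ℂ) • O (bb j) (r + n) := by
  have fX : ∀ i, IsField (fun n => ∑ l, (eps j i l : ℂ) • E (aa l) n) := fun i =>
    IsField.sum _ fun l => (R.fE (aa l)).smul _
  have fY : ∀ i, IsField (fun n => ∑ l, (eps j i l : ℂ) • O (aa l) n) := fun i =>
    IsField.sum _ fun l => (R.fO (aa l)).smul _
  have hEO : ∀ (a : ℂ) (i l : Fin 4) (k k' : ℤ), (a • E (aa i) k) * O (aa l) k'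
      = (1 : ℂ) • (O (aa l) k' * (a • E (aa i) k)) := fun a i l k k' => by
    rw [smul_mul_assoc, R.EO, br_aa_left, R.O_zero, add_zero, one_smul, mul_smul_comm]
  have h1 : ∀ i, E (bb j) n * nprod 1 0 (bt E O i) (O (aa i)) r
      = nprod 1 0 (bt E O i) (O (aa i)) r * E (bb j) n
        + nprod 1 n (fun n => ∑ l, (eps j i l : ℂ) • E (aa l) n) (O (aa i)) (r + n) := fun i => by
    have := comm_nprod_even (ε := 1) (m := n) (m' := 0) (D := E (bb j) n) (R.fbt i) (R.fO (aa i))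
      (fX i) isField_zero (fun l => by
        rw [bt, mul_add, R.EE, br_bb, R.E_sum, mul_smul_comm, R.E_cc, add_mul,
          smul_mul_assoc, pairing_bb_bb, add_comm n l]
        simp only [R.E_smul, mul_zero, ite_self, zero_smul, add_zero]
        abel) (fun l => by rw [R.EO, br_aa_right, R.O_zero, add_zero]) r
    simpa [nprod_zero_right] using this
  have h2 : ∀ i, E (bb j) n * nprod 1 0 (E (aa i)) (O (bb i)) r
      = nprod 1 0 (E (aa i)) (O (bb i)) r * E (bb j) n
        + (if j = i then n else 0 : ℂ) • O (bb i) (r + n)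
        + nprod 1 0 (E (aa i)) (fun n => ∑ l, (eps j i l : ℂ) • O (aa l) n) (r + n) := fun i => by
    have := comm_nprod_even (ε := 1) (m := 0) (m' := n) (D := E (bb j) n) (R.fE (aa i))
      (R.fO (bb i)) (isField_delta n (if j = i then (n : ℂ) else 0)) (fY i) (fun l => by
        rw [R.EE, br_aa_right, R.E_zero, pairing_bb_aa, add_comm n l]
        simp only [add_zero, mul_ite, mul_one, mul_zero])
      (fun l => by rw [R.EO, br_bb, R.O_sum, add_comm n l]; simp only [R.O_smul]) r
    rw [nprod_delta_left (R.fO _)] at this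
    simpa using this
  have sL : ∀ i, nprod 1 n (fun n => ∑ l, (eps j i l : ℂ) • E (aa l) n) (O (aa i)) (r + n)
      = ∑ l, (eps j i l : ℂ) • nprod 1 0 (E (aa l)) (O (aa i)) (r + n) := fun i => by
    rw [nprod_split_zero (fX i) (R.fO _) (fun k l => by
      simp only [Finset.sum_mul, Finset.mul_sum, Finset.smul_sum, hEO])]
    simpa [nterm, Fin.sum_univ_four, add_mul, mul_add] using nprod_sum_congr {()} Finset.univ
      (fun _ => 1) (fun _ => 1) (fun _ => 0)
      (fun _ n => ∑ l, (eps j i l : ℂ) • E (aa l) n) (fun _ => O (aa i)) (fun _ => r + n)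
      (fun l => (eps j i l : ℂ)) (fun _ => 1) (fun _ => 0) (fun l => E (aa l)) (fun _ => O (aa i))
      (fun _ => r + n) (fun _ => fX i) (fun _ => R.fO _) (fun _ => R.fE _) (fun _ => R.fO _)
      (fun k => by
        simp only [nterm]
        split_ifs <;> simp [Finset.sum_mul, Finset.mul_sum])
  have sR : ∀ i, nprod 1 0 (E (aa i)) (fun n => ∑ l, (eps j i l : ℂ) • O (aa l) n) (r + n)
      = ∑ l, (eps j i l : ℂ) • nprod 1 0 (E (aa i)) (O (aa l)) (r + n) := fun i => by
    simpa [nterm, Fin.sum_univ_four, add_mul, mul_add] using nprod_sum_congr {()} Finset.univ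
      (fun _ => 1) (fun _ => 1) (fun _ => 0)
      (fun _ => E (aa i)) (fun _ n => ∑ l, (eps j i l : ℂ) • O (aa l) n) (fun _ => r + n)
      (fun l => (eps j i l : ℂ)) (fun _ => 1) (fun _ => 0) (fun _ => E (aa i)) (fun l => O (aa l))
      (fun _ => r + n) (fun _ => R.fE _) (fun _ => fY i) (fun _ => R.fE _) (fun _ => R.fO _)
      (fun k => by
        simp only [nterm]
        split_ifs <;> simp [Finset.sum_mul, Finset.mul_sum])
  have key : ∑ i, nprod 1 n (fun n => ∑ l, (eps j i l : ℂ) • E (aa l) n) (O (aa i)) (r + n)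
      + ∑ i, nprod 1 0 (E (aa i)) (fun n => ∑ l, (eps j i l : ℂ) • O (aa l) n) (r + n) = 0 := by
    simp only [sL, sR]
    rw [Finset.sum_comm, ← Finset.sum_add_distrib]
    refine Finset.sum_eq_zero fun i _ => ?_
    rw [← Finset.sum_add_distrib]
    refine Finset.sum_eq_zero fun l _ => ?_
    rw [eps_swap' j i l]
    push_cast
    module
  simp only [superG, Finset.mul_sum, Finset.sum_mul, mul_add, add_mul, h1, h2,
    Finset.sum_add_distrib, ite_smul, zero_smul, Finset.sum_ite_eq, Finset.mem_univ,
    if_true]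
  rw [eq_neg_of_add_eq_zero_left key]
  abel

/-- `[u_n, G_r] = n ū_{r+n}`. -/
theorem E_superG (u : GC) (n r : ℤ) : E u n * superG E O r
    = superG E O r * E u n + (n : ℂ) • O u (r + n) := by
  have h := R.E_sum Finset.univ (fun i => u (.inl i) • bb i + u (.inr i) • aa i) n
  have h' := R.O_sum Finset.univ (fun i => u (.inl i) • bb i + u (.inr i) • aa i) (r + n)
  rw [← gc_decomp] at h h'
  rw [h, h', Finset.sum_mul, Finset.mul_sum, Finset.smul_sum, ← Finset.sum_add_distrib]
  refine Finset.sum_congr rfl fun i _ => ?_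
  simp only [R.O_add, R.O_smul, R.E_add, R.E_smul, add_mul, mul_add, smul_mul_assoc,
    mul_smul_comm, R.E_aa_superG, R.E_bb_superG]
  module

theorem fsuperG : IsField (superG E O) :=
  IsField.sum _ fun i => (isField_nprod (R.fbt i) (R.fO _) _ _).add
    (isField_nprod (R.fE _) (R.fO _) _ _)

end ModeRep

end NOne

/-! ## Bilinears in the fermions -/

section Bilinears

variable {V : Type*} [AddCommGroup V] [Module ℂ V]

/-- Fields depending linearly on a vector of `(g ⊕ t²) ⊗ ℂ`. -/
structure IsLinField (A : GC → ℤ → Module.End ℂ V) : Prop where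
  add : ∀ u v n, A (u + v) n = A u n + A v n
  smul : ∀ (c : ℂ) u n, A (c • u) n = c • A u n
  field : ∀ u, IsField (A u)

theorem ModeRep.lfE {E O : GC → ℤ → Module.End ℂ V} (R : ModeRep E O) : IsLinField E :=
  ⟨R.E_add, R.E_smul, R.fE⟩

theorem ModeRep.lfO {E O : GC → ℤ → Module.End ℂ V} (R : ModeRep E O) : IsLinField O :=
  ⟨R.O_add, R.O_smul, R.fO⟩

/-- The normally ordered product of linear families of fields, as a bilinear map. -/
def nbil {A B : GC → ℤ → Module.End ℂ V} (hA : IsLinField A) (hB : IsLinField B) (ε : ℂ)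
    (c n : ℤ) : GC →ₗ[ℂ] GC →ₗ[ℂ] Module.End ℂ V :=
  LinearMap.mk₂ ℂ (fun x y => nprod ε c (A x) (B y) n)
    (fun x x' y => by
      rw [show A (x + x') = fun k => A x k + A x' k from funext (hA.add x x')]
      exact nprod_add_left (hA.field x) (hB.field y) (hA.field x') _ _ _)
    (fun a x y => by
      rw [show A (a • x) = fun k => a • A x k from funext (hA.smul a x)]
      exact nprod_smul_left (hA.field x) (hB.field y) _ _ _ _)
    (fun x y y' => by
      rw [show B (y + y') = fun k => B y k + B y' k from funext (hB.add y y')]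
      exact nprod_add_right (hA.field x) (hB.field y) (hB.field y') _ _ _)
    (fun a x y => by
      rw [show B (a • y) = fun k => a • B y k from funext (hB.smul a y)]
      exact nprod_smul_right (hA.field x) (hB.field y) _ _ _ _)

theorem nbil_apply {A B : GC → ℤ → Module.End ℂ V} (hA : IsLinField A) (hB : IsLinField B) (ε : ℂ)
    (c n : ℤ) (x y : GC) : nbil hA hB ε c n x y = nprod ε c (A x) (B y) n := rfl

/-- If the modes of both factors are rescaled by weights adding up to `w`, the normally ordered
product is rescaled by `w`. -/
theorem nprod_weights {A B : ℤ → Module.End ℂ V} (hA : IsField A) (hB : IsField B) (ε : ℂ)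
    (a b : ℤ → ℂ) (c n : ℤ) (w : ℂ) (h : ∀ k, a k + b (n - k) = w) :
    nprod ε c (fun k => a k • A k) B n + nprod ε c A (fun k => b k • B k) n
      = w • nprod ε c A B n := by
  ext v
  rw [LinearMap.add_apply, LinearMap.smul_apply, nprod_apply (hA.wsmul a) hB,
    nprod_apply hA (hB.wsmul b), nprod_apply hA hB, smul_finsum,
    ← finsum_add_distrib (nterm_finite (hA.wsmul a) hB _ _ _ v)
      (nterm_finite hA (hB.wsmul b) _ _ _ v)]
  refine finsum_congr fun k => ?_
  simp only [nterm]
  split_ifs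
  · simp [← h k, add_smul]
  · simp only [mul_smul_comm, smul_mul_assoc, LinearMap.smul_apply, smul_smul, ← h k, ← add_smul]
    congr 1
    ring

namespace ModeRep

variable {E O : GC → ℤ → Module.End ℂ V} (R : ModeRep E O)
include R

/-- `O x k` has degree k + 1/2, so a fermion bilinear of degree n carries the index n - 1. Each mode
moved across contributes the pairing, and only when n = 0. -/
theorem nprod_O_split (x y : GC) (c n : ℤ) : nprod (-1) c (O x) (O y) (n - 1)
    = nprod (-1) 0 (O x) (O y) (n - 1) + (if n = 0 then c * pairing x y else 0) • 1 := by
  refine nprod_split (R.fO x) (R.fO y) (fun m => (if n = 0 then m * pairing x y else 0) • 1)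
    (by simp) (fun k => ?_) c
  rw [R.OO, show k + (n - 1 - k) + 1 = n by ring, ← sub_smul]
  split_ifs
  · push_cast
    module
  · simp

/-- Exchanging the factors moves the ordering point from 0 to `n`. The resulting central term is `n`
times a quantity supported at n = 0, hence zero. -/
theorem nprod_O_swap (x y : GC) (n : ℤ) : nprod (-1) 0 (O x) (O y) (n - 1)
    = -nprod (-1) 0 (O y) (O x) (n - 1) := by
  rw [nprod_swap (R.fO _) (R.fO _) (by norm_num), R.nprod_O_split y x]
  split_ifs with h
  · simp [h]
  · simp

theorem O_nprod (v x y : GC) (k n : ℤ) : O v k * nprod (-1) 0 (O x) (O y) (n - 1)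
    = nprod (-1) 0 (O x) (O y) (n - 1) * O v k
      + (pairing v x • O y (n + k) - pairing v y • O x (n + k)) := by
  have := comm_nprod_odd_odd (m := 0) (m' := 0) (D := O v k) (R.fO x) (R.fO y)
    (isField_delta (k + 1) (pairing v x)) (isField_delta (k + 1) (pairing v y))
    (fun l => by rw [R.OO, add_zero, show k + l + 1 = l + (k + 1) by ring])
    (fun l => by rw [R.OO, add_zero, show k + l + 1 = l + (k + 1) by ring]) (n - 1)
  rw [nprod_delta_left (R.fO _), nprod_delta_right (R.fO _)] at this
  rw [this]
  ring_nf
  abel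

/-- The derivation rule, with a central term because the first product comes out ordered at `m`. -/
theorem E_nprod (u x y : GC) (m n : ℤ) : E u m * nprod (-1) 0 (O x) (O y) (n - 1)
    = nprod (-1) 0 (O x) (O y) (n - 1) * E u m
      + (nprod (-1) 0 (O (br u x)) (O y) (n + m - 1) + nprod (-1) 0 (O x) (O (br u y)) (n + m - 1)
      + (if n + m = 0 then m * pairing (br u x) y else 0) • 1) := by
  have := comm_nprod_even (ε := -1) (m := m) (m' := m) (D := E u m) (R.fO x) (R.fO y)
    (R.fO (br u x)) (R.fO (br u y)) (fun l => by rw [R.EO, add_comm m l])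
    (fun l => by rw [R.EO, add_comm m l]) (n - 1)
  rw [show n - 1 + m = n + m - 1 by ring, R.nprod_O_split (br u x) y m (n + m)] at this
  rw [this]
  abel

end ModeRep

end Bilinears

/-! ## Manin triples -/

/-- An involution `K` of `(g ⊕ t²) ⊗ ℂ` whose eigenspaces, with dual bases `e` (eigenvalue `-1`) and
`e'` (eigenvalue `1`), are unimodular Lagrangian subalgebras. -/
structure IsManinTriple (K : GC →ₗ[ℂ] GC) (e e' : Fin 4 → GC) : Prop where
  K_e : ∀ i, K (e i) = -e i
  K_e' : ∀ i, K (e' i) = e' i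
  dual : ∀ i, pairing (e' i) (e i) = 1
  complete : ∀ x, x = ∑ i, (pairing (e i) x • e' i + pairing (e' i) x • e i)
  nijenhuis : ∀ u v, br u v - K (br u (K v)) = K (br (K u) v) - br (K u) (K v)
  unimodular : ∑ i, br (e' i) (e i) = 0

/-- Invariance of the pairing is the cyclic symmetry of ε. -/
theorem pairing_br (u v w : GC) : pairing (br u v) w = pairing u (br v w) := by
  simp only [pairing, br, Sum.elim_inl, Sum.elim_inr, zero_mul, mul_zero, zero_add, add_zero]
  simp only [Fin.sum_univ_four, eps]
  simp
  ring

theorem pairing_add_right (u v v' : GC) : pairing u (v + v') = pairing u v + pairing u v' := by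
  rw [pairing_comm, pairing_add_left, pairing_comm v, pairing_comm v']

theorem pairing_smul_right (c : ℂ) (u v : GC) : pairing u (c • v) = c * pairing u v := by
  rw [pairing_comm, pairing_smul_left, pairing_comm v]

/-- The invariant pairing, as a bilinear map. -/
def pairingL : GC →ₗ[ℂ] GC →ₗ[ℂ] ℂ :=
  LinearMap.mk₂ ℂ pairing pairing_add_left pairing_smul_left pairing_add_right pairing_smul_right

theorem pairingL_apply (u v : GC) : pairingL u v = pairing u v := rfl

/-- The adjoint action. -/
def adL : GC →ₗ[ℂ] GC →ₗ[ℂ] GC :=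
  LinearMap.mk₂ ℂ br br_add_left br_smul_left br_add_right br_smul_right

theorem adL_apply (u v : GC) : adL u v = br u v := rfl

/-- `g ⊕ t²` is two-step nilpotent. -/
theorem br_br_left (u v w : GC) : br (br u v) w = 0 := by
  funext x
  rcases x with x | x <;> simp [br]

theorem br_br_right (u v w : GC) : br u (br v w) = 0 := by
  rw [br_swap, br_br_left, neg_zero]

theorem pairing_zero_left (v : GC) : pairing 0 v = 0 := by simpa using pairing_smul_left 0 0 v

namespace IsManinTriple

variable {K : GC →ₗ[ℂ] GC} {e e' : Fin 4 → GC} (T : IsManinTriple K e e')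
include T

theorem K_K (x : GC) : K (K x) = x := by
  conv_lhs => rw [T.complete x]
  conv_rhs => rw [T.complete x]
  simp only [map_sum, map_add, map_smul, T.K_e, T.K_e', map_neg, neg_neg]

theorem K_apply (x : GC) :
    K x = ∑ i, (pairing (e i) x • e' i - pairing (e' i) x • e i) := by
  conv_lhs => rw [T.complete x]
  simp only [map_sum, map_add, map_smul, T.K_e, T.K_e', smul_neg, sub_eq_add_neg]

/-- The canonical tensor of the pairing is symmetric: an endomorphism may be moved to the other
factor, replacing it by its adjoint. -/
theorem sum_transpose {W : Type*} [AddCommGroup W] [Module ℂ W] (F : GC →ₗ[ℂ] GC →ₗ[ℂ] W)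
    (M M' : GC →ₗ[ℂ] GC) (h : ∀ x y, pairing (M x) y = pairing x (M' y)) :
    ∑ i, (F (M (e' i)) (e i) + F (M (e i)) (e' i))
      = ∑ i, (F (e' i) (M' (e i)) + F (e i) (M' (e' i))) := by
  have h1 : ∀ x z, F (M x) z = ∑ j, (pairing x (M' (e j)) • F (e' j) z
      + pairing x (M' (e' j)) • F (e j) z) := fun x z => by
    conv_lhs => rw [T.complete (M x)]
    simp only [map_sum, map_add, map_smul, LinearMap.sum_apply, LinearMap.add_apply,
      LinearMap.smul_apply]
    refine Finset.sum_congr rfl fun j _ => ?_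
    rw [pairing_comm (e j), pairing_comm (e' j), h, h]
  have h2 : ∀ x z, F z (M' x) = ∑ i, (pairing (e i) (M' x) • F z (e' i)
      + pairing (e' i) (M' x) • F z (e i)) := fun x z => by
    conv_lhs => rw [T.complete (M' x)]
    simp only [map_sum, map_add, map_smul]
  simp only [h1, h2, Finset.sum_add_distrib]
  rw [Finset.sum_comm, Finset.sum_comm (f := fun i j => pairing (e' i) (M' (e' j)) • F (e j) (e i)),
    Finset.sum_comm (f := fun i j => pairing (e i) (M' (e j)) • F (e' j) (e' i)),
    Finset.sum_comm (f := fun i j => pairing (e i) (M' (e' j)) • F (e j) (e' i))]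
  abel

theorem pairing_K (x y : GC) : pairing (K x) y = -pairing x (K y) := by
  simp only [← pairingL_apply, T.K_apply x, T.K_apply y, map_sum, map_sub, map_smul,
    LinearMap.sum_apply, LinearMap.sub_apply, LinearMap.smul_apply, smul_eq_mul,
    ← Finset.sum_neg_distrib]
  refine Finset.sum_congr rfl fun i _ => ?_
  simp only [pairingL_apply, pairing_comm x]
  ring

end IsManinTriple

/-! ## The super-field of a Manin triple -/

section ManinFields

variable {V : Type*} [AddCommGroup V] [Module ℂ V]

/-- The modes of `∑ :ē^i(z) ē_i(z):`. -/
def manJ (O : GC → ℤ → Module.End ℂ V) (e e' : Fin 4 → GC) (m : ℤ) : Module.End ℂ V :=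
  ∑ i, nprod (-1) 0 (O (e' i)) (O (e i)) (m - 1)

/-- The modes (`r + 1/2`) of `∑ (:e^i(z) ē_i(z): - :ē^i(z) e_i(z):)`. -/
def manQ (E O : GC → ℤ → Module.End ℂ V) (e e' : Fin 4 → GC) (r : ℤ) : Module.End ℂ V :=
  ∑ i, (nprod 1 0 (E (e' i)) (O (e i)) r - nprod 1 0 (O (e' i)) (E (e i)) r)

/-- The fermion bilinear of an endomorphism of `(g ⊕ t²) ⊗ ℂ`. -/
def bil (O : GC → ℤ → Module.End ℂ V) (e e' : Fin 4 → GC) (M : GC →ₗ[ℂ] GC) (n : ℤ) :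
    Module.End ℂ V :=
  ∑ i, (nprod (-1) 0 (O (M (e' i))) (O (e i)) (n - 1)
    + nprod (-1) 0 (O (M (e i))) (O (e' i)) (n - 1))

/-- The skew-adjoint endomorphism `(ad_u K - K ad_u) / 2`. -/
def wad (K : GC →ₗ[ℂ] GC) (u : GC) : GC →ₗ[ℂ] GC := (1 / 2 : ℂ) • (adL u ∘ₗ K - K ∘ₗ adL u)

/-- The Nijenhuis identity together with K² = 1. It describes how the currents `curB` transform
under J_0. -/
theorem IsManinTriple.wad_comm {K : GC →ₗ[ℂ] GC} {e e' : Fin 4 → GC} (T : IsManinTriple K e e')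
    (u : GC) : K ∘ₗ wad K u - wad K u ∘ₗ K = (2 : ℂ) • wad K (K u) := by
  refine LinearMap.ext fun x => ?_
  simp only [wad, LinearMap.sub_apply, LinearMap.comp_apply, LinearMap.smul_apply, map_smul,
    map_sub, T.K_K, adL_apply]
  have h := T.nijenhuis u x
  have h' : br (K u) (K x) = K (br (K u) x) - br u x + K (br u (K x)) := by
    rw [sub_eq_iff_eq_add] at h
    rw [h]
    abel
  rw [h']
  module

/-- The commutator of `J(z)` with the current `u`. -/
def curB (O : GC → ℤ → Module.End ℂ V) (K : GC →ₗ[ℂ] GC) (e e' : Fin 4 → GC) (u : GC) (n : ℤ) :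
    Module.End ℂ V := -bil O e e' (wad K u) n

variable {E O : GC → ℤ → Module.End ℂ V} (R : ModeRep E O) {K : GC →ₗ[ℂ] GC} {e e' : Fin 4 → GC}
  (T : IsManinTriple K e e')

namespace ModeRep

include R

theorem bil_eq (M : GC →ₗ[ℂ] GC) (n : ℤ) : bil O e e' M n
    = ∑ i, (nbil R.lfO R.lfO (-1) 0 (n - 1) (M (e' i)) (e i)
      + nbil R.lfO R.lfO (-1) 0 (n - 1) (M (e i)) (e' i)) := rfl

theorem bil_add (M M' : GC →ₗ[ℂ] GC) (n : ℤ) :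
    bil O e e' (M + M') n = bil O e e' M n + bil O e e' M' n := by
  simp only [R.bil_eq, LinearMap.add_apply, map_add, ← Finset.sum_add_distrib]
  exact Finset.sum_congr rfl fun i _ => by abel

theorem bil_smul (c : ℂ) (M : GC →ₗ[ℂ] GC) (n : ℤ) :
    bil O e e' (c • M) n = c • bil O e e' M n := by
  simp only [R.bil_eq, LinearMap.smul_apply, map_smul, Finset.smul_sum, smul_add]

theorem bil_neg (M : GC →ₗ[ℂ] GC) (n : ℤ) :
    bil O e e' (-M) n = -bil O e e' M n := by
  rw [← neg_one_smul ℂ M, R.bil_smul, neg_one_smul]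

theorem bil_zero (n : ℤ) : bil O e e' 0 n = 0 := by
  rw [← zero_smul ℂ (0 : GC →ₗ[ℂ] GC), R.bil_smul, zero_smul]

theorem lf_curB : IsLinField (curB O K e e') where
  add u v n := by
    rw [curB, show wad K (u + v) = wad K u + wad K v by
      simp only [wad, map_add, LinearMap.add_comp, LinearMap.comp_add]
      module, R.bil_add, neg_add]
    rfl
  smul c u n := by
    rw [curB, show wad K (c • u) = c • wad K u by
      simp only [wad, map_smul, LinearMap.smul_comp, LinearMap.comp_smul]
      module, R.bil_smul, ← smul_neg]
    rfl
  field u := IsField.neg <| IsField.sum _ fun _ =>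
    ((isField_nprod (R.fO _) (R.fO _) _ _).shift (-1)).add
      ((isField_nprod (R.fO _) (R.fO _) _ _).shift (-1))

theorem f_manJ : IsField (manJ O e e') :=
  IsField.sum _ fun _ => (isField_nprod (R.fO _) (R.fO _) _ _).shift (-1)

theorem f_manQ : IsField (manQ E O e e') :=
  IsField.sum _ fun _ => (isField_nprod (R.fE _) (R.fO _) _ _).sub
    (isField_nprod (R.fO _) (R.fE _) _ _)

include T

theorem manJ_O (v : GC) (m k : ℤ) :
    manJ O e e' m * O v k = O v k * manJ O e e' m + O (K v) (m + k) := by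
  rw [T.K_apply, R.O_sum]
  simp only [manJ, Finset.mul_sum, Finset.sum_mul, R.O_nprod, R.O_sub, R.O_smul,
    ← Finset.sum_add_distrib, pairing_comm v]
  exact Finset.sum_congr rfl fun i _ => by abel

/-- Fermion bilinears are antisymmetric, so `bil` only sees the skew-adjoint part of an
endomorphism. The adjoint of ad_u K is K ad_u, by invariance of the pairing and skewness of K, and
the skew part is `wad`. -/
theorem bil_ad (u : GC) (n : ℤ) : bil O e e' (adL u ∘ₗ K) n = bil O e e' (wad K u) n := by
  have h := T.sum_transpose (nbil R.lfO R.lfO (-1) 0 (n - 1)) (adL u ∘ₗ K) (K ∘ₗ adL u)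
    (fun x y => by
      simp only [LinearMap.comp_apply, adL_apply]
      rw [br_swap, ← neg_one_smul ℂ, pairing_smul_left, pairing_br, T.pairing_K]
      ring)
  rw [← R.bil_eq] at h
  have h' : bil O e e' (adL u ∘ₗ K) n = -bil O e e' (K ∘ₗ adL u) n := by
    rw [h, bil, ← Finset.sum_neg_distrib]
    refine Finset.sum_congr rfl fun i _ => ?_
    rw [nbil_apply, nbil_apply, R.nprod_O_swap (e' i), R.nprod_O_swap (e i)]
    abel
  rw [wad, R.bil_smul, sub_eq_add_neg, R.bil_add, R.bil_neg, ← h']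
  module

/-- The central terms add up to a multiple of the pairing of `u` with the sum of all [e^i, e_i],
which vanishes by unimodularity. -/
theorem E_manJ (u : GC) (m n : ℤ) :
    E u n * manJ O e e' m = manJ O e e' m * E u n + bil O e e' (wad K u) (m + n) := by
  have h1 : ∑ i, (if m + n = 0 then (n : ℂ) * pairing (br u (e' i)) (e i) else 0) •
      (1 : Module.End ℂ V) = 0 := by
    rw [← Finset.sum_smul]
    split_ifs
    · simp only [pairing_br, ← Finset.mul_sum]
      simp only [← pairingL_apply, ← map_sum]
      rw [T.unimodular, map_zero, mul_zero, zero_smul]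
    · simp
  rw [← R.bil_ad T]
  simp only [manJ, Finset.mul_sum, Finset.sum_mul, R.E_nprod, Finset.sum_add_distrib, h1, add_zero]
  rw [bil, Finset.sum_add_distrib]
  congr 2
  · exact Finset.sum_congr rfl fun i _ => by rw [LinearMap.comp_apply, T.K_e', adL_apply]
  · exact Finset.sum_congr rfl fun i _ => by
      rw [LinearMap.comp_apply, T.K_e, map_neg, adL_apply, R.nprod_O_swap,
        ← nbil_apply R.lfO R.lfO, ← nbil_apply R.lfO R.lfO, map_neg, LinearMap.neg_apply]

theorem manJ_E (u : GC) (m n : ℤ) :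
    manJ O e e' m * E u n = E u n * manJ O e e' m + curB O K e e' u (m + n) := by
  rw [R.E_manJ T, curB]
  abel

theorem manJ_bil (M : GC →ₗ[ℂ] GC) (n : ℤ) : manJ O e e' 0 * bil O e e' M n
    = bil O e e' M n * manJ O e e' 0 + bil O e e' (K ∘ₗ M - M ∘ₗ K) n := by
  have h : ∀ x y, manJ O e e' 0 * nprod (-1) 0 (O x) (O y) (n - 1)
      = nprod (-1) 0 (O x) (O y) (n - 1) * manJ O e e' 0
        + nprod (-1) 0 (O (K x)) (O y) (n - 1) + nprod (-1) 0 (O x) (O (K y)) (n - 1) :=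
    fun x y => by
      simpa using comm_nprod_even (ε := -1) (m := 0) (m' := 0) (D := manJ O e e' 0)
        (R.fO x) (R.fO y) (R.fO (K x)) (R.fO (K y)) (fun l => by rw [R.manJ_O T, add_comm 0 l])
        (fun l => by rw [R.manJ_O T, add_comm 0 l]) (n - 1)
  rw [sub_eq_add_neg, R.bil_add, R.bil_neg]
  simp only [bil, Finset.mul_sum, Finset.sum_mul, ← Finset.sum_neg_distrib,
    ← Finset.sum_add_distrib, mul_add, add_mul, h, LinearMap.comp_apply, T.K_e, T.K_e']
  refine Finset.sum_congr rfl fun i _ => ?_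
  simp only [← nbil_apply R.lfO R.lfO, map_neg, LinearMap.neg_apply]
  abel

theorem manJ_curB (u : GC) (n : ℤ) : manJ O e e' 0 * curB O K e e' u n
    = curB O K e e' u n * manJ O e e' 0 + (2 : ℂ) • curB O K e e' (K u) n := by
  simp only [curB, mul_neg, neg_mul, R.manJ_bil T, T.wad_comm, R.bil_smul, neg_add, smul_neg]

omit T in
theorem curB_br (u v : GC) (n : ℤ) : curB O K e e' (br u v) n = 0 := by
  rw [curB, show wad K (br u v) = 0 by
    refine LinearMap.ext fun x => ?_
    simp [wad, adL_apply, br_br_left], R.bil_zero, neg_zero]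

/-- Commuting J_0 with the vanishing operator `curB` of [u, v] gives twice the operator in question.
-/
theorem curB_K_br (u v : GC) (n : ℤ) : curB O K e e' (K (br u v)) n = 0 := by
  have := R.manJ_curB T (br u v) n
  rw [R.curB_br, mul_zero, zero_mul, zero_add] at this
  exact (smul_eq_zero.1 this.symm).resolve_left two_ne_zero

/-- The bilinear terms cancel since K has opposite eigenvalues on the two factors. Each of the four
dual pairs leaves `m` from the displaced ordering point, so 4 = c/3 with c = 12. -/
theorem manJ_manJ (m n : ℤ) : manJ O e e' m * manJ O e e' n
    = manJ O e e' n * manJ O e e' m + (if m + n = 0 then 4 * m else 0 : ℂ) • 1 := by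
  have h : ∀ i, manJ O e e' m * nprod (-1) 0 (O (e' i)) (O (e i)) (n - 1)
      = nprod (-1) 0 (O (e' i)) (O (e i)) (n - 1) * manJ O e e' m
        + (if m + n = 0 then (m : ℂ) else 0) • 1 :=
    fun i => by
      have := comm_nprod_even (ε := -1) (m := m) (m' := m) (D := manJ O e e' m)
        (R.fO (e' i)) (R.fO (e i)) (R.fO (K (e' i))) (R.fO (K (e i)))
        (fun l => by rw [R.manJ_O T, add_comm m l])
        (fun l => by rw [R.manJ_O T, add_comm m l]) (n - 1)
      rw [this, T.K_e', T.K_e, show n - 1 + m = n + m - 1 by ring,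
        R.nprod_O_split _ _ m (n + m), ← nbil_apply R.lfO R.lfO, ← nbil_apply R.lfO R.lfO,
        ← nbil_apply R.lfO R.lfO, map_neg, T.dual, add_comm m n, mul_one]
      abel
  conv_lhs => rw [manJ.eq_def _ _ _ n, Finset.mul_sum]
  conv_rhs => rw [manJ.eq_def _ _ _ n, Finset.sum_mul]
  simp only [h, Finset.sum_add_distrib, Finset.sum_const, Finset.card_univ, Fintype.card_fin]
  split_ifs
  · module
  · simp

end ModeRep

end ManinFields

/-! ## The `N = 2` structure of a Manin triple -/

section NTwo

variable {V : Type*} [AddCommGroup V] [Module ℂ V] {E O : GC → ℤ → Module.End ℂ V}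
  (R : ModeRep E O) {K : GC →ₗ[ℂ] GC} {e e' : Fin 4 → GC} (T : IsManinTriple K e e')

namespace ModeRep

include R

theorem superG_O (u : GC) (r k : ℤ) : superG E O r * O u k
    = -(O u k * superG E O r) + E u (k + (r + 1)) := by
  rw [R.O_superG, show k + (r + 1) = r + k + 1 by ring]
  abel

theorem superG_E (u : GC) (r n : ℤ) : superG E O r * E u n
    = E u n * superG E O r + (-(n : ℂ)) • O u (n + r) := by
  rw [R.E_superG, add_comm n r]
  module

theorem superG_nprod (x y : GC) (r n : ℤ) : superG E O r * nprod (-1) 0 (O x) (O y) (n - 1)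
    = nprod (-1) 0 (O x) (O y) (n - 1) * superG E O r
      + nprod 1 (r + 1) (E x) (O y) (n + r) - nprod 1 0 (O x) (E y) (n + r) := by
  have := comm_nprod_odd_odd (m := r + 1) (m' := r + 1) (D := superG E O r) (R.fO x) (R.fO y)
    (R.fE x) (R.fE y) (R.superG_O x r) (R.superG_O y r) (n - 1)
  rw [this, show n - 1 + (r + 1) = n + r by ring]

include T

/-- The commutators add up to the fermion of the sum of all [e^i, e_i], which is zero. -/
theorem sum_EO_split (c n : ℤ) : ∑ i, nprod 1 c (E (e' i)) (O (e i)) n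
    = ∑ i, nprod 1 0 (E (e' i)) (O (e i)) n := by
  rw [sum_nprod_split Finset.univ (fun i => R.fE (e' i)) (fun i => R.fO (e i)) (fun _ => 0) rfl
    (fun k => ?_) c, add_zero]
  simp only [R.EO, one_smul, add_sub_cancel_left, ← R.O_sum, T.unimodular, R.O_zero, sub_zero]

theorem superG_manJ (r m : ℤ) : superG E O r * manJ O e e' m
    = manJ O e e' m * superG E O r + manQ E O e e' (m + r) := by
  simp only [manJ, manQ, Finset.mul_sum, Finset.sum_mul, R.superG_nprod, Finset.sum_sub_distrib,
    Finset.sum_add_distrib, R.sum_EO_split T]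
  abel

/-- The products of two currents cancel, and the fermion bilinears combine to (r - s) J because
their mode weights add up to a constant. What remains are the central terms of two displaced
ordering points, one bosonic and one fermionic, which agree. -/
theorem superG_manQ (r s : ℤ) : superG E O r * manQ E O e e' s
    = -(manQ E O e e' s * superG E O r) + ((r : ℂ) - s) • manJ O e e' (r + s + 1) := by
  have fA : ∀ x, IsField fun k => (-((k : ℂ) - r)) • O x k := fun x => (R.fO x).wsmul _
  have hE : ∀ (x : GC) (k : ℤ), superG E O r * E x k
      = E x k * superG E O r + (fun k : ℤ => (-((k : ℂ) - r)) • O x k) (k + r) := fun x k => by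
    rw [R.superG_E]
    push_cast
    rw [add_sub_cancel_right]
  have h1 : ∀ i, superG E O r * nprod 1 0 (E (e' i)) (O (e i)) s
      = -(nprod 1 0 (E (e' i)) (O (e i)) s * superG E O r)
        + nprod (-1) r (fun k : ℤ => (-((k : ℂ) - r)) • O (e' i) k) (O (e i)) (s + r)
        + nprod 1 0 (E (e' i)) (E (e i)) (s + (r + 1)) := fun i =>
    comm_nprod_even_odd (R.fE _) (R.fO _) (fA _) (R.fE _) (hE _) (R.superG_O _ r) s
  have h2 : ∀ i, superG E O r * nprod 1 0 (O (e' i)) (E (e i)) s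
      = -(nprod 1 0 (O (e' i)) (E (e i)) s * superG E O r)
        + nprod 1 (r + 1) (E (e' i)) (E (e i)) (s + (r + 1))
        - nprod (-1) 0 (O (e' i)) (fun k : ℤ => (-((k : ℂ) - r)) • O (e i) k) (s + r) := fun i =>
    comm_nprod_odd_even (R.fO _) (R.fE _) (R.fE _) (fA _) (R.superG_O _ r) (hE _) s
  have cE : ∀ i k l, E (e' i) k * E (e i) l - (1 : ℂ) • (E (e i) l * E (e' i) k)
      = E (br (e' i) (e i)) (k + l) + (if k + l = 0 then (k : ℂ) else 0) • 1 := fun i k l => by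
    rw [R.EE, T.dual, mul_one, one_smul, add_assoc, add_sub_cancel_left]
  have cO : ∀ i (k l : ℤ), (-((k : ℂ) - r)) • O (e' i) k * O (e i) l
      - (-1 : ℂ) • (O (e i) l * ((-((k : ℂ) - r)) • O (e' i) k))
      = (if k + l + 1 = 0 then -((k : ℂ) - r) else 0) • 1 := fun i k l => by
    rw [smul_mul_assoc, mul_smul_comm, R.OO, T.dual]
    split_ifs <;> module
  -- Four dual pairs contribute 4k at the step k, and 2m(m - 1) is the primitive of 4k that vanishes
  -- at 0.
  have sE := sum_nprod_split (ε := 1) (n := s + (r + 1)) Finset.univ (fun i => R.fE (e' i))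
    (fun i => R.fE (e i))
    (fun m => (if s + (r + 1) = 0 then 2 * (m : ℂ) * (m - 1) else 0) • 1) (by simp) (fun k => by
      simp only [cE, Finset.sum_add_distrib, ← R.E_sum, T.unimodular, R.E_zero, zero_add,
        add_sub_cancel, Finset.sum_const, Finset.card_univ, Fintype.card_fin]
      rw [← sub_smul]
      split_ifs
      · push_cast
        module
      · simp) (r + 1)
  -- Here each step contributes -4(k - r), with primitive -(2m(m - 1) - 4rm).
  have sO := sum_nprod_split (ε := -1) (n := s + r) Finset.univ (fun i => fA (e' i))
    (fun i => R.fO (e i))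
    (fun m => (if s + (r + 1) = 0 then -(2 * (m : ℂ) * (m - 1) - 4 * r * m) else 0) • 1) (by simp)
    (fun k => by
      simp only [cO, show k + (s + r - k) + 1 = s + (r + 1) by ring, Finset.sum_const,
        Finset.card_univ, Fintype.card_fin]
      split_ifs
      · push_cast
        module
      · module) r
  -- Both primitives take the value 2r(r + 1): the fermionic one at r, the bosonic one at r + 1. So
  -- the same `Z` occurs with opposite signs.
  have hc : ((if s + (r + 1) = 0 then -(2 * (r : ℂ) * (r - 1) - 4 * r * r) else 0) •
      (1 : Module.End ℂ V)) = (if s + (r + 1) = 0 then 2 * ((r + 1 : ℤ) : ℂ) * ((r + 1 : ℤ) - 1)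
        else 0) • 1 := by
    congr 1
    split_ifs
    · push_cast
      ring
    · rfl
  rw [hc] at sO
  generalize (if s + (r + 1) = 0 then 2 * ((r + 1 : ℤ) : ℂ) * ((r + 1 : ℤ) - 1) else 0) •
    (1 : Module.End ℂ V) = Z at sE sO
  have hw : ∀ i, nprod (-1) 0 (fun k : ℤ => (-((k : ℂ) - r)) • O (e' i) k) (O (e i)) (s + r)
      + nprod (-1) 0 (O (e' i)) (fun k : ℤ => (-((k : ℂ) - r)) • O (e i) k) (s + r)
      = ((r : ℂ) - s) • nprod (-1) 0 (O (e' i)) (O (e i)) (s + r) := fun i =>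
    nprod_weights (R.fO _) (R.fO _) (-1) _ _ 0 (s + r) _ (fun k => by push_cast; ring)
  have hw' := Finset.sum_congr (s₁ := Finset.univ) rfl fun i _ => hw i
  rw [Finset.sum_add_distrib, ← Finset.smul_sum] at hw'
  simp only [manQ, manJ, Finset.mul_sum, Finset.sum_mul, mul_sub, sub_mul, h1, h2,
    Finset.sum_sub_distrib, Finset.sum_add_distrib, sE, sO]
  rw [show r + s + 1 - 1 = s + r by ring, ← hw']
  simp only [Finset.sum_neg_distrib]
  abel

end ModeRep

end NTwo

namespace IsManinTriple

variable {K : GC →ₗ[ℂ] GC} {e e' : Fin 4 → GC} (T : IsManinTriple K e e')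
include T

/-- Since K² = 1, the endomorphism `wad K u` anticommutes with K, so half of the commutator in
`wad_comm` is K ∘ `wad K u`. -/
theorem K_wad (u x : GC) : K (wad K u x) = wad K (K u) x := by
  have h := LinearMap.congr_fun (T.wad_comm u) x
  have h' : wad K u (K x) = -K (wad K u x) := by
    simp only [wad, LinearMap.sub_apply, LinearMap.comp_apply, LinearMap.smul_apply, map_smul,
      map_sub, T.K_K, adL_apply]
    module
  rw [LinearMap.sub_apply, LinearMap.comp_apply, LinearMap.comp_apply, h', sub_neg_eq_add,
    ← two_smul ℂ, LinearMap.smul_apply] at h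
  exact smul_right_injective _ (two_ne_zero' ℂ) h

theorem pairing_wad (u x y : GC) : pairing (wad K u x) y = pairing x ((-wad K u) y) := by
  have h : ∀ x y, pairingL (br u x) y = -pairingL x (br u y) := fun x y => by
    rw [br_swap, map_neg, LinearMap.neg_apply, pairingL_apply, pairingL_apply, pairing_br]
  have h' : ∀ x y, pairingL (K x) y = -pairingL x (K y) := T.pairing_K
  simp only [← pairingL_apply, wad, LinearMap.sub_apply, LinearMap.comp_apply,
    LinearMap.smul_apply, LinearMap.neg_apply, map_smul, map_sub, map_neg, adL_apply, h, h', smul_eq_mul]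
  ring

end IsManinTriple

/-! ### Closing the algebra generated by `superG` and `manJ` -/

section NTwoClosure

variable {V : Type*} [AddCommGroup V] [Module ℂ V] {E O : GC → ℤ → Module.End ℂ V}
  (R : ModeRep E O) {K : GC →ₗ[ℂ] GC} {e e' : Fin 4 → GC} (T : IsManinTriple K e e')

namespace ModeRep

include R

section degree

/-- Twice the degree operator. -/
def degOp (E O : GC → ℤ → Module.End ℂ V) : Module.End ℂ V :=
  superG E O 0 * superG E O (-1) + superG E O (-1) * superG E O 0

/-- G takes fermions to currents and currents back to fermions; doing both in the two possible
orders gives minus twice the degree k + 1/2. -/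
theorem degOp_O (u : GC) (k : ℤ) : degOp E O * O u k
    = O u k * degOp E O + (-(2 * k + 1 : ℂ)) • O u k := by
  have h1 := R.superG_O u 0 k
  have h2 := R.superG_O u (-1) k
  have h3 := R.superG_E u 0 (k + (-1 + 1))
  have h4 := R.superG_E u (-1) (k + (0 + 1))
  rw [show k + (-1 + 1) = k by ring] at h2 h3
  rw [show k + (0 + 1) = k + 1 by ring] at h1 h4
  rw [add_zero] at h3
  rw [show k + 1 + -1 = k by ring] at h4
  rw [degOp, add_mul, mul_assoc, mul_assoc, h1, h2, mul_add, mul_add, mul_neg, mul_neg,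
    ← mul_assoc, ← mul_assoc, h1, h2, h3, h4]
  simp only [add_mul, mul_add, neg_mul, mul_assoc]
  push_cast
  module

theorem degOp_E (u : GC) (n : ℤ) : degOp E O * E u n
    = E u n * degOp E O + (-(2 * n : ℂ)) • E u n := by
  have h1 := R.superG_E u 0 n
  have h2 := R.superG_E u (-1) n
  have h3 := R.superG_O u 0 (n + -1)
  have h4 := R.superG_O u (-1) n
  rw [show n + -1 + (0 + 1) = n by ring] at h3
  rw [show n + (-1 + 1) = n by ring] at h4
  rw [add_zero] at h1
  rw [degOp, add_mul, mul_assoc, mul_assoc, h1, h2, mul_add, mul_add, mul_smul_comm, mul_smul_comm,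
    ← mul_assoc, ← mul_assoc, h1, h2, h3, h4]
  simp only [add_mul, mul_add, mul_assoc, smul_mul_assoc]
  module

omit R in
/-- Normally ordered products are homogeneous. -/
theorem degOp_nprod {A B : ℤ → Module.End ℂ V} (hA : IsField A) (hB : IsField B) (ε : ℂ)
    (a b : ℤ → ℂ) (n : ℤ) (w : ℂ) (h : ∀ k, a k + b (n - k) = w)
    (h1 : ∀ k, degOp E O * A k = A k * degOp E O + a k • A k)
    (h2 : ∀ k, degOp E O * B k = B k * degOp E O + b k • B k) :
    degOp E O * nprod ε 0 A B n = nprod ε 0 A B n * degOp E O + w • nprod ε 0 A B n := by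
  have := comm_nprod_even (ε := ε) (m := 0) (m' := 0) (D := degOp E O) hA hB (hA.wsmul a)
    (hB.wsmul b) (fun k => by rw [h1, add_zero]) (fun k => by rw [h2, add_zero]) n
  rw [this, add_assoc, add_zero, nprod_weights hA hB ε a b 0 n w h]

/-- Homogeneity is read off from the modes of which G is built, without using any relation between
two modes of G. -/
theorem degOp_superG (r : ℤ) : degOp E O * superG E O r
    = superG E O r * degOp E O + (-(2 * r + 1 : ℂ)) • superG E O r := by
  have hc : ∀ n, degOp E O * cc O n = cc O n * degOp E O + (-(2 * n : ℂ)) • cc O n := fun n =>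
    degOp_nprod (R.fO _) (R.fO _) (-1) _ _ (n - 1) _ (fun k => by push_cast; ring)
      (R.degOp_O _) (R.degOp_O _)
  have hb : ∀ i n, degOp E O * bt E O i n = bt E O i n * degOp E O
      + (-(2 * n : ℂ)) • bt E O i n := fun i n => by
    rw [bt, mul_add, add_mul, R.degOp_E, mul_smul_comm, hc, smul_mul_assoc]
    module
  have h1 : ∀ i, degOp E O * nprod 1 0 (bt E O i) (O (aa i)) r
      = nprod 1 0 (bt E O i) (O (aa i)) r * degOp E O
        + (-(2 * r + 1 : ℂ)) • nprod 1 0 (bt E O i) (O (aa i)) r := fun i =>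
    degOp_nprod (R.fbt _) (R.fO _) 1 _ _ r _ (fun k => by push_cast; ring)
      (hb i) (R.degOp_O _)
  have h2 : ∀ i, degOp E O * nprod 1 0 (E (aa i)) (O (bb i)) r
      = nprod 1 0 (E (aa i)) (O (bb i)) r * degOp E O
        + (-(2 * r + 1 : ℂ)) • nprod 1 0 (E (aa i)) (O (bb i)) r := fun i =>
    degOp_nprod (R.fE _) (R.fO _) 1 _ _ r _ (fun k => by push_cast; ring)
      (R.degOp_E _) (R.degOp_O _)
  simp only [superG, Finset.mul_sum, Finset.sum_mul, mul_add, add_mul, h1, h2, Finset.smul_sum,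
    smul_add, ← Finset.sum_add_distrib]
  exact Finset.sum_congr rfl fun i _ => by abel

theorem degOp_manJ (m : ℤ) : degOp E O * manJ O e e' m
    = manJ O e e' m * degOp E O + (-(2 * m : ℂ)) • manJ O e e' m := by
  have h : ∀ i, degOp E O * nprod (-1) 0 (O (e' i)) (O (e i)) (m - 1)
      = nprod (-1) 0 (O (e' i)) (O (e i)) (m - 1) * degOp E O
        + (-(2 * m : ℂ)) • nprod (-1) 0 (O (e' i)) (O (e i)) (m - 1) := fun i =>
    degOp_nprod (R.fO _) (R.fO _) (-1) _ _ (m - 1) _ (fun k => by push_cast; ring)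
      (R.degOp_O _) (R.degOp_O _)
  simp only [manJ, Finset.mul_sum, Finset.sum_mul, h, Finset.smul_sum, ← Finset.sum_add_distrib]

/-- An odd operator super-commuting with all modes anticommutes with the `N = 1` generator. -/
theorem odd_comm_superG {X : Module.End ℂ V} (hO : ∀ u k, X * O u k = -(O u k * X))
    (hE : ∀ u n, X * E u n = E u n * X) (r : ℤ) : X * superG E O r = -(superG E O r * X) := by
  have hc : ∀ n, X * cc O n = cc O n * X := fun n => by
    simpa [cc, nprod_zero_left, nprod_zero_right] using comm_nprod_odd_odd (m := 0) (m' := 0)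
      (D := X) (R.fO (aa 1)) (R.fO (aa 2)) isField_zero isField_zero
      (fun l => by rw [hO, add_zero]) (fun l => by rw [hO, add_zero]) (n - 1)
  have h1 : ∀ i, X * nprod 1 0 (bt E O i) (O (aa i)) r
      = -(nprod 1 0 (bt E O i) (O (aa i)) r * X) := fun i => by
    simpa [nprod_zero_left, nprod_zero_right] using comm_nprod_even_odd (m := 0) (m' := 0)
      (D := X) (R.fbt i) (R.fO (aa i)) isField_zero isField_zero
      (fun l => by rw [bt, mul_add, add_mul, hE, mul_smul_comm, hc, smul_mul_assoc, add_zero])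
      (fun l => by rw [hO, add_zero]) r
  have h2 : ∀ i, X * nprod 1 0 (E (aa i)) (O (bb i)) r
      = -(nprod 1 0 (E (aa i)) (O (bb i)) r * X) := fun i => by
    simpa [nprod_zero_left, nprod_zero_right] using comm_nprod_even_odd (m := 0) (m' := 0)
      (D := X) (R.fE (aa i)) (R.fO (bb i)) isField_zero isField_zero
      (fun l => by rw [hE, add_zero]) (fun l => by rw [hO, add_zero]) r
  simp only [superG, Finset.mul_sum, Finset.sum_mul, mul_add, add_mul, h1, h2,
    ← Finset.sum_neg_distrib]
  exact Finset.sum_congr rfl fun i _ => by abel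

/-- An odd homogeneous operator super-commuting with all modes vanishes. -/
theorem odd_eq_zero {X : Module.End ℂ V} (hO : ∀ u k, X * O u k = -(O u k * X))
    (hE : ∀ u n, X * E u n = E u n * X) {r : ℤ}
    (hX : degOp E O * X = X * degOp E O + (-(2 * r + 1 : ℂ)) • X) : X = 0 := by
  have h0 := R.odd_comm_superG hO hE 0
  have h1 := R.odd_comm_superG hO hE (-1)
  -- `X` anticommutes with both factors in each summand of `degOp`, hence commutes with it.
  -- Homogeneity then gives (2r + 1) X = 0, and 2r + 1 is odd.
  have h : X * degOp E O = degOp E O * X := by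
    rw [degOp, mul_add, ← mul_assoc, ← mul_assoc, h0, h1, neg_mul, neg_mul, mul_assoc, mul_assoc,
      h0, h1, add_mul]
    noncomm_ring
  rw [h] at hX
  refine (smul_eq_zero.1 (left_eq_add.1 hX)).resolve_left ?_
  rw [neg_eq_zero]
  exact_mod_cast (show 2 * r + 1 ≠ 0 by omega)

end degree

include T

/-- Writing Q as a commutator lets its relations with the modes be derived from those of G and J_0
by the Jacobi identity. -/
theorem manQ_eq (r : ℤ) : manQ E O e e' r
    = superG E O r * manJ O e e' 0 - manJ O e e' 0 * superG E O r := by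
  rw [R.superG_manJ T, zero_add]
  abel

theorem manQ_O (u : GC) (r k : ℤ) : manQ E O e e' r * O u k
    = -(O u k * manQ E O e e' r)
      + (E (K u) (k + (r + 1)) - curB O K e e' u (k + (r + 1))) := by
  have h1 := R.superG_O u r k
  have h2 := R.manJ_O T u 0 k
  have h3 := R.manJ_E T u 0 (k + (r + 1))
  have h4 := R.superG_O (K u) r k
  rw [zero_add] at h2 h3
  rw [R.manQ_eq T, sub_mul, mul_assoc, mul_assoc, h1, h2, mul_add, mul_add, ← mul_assoc, h1, h4, h3,
    mul_neg, ← mul_assoc, h2]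
  noncomm_ring

theorem manQ_E (u : GC) (r n : ℤ) : manQ E O e e' r * E u n
    = E u n * manQ E O e e' r + (n : ℂ) • O (K u) (n + r)
      + (superG E O r * curB O K e e' u n - curB O K e e' u n * superG E O r) := by
  have h1 := R.superG_E u r n
  have h2 := R.manJ_E T u 0 n
  have h3 := R.manJ_O T u 0 (n + r)
  rw [zero_add] at h2 h3
  rw [R.manQ_eq T, sub_mul, mul_assoc, mul_assoc, h1, h2, mul_add, mul_add, ← mul_assoc, h1,
    mul_smul_comm, h3, ← mul_assoc, h2]
  simp only [add_mul, mul_add, smul_add, neg_smul, neg_mul, smul_mul_assoc, mul_sub, mul_assoc]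
  abel

/-- Both sides are sums of products of a current and a fermion. On the left the currents are those
of `wad K (K u)`, which is K ∘ `wad K u`; on the right the K comes from the action of Q on fermions.
Moving skew-adjoint endomorphisms across the canonical tensor identifies the two. -/
theorem superG_curB (u : GC) (r n : ℤ) :
    superG E O r * curB O K e e' (K u) n - curB O K e e' (K u) n * superG E O r
      = manQ E O e e' r * curB O K e e' u n - curB O K e e' u n * manQ E O e e' r := by
  have fC : ∀ x, IsField fun k => E (K x) k - curB O K e e' x k := fun x =>
    (R.fE _).sub (R.lf_curB.field x)
  have lC : IsLinField fun x k => E (K x) k - curB O K e e' x k :=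
    ⟨fun x y k => by rw [map_add, R.E_add, R.lf_curB.add]; abel,
      fun c x k => by rw [map_smul, R.E_smul, R.lf_curB.smul, smul_sub], fC⟩
  -- The image of `wad` consists of combinations of brackets and of K applied to brackets, on which
  -- `curB` vanishes.
  have hC : ∀ x, (fun k => E (K (wad K u x)) k - curB O K e e' (wad K u x) k)
      = E (wad K (K u) x) := fun x => by
    funext k
    have h : curB O K e e' (wad K u x) k = 0 := by
      rw [show wad K u x = (1 / 2 : ℂ) • (br u (K x) + (-1 : ℂ) • K (br u x)) by
        simp [wad, adL_apply, sub_eq_add_neg], R.lf_curB.smul, R.lf_curB.add, R.lf_curB.smul,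
        R.curB_br, R.curB_K_br T]
      simp
    rw [h, sub_zero, T.K_wad]
  have hQ : ∀ x y, manQ E O e e' r * nprod (-1) 0 (O x) (O y) (n - 1)
      = nprod (-1) 0 (O x) (O y) (n - 1) * manQ E O e e' r
        + nprod 1 (r + 1) (fun k => E (K x) k - curB O K e e' x k) (O y) (n + r)
        - nprod 1 0 (O x) (fun k => E (K y) k - curB O K e e' y k) (n + r) := fun x y => by
    have := comm_nprod_odd_odd (m := r + 1) (m' := r + 1) (D := manQ E O e e' r) (R.fO x) (R.fO y)
      (fC x) (fC y) (R.manQ_O T x r) (R.manQ_O T y r) (n - 1)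
    rw [this, show n - 1 + (r + 1) = n + r by ring]
  have t1 := T.sum_transpose (nbil R.lfO lC 1 0 (n + r)) (wad K u) (-wad K u) (T.pairing_wad u)
  have t2 := T.sum_transpose (nbil R.lfO R.lfE 1 0 (n + r)) (wad K (K u)) (-wad K (K u))
    (T.pairing_wad (K u))
  simp only [LinearMap.neg_apply, map_neg, nbil_apply, hC] at t1 t2
  rw [← t2] at t1
  have hG : superG E O r * bil O e e' (wad K (K u)) n - bil O e e' (wad K (K u)) n * superG E O r
      = manQ E O e e' r * bil O e e' (wad K u) n - bil O e e' (wad K u) n * manQ E O e e' r := by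
    simp only [bil, Finset.mul_sum, Finset.sum_mul, mul_add, add_mul, R.superG_nprod, hQ, hC,
      Finset.sum_add_distrib, Finset.sum_sub_distrib] at t1 ⊢
    rw [← sub_eq_zero] at t1 ⊢
    rw [← t1]
    abel
  simp only [curB, mul_neg, neg_mul, sub_neg_eq_add]
  rw [neg_add_eq_sub, neg_add_eq_sub, ← neg_sub, hG, neg_sub]

/-- By `odd_eq_zero` it suffices that [J_0, Q_r] + G_r supercommutes with every mode and is
homogeneous. On fermions the terms in `curB` cancel by `manJ_curB`, on currents by `superG_curB`. -/
theorem manJ_manQ_zero (r : ℤ) : manJ O e e' 0 * manQ E O e e' r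
    = manQ E O e e' r * manJ O e e' 0 - superG E O r := by
  have h0 : ∀ u n, manJ O e e' 0 * curB O K e e' u n - curB O K e e' u n * manJ O e e' 0
      = (2 : ℂ) • curB O K e e' (K u) n := fun u n => by
    rw [R.manJ_curB T]
    abel
  have key : manJ O e e' 0 * manQ E O e e' r - manQ E O e e' r * manJ O e e' 0
      + superG E O r = 0 := by
    refine R.odd_eq_zero (r := r) (fun u k => ?_) (fun u n => ?_) ?_
    · have h1 := R.manQ_O T u r k
      have h2 := R.manJ_O T u 0 k
      have h3 := R.manJ_E T (K u) 0 (k + (r + 1))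
      have h4 := R.manQ_O T (K u) r k
      have h5 := R.superG_O u r k
      have h6 := R.manJ_curB T u (k + (r + 1))
      rw [zero_add] at h2 h3
      rw [T.K_K] at h4
      rw [add_mul, sub_mul, mul_assoc, mul_assoc, h1, h2, h5, mul_add, mul_add, mul_neg,
        ← mul_assoc, ← mul_assoc, h1, h2, h4, mul_sub, h3, h6]
      simp only [add_mul, mul_add, sub_mul, mul_sub, neg_mul, mul_assoc]
      module
    · have h1 := R.manQ_E T u r n
      have h2 := R.manJ_E T u 0 n
      have h3 := R.manJ_O T (K u) 0 (n + r)
      have h4 := R.superG_E u r n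
      have h5 := R.superG_curB T u r n
      have h6 := R.manJ_curB T u n
      have h7 := R.manQ_eq T r
      rw [zero_add] at h2 h3
      rw [T.K_K] at h3
      have h8 : manJ O e e' 0 * superG E O r = superG E O r * manJ O e e' 0 - manQ E O e e' r := by
        rw [h7]
        abel
      have e1 : manJ O e e' 0 * (manQ E O e e' r * E u n)
          = E u n * manJ O e e' 0 * manQ E O e e' r + curB O K e e' u n * manQ E O e e' r
            + (n : ℂ) • (O (K u) (n + r) * manJ O e e' 0 + O u (n + r))
            + (superG E O r * (manJ O e e' 0 * curB O K e e' u n)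
              - manQ E O e e' r * curB O K e e' u n
              - curB O K e e' u n * (manJ O e e' 0 * superG E O r)
              - (2 : ℂ) • (curB O K e e' (K u) n * superG E O r)) := by
        rw [h1, mul_add, mul_add, ← mul_assoc, h2, mul_smul_comm, h3, mul_sub, ← mul_assoc, h8,
          ← mul_assoc, h6]
        simp only [add_mul, sub_mul, mul_assoc, smul_mul_assoc, h6, h8]
        abel
      have e2 : manQ E O e e' r * (manJ O e e' 0 * E u n)
          = E u n * manQ E O e e' r * manJ O e e' 0 + (n : ℂ) • O (K u) (n + r) * manJ O e e' 0
            + (superG E O r * curB O K e e' u n - curB O K e e' u n * superG E O r)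
              * manJ O e e' 0 + manQ E O e e' r * curB O K e e' u n := by
        rw [h2, mul_add, ← mul_assoc, h1]
        simp only [add_mul]
      rw [h6, h8] at e1
      have h9 : (2 : ℂ) • (superG E O r * curB O K e e' (K u) n
          - curB O K e e' (K u) n * superG E O r - (manQ E O e e' r * curB O K e e' u n
          - curB O K e e' u n * manQ E O e e' r)) = 0 := by rw [h5, sub_self, smul_zero]
      rw [add_mul, sub_mul, mul_assoc, mul_assoc, e1, e2, h4, ← sub_eq_zero, ← h9]
      simp only [mul_add, add_mul, mul_sub, sub_mul, mul_assoc, smul_mul_assoc, mul_smul_comm]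
      module
    · have h1 := R.degOp_superG r
      have h2 := R.degOp_manJ (e := e) (e' := e') 0
      rw [Int.cast_zero, mul_zero, neg_zero, zero_smul, add_zero] at h2
      have h3 : degOp E O * manQ E O e e' r
          = manQ E O e e' r * degOp E O + (-(2 * r + 1 : ℂ)) • manQ E O e e' r := by
        rw [R.manQ_eq T, mul_sub, ← mul_assoc, h1, ← mul_assoc, h2, mul_assoc, h1]
        simp only [add_mul, mul_add, sub_mul, mul_assoc, h2, smul_mul_assoc, mul_smul_comm]
        module
      rw [mul_add, mul_sub, ← mul_assoc, ← mul_assoc, h1, h2, h3, mul_assoc, h3]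
      simp only [add_mul, mul_add, sub_mul, mul_assoc, h2, smul_mul_assoc, mul_smul_comm]
      module
  rw [add_eq_zero_iff_eq_neg, sub_eq_iff_eq_add'] at key
  rw [key, sub_eq_add_neg]

end ModeRep

end NTwoClosure

/-! ### From three fields to the N = 2 algebra -/

section NTwoStructure

variable {V : Type*} [AddCommGroup V] [Module ℂ V]

/-- Operators `J_m`, `G_r`, `Q_r` (the latter two of degree `r + 1/2`) whose relations amount to those
of an `N = 2` algebra of central charge `12`. -/
structure IsSuperTriple (J G Q : ℤ → Module.End ℂ V) : Prop where
  fJ : IsField J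
  fG : IsField G
  fQ : IsField Q
  JJ : ∀ m n, J m * J n = J n * J m + (if m + n = 0 then 4 * m else 0 : ℂ) • 1
  JG : ∀ m r, J m * G r = G r * J m - Q (m + r)
  JQ : ∀ m r, J m * Q r = Q r * J m - G (m + r)
  GQ : ∀ r s, G r * Q s = -(Q s * G r) + ((r : ℂ) - s) • J (r + s + 1)

namespace ModeRep

variable {E O : GC → ℤ → Module.End ℂ V} (R : ModeRep E O) {K : GC →ₗ[ℂ] GC} {e e' : Fin 4 → GC}
  (T : IsManinTriple K e e')
include R T

theorem isSuperTriple : IsSuperTriple (manJ O e e') (superG E O) (manQ E O e e') where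
  fJ := R.f_manJ
  fG := R.fsuperG
  fQ := R.f_manQ
  JJ := R.manJ_manJ T
  JG m r := by
    rw [R.superG_manJ T]
    abel
  JQ m r := by
    -- The case m = 0 implies the general one: J_m commutes with J_0, so [J_m, [G_r, J_0]] = [[J_m,
    -- G_r], J_0] = -[Q_{m+r}, J_0] = -G_{m+r}.
    have h1 := R.superG_manJ T r m
    have h2 := R.superG_manJ T (m + r) 0
    have h3 := R.manJ_manQ_zero T (m + r)
    have h4 := R.manJ_manJ T m 0
    have h5 := R.superG_manJ T r 0
    rw [add_zero] at h4
    rw [zero_add] at h2 h5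
    have h4' : manJ O e e' m * manJ O e e' 0 = manJ O e e' 0 * manJ O e e' m := by
      rw [h4]
      split_ifs with h
      · simp [h]
      · simp
    have e1 : manQ E O e e' r = superG E O r * manJ O e e' 0 - manJ O e e' 0 * superG E O r :=
      eq_sub_of_add_eq' h5.symm
    have e2 : manQ E O e e' (m + r) = superG E O r * manJ O e e' m - manJ O e e' m * superG E O r :=
      eq_sub_of_add_eq' h1.symm
    rw [e2] at h3
    have h3' : superG E O (m + r) = (superG E O r * manJ O e e' m - manJ O e e' m * superG E O r)
        * manJ O e e' 0 - manJ O e e' 0 *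
          (superG E O r * manJ O e e' m - manJ O e e' m * superG E O r) := by
      rw [h3]
      abel
    rw [h3', e1]
    simp only [mul_sub, sub_mul]
    have a1 : superG E O r * manJ O e e' 0 * manJ O e e' m
        = superG E O r * manJ O e e' m * manJ O e e' 0 := by rw [mul_assoc, ← h4', ← mul_assoc]
    have a2 : manJ O e e' m * (manJ O e e' 0 * superG E O r)
        = manJ O e e' 0 * (manJ O e e' m * superG E O r) := by
      rw [← mul_assoc, h4', mul_assoc]
    rw [a1, a2]
    simp only [mul_assoc]
    abel
  GQ := R.superG_manQ T

end ModeRep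

namespace IsSuperTriple

variable {J G Q : ℤ → Module.End ℂ V} (S : IsSuperTriple J G Q)
include S

/-- The commutator of J_m with the relation for {G_r, Q_s}; the scalar is the central term of [J_m,
J_{r+s+1}]. -/
theorem QQ_add_GG (m r s : ℤ) : Q (m + r) * Q s + Q s * Q (m + r)
    + (G r * G (m + s) + G (m + s) * G r)
    = -((if m + r + s + 1 = 0 then 4 * m * ((r : ℂ) - s) else 0) • 1) := by
  have h1 := S.JG m r
  have h2 := S.JQ m s
  have h3 := S.GQ r s
  have h4 := S.JJ m (r + s + 1)
  have e := congrArg (J m * ·) h3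
  simp only [mul_add, mul_neg, mul_smul_comm, ← mul_assoc, h1, h2, h4, sub_mul] at e
  simp only [mul_assoc, h1, h2, mul_sub] at e
  simp only [← mul_assoc, h3] at e
  simp only [add_mul, neg_mul, smul_mul_assoc, smul_add] at e
  rw [← sub_eq_zero] at e ⊢
  rw [show m + (r + s + 1) = m + r + s + 1 by ring] at e
  rw [← neg_eq_zero, ← e]
  split_ifs
  · module
  · module

theorem QQ_eq (r s : ℤ) : Q r * Q s + Q s * Q r = -(G r * G s + G s * G r) := by
  have := S.QQ_add_GG 0 r s
  rw [eq_neg_iff_add_eq_zero]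
  simpa using this

/-- Up to a scalar the anticommutator depends only on r + s. This is why the Virasoro modes may be
defined with G_0 as one of the factors. -/
theorem GG_eq (r s : ℤ) : G r * G s + G s * G r = G (r + s) * G 0 + G 0 * G (r + s)
    + (if r + s + 1 = 0 then 4 * r * ((r : ℂ) + 1) else 0) • 1 := by
  have h1 := S.QQ_add_GG s r 0
  rw [add_zero, add_zero, S.QQ_eq, add_comm s r] at h1
  rw [neg_add_eq_iff_eq_add] at h1
  rw [h1, ← sub_eq_add_neg, sub_eq_add_neg, ← neg_smul]
  congr 2
  split_ifs with h
  · have : (s : ℂ) = -r - 1 := by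
      have : s = -r - 1 := by omega
      rw [this]
      push_cast
      ring
    rw [this]
    push_cast
    ring
  · simp

/-- The charge `1` generator. -/
def gp (_ : IsSuperTriple J G Q) (k : ℤ) : Module.End ℂ V := (1 / 2 : ℂ) • (G k - Q k)

/-- The charge `-1` generator. -/
def gm (_ : IsSuperTriple J G Q) (k : ℤ) : Module.End ℂ V := (1 / 2 : ℂ) • (G k + Q k)

/-- The Virasoro generator. -/
def vir (_ : IsSuperTriple J G Q) (n : ℤ) : Module.End ℂ V :=
  (1 / 2 : ℂ) • (G (n - 1) * G 0 + G 0 * G (n - 1))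

theorem gp_gp (k l : ℤ) : S.gp k * S.gp l + S.gp l * S.gp k = 0 := by
  have h1 := S.QQ_eq k l
  have h2 := S.GQ k l
  have h3 := S.GQ l k
  rw [add_comm l k] at h3
  have e : S.gp k * S.gp l + S.gp l * S.gp k
      = (1 / 4 : ℂ) • ((G k * G l + G l * G k) + (Q k * Q l + Q l * Q k)
        - (G k * Q l + Q l * G k) - (G l * Q k + Q k * G l)) := by
    simp only [gp, smul_mul_assoc, mul_smul_comm, mul_sub, sub_mul]
    module
  rw [e, h1, h2, h3]
  module

theorem gm_gm (k l : ℤ) : S.gm k * S.gm l + S.gm l * S.gm k = 0 := by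
  have h1 := S.QQ_eq k l
  have h2 := S.GQ k l
  have h3 := S.GQ l k
  rw [add_comm l k] at h3
  have e : S.gm k * S.gm l + S.gm l * S.gm k
      = (1 / 4 : ℂ) • ((G k * G l + G l * G k) + (Q k * Q l + Q l * Q k)
        + (G k * Q l + Q l * G k) + (G l * Q k + Q k * G l)) := by
    simp only [gm, smul_mul_assoc, mul_smul_comm, mul_add, add_mul]
    module
  rw [e, h1, h2, h3]
  module

theorem gp_gm (k l : ℤ) : S.gp k * S.gm l + S.gm l * S.gp k = S.vir (k + l + 1)
    + (((k : ℂ) - l) / 2) • J (k + l + 1)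
    + (if k + l + 1 = 0 then (12 : ℂ) / 6 * (((k : ℂ) + 1 / 2) ^ 2 - 1 / 4) else 0) • 1 := by
  have h1 := S.QQ_eq k l
  have h2 := S.GQ k l
  have h3 := S.GQ l k
  have h4 := S.GG_eq k l
  rw [add_comm l k] at h3
  have e : S.gp k * S.gm l + S.gm l * S.gp k
      = (1 / 4 : ℂ) • ((G k * G l + G l * G k) - (Q k * Q l + Q l * Q k)
        + (G k * Q l + Q l * G k) - (G l * Q k + Q k * G l)) := by
    simp only [gp, gm, smul_mul_assoc, mul_smul_comm, mul_add, add_mul, mul_sub, sub_mul]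
    module
  rw [e, h1, h4, h2, h3, vir, add_sub_cancel_right]
  split_ifs <;> module

theorem J_gp (m k : ℤ) : J m * S.gp k - S.gp k * J m = S.gp (m + k) := by
  simp only [gp, smul_mul_assoc, mul_smul_comm, mul_sub, sub_mul, S.JG, S.JQ]
  module

theorem J_gm (m k : ℤ) : J m * S.gm k - S.gm k * J m = -S.gm (m + k) := by
  simp only [gm, smul_mul_assoc, mul_smul_comm, mul_add, add_mul, S.JG, S.JQ]
  module

theorem vir_J (m n : ℤ) : S.vir m * J n - J n * S.vir m = (-(n : ℂ)) • J (m + n) := by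
  have h1 := S.JG n (m - 1)
  have h2 := S.JG n 0
  have h3 := S.GQ 0 (n + (m - 1))
  have h4 := S.GQ (m - 1) n
  rw [add_zero] at h2
  rw [show 0 + (n + (m - 1)) + 1 = m + n by ring] at h3
  rw [show m - 1 + n + 1 = m + n by ring] at h4
  have e : J n * S.vir m = S.vir m * J n - (1 / 2 : ℂ) • ((G 0 * Q (n + (m - 1))
      + Q (n + (m - 1)) * G 0) + (G (m - 1) * Q n + Q n * G (m - 1))) := by
    simp only [vir, mul_smul_comm, smul_mul_assoc, mul_add, add_mul, ← mul_assoc, h1, h2, sub_mul]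
    simp only [mul_assoc, h1, h2, mul_sub]
    module
  rw [e, h3, h4]
  push_cast
  module

/-- L_m can be expressed through {G⁺_k, G⁻_{m-k-1}} with the same k. As G⁺_k squares to zero it
commutes with this anticommutator, and only the term in J_m contributes. -/
theorem vir_gp (m k : ℤ) : S.vir m * S.gp k - S.gp k * S.vir m
    = ((m : ℂ) / 2 - (k + 1 / 2)) • S.gp (m + k) := by
  have h1 := S.gp_gm k (m - k - 1)
  have h2 := S.J_gp m k
  have h3 : S.gp k * S.gp k = 0 := by
    have := S.gp_gp k k
    rw [← two_smul ℂ] at this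
    exact (smul_eq_zero.1 this).resolve_left two_ne_zero
  rw [show k + (m - k - 1) + 1 = m by ring] at h1
  generalize (if m = 0 then (12 : ℂ) / 6 * (((k : ℂ) + 1 / 2) ^ 2 - 1 / 4) else 0) = z at h1
  have e : S.vir m = S.gp k * S.gm (m - k - 1) + S.gm (m - k - 1) * S.gp k
      - (((k : ℂ) - (m - k - 1 : ℤ)) / 2) • J m - z • 1 := by
    rw [h1]
    abel
  rw [e, ← h2]
  simp only [sub_mul, mul_sub, add_mul, mul_add, smul_mul_assoc, mul_smul_comm, mul_assoc, h3]
  simp only [← mul_assoc, h3]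
  push_cast
  simp only [zero_mul, mul_zero, one_mul, mul_one]
  module

theorem vir_gm (m k : ℤ) : S.vir m * S.gm k - S.gm k * S.vir m
    = ((m : ℂ) / 2 - (k + 1 / 2)) • S.gm (m + k) := by
  have h1 := S.gp_gm (m - k - 1) k
  have h2 := S.J_gm m k
  have h3 : S.gm k * S.gm k = 0 := by
    have := S.gm_gm k k
    rw [← two_smul ℂ] at this
    exact (smul_eq_zero.1 this).resolve_left two_ne_zero
  rw [show m - k - 1 + k + 1 = m by ring] at h1
  generalize (if m = 0 then (12 : ℂ) / 6 * ((((m - k - 1 : ℤ) : ℂ) + 1 / 2) ^ 2 - 1 / 4) else 0) = z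
    at h1
  have e : S.vir m = S.gp (m - k - 1) * S.gm k + S.gm k * S.gp (m - k - 1)
      - ((((m - k - 1 : ℤ) : ℂ) - k) / 2) • J m - z • 1 := by
    rw [h1]
    abel
  rw [e, ← neg_neg (S.gm (m + k)), ← h2]
  simp only [sub_mul, mul_sub, add_mul, mul_add, smul_mul_assoc, mul_smul_comm, mul_assoc, h3]
  simp only [← mul_assoc, h3]
  push_cast
  simp only [zero_mul, mul_zero, one_mul, mul_one]
  module

/-- L_n is an anticommutator of G⁺ and G⁻ up to J_n and a scalar, and the brackets of L_m with these
are known. -/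
theorem vir_vir (m n : ℤ) : S.vir m * S.vir n - S.vir n * S.vir m
    = ((m : ℂ) - n) • S.vir (m + n)
      + (if m + n = 0 then (12 : ℂ) / 12 * ((m : ℂ) ^ 3 - m) else 0) • 1 := by
  have h1 := S.gp_gm (n - 1) 0
  have h2 := S.gp_gm (m + (n - 1)) 0
  have h3 := S.gp_gm (n - 1) (m + 0)
  have h4 := S.vir_gp m (n - 1)
  have h5 := S.vir_gm m 0
  have h6 := S.vir_J m n
  rw [show n - 1 + 0 + 1 = n by ring] at h1
  rw [show m + (n - 1) + 0 + 1 = m + n by ring] at h2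
  rw [show n - 1 + (m + 0) + 1 = m + n by ring] at h3
  generalize (if n = 0 then (12 : ℂ) / 6 * ((((n - 1 : ℤ) : ℂ) + 1 / 2) ^ 2 - 1 / 4) else 0) = z
    at h1
  have e : S.vir n = S.gp (n - 1) * S.gm 0 + S.gm 0 * S.gp (n - 1)
      - ((((n - 1 : ℤ) : ℂ) - (0 : ℤ)) / 2) • J n - z • 1 := by
    rw [h1]
    abel
  rw [sub_eq_iff_eq_add] at h4 h5 h6
  have e2 : S.vir m * S.vir n - S.vir n * S.vir m
      = ((m : ℂ) / 2 - ((n - 1 : ℤ) + 1 / 2)) • (S.gp (m + (n - 1)) * S.gm 0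
          + S.gm 0 * S.gp (m + (n - 1)))
        + ((m : ℂ) / 2 - ((0 : ℤ) + 1 / 2)) • (S.gp (n - 1) * S.gm (m + 0)
          + S.gm (m + 0) * S.gp (n - 1))
        - ((((n - 1 : ℤ) : ℂ) - (0 : ℤ)) / 2) • (-(n : ℂ)) • J (m + n) := by
    rw [e]
    simp only [sub_mul, mul_sub, add_mul, mul_add, smul_mul_assoc, mul_smul_comm, ← mul_assoc,
      h4, h5, h6]
    simp only [mul_assoc, h4, h5, mul_add, smul_mul_assoc, mul_smul_comm, mul_one, one_mul]
    module
  rw [e2, h2, h3]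
  push_cast
  split_ifs with h
  · have : (n : ℂ) = -m := by
      have : n = -m := by omega
      rw [this]
      push_cast
      ring
    rw [this]
    module
  · module

omit S in
theorem _root_.MirrorKT.IsField.anticomm {A : ℤ → Module.End ℂ V} (hA : IsField A)
    (D : Module.End ℂ V) : IsField (fun n => A n * D + D * A n) := by
  intro v
  obtain ⟨M, hM⟩ := hA v
  obtain ⟨M', hM'⟩ := hA (D v)
  refine ⟨max M M', fun n hn => ?_⟩
  rw [LinearMap.add_apply, Module.End.mul_apply, Module.End.mul_apply,
    hM n (le_of_max_le_left hn), hM' n (le_of_max_le_right hn), map_zero, add_zero]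

/-- The `N = 2` structure of a super-triple. -/
def n2 : N2Structure 12 V where
  L := S.vir
  J := J
  Gp := S.gp
  Gm := S.gm
  truncated v := by
    obtain ⟨M1, h1⟩ := (((S.fG.anticomm (G 0)).shift (-1)).smul (1 / 2)) v
    obtain ⟨M2, h2⟩ := S.fJ v
    obtain ⟨M3, h3⟩ := ((S.fG.sub S.fQ).smul (1 / 2)) v
    obtain ⟨M4, h4⟩ := ((S.fG.add S.fQ).smul (1 / 2)) v
    exact ⟨max (max M1 M2) (max M3 M4), fun n hn => ⟨h1 n (by omega), h2 n (by omega),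
      h3 n (by omega), h4 n (by omega)⟩⟩
  LL := S.vir_vir
  LJ := S.vir_J
  LGp := S.vir_gp
  LGm := S.vir_gm
  JJ m n := by
    rw [S.JJ, add_sub_cancel_left]
    norm_num
  JGp := S.J_gp
  JGm := S.J_gm
  GpGp := S.gp_gp
  GmGm := S.gm_gm
  GpGm := S.gp_gm

end IsSuperTriple

end NTwoStructure

/-! ## The induced module -/

section Induced

variable (D : ZeroModeData)

/-- The action of the mode algebra on the induced module by complex-linear maps. -/
def indOp : ModeAlg →ₐ[ℂ] Module.End ℂ (Ind D) := Algebra.lsmul ℂ ℂ (Ind D)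

theorem smul_vac (a : ModeAlg) (f : ZeroModes D) :
    a • vac D f = Submodule.Quotient.mk (a ⊗ₜ f) := by
  simp only [vac]
  rw [← Submodule.Quotient.mk_smul, TensorProduct.smul_tmul', smul_eq_mul, mul_one]

variable {D}

/-- The mode algebra as a quotient of the free algebra. -/
def modeHom : FreeModes →ₐ[ℂ] ModeAlg := RingQuot.mkAlgHom ℂ ModeRel

theorem mode_rel {x y : FreeModes} (h : ModeRel x y) :
    modeHom x = modeHom y :=
  RingQuot.mkAlgHom_rel ℂ h

/-- The induced module is generated by the zero modes. -/
theorem ind_induction {p : Ind D → Prop} (hvac : ∀ f, p (vac D f))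
    (hadd : ∀ v w, p v → p w → p (v + w)) (hsmul : ∀ (c : ℂ) v, p v → p (c • v))
    (hmode : ∀ (x : Gen) v, p v → p (x.mode • v)) (v : Ind D) : p v := by
  have key : ∀ (x : FreeModes) v, p v → p (modeHom x • v) := by
    intro x
    induction x using FreeAlgebra.induction with
    | grade0 c =>
      intro v hv
      rw [AlgHom.commutes, algebraMap_smul]
      exact hsmul c v hv
    | grade1 x => exact fun v hv => hmode x v hv
    | mul a b ha hb =>
      intro v hv
      rw [map_mul]
      have := ha _ (hb v hv)
      rwa [← mul_smul] at this
    | add a b ha hb =>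
      intro v hv
      rw [map_add]
      have := hadd _ _ (ha v hv) (hb v hv)
      rwa [← add_smul] at this
  obtain ⟨t, rfl⟩ := Submodule.Quotient.mk_surjective _ v
  induction t using TensorProduct.induction_on with
  | zero => simpa [vac] using hvac 0
  | tmul a f =>
    obtain ⟨x, rfl⟩ := show ∃ x, modeHom x = a from RingQuot.mkAlgHom_surjective ℂ ModeRel a
    rw [← smul_vac]
    exact key x (vac D f) (hvac f)
  | add s t hs ht => exact hadd _ _ hs ht

theorem ev_pos (u : GC) {n : ℤ} (hn : 0 < n) (f : ZeroModes D) : ev u n • vac D f = 0 := by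
  rw [smul_vac]
  exact (Submodule.Quotient.mk_eq_zero _).2 (Submodule.subset_span (IndRel.even_pos u n hn f))

theorem od_nonneg (u : GC) {k : ℤ} (hk : 0 ≤ k) (f : ZeroModes D) : od u k • vac D f = 0 := by
  rw [smul_vac]
  exact (Submodule.Quotient.mk_eq_zero _).2 (Submodule.subset_span (IndRel.odd_pos u k hk f))

theorem ev_comm (u v : GC) (m n : ℤ) : ev u m * ev v n = ev v n * ev u m + (ev (br u v) (m + n)
    + algebraMap ℂ ModeAlg (if m + n = 0 then m * pairing u v else 0)) := by
  have := mode_rel (ModeRel.even_even u v m n)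
  simp only [map_sub, map_mul, map_add, AlgHom.commutes] at this
  exact sub_eq_iff_eq_add'.1 this

theorem ev_od_comm (u v : GC) (m k : ℤ) :
    ev u m * od v k = od v k * ev u m + od (br u v) (m + k) := by
  have := mode_rel (ModeRel.even_odd u v m k)
  simp only [map_sub, map_mul] at this
  exact sub_eq_iff_eq_add'.1 this

theorem od_comm (u v : GC) (k l : ℤ) : od u k * od v l = -(od v l * od u k)
    + algebraMap ℂ ModeAlg (if k + l + 1 = 0 then pairing u v else 0) := by
  have := mode_rel (ModeRel.odd_odd u v k l)
  simp only [map_add, map_mul, AlgHom.commutes] at this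
  rw [neg_add_eq_sub]
  exact eq_sub_of_add_eq this

/-- Moving a mode of `u` past a fixed mode of `w` produces a mode of [u, w], so the induction needs
the bound for all vectors at once. -/
theorem ind_truncated (v : Ind D) : ∀ u, ∃ M : ℤ, ∀ n, M ≤ n → ev u n • v = 0 ∧ od u n • v = 0 := by
  induction v using ind_induction with
  | hvac f => exact fun u => ⟨1, fun n hn => ⟨ev_pos u (by omega) f, od_nonneg u (by omega) f⟩⟩
  | hadd v w hv hw =>
    intro u
    obtain ⟨M, hM⟩ := hv u
    obtain ⟨M', hM'⟩ := hw u
    refine ⟨max M M', fun n hn => ?_⟩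
    have h1 := hM n (le_of_max_le_left hn)
    have h2 := hM' n (le_of_max_le_right hn)
    exact ⟨by rw [smul_add, h1.1, h2.1, add_zero], by rw [smul_add, h1.2, h2.2, add_zero]⟩
  | hsmul c v hv =>
    intro u
    obtain ⟨M, hM⟩ := hv u
    exact ⟨M, fun n hn => ⟨by rw [smul_comm, (hM n hn).1, smul_zero],
      by rw [smul_comm, (hM n hn).2, smul_zero]⟩⟩
  | hmode x v hv =>
    intro u
    obtain ⟨M, hM⟩ := hv u
    rcases x with ⟨w, m⟩ | ⟨w, m⟩
    · obtain ⟨M', hM'⟩ := hv (br u w)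
      obtain ⟨M'', hM''⟩ := hv (br w u)
      refine ⟨max (max M (M' - m)) (max (M'' - m) (1 - m)), fun n hn => ?_⟩
      change ev u n • ev w m • v = 0 ∧ od u n • ev w m • v = 0
      have h1 := hM n (by omega)
      have h2 := hM' (n + m) (by omega)
      have h3 := hM'' (m + n) (by omega)
      have h4 : od u n * ev w m = ev w m * od u n - od (br w u) (m + n) := by
        rw [ev_od_comm]
        abel
      rw [← mul_smul, ← mul_smul, ev_comm, h4, if_neg (by omega), map_zero, add_zero, add_smul,
        sub_smul, mul_smul, mul_smul, h1.1, h1.2, h2.1, h3.2]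
      simp
    · obtain ⟨M', hM'⟩ := hv (br u w)
      refine ⟨max (max M (M' - m)) (- m), fun n hn => ?_⟩
      change ev u n • od w m • v = 0 ∧ od u n • od w m • v = 0
      have h1 := hM n (by omega)
      have h2 := hM' (n + m) (by omega)
      rw [← mul_smul, ← mul_smul, ev_od_comm, od_comm, if_neg (by omega), map_zero, add_zero,
        add_smul, neg_smul, mul_smul, mul_smul, h1.1, h1.2, h2.2]
      simp

theorem ind_modeRep : ModeRep (fun u n => indOp D (ev u n)) (fun u k => indOp D (od u k)) where
  E_add u v n := by
    have : ev (u + v) n = ev u n + ev v n := by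
      have := mode_rel (ModeRel.even_add u v n)
      rwa [map_add] at this
    rw [this, map_add]
  E_smul c u n := by
    have : ev (c • u) n = c • ev u n := by
      have := mode_rel (ModeRel.even_smul c u n)
      rwa [map_smul] at this
    rw [this, map_smul]
  O_add u v n := by
    have : od (u + v) n = od u n + od v n := by
      have := mode_rel (ModeRel.odd_add u v n)
      rwa [map_add] at this
    rw [this, map_add]
  O_smul c u n := by
    have : od (c • u) n = c • od u n := by
      have := mode_rel (ModeRel.odd_smul c u n)
      rwa [map_smul] at this
    rw [this, map_smul]
  EE u v m n := by
    rw [← map_mul, ev_comm, map_add, map_add, map_mul, AlgHom.commutes, Algebra.algebraMap_eq_smul_one]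
    abel
  EO u v m k := by rw [← map_mul, ev_od_comm, map_add, map_mul]
  OO u v k l := by
    rw [← map_mul, od_comm, map_add, map_neg, map_mul, AlgHom.commutes,
      Algebra.algebraMap_eq_smul_one]
  fE u v := by
    obtain ⟨M, hM⟩ := ind_truncated v u
    exact ⟨M, fun n hn => (hM n hn).1⟩
  fO u v := by
    obtain ⟨M, hM⟩ := ind_truncated v u
    exact ⟨M, fun n hn => (hM n hn).2⟩

theorem manJ_ind (e e' : Fin 4 → GC) (n : ℤ) (v : Ind D) :
    manJ (fun u k => indOp D (od u k)) e e' n v = superJ e e' n v := by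
  have R := ind_modeRep (D := D)
  simp only [manJ, superJ, LinearMap.sum_apply]
  refine Finset.sum_congr rfl fun i _ => ?_
  rw [nprod_apply (R.fO _) (R.fO _)]
  refine finsum_congr fun k => ?_
  simp only [nterm]
  split_ifs with h
  · rfl
  · rw [LinearMap.smul_apply, neg_one_smul]
    rfl

theorem manQ_ind (e e' : Fin 4 → GC) (k : ℤ) (v : Ind D) :
    manQ (fun u n => indOp D (ev u n)) (fun u k => indOp D (od u k)) e e' k v
      = superJodd e e' k v := by
  have R := ind_modeRep (D := D)
  simp only [manQ, superJodd, LinearMap.sum_apply, LinearMap.sub_apply]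
  refine Finset.sum_congr rfl fun i _ => ?_
  rw [nprod_apply (R.fO _) (R.fE _), nprod_apply (R.fE _) (R.fO _)]
  congr 1
  · refine finsum_congr fun l => ?_
    simp only [nterm, one_smul]
    split_ifs with h <;> rfl
  · refine finsum_congr fun l => ?_
    simp only [nterm, one_smul]
    split_ifs with h <;> rfl

/-- The `N = 2` structure attached to a Manin triple. -/
theorem generatedBy_n2 {K : GC →ₗ[ℂ] GC} {e e' f f' : Fin 4 → GC}
    (T : IsManinTriple K e e')
    (hJ : ∀ m, manJ (fun u k => indOp D (od u k)) f f' m = manJ (fun u k => indOp D (od u k)) e e' m)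
    (hQ : ∀ m, manQ (fun u n => indOp D (ev u n)) (fun u k => indOp D (od u k)) f f' m
      = manQ (fun u n => indOp D (ev u n)) (fun u k => indOp D (od u k)) e e' m) :
    ((ind_modeRep (D := D)).isSuperTriple T).n2.GeneratedBy f f' := by
  refine ⟨fun n v => ?_, fun k v => ?_⟩
  · rw [← manJ_ind, hJ]
    rfl
  · rw [← manQ_ind, hQ]
    change ((ind_modeRep (D := D)).isSuperTriple T).gm k v
      - ((ind_modeRep (D := D)).isSuperTriple T).gp k v = _
    simp only [IsSuperTriple.gm, IsSuperTriple.gp, LinearMap.smul_apply, LinearMap.sub_apply,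
      LinearMap.add_apply]
    module

end Induced

/-! ## Manin triples from generalized complex structures -/

/-- The conditions on the matrix in the frame of an equivariant generalized complex structure. -/
structure IsFrameGC (A : Matrix Ix Ix ℝ) : Prop where
  sq : A * A = -1
  orthogonal : Aᵀ * Matrix.fromBlocks 0 1 1 0 * A = Matrix.fromBlocks 0 1 1 0
  closed : ∀ u v : GC, cplx A *ᵥ u = Complex.I • u → cplx A *ᵥ v = Complex.I • v →
    cplx A *ᵥ br u v = Complex.I • br u v

theorem cplx_mul (A B : Matrix Ix Ix ℝ) : cplx (A * B) = cplx A * cplx B :=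
  Matrix.map_mul (f := Complex.ofRealHom)

theorem cplx_one : cplx 1 = 1 :=
  Matrix.map_one (fun x : ℝ => (x : ℂ)) (by simp) (by simp)

theorem cplx_neg (A : Matrix Ix Ix ℝ) : cplx (-A) = -cplx A := by
  ext i j
  simp [cplx]

theorem cplx_transpose (A : Matrix Ix Ix ℝ) : cplx Aᵀ = (cplx A)ᵀ := rfl

theorem cplx_mulVec_star (A : Matrix Ix Ix ℝ) (u : GC) : cplx A *ᵥ star u = star (cplx A *ᵥ u) := by
  funext i
  simp [Matrix.mulVec, dotProduct, cplx]

theorem br_star (u v : GC) : br (star u) (star v) = star (br u v) := by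
  funext i
  rcases i with i | i <;> simp [br]

theorem pairing_star (u v : GC) : pairing (star u) (star v) = star (pairing u v) := by
  simp [pairing]

theorem pairing_eq_dotProduct (u v : GC) :
    pairing u v = u ⬝ᵥ (cplx (Matrix.fromBlocks 0 1 1 0) *ᵥ v) := by
  have : cplx (Matrix.fromBlocks 0 1 1 0) = Matrix.fromBlocks 0 1 1 0 := by
    rw [cplx, Matrix.fromBlocks_map, Matrix.map_zero _ (by simp), Matrix.map_one _ (by simp) (by simp)]
  rw [this, Matrix.fromBlocks_mulVec]
  simp [dotProduct, pairing, Finset.sum_add_distrib]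

theorem pairing_ext {u v : GC} (h : ∀ w, pairing w u = pairing w v) : u = v := by
  funext i
  rcases i with i | i
  · simpa [pairing, aa, Pi.single_apply] using h (aa i)
  · simpa [pairing, bb, Pi.single_apply] using h (bb i)

/-- A vector of `K`-eigenvalue `-1` for `K = √-1 A`. -/
def frameK (A : Matrix Ix Ix ℝ) : GC →ₗ[ℂ] GC := Complex.I • (cplx A).mulVecLin

theorem frameK_apply (A : Matrix Ix Ix ℝ) (u : GC) : frameK A u = Complex.I • (cplx A *ᵥ u) := rfl

theorem frameK_eq_neg_iff {A : Matrix Ix Ix ℝ} {u : GC} :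
    frameK A u = -u ↔ cplx A *ᵥ u = Complex.I • u := by
  rw [frameK_apply]
  constructor
  · intro h
    have := congrArg (fun x => -Complex.I • x) h
    simpa [smul_smul] using this
  · intro h
    rw [h, smul_smul, Complex.I_mul_I, neg_one_smul]

theorem frameK_eq_iff {A : Matrix Ix Ix ℝ} {u : GC} :
    frameK A u = u ↔ cplx A *ᵥ u = -(Complex.I • u) := by
  rw [frameK_apply]
  constructor
  · intro h
    have := congrArg (fun x => -Complex.I • x) h
    simpa [smul_smul] using this
  · intro h
    rw [h, smul_neg, smul_smul, Complex.I_mul_I, neg_one_smul, neg_neg]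

theorem frameK_star (A : Matrix Ix Ix ℝ) (u : GC) : frameK A (star u) = -star (frameK A u) := by
  rw [frameK_apply, frameK_apply, cplx_mulVec_star, star_smul]
  simp

namespace IsFrameGC

variable {A : Matrix Ix Ix ℝ} (hA : IsFrameGC A)
include hA

theorem K_K (u : GC) : frameK A (frameK A u) = u := by
  rw [frameK_apply, frameK_apply, Matrix.mulVec_smul, smul_smul, Complex.I_mul_I, Matrix.mulVec_mulVec,
    ← cplx_mul, hA.sq, cplx_neg, cplx_one, Matrix.neg_mulVec, Matrix.one_mulVec]
  simp

/-- An orthogonal endomorphism with square -1 is skew-adjoint. -/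
theorem pairing_K (u v : GC) : pairing (frameK A u) v = -pairing u (frameK A v) := by
  have h : Aᵀ * Matrix.fromBlocks 0 1 1 0 = -(Matrix.fromBlocks 0 1 1 0 * A) := by
    calc _ = -(Aᵀ * Matrix.fromBlocks 0 1 1 0 * (A * A)) := by rw [hA.sq, Matrix.mul_neg, mul_one, neg_neg]
      _ = _ := by rw [← mul_assoc, hA.orthogonal]
  have h' := congrArg cplx h
  rw [cplx_mul, cplx_neg, cplx_mul, cplx_transpose] at h'
  rw [frameK_apply, frameK_apply, pairing_smul_left, pairing_smul_right, pairing_eq_dotProduct,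
    pairing_eq_dotProduct, ← mul_neg]
  congr 1
  rw [← Matrix.vecMul_transpose, Matrix.dotProduct_mulVec, Matrix.vecMul_vecMul, h',
    Matrix.vecMul_neg, neg_dotProduct, ← Matrix.dotProduct_mulVec, Matrix.mulVec_mulVec]

theorem pairing_isotropic {u v : GC} (hu : frameK A u = -u) (hv : frameK A v = -v) :
    pairing u v = 0 := by
  have := hA.pairing_K u v
  rw [hu, hv, ← neg_one_smul ℂ, ← neg_one_smul ℂ v, pairing_smul_left, pairing_smul_right] at this
  linear_combination (-1 / 2) * this

theorem pairing_isotropic' {u v : GC} (hu : frameK A u = u) (hv : frameK A v = v) :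
    pairing u v = 0 := by
  have := hA.pairing_K u v
  rw [hu, hv] at this
  linear_combination (1 / 2) * this

theorem br_eigen {u v : GC} (hu : frameK A u = -u) (hv : frameK A v = -v) :
    frameK A (br u v) = -br u v :=
  frameK_eq_neg_iff.2 (hA.closed u v (frameK_eq_neg_iff.1 hu) (frameK_eq_neg_iff.1 hv))

/-- Complex conjugation exchanges the two eigenspaces, since `A` and the bracket are real. -/
theorem br_eigen' {u v : GC} (hu : frameK A u = u) (hv : frameK A v = v) :
    frameK A (br u v) = br u v := by
  have := hA.br_eigen (u := star u) (v := star v) (by rw [frameK_star, hu]) (by rw [frameK_star, hv])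
  rw [br_star, frameK_star, neg_inj] at this
  exact star_injective this

/-- Both eigenspaces are subalgebras; apply this to the projections u ∓ K u and v ∓ K v, and take
half the difference. -/
theorem nijenhuis (u v : GC) : br u v - frameK A (br u (frameK A v))
    = frameK A (br (frameK A u) v) - br (frameK A u) (frameK A v) := by
  have h1 := hA.br_eigen (u := u - frameK A u) (v := v - frameK A v)
    (by rw [map_sub, hA.K_K, neg_sub]) (by rw [map_sub, hA.K_K, neg_sub])
  have h2 := hA.br_eigen' (u := u + frameK A u) (v := v + frameK A v)
    (by rw [map_add, hA.K_K, add_comm]) (by rw [map_add, hA.K_K, add_comm])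
  simp only [sub_eq_add_neg, ← neg_one_smul ℂ (frameK A u), ← neg_one_smul ℂ (frameK A v),
    br_add_left, br_add_right, br_smul_left, br_smul_right, map_add, map_smul] at h1 h2
  rw [← sub_eq_zero] at h1 h2 ⊢
  have h3 := congrArg₂ (fun a b => (1 / 2 : ℂ) • (a - b)) h1 h2
  simp only [sub_zero, smul_zero] at h3
  rw [← h3]
  module

/-- The sum is the trace of ad_w on the eigenspace with basis `e'`. Two-step nilpotency makes the
square of ad_w zero, so the trace vanishes. -/
theorem trace_br {e e' : Fin 4 → GC} (he' : ∀ i, frameK A (e' i) = e' i)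
    (hc : ∀ x, x = ∑ i, (pairing (e i) x • e' i + pairing (e' i) x • e i)) {w : GC}
    (hw : frameK A w = w) : ∑ i, pairing (e i) (br w (e' i)) = 0 := by
  have key : ∀ k, br w (e' k) = ∑ i, pairing (e i) (br w (e' k)) • e' i := fun k => by
    conv_lhs => rw [hc (br w (e' k))]
    refine Finset.sum_congr rfl fun i _ => ?_
    rw [hA.pairing_isotropic' (he' i) (hA.br_eigen' hw (he' k)), zero_smul, add_zero]
  have hM : IsNilpotent (Matrix.of fun i j => pairing (e i) (br w (e' j))) := by
    refine ⟨2, ?_⟩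
    ext i k
    rw [pow_two, Matrix.mul_apply]
    have : pairing (e i) (br w (br w (e' k))) = 0 := by
      rw [br_br_right, pairing_comm, pairing_zero_left]
    rw [key k, ← adL_apply, ← pairingL_apply, map_sum, map_sum] at this
    simp only [map_smul, smul_eq_mul, pairingL_apply, adL_apply] at this
    simpa [mul_comm] using this
  simpa [Matrix.trace] using (Matrix.isNilpotent_trace_of_isNilpotent hM).eq_zero

theorem trace_br' {e e' : Fin 4 → GC} (he : ∀ i, frameK A (e i) = -e i)
    (hc : ∀ x, x = ∑ i, (pairing (e i) x • e' i + pairing (e' i) x • e i)) {w : GC}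
    (hw : frameK A w = -w) : ∑ i, pairing (e' i) (br w (e i)) = 0 := by
  have h := hA.trace_br (e := fun i => star (e' i)) (e' := fun i => star (e i)) (w := star w)
    (fun i => by rw [frameK_star, he, star_neg, neg_neg])
    (fun x => by
      have := congrArg star (hc (star x))
      rw [star_star] at this
      conv_lhs => rw [this]
      rw [star_sum]
      refine Finset.sum_congr rfl fun i _ => ?_
      rw [star_add, star_smul, star_smul, ← pairing_star, ← pairing_star, star_star, add_comm])
    (by rw [frameK_star, hw, star_neg, neg_neg])
  simp only [br_star, pairing_star, ← star_sum] at h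
  exact star_eq_zero.1 h

/-- By invariance, pairing the sum with `w` in either eigenspace gives, up to sign, the trace of
ad_w on that eigenspace. The pairing is non-degenerate and the eigenspaces span. -/
theorem unimodular {e e' : Fin 4 → GC} (he : ∀ i, frameK A (e i) = -e i)
    (he' : ∀ i, frameK A (e' i) = e' i)
    (hc : ∀ x, x = ∑ i, (pairing (e i) x • e' i + pairing (e' i) x • e i)) :
    ∑ i, br (e' i) (e i) = 0 := by
  have hp : ∀ w, frameK A w = w → pairing w (∑ i, br (e' i) (e i)) = 0 := fun w hw => by
    rw [← pairingL_apply, map_sum, ← hA.trace_br he' hc hw]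
    exact Finset.sum_congr rfl fun i _ => by
      rw [pairingL_apply, ← pairing_br, pairing_comm]
  have hm : ∀ w, frameK A w = -w → pairing w (∑ i, br (e' i) (e i)) = 0 := fun w hw => by
    rw [← pairingL_apply, map_sum, ← neg_zero, ← hA.trace_br' he hc hw, ← Finset.sum_neg_distrib]
    exact Finset.sum_congr rfl fun i _ => by
      rw [pairingL_apply, br_swap, ← neg_one_smul ℂ, pairing_smul_right, ← pairing_br, pairing_comm,
        neg_one_mul]
  refine pairing_ext fun w => ?_
  have hw : w = (1 / 2 : ℂ) • ((w + frameK A w) + (w - frameK A w)) := by module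
  rw [pairing_comm w 0, pairing_zero_left, hw, pairing_smul_left, pairing_add_left,
    hp _ (by rw [map_add, hA.K_K, add_comm]), hm _ (by rw [map_sub, hA.K_K, neg_sub])]
  simp

/-- Isotropy and duality say that the matrix `P` of pairings is a left inverse of the square matrix
`Q` with columns `e`, `e'`; it is then also a right inverse, which is the expansion. -/
theorem complete {e e' : Fin 4 → GC} (he : ∀ i, frameK A (e i) = -e i)
    (he' : ∀ i, frameK A (e' i) = e' i) (hd : ∀ i j, pairing (e' i) (e j) = if i = j then 1 else 0)
    (x : GC) : x = ∑ i, (pairing (e i) x • e' i + pairing (e' i) x • e i) := by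
  let P : Matrix Ix Ix ℂ := Matrix.of fun s b => Sum.elim e' e s b.swap
  let Q : Matrix Ix Ix ℂ := Matrix.of fun b s => Sum.elim e e' s b
  have hP : ∀ s v, (P *ᵥ v) s = pairing (Sum.elim e' e s) v := fun s v => by
    simp [P, Matrix.mulVec, dotProduct, pairing, Finset.sum_add_distrib, add_comm]
  have hPQ : P * Q = 1 := by
    ext s t
    have : (P * Q) s t = pairing (Sum.elim e' e s) (Sum.elim e e' t) := hP s fun b => Q b t
    rw [this, Matrix.one_apply]
    rcases s with s | s <;> rcases t with t | t
    · simp [hd]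
    · simp [hA.pairing_isotropic' (he' s) (he' t)]
    · simp [hA.pairing_isotropic (he s) (he t)]
    · simp [pairing_comm (e s), hd, eq_comm]
  have hQP := mul_eq_one_comm.1 hPQ
  conv_lhs => rw [← Matrix.one_mulVec x, ← hQP, ← Matrix.mulVec_mulVec]
  funext b
  change ∑ s, Q b s * (P *ᵥ x) s = _
  simp only [hP]
  simp [Q, Finset.sum_add_distrib, add_comm, mul_comm]

theorem isManinTriple {e e' : Fin 4 → GC} (he : ∀ i, frameK A (e i) = -e i)
    (he' : ∀ i, frameK A (e' i) = e' i) (hd : ∀ i j, pairing (e' i) (e j) = if i = j then 1 else 0) :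
    IsManinTriple (frameK A) e e' where
  K_e := he
  K_e' := he'
  dual i := by simp [hd]
  complete := hA.complete he he' hd
  nijenhuis := hA.nijenhuis
  unimodular := hA.unimodular he he' (hA.complete he he' hd)

end IsFrameGC

/-! ## Dual bases -/

namespace IsManinTriple

variable {K : GC →ₗ[ℂ] GC} {e e' f f' : Fin 4 → GC}

theorem expand_neg (T : IsManinTriple K e e') {x : GC} (hx : K x = -x) :
    x = ∑ i, pairing (e' i) x • e i := by
  have h := T.K_apply x
  have h' := T.complete x
  rw [hx, Finset.sum_sub_distrib] at h
  rw [Finset.sum_add_distrib] at h'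
  have : (2 : ℂ) • x = (2 : ℂ) • ∑ i, pairing (e' i) x • e i := by
    have : x + x = (∑ i, pairing (e i) x • e' i + ∑ i, pairing (e' i) x • e i)
        - (∑ i, pairing (e i) x • e' i - ∑ i, pairing (e' i) x • e i) := by
      rw [← h', ← h, sub_neg_eq_add]
    rw [two_smul, this]
    module
  exact smul_right_injective _ two_ne_zero this

theorem expand_pos (T : IsManinTriple K e e') {x : GC} (hx : K x = x) :
    x = ∑ i, pairing (e i) x • e' i := by
  have h := T.K_apply x
  have h' := T.complete x
  rw [hx, Finset.sum_sub_distrib] at h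
  rw [Finset.sum_add_distrib] at h'
  have : (2 : ℂ) • x = (2 : ℂ) • ∑ i, pairing (e i) x • e' i := by
    have : x + x = (∑ i, pairing (e i) x • e' i + ∑ i, pairing (e' i) x • e i)
        + (∑ i, pairing (e i) x • e' i - ∑ i, pairing (e' i) x • e i) := by
      rw [← h', ← h]
    rw [two_smul, this]
    module
  exact smul_right_injective _ two_ne_zero this

/-- The canonical tensor of the pairing of the eigenspaces of `K`. -/
theorem sum_dual_eq (T : IsManinTriple K e e') (S : IsManinTriple K f f') {W : Type*}
    [AddCommGroup W] [Module ℂ W] (F : GC →ₗ[ℂ] GC →ₗ[ℂ] W) :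
    ∑ j, F (f' j) (f j) = ∑ i, F (e' i) (e i) := by
  calc ∑ j, F (f' j) (f j) = ∑ j, ∑ i, pairing (e' i) (f j) • F (f' j) (e i) := by
        refine Finset.sum_congr rfl fun j _ => ?_
        conv_lhs => rw [T.expand_neg (S.K_e j)]
        simp only [map_sum, map_smul]
    _ = ∑ i, F (e' i) (e i) := by
        rw [Finset.sum_comm]
        refine Finset.sum_congr rfl fun i _ => ?_
        conv_rhs => rw [S.expand_pos (T.K_e' i)]
        simp only [map_sum, map_smul, LinearMap.sum_apply, LinearMap.smul_apply]
        exact Finset.sum_congr rfl fun j _ => by rw [pairing_comm]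

variable {V : Type*} [AddCommGroup V] [Module ℂ V] {E O : GC → ℤ → Module.End ℂ V}

theorem manJ_eq (T : IsManinTriple K e e') (S : IsManinTriple K f f') (R : ModeRep E O) (m : ℤ) :
    manJ O f f' m = manJ O e e' m :=
  T.sum_dual_eq S (nbil R.lfO R.lfO (-1) 0 (m - 1))

theorem manQ_eq (T : IsManinTriple K e e') (S : IsManinTriple K f f') (R : ModeRep E O) (m : ℤ) :
    manQ E O f f' m = manQ E O e e' m :=
  T.sum_dual_eq S (nbil R.lfE R.lfO 1 0 m - nbil R.lfO R.lfE 1 0 m)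

end IsManinTriple

/-- The eigenspace of `√-1 A` with eigenvalue `c`. -/
def eigenK (A : Matrix Ix Ix ℝ) (c : ℂ) : Submodule ℂ GC := LinearMap.ker (frameK A - c • 1)

theorem mem_eigenK {A : Matrix Ix Ix ℝ} {c : ℂ} {u : GC} : u ∈ eigenK A c ↔ frameK A u = c • u := by
  simp [eigenK, sub_eq_zero]

namespace IsFrameGC

variable {A : Matrix Ix Ix ℝ} (hA : IsFrameGC A)
include hA

/-- For every w the vector w - cKw lies in the opposite eigenspace, and its pairing with x equals
2(x, w). -/
theorem pairing_injective {c : ℂ} (hc : c = 1 ∨ c = -1) :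
    Function.Injective (pairingL.domRestrict₁₂ (eigenK A c) (eigenK A (-c))) := by
  rw [← LinearMap.ker_eq_bot, LinearMap.ker_eq_bot']
  rintro ⟨x, hx⟩ h
  rw [mem_eigenK] at hx
  refine Subtype.ext (pairing_ext fun w => ?_)
  have hc2 : c * c = 1 := by rcases hc with rfl | rfl <;> norm_num
  have h1 : pairing x (w - c • frameK A w) = 0 := LinearMap.congr_fun h ⟨w - c • frameK A w, by
    rw [mem_eigenK, map_sub, map_smul, hA.K_K, smul_sub, smul_smul, neg_mul, hc2]
    module⟩
  have h2 : pairing x (c • frameK A w) = -pairing x w := by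
    have := hA.pairing_K x w
    rw [hx, pairing_smul_left] at this
    rw [pairing_smul_right]
    linear_combination c * this - (pairing x w) * hc2
  rw [sub_eq_add_neg, pairing_add_right, ← neg_one_smul ℂ (c • _), pairing_smul_right, h2] at h1
  change pairing w x = pairing w 0
  rw [pairing_comm w, pairing_comm w, pairing_zero_left]
  linear_combination (1 / 2) * h1

theorem finrank_le {c : ℂ} (hc : c = 1 ∨ c = -1) :
    Module.finrank ℂ (eigenK A c) ≤ Module.finrank ℂ (eigenK A (-c)) := by
  rw [← Subspace.dual_finrank_eq (V := eigenK A (-c))]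
  exact LinearMap.finrank_le_finrank_of_injective (hA.pairing_injective hc)

/-- The pairing embeds each eigenspace in the dual of the other, so their dimensions agree; they are
complementary in dimension 8. -/
theorem finrank_eigenK : Module.finrank ℂ (eigenK A (-1)) = 4 ∧ Module.finrank ℂ (eigenK A 1) = 4 := by
  have h1 := hA.finrank_le (c := 1) (.inl rfl)
  have h2 := hA.finrank_le (c := -1) (.inr rfl)
  rw [neg_neg] at h2
  have hcompl : IsCompl (eigenK A (-1)) (eigenK A 1) := by
    refine IsCompl.of_eq (eq_bot_iff.2 fun x hx => ?_) (eq_top_iff.2 fun x _ => ?_)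
    · obtain ⟨h, h'⟩ := Submodule.mem_inf.1 hx
      rw [mem_eigenK] at h h'
      have : (2 : ℂ) • x = 0 := by
        have : x = (-1 : ℂ) • x := by rw [← h, h', one_smul]
        calc (2 : ℂ) • x = x + x := two_smul _ _
          _ = x + (-1 : ℂ) • x := by rw [← this]
          _ = 0 := by module
      simpa using this
    · refine Submodule.mem_sup.2 ⟨(1 / 2 : ℂ) • (x - frameK A x), ?_, (1 / 2 : ℂ) • (x + frameK A x), ?_,
        by module⟩
      · rw [mem_eigenK, map_smul, map_sub, hA.K_K]
        module
      · rw [mem_eigenK, map_smul, map_add, hA.K_K]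
        module
  have h3 := Submodule.finrank_add_eq_of_isCompl hcompl
  have h4 : Module.finrank ℂ GC = 8 := by simp
  omega

/-- The eigenspaces of a generalized complex structure have dual bases. -/
theorem exists_dual : ∃ e e' : Fin 4 → GC, (∀ i, frameK A (e i) = -e i) ∧
    (∀ i, frameK A (e' i) = e' i) ∧ ∀ i j, pairing (e' i) (e j) = if i = j then 1 else 0 := by
  obtain ⟨h1, h2⟩ := hA.finrank_eigenK
  let b := Module.finBasisOfFinrankEq ℂ (eigenK A (-1)) h1
  have hinj : Function.Injective (pairingL.domRestrict₁₂ (eigenK A 1) (eigenK A (-1))) :=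
    hA.pairing_injective (.inl rfl)
  have hsurj := (LinearMap.injective_iff_surjective_of_finrank_eq_finrank
    (f := pairingL.domRestrict₁₂ (eigenK A 1) (eigenK A (-1)))
    (by rw [Subspace.dual_finrank_eq, h1, h2])).1 hinj
  choose g hg using fun i => hsurj (b.coord i)
  refine ⟨fun i => b i, fun i => g i, fun i => ?_, fun i => ?_, fun i j => ?_⟩
  · simpa using mem_eigenK.1 (b i).2
  · simpa using mem_eigenK.1 (g i).2
  · have := LinearMap.congr_fun (hg i) (b j)
    rw [Module.Basis.coord_apply, Module.Basis.repr_self, Finsupp.single_apply] at this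
    rw [← pairingL_apply]
    simp only [eq_comm (a := i)]
    exact this

end IsFrameGC

/-! ## Frames -/

/-- Frames whose pairings are those of `β_i, α^i`. -/
def IsOrthoFrame (M : Target) : Prop :=
  ∀ p, (M.frame p)ᵀ * Matrix.fromBlocks 0 1 1 0 * M.frame p = Matrix.fromBlocks 0 1 1 0

/-- The inverse of an orthogonal frame. -/
def Target.frameInv (M : Target) (p : R4) : Matrix Ix Ix ℝ :=
  Matrix.fromBlocks 0 1 1 0 * (M.frame p)ᵀ * Matrix.fromBlocks 0 1 1 0

theorem etaM_mul_self : (Matrix.fromBlocks 0 1 1 0 * Matrix.fromBlocks 0 1 1 0 : Matrix Ix Ix ℝ) = 1 := by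
  simp [Matrix.fromBlocks_multiply]

theorem IsOrthoFrame.inv_mul {M : Target} (h : IsOrthoFrame M) (p : R4) :
    M.frameInv p * M.frame p = 1 := by
  rw [Target.frameInv, mul_assoc, mul_assoc, ← mul_assoc (M.frame p)ᵀ, h, etaM_mul_self]

theorem IsOrthoFrame.mul_inv {M : Target} (h : IsOrthoFrame M) (p : R4) :
    M.frame p * M.frameInv p = 1 := mul_eq_one_comm.1 (h.inv_mul p)

theorem isOrthoFrame_Y : IsOrthoFrame targetY := fun p => by simp [targetY]

theorem isOrthoFrame_N : IsOrthoFrame targetN := fun p => by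
  ext i j
  rcases i with i | i <;> rcases j with j | j <;> fin_cases i <;> fin_cases j <;>
    simp [targetN, frameN, Matrix.mul_apply, Fin.sum_univ_four, Matrix.one_apply]

section

variable {M : Target} {𝒥 : R4 → Matrix Ix Ix ℝ} {A : Matrix Ix Ix ℝ}

theorem HasFrameMatrix.mulVec (h : HasFrameMatrix M 𝒥 A) (p : R4) (v : GC) :
    cplx (𝒥 p) *ᵥ (cplx (M.frame p) *ᵥ v) = cplx (M.frame p) *ᵥ (cplx A *ᵥ v) := by
  rw [Matrix.mulVec_mulVec, Matrix.mulVec_mulVec, ← cplx_mul, ← cplx_mul, h]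

theorem IsOrthoFrame.mulVec_injective (h : IsOrthoFrame M) (p : R4) :
    Function.Injective (cplx (M.frame p) *ᵥ ·) := fun u v huv => by
  have := congrArg (cplx (M.frameInv p) *ᵥ ·) huv
  simpa only [Matrix.mulVec_mulVec, ← cplx_mul, h.inv_mul, cplx_one, Matrix.one_mulVec] using this

/-- The conditions at all points collapse to one condition on the matrix `A`, so structures with
equal matrices on different targets have the same dual bases. -/
theorem isDualBasis_iff (hM : IsOrthoFrame M) (h : HasFrameMatrix M 𝒥 A) (e e' : Fin 4 → GC) :
    IsDualBasis M 𝒥 e e' ↔ (∀ i, frameK A (e i) = -e i) ∧ (∀ i, frameK A (e' i) = e' i) ∧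
      ∀ i j, pairing (e' i) (e j) = if i = j then 1 else 0 := by
  constructor
  · rintro ⟨h1, h2, h3⟩
    refine ⟨fun i => frameK_eq_neg_iff.2 ?_, fun i => frameK_eq_iff.2 ?_, h3⟩
    · have := h1 i 0
      rw [h.mulVec, ← Matrix.mulVec_smul] at this
      exact hM.mulVec_injective 0 this
    · have := h2 i 0
      rw [h.mulVec, ← Matrix.mulVec_smul, ← Matrix.mulVec_neg] at this
      exact hM.mulVec_injective 0 this
  · rintro ⟨h1, h2, h3⟩
    refine ⟨fun i p => ?_, fun i p => ?_, h3⟩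
    · rw [h.mulVec, frameK_eq_neg_iff.1 (h1 i), Matrix.mulVec_smul]
    · rw [h.mulVec, frameK_eq_iff.1 (h2 i), Matrix.mulVec_neg, Matrix.mulVec_smul]

/-- The `N = 2` structure attached to a generalized complex structure. -/
theorem IsFrameGC.exists_isAttached (hM : IsOrthoFrame M) (h : HasFrameMatrix M 𝒥 A)
    (hA : IsFrameGC A) (D : ZeroModeData) :
    ∃ S : N2Structure 12 (Ind D), IsAttached M 𝒥 S := by
  obtain ⟨e, e', he, he', hd⟩ := hA.exists_dual
  have T := hA.isManinTriple he he' hd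
  refine ⟨(ind_modeRep.isSuperTriple T).n2, ⟨e, e', (isDualBasis_iff hM h e e').2 ⟨he, he', hd⟩⟩,
    fun f f' hf => ?_⟩
  obtain ⟨hf1, hf2, hf3⟩ := (isDualBasis_iff hM h f f').1 hf
  have S := hA.isManinTriple hf1 hf2 hf3
  exact generatedBy_n2 T (T.manJ_eq S ind_modeRep) (T.manQ_eq S ind_modeRep)

end

/-! ## Exterior algebra -/

/-- `wedge`, as a linear map. -/
def wedgeL (i : Fin 4) : Module.End ℂ Form where
  toFun := wedge i
  map_add' φ ψ := by
    funext I
    simp only [wedge, Pi.add_apply]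
    split_ifs <;> ring
  map_smul' c φ := by
    funext I
    simp only [wedge, Pi.smul_apply, smul_eq_mul, RingHom.id_apply]
    split_ifs <;> ring

/-- `contract`, as a linear map. -/
def contractL (i : Fin 4) : Module.End ℂ Form where
  toFun := contract i
  map_add' φ ψ := by
    funext I
    simp only [contract, Pi.add_apply]
    split_ifs <;> ring
  map_smul' c φ := by
    funext I
    simp only [contract, Pi.smul_apply, smul_eq_mul, RingHom.id_apply]
    split_ifs <;> ring

/-- With integral signs the identities for moving indices can be decided by running over all subsets
of `Fin 4`. -/
theorem sgn_eq (i : Fin 4) (I : Finset (Fin 4)) :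
    sgn i I = (((-1) ^ (I.filter (· < i)).card : ℤ) : ℂ) := by
  simp [sgn]

theorem wedgeL_mul (i j : Fin 4) : wedgeL i * wedgeL j = -(wedgeL j * wedgeL i) := by
  refine LinearMap.ext fun φ => funext fun I => ?_
  change wedge i (wedge j φ) I = -wedge j (wedge i φ) I
  simp only [wedge, sgn_eq, Finset.mem_erase]
  by_cases hij : i = j
  · simp [hij]
  by_cases hi : i ∈ I
  · by_cases hj : j ∈ I
    · have key : ∀ (i j : Fin 4) (I : Finset (Fin 4)), i ≠ j → i ∈ I → j ∈ I →
          ((-1) ^ (I.filter (· < i)).card * (-1) ^ ((I.erase i).filter (· < j)).card : ℤ)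
          = -((-1) ^ (I.filter (· < j)).card * (-1) ^ ((I.erase j).filter (· < i)).card) := by decide
      have := congrArg (Int.cast (R := ℂ)) (key i j I hij hi hj)
      simp only [hi, hj, if_true, ne_eq, hij, Ne.symm hij, not_false_eq_true, and_self,
        Finset.erase_right_comm (a := j)]
      push_cast at this ⊢
      linear_combination (φ ((I.erase i).erase j)) * this
    · simp [hj]
  · simp [hi]

theorem contractL_mul (i j : Fin 4) : contractL i * contractL j = -(contractL j * contractL i) := by
  refine LinearMap.ext fun φ => funext fun I => ?_
  change contract i (contract j φ) I = -contract j (contract i φ) I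
  simp only [contract, sgn_eq, Finset.mem_insert]
  by_cases hij : i = j
  · simp [hij]
  by_cases hi : i ∈ I
  · simp [hi]
  · by_cases hj : j ∈ I
    · simp [hj]
    · have key : ∀ (i j : Fin 4) (I : Finset (Fin 4)), i ≠ j → i ∉ I → j ∉ I →
          ((-1) ^ (I.filter (· < i)).card * (-1) ^ ((insert i I).filter (· < j)).card : ℤ)
          = -((-1) ^ (I.filter (· < j)).card * (-1) ^ ((insert j I).filter (· < i)).card) := by decide
      have := congrArg (Int.cast (R := ℂ)) (key i j I hij hi hj)
      simp only [hi, hj, if_false, hij, Ne.symm hij, or_self, Finset.insert_comm j]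
      push_cast at this ⊢
      linear_combination (φ (insert i (insert j I))) * this

theorem contractL_wedgeL (i j : Fin 4) :
    contractL i * wedgeL j = (if i = j then 1 else 0) - wedgeL j * contractL i := by
  refine LinearMap.ext fun φ => funext fun I => ?_
  have hr : ((if i = j then 1 else 0 : Module.End ℂ Form) - wedgeL j * contractL i) φ I
      = (if i = j then φ I else 0) - wedge j (contract i φ) I := by
    split_ifs <;> rfl
  rw [hr]
  change contract i (wedge j φ) I = _
  simp only [contract, wedge, sgn_eq, Finset.mem_insert, Finset.mem_erase]
  by_cases hij : i = j
  · subst hij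
    by_cases hi : i ∈ I
    · have key : ∀ (i : Fin 4) (I : Finset (Fin 4)), i ∈ I →
          ((-1) ^ (I.filter (· < i)).card * (-1) ^ ((I.erase i).filter (· < i)).card : ℤ) = 1 := by
        decide
      have := congrArg (Int.cast (R := ℂ)) (key i I hi)
      simp only [hi, if_true, not_true_eq_false, ne_eq, false_and, if_false, Finset.insert_erase]
      push_cast at this ⊢
      linear_combination (φ I) * this
    · have key : ∀ (i : Fin 4) (I : Finset (Fin 4)), i ∉ I →
          ((-1) ^ (I.filter (· < i)).card * (-1) ^ ((insert i I).filter (· < i)).card : ℤ) = 1 := by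
        decide
      have := congrArg (Int.cast (R := ℂ)) (key i I hi)
      simp only [hi, if_false, if_true, true_or, Finset.erase_insert, not_false_eq_true]
      push_cast at this ⊢
      linear_combination (φ I) * this
  · by_cases hi : i ∈ I
    · simp [hi, hij]
    · by_cases hj : j ∈ I
      · have key : ∀ (i j : Fin 4) (I : Finset (Fin 4)), i ≠ j → i ∉ I → j ∈ I →
          ((-1) ^ (I.filter (· < i)).card * (-1) ^ ((insert i I).filter (· < j)).card : ℤ)
          = -((-1) ^ (I.filter (· < j)).card * (-1) ^ ((I.erase j).filter (· < i)).card) := by decide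
        have := congrArg (Int.cast (R := ℂ)) (key i j I hij hi hj)
        have he : (insert i I).erase j = insert i (I.erase j) :=
          Finset.erase_insert_of_ne hij
        simp only [hi, hj, if_true, if_false, hij, Ne.symm hij, and_false, false_or, he]
        push_cast at this ⊢
        linear_combination (φ (insert i (I.erase j))) * this
      · simp [hj, hij, Ne.symm hij]

theorem wedgeList_cons (ξ : R4) (l : List R4) :
    wedgeList (ξ :: l) = ∑ j, (ξ j : ℂ) • wedgeL j (wedgeList l) := rfl

theorem wedge_single {i : Fin 4} {I : Finset (Fin 4)} (h : ∀ j ∈ I, i < j) :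
    wedgeL i (Pi.single I 1) = Pi.single (insert i I) 1 := by
  have hi : i ∉ I := fun hi => lt_irrefl _ (h i hi)
  funext J
  change wedge i (Pi.single I 1) J = _
  rw [wedge]
  split_ifs with hJ
  · by_cases hIJ : J.erase i = I
    · have hJ' : J = insert i I := by rw [← hIJ, Finset.insert_erase hJ]
      have : ((insert i I).filter (· < i)) = ∅ := by
        refine Finset.filter_eq_empty_iff.2 fun j hj => ?_
        rcases Finset.mem_insert.1 hj with rfl | hj
        · exact lt_irrefl _
        · exact (h j hj).not_gt
      rw [hJ', Finset.erase_insert hi, sgn, this]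
      simp
    · rw [Pi.single_eq_of_ne hIJ, Pi.single_eq_of_ne, mul_zero]
      rintro rfl
      exact hIJ (Finset.erase_insert hi)
  · rw [Pi.single_eq_of_ne]
    rintro rfl
    exact hJ (Finset.mem_insert_self _ _)

theorem wedgeList_basis (l : List (Fin 4)) (hl : l.Pairwise (· < ·)) :
    wedgeList (l.map fun i => Pi.single i 1) = Pi.single l.toFinset 1 := by
  induction l with
  | nil => rfl
  | cons i l ih =>
    rw [List.pairwise_cons] at hl
    rw [List.map_cons, wedgeList_cons, ih hl.2, List.toFinset_cons, ← wedge_single (by simpa using hl.1),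
      Finset.sum_eq_single i (fun j _ hj => by simp [Pi.single_eq_of_ne hj]) (by simp)]
    simp

/-- If `P` intertwines `dx^i ∧` with the pulled back covectors and fixes `1`, it is the pull-back. -/
theorem pullForm_eq (D : Matrix (Fin 4) (Fin 4) ℝ) (P : Module.End ℂ Form)
    (h1 : P (Pi.single ∅ 1) = Pi.single ∅ 1)
    (hP : ∀ i φ, ∑ j, (D i j : ℂ) • wedgeL j (P φ) = P (wedgeL i φ)) (φ : Form) :
    pullForm D φ = P φ := by
  have key : ∀ l : List (Fin 4), wedgeList (l.map fun i => D i)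
      = P (wedgeList (l.map fun i => Pi.single i 1)) := by
    intro l
    induction l with
    | nil => exact h1.symm
    | cons i l ih =>
      rw [List.map_cons, List.map_cons, wedgeList_cons, wedgeList_cons, ih, hP,
        Finset.sum_eq_single i (fun j _ hj => by simp [Pi.single_eq_of_ne hj]) (by simp)]
      simp
  have hφ : φ = ∑ I, φ I • (Pi.single I 1 : Form) := by
    funext J
    simp [Finset.sum_apply, Pi.single_apply]
  conv_rhs => rw [hφ]
  rw [pullForm, map_sum]
  refine Finset.sum_congr rfl fun I _ => ?_
  rw [key, wedgeList_basis _ (Finset.sortedLT_sort I).pairwise, Finset.sort_toFinset, map_smul]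

theorem pullForm_one (φ : Form) : pullForm 1 φ = φ :=
  pullForm_eq 1 1 rfl (fun i φ => by
    rw [Finset.sum_eq_single i (fun j _ hj => by simp [Matrix.one_apply_ne' hj]) (by simp)]
    simp) φ

theorem clifford_eq (v : GC) (φ : Form) :
    clifford v φ = ∑ i, (v (.inl i) • contractL i φ + v (.inr i) • wedgeL i φ) := rfl

/-! ### Normal forms for products of wedges and contractions -/

section ExteriorRules

variable (X : Module.End ℂ Form)

theorem form_neg_mul (Y : Module.End ℂ Form) : -X * Y = -(X * Y) := LinearMap.neg_comp _ _

theorem form_mul_neg (Y : Module.End ℂ Form) : X * -Y = -(X * Y) := LinearMap.comp_neg _ _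

theorem form_sub_mul (Y Z : Module.End ℂ Form) : (X - Y) * Z = X * Z - Y * Z :=
  LinearMap.sub_comp _ _ _

theorem form_mul_sub (Y Z : Module.End ℂ Form) : X * (Y - Z) = X * Y - X * Z :=
  LinearMap.comp_sub _ _ _

/-- The inequality orients the rule towards increasing indices, so that rewriting with it
terminates. -/
theorem wedgeL_swap {i j : Fin 4} (_ : j < i) : wedgeL i * wedgeL j = -(wedgeL j * wedgeL i) :=
  wedgeL_mul i j

theorem wedgeL_swap_assoc {i j : Fin 4} (_ : j < i) :
    wedgeL i * (wedgeL j * X) = -(wedgeL j * (wedgeL i * X)) := by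
  rw [← mul_assoc, wedgeL_mul, form_neg_mul, mul_assoc]

theorem wedgeL_self (i : Fin 4) : wedgeL i * wedgeL i = 0 := by
  have h := wedgeL_mul i i
  have : (2 : ℂ) • (wedgeL i * wedgeL i) = 0 := by rw [two_smul, ← neg_eq_iff_add_eq_zero, ← h]
  simpa using this

theorem wedgeL_self_assoc (i : Fin 4) : wedgeL i * (wedgeL i * X) = 0 := by
  rw [← mul_assoc, wedgeL_self, zero_mul]

theorem contractL_swap {i j : Fin 4} (_ : j < i) :
    contractL i * contractL j = -(contractL j * contractL i) :=
  contractL_mul i j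

theorem contractL_self (i : Fin 4) : contractL i * contractL i = 0 := by
  have h := contractL_mul i i
  have : (2 : ℂ) • (contractL i * contractL i) = 0 := by
    rw [two_smul, ← neg_eq_iff_add_eq_zero, ← h]
  simpa using this

theorem contractL_wedgeL_ne {i j : Fin 4} (h : i ≠ j) :
    contractL i * wedgeL j = -(wedgeL j * contractL i) := by
  rw [contractL_wedgeL, if_neg h, zero_sub]

theorem contractL_wedgeL_ne_assoc {i j : Fin 4} (h : i ≠ j) :
    contractL i * (wedgeL j * X) = -(wedgeL j * (contractL i * X)) := by
  rw [← mul_assoc, contractL_wedgeL_ne h, form_neg_mul, mul_assoc]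

theorem contractL_wedgeL_self (i : Fin 4) :
    contractL i * wedgeL i = 1 - wedgeL i * contractL i := by
  rw [contractL_wedgeL, if_pos rfl]

theorem contractL_wedgeL_self_assoc (i : Fin 4) :
    contractL i * (wedgeL i * X) = X - wedgeL i * (contractL i * X) := by
  rw [← mul_assoc, contractL_wedgeL_self, form_sub_mul, one_mul, mul_assoc]

end ExteriorRules

theorem fin4_cases (i : Fin 4) : i = 0 ∨ i = 1 ∨ i = 2 ∨ i = 3 := by
  fin_cases i <;> simp

/-! ### Shears and the flip: comparing spinors of the two frames -/

/-- `1 + θ ∧ ι_2` with `θ = s dx¹ + t dx³`: pull-back along a shear. -/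
def shear (s t : ℂ) : Module.End ℂ Form :=
  1 + (s • wedgeL 1 + t • wedgeL 3) * contractL 2

/-- As θ involves neither dx² nor its contraction, products of two operators θ ∧ ι_2 vanish. -/
theorem shear_mul (s t s' t' : ℂ) : shear s t * shear s' t' = shear (s + s') (t + t') := by
  simp only [shear, mul_add, add_mul, smul_mul_assoc, mul_smul_comm, mul_assoc, mul_one, one_mul,
    contractL_wedgeL_ne_assoc _ (show (2 : Fin 4) ≠ 1 by decide),
    contractL_wedgeL_ne_assoc _ (show (2 : Fin 4) ≠ 3 by decide), contractL_self, mul_zero,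
    neg_zero, smul_zero]
  module

theorem shear_zero : shear 0 0 = 1 := by simp [shear]

theorem shear_injective (s t : ℂ) : Function.Injective (shear s t) := fun φ ψ h => by
  have := congrArg (shear (-s) (-t)) h
  rwa [← Module.End.mul_apply, ← Module.End.mul_apply, shear_mul, neg_add_cancel, neg_add_cancel,
    shear_zero] at this

theorem wedgeL_shear (s t : ℂ) {i : Fin 4} (hi : i ≠ 2) :
    wedgeL i * shear s t = shear s t * wedgeL i := by
  simp only [shear, mul_add, add_mul, smul_mul_assoc, mul_smul_comm, mul_assoc, mul_one, one_mul,
    contractL_wedgeL_ne hi.symm, form_mul_neg]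
  rw [← mul_assoc (wedgeL i), wedgeL_mul i 1, ← mul_assoc (wedgeL i), wedgeL_mul i 3, form_neg_mul, form_neg_mul,
    mul_assoc, mul_assoc]

theorem wedgeL_two_shear (s t : ℂ) :
    (wedgeL 2 + (s • wedgeL 1 + t • wedgeL 3)) * shear s t = shear s t * wedgeL 2 := by
  simp (discharger := decide) only [shear, mul_add, add_mul, smul_mul_assoc, mul_smul_comm, mul_assoc,
    mul_one, one_mul, contractL_wedgeL_self, wedgeL_swap_assoc, wedgeL_self_assoc, form_mul_sub,
    form_neg_mul, form_mul_neg]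
  module

theorem contractL_shear (s t : ℂ) (i : Fin 4) : contractL i * shear s t = shear s t *
    (contractL i + (if i = 1 then s else if i = 3 then t else 0) • contractL 2) := by
  obtain rfl | rfl | rfl | rfl := fin4_cases i <;>
  · simp (discharger := decide) [shear, mul_add, add_mul, mul_assoc, contractL_wedgeL_self_assoc,
      contractL_wedgeL_ne_assoc, contractL_self, contractL_swap, form_mul_sub, form_mul_neg]
    try module

/-- The action on spinors of the exchange of `∂_2` and `dx²`. -/
def flipTwo : Module.End ℂ Form := contractL 2 + wedgeL 2

theorem flip_flip : flipTwo * flipTwo = 1 := by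
  simp only [flipTwo, mul_add, add_mul, contractL_wedgeL_self, contractL_self, wedgeL_self]
  abel

theorem wedgeL_flip {i : Fin 4} (hi : i ≠ 2) : wedgeL i * flipTwo = -(flipTwo * wedgeL i) := by
  rw [flipTwo, mul_add, add_mul, contractL_wedgeL_ne hi.symm, wedgeL_mul i 2]
  abel

theorem contractL_flip {i : Fin 4} (hi : i ≠ 2) : contractL i * flipTwo = -(flipTwo * contractL i) := by
  rw [flipTwo, mul_add, add_mul, contractL_wedgeL_ne hi, contractL_mul i 2]
  abel

theorem contractL_two_flip : contractL 2 * flipTwo = flipTwo * wedgeL 2 := by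
  rw [flipTwo, mul_add, add_mul, contractL_self, wedgeL_self, zero_add, add_zero]

theorem wedgeL_two_flip : wedgeL 2 * flipTwo = flipTwo * contractL 2 := by
  rw [flipTwo, mul_add, add_mul, contractL_self, wedgeL_self, zero_add, add_zero]

/-! ## The geometry of the nilmanifold -/

/-- The Jacobian of left translation by `g`. -/
def jacN (g : R4) : Matrix (Fin 4) (Fin 4) ℝ :=
  !![1, 0, 0, 0; 0, 1, 0, 0; 0, -(g 3) / 2, 1, g 1 / 2; 0, 0, 0, 1]

/-- In these coordinates left translation is affine, so the Jacobian does not depend on the point.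
-/
theorem jac_targetN (g p : R4) : targetN.jac g p = jacN g := by
  have h : targetN.mul g = fun q => kmul g 0 + (Matrix.toLin' (jacN g)).toContinuousLinearMap q := by
    funext q i
    obtain rfl | rfl | rfl | rfl := fin4_cases i <;>
      simp [targetN, kmul, jacN, Matrix.mulVec, dotProduct, Fin.sum_univ_four]
    ring
  ext i j
  rw [Target.jac, Matrix.of_apply, h, fderiv_const_add, ContinuousLinearMap.fderiv]
  simp

theorem jacN_mul_neg (g : R4) : jacN g * jacN (-g) = 1 := by
  ext i j
  obtain rfl | rfl | rfl | rfl := fin4_cases i <;> obtain rfl | rfl | rfl | rfl := fin4_cases j <;>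
    simp [jacN, Matrix.mul_apply, Fin.sum_univ_four, neg_div]

theorem push_frameN (g p : R4) : targetN.push g p * frameN p = frameN (kmul g p) := by
  rw [Target.push, jac_targetN, Matrix.inv_eq_right_inv (jacN_mul_neg g)]
  ext i j
  rcases i with i | i <;> rcases j with j | j <;> obtain rfl | rfl | rfl | rfl := fin4_cases i <;>
    obtain rfl | rfl | rfl | rfl := fin4_cases j <;>
    simp [jacN, frameN, kmul, Matrix.mul_apply, Fin.sum_univ_four, neg_div] <;> ring

theorem pullForm_jacN (g : R4) (φ : Form) :
    pullForm (jacN g) φ = shear (-(g 3 : ℂ) / 2) ((g 1 : ℂ) / 2) φ := by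
  refine pullForm_eq _ _ ?_ (fun i φ => ?_) φ
  · have : contractL 2 (Pi.single ∅ 1) = 0 := by
      funext I
      change contract 2 (Pi.single ∅ 1) I = 0
      rw [contract]
      split_ifs
      · rfl
      · rw [Pi.single_eq_of_ne (Finset.insert_ne_empty _ _), mul_zero]
    simp [shear, this]
  · rw [← Module.End.mul_apply]
    by_cases hi : i = 2
    · subst hi
      rw [← wedgeL_two_shear]
      have h : (-g 3 / 2 : ℝ) = (-(g 3 : ℂ) / 2) ∧ (g 1 / 2 : ℝ) = (g 1 : ℂ) / 2 := by
        push_cast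
        exact ⟨rfl, rfl⟩
      simp only [Fin.sum_univ_four, jacN, Matrix.of_apply, Matrix.cons_val, h.1, h.2, LinearMap.add_apply,
        Module.End.mul_apply, LinearMap.smul_apply]
      simp only [Complex.ofReal_zero, Complex.ofReal_one, zero_smul, one_smul]
      abel
    · rw [← wedgeL_shear _ _ hi]
      obtain rfl | rfl | rfl | rfl := fin4_cases i
      · simp [Fin.sum_univ_four, jacN]
      · simp [Fin.sum_univ_four, jacN]
      · exact absurd rfl hi
      · simp [Fin.sum_univ_four, jacN]

/-! ## Equivariant generalized Calabi-Yau structures in a frame -/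

theorem pd_apply {s : R4 → GC} {p : R4} (hs : DifferentiableAt ℝ s p) (i : Fin 4) (a : Ix) :
    pd i (fun q => s q a) p = pd i s p a := by
  rw [pd, pd, fderiv_apply hs]
  rfl

theorem contDiff_mulVec {B : R4 → Matrix Ix Ix ℂ} {τ : R4 → GC}
    (hB : ∀ a b, ContDiff ℝ ∞ fun q => B q a b) (hτ : ContDiff ℝ ∞ τ) :
    ContDiff ℝ ∞ fun q => B q *ᵥ τ q := by
  have : (fun q => B q *ᵥ τ q) = fun q a => ∑ b, B q a b * τ q b := rfl
  rw [this, contDiff_pi]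
  exact fun a => ContDiff.sum fun b _ => (hB a b).mul (contDiff_pi.1 hτ b)

theorem dorfman_eq (h : ℝ) {s t : R4 → GC} {p : R4} (hs : DifferentiableAt ℝ s p)
    (ht : DifferentiableAt ℝ t p) : dorfman h s t p
      = ∑ i, (s p (.inl i) • pd i t p - t p (.inl i) • pd i s p)
        + Sum.elim (fun _ => 0) (fun j => pairing (t p) (pd j s p)
          + h * ∑ a, ∑ b, (eps a b j : ℂ) * s p (.inl a) * t p (.inl b)) := by
  funext x
  rcases x with j | j
  · simp only [dorfman, Sum.elim_inl, pd_apply hs, pd_apply ht, Pi.add_apply, Finset.sum_apply,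
      Pi.sub_apply, Pi.smul_apply, smul_eq_mul, add_zero]
  · simp only [dorfman, Sum.elim_inr, pd_apply hs, pd_apply ht, Pi.add_apply, Finset.sum_apply,
      Pi.sub_apply, Pi.smul_apply, smul_eq_mul, pairing, ← add_assoc, ← Finset.sum_add_distrib,
      ← Finset.sum_sub_distrib]
    congr 1
    exact Finset.sum_congr rfl fun i _ => by ring

/-- A frame of `T ⊕ T^*` that is left-invariant, orthogonal and has the brackets of `g ⊕ t²`,
together with an identification `S` of the left-invariant forms with spinors. -/
structure IsModel (M : Target) (S : R4 → Form → Form) : Prop where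
  ortho : IsOrthoFrame M
  mul_zero : ∀ p, M.mul p 0 = p
  push : ∀ g p, M.push g p * M.frame p = M.frame (M.mul g p)
  smooth : ∀ a b, ContDiff ℝ ∞ fun p => M.frame p a b
  bracket : ∀ u v p, dorfman M.flux (fun q => cplx (M.frame q) *ᵥ u) (fun q => cplx (M.frame q) *ᵥ v) p
    = cplx (M.frame p) *ᵥ br u v
  spinor_smooth : ∀ φ, ContDiff ℝ ∞ fun p => S p φ
  spinor_ne : ∀ φ p, φ ≠ 0 → S p φ ≠ 0
  spinor_clifford : ∀ v φ p, clifford (cplx (M.frame p) *ᵥ v) (S p φ) = 0 ↔ clifford v φ = 0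
  spinor_equivariant : ∀ g p φ, pullForm (M.jac g p) (S (M.mul g p) φ) = S p φ
  spinor_exists : ∀ ρ : R4 → Form, (∀ g p, pullForm (M.jac g p) (ρ (M.mul g p)) = ρ p) →
    ∃ φ, ρ = fun p => S p φ
  spinor_closed : ∀ φ, (∀ p, twistedD M.flux (fun q => S q φ) p = 0) ↔
    wedge 1 (wedge 2 (wedge 3 φ)) = 0

/-- The conditions on the matrix in the frame of an equivariant generalized Calabi-Yau structure. -/
structure IsFrameCY (A : Matrix Ix Ix ℝ) : Prop extends IsFrameGC A where
  spinor : ∃ φ : Form, φ ≠ 0 ∧ (∀ v, cplx A *ᵥ v = Complex.I • v → clifford v φ = 0) ∧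
    wedge 1 (wedge 2 (wedge 3 φ)) = 0

namespace IsModel

variable {M : Target} {S : R4 → Form → Form} (hM : IsModel M S)
include hM

theorem contDiff_frame_mulVec {σ : R4 → GC} (hσ : ContDiff ℝ ∞ σ) :
    ContDiff ℝ ∞ fun q => cplx (M.frame q) *ᵥ σ q :=
  contDiff_mulVec (fun a b => Complex.ofRealCLM.contDiff.comp (hM.smooth a b)) hσ

theorem contDiff_frameInv_mulVec {σ : R4 → GC} (hσ : ContDiff ℝ ∞ σ) :
    ContDiff ℝ ∞ fun q => cplx (M.frameInv q) *ᵥ σ q := by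
  have : (fun q => cplx (M.frameInv q) *ᵥ σ q) = fun q => cplx (Matrix.fromBlocks 0 1 1 0) *ᵥ
      ((cplx (M.frame q))ᵀ *ᵥ (cplx (Matrix.fromBlocks 0 1 1 0) *ᵥ σ q)) := by
    funext q
    rw [Target.frameInv, cplx_mul, cplx_mul, Matrix.mulVec_mulVec, Matrix.mulVec_mulVec]
    rfl
  rw [this]
  exact contDiff_mulVec (fun _ _ => contDiff_const) <| contDiff_mulVec
    (fun a b => Complex.ofRealCLM.contDiff.comp (hM.smooth b a)) <|
    contDiff_mulVec (fun _ _ => contDiff_const) hσ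

theorem pd_frame_mulVec {σ : R4 → GC} (hσ : ContDiff ℝ ∞ σ) (i : Fin 4) (p : R4) :
    pd i (fun q => cplx (M.frame q) *ᵥ σ q) p
      = pd i (fun q => cplx (M.frame q) *ᵥ σ p) p + cplx (M.frame p) *ᵥ pd i σ p := by
  have hd : ∀ {f : R4 → GC}, ContDiff ℝ ∞ f → DifferentiableAt ℝ f p := fun hf =>
    (hf.differentiable (by simp)).differentiableAt
  have hF : ∀ a b, DifferentiableAt ℝ (fun q => (M.frame q a b : ℂ)) p := fun a b =>
    ((Complex.ofRealCLM.contDiff.comp (hM.smooth a b)).differentiable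
      (by simp)).differentiableAt
  have hσ' := differentiableAt_pi.1 (hd hσ)
  funext a
  rw [Pi.add_apply, ← pd_apply (hd (hM.contDiff_frame_mulVec hσ)),
    ← pd_apply (hd (hM.contDiff_frame_mulVec contDiff_const))]
  simp only [Matrix.mulVec, dotProduct, cplx, Matrix.map_apply, pd]
  rw [fderiv_fun_sum fun b _ => (hF a b).fun_mul (hσ' b),
    fderiv_fun_sum fun b _ => (hF a b).mul_const _]
  simp only [FunLike.coe_sum, Finset.sum_apply, ← Finset.sum_add_distrib]
  refine Finset.sum_congr rfl fun b _ => ?_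
  rw [fderiv_fun_mul (hF a b) (hσ' b), fderiv_mul_const (hF a b)]
  have := pd_apply (hd hσ) i b
  rw [pd, pd] at this
  rw [← this]
  simp only [add_apply, smul_apply, smul_eq_mul]
  ring

theorem pairing_frame (p : R4) (u v : GC) :
    pairing (cplx (M.frame p) *ᵥ u) (cplx (M.frame p) *ᵥ v) = pairing u v := by
  rw [pairing_eq_dotProduct, pairing_eq_dotProduct, ← Matrix.vecMul_transpose, Matrix.mulVec_mulVec,
    Matrix.dotProduct_mulVec, Matrix.vecMul_vecMul, ← mul_assoc, ← cplx_transpose, ← cplx_mul,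
    ← cplx_mul, hM.ortho, Matrix.dotProduct_mulVec]

/-- The Dorfman bracket is not a derivation in its first argument: the defect is the 1-form with
components `pairing (τ p) (pd j σ p)`. When it vanishes, what remains is the algebraic bracket and
derivatives of the coefficients. -/
theorem dorfman_frame {σ τ : R4 → GC} (hσ : ContDiff ℝ ∞ σ) (hτ : ContDiff ℝ ∞ τ) (p : R4)
    (h0 : ∀ j, pairing (τ p) (pd j σ p) = 0) :
    dorfman M.flux (fun q => cplx (M.frame q) *ᵥ σ q) (fun q => cplx (M.frame q) *ᵥ τ q) p
      = cplx (M.frame p) *ᵥ (br (σ p) (τ p)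
        + ∑ i, ((cplx (M.frame p) *ᵥ σ p) (.inl i) • pd i τ p
          - (cplx (M.frame p) *ᵥ τ p) (.inl i) • pd i σ p)) := by
  have hd : ∀ {f : R4 → GC}, ContDiff ℝ ∞ f →
      DifferentiableAt ℝ (fun q => cplx (M.frame q) *ᵥ f q) p := fun hf =>
    ((hM.contDiff_frame_mulVec hf).differentiable (by simp)).differentiableAt
  have hb := hM.bracket (σ p) (τ p) p
  rw [dorfman_eq _ (hd contDiff_const) (hd contDiff_const)] at hb
  rw [dorfman_eq _ (hd hσ) (hd hτ), Matrix.mulVec_add, ← hb]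
  simp only [hM.pd_frame_mulVec hσ, hM.pd_frame_mulVec hτ, pairing_add_right, hM.pairing_frame, h0,
    add_zero, Matrix.mulVec_sum, Matrix.mulVec_sub, Matrix.mulVec_smul, smul_add, Finset.sum_sub_distrib,
    Finset.sum_add_distrib]
  abel

/-- Translating from the identity 0 to `p` carries frame to frame and 𝒥 to 𝒥, so the matrix at `p`
is that at 0. -/
theorem exists_frameMatrix {𝒥 : R4 → Matrix Ix Ix ℝ}
    (h : ∀ g p, 𝒥 (M.mul g p) * M.push g p = M.push g p * 𝒥 p) :
    HasFrameMatrix M 𝒥 (M.frameInv 0 * 𝒥 0 * M.frame 0) := fun p => by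
  have h1 := h p 0
  have h2 := hM.push p 0
  rw [hM.mul_zero] at h1 h2
  calc 𝒥 p * M.frame p = M.push p 0 * 𝒥 0 * M.frame 0 := by rw [← h2, ← mul_assoc, h1]
    _ = M.push p 0 * (M.frame 0 * M.frameInv 0) * 𝒥 0 * M.frame 0 := by
        rw [hM.ortho.mul_inv, mul_one]
    _ = _ := by rw [← h2]; simp only [mul_assoc]

theorem eq_of_hasFrameMatrix {𝒥 : R4 → Matrix Ix Ix ℝ} {A : Matrix Ix Ix ℝ}
    (h : HasFrameMatrix M 𝒥 A) : 𝒥 = fun p => M.frame p * A * M.frameInv p := by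
  funext p
  rw [← h p, mul_assoc, hM.ortho.mul_inv, mul_one]

theorem hasFrameMatrix_iff {𝒥 : R4 → Matrix Ix Ix ℝ} {A B : Matrix Ix Ix ℝ}
    (h : HasFrameMatrix M 𝒥 A) : HasFrameMatrix M 𝒥 B ↔ B = A := by
  refine ⟨fun h' => ?_, fun hB => hB ▸ h⟩
  have := (h 0).symm.trans (h' 0)
  have := congrArg (M.frameInv 0 * ·) this
  simpa only [← mul_assoc, hM.ortho.inv_mul, one_mul, eq_comm] using this

theorem frame_inv_mulVec (p : R4) (v : GC) :
    cplx (M.frame p) *ᵥ (cplx (M.frameInv p) *ᵥ v) = v := by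
  rw [Matrix.mulVec_mulVec, ← cplx_mul, hM.ortho.mul_inv, cplx_one, Matrix.one_mulVec]

variable {𝒥 : R4 → Matrix Ix Ix ℝ} {A : Matrix Ix Ix ℝ} (h : HasFrameMatrix M 𝒥 A)
include h

theorem eigen_iff (p : R4) (v : GC) : cplx (𝒥 p) *ᵥ (cplx (M.frame p) *ᵥ v)
    = Complex.I • (cplx (M.frame p) *ᵥ v) ↔ cplx A *ᵥ v = Complex.I • v := by
  rw [h.mulVec, ← Matrix.mulVec_smul]
  exact ⟨fun h' => hM.ortho.mulVec_injective p h', fun h' => by rw [h']⟩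

theorem isFrameGC (hJ : IsEquivariantGC M 𝒥) : IsFrameGC A where
  sq := by
    have h1 := hJ.sq 0
    rw [hM.eq_of_hasFrameMatrix h] at h1
    have h2 := hM.ortho.inv_mul 0
    calc A * A = (M.frameInv 0 * M.frame 0) * A * (M.frameInv 0 * M.frame 0) * A
          * (M.frameInv 0 * M.frame 0) := by rw [h2]; simp
      _ = M.frameInv 0 * (M.frame 0 * A * M.frameInv 0 * (M.frame 0 * A * M.frameInv 0))
          * M.frame 0 := by simp only [mul_assoc]
      _ = -1 := by rw [h1]; simp [h2]
  orthogonal := by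
    have h1 := hJ.orthogonal 0
    have h2 : M.frame 0 * A = 𝒥 0 * M.frame 0 := (h 0).symm
    calc Aᵀ * Matrix.fromBlocks 0 1 1 0 * A
        = Aᵀ * ((M.frame 0)ᵀ * Matrix.fromBlocks 0 1 1 0 * M.frame 0) * A := by rw [hM.ortho]
      _ = (M.frame 0 * A)ᵀ * Matrix.fromBlocks 0 1 1 0 * (M.frame 0 * A) := by
          rw [Matrix.transpose_mul]; simp only [mul_assoc]
      _ = (M.frame 0)ᵀ * ((𝒥 0)ᵀ * Matrix.fromBlocks 0 1 1 0 * 𝒥 0) * M.frame 0 := by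
          rw [h2, Matrix.transpose_mul]; simp only [mul_assoc]
      _ = _ := by rw [h1, hM.ortho]
  closed u v hu hv := by
    have := hJ.integrable _ _ (hM.contDiff_frame_mulVec (contDiff_const (c := u)))
      (hM.contDiff_frame_mulVec (contDiff_const (c := v))) (fun p => (hM.eigen_iff h p u).2 hu)
      (fun p => (hM.eigen_iff h p v).2 hv) 0
    rw [hM.bracket] at this
    exact (hM.eigen_iff h 0 _).1 this

/-- For involutivity, a section of the eigenbundle has coefficients in a fixed eigenspace, and so do
its derivatives. That eigenspace is isotropic, which removes the defect in `dorfman_frame`, and it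
is a subalgebra. -/
theorem isEquivariantGC (hA : IsFrameGC A) : IsEquivariantGC M 𝒥 where
  sq p := by
    rw [hM.eq_of_hasFrameMatrix h]
    calc M.frame p * A * M.frameInv p * (M.frame p * A * M.frameInv p)
        = M.frame p * (A * (M.frameInv p * M.frame p) * A) * M.frameInv p := by simp only [mul_assoc]
      _ = -1 := by rw [hM.ortho.inv_mul, mul_one, hA.sq]; simp [hM.ortho.mul_inv]
  orthogonal p := by
    have h2 : 𝒥 p = M.frame p * A * M.frameInv p := by rw [hM.eq_of_hasFrameMatrix h]
    have h3 : (M.frameInv p)ᵀ * Matrix.fromBlocks 0 1 1 0 * M.frameInv p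
        = Matrix.fromBlocks 0 1 1 0 := by
      calc _ = (M.frameInv p)ᵀ * ((M.frame p)ᵀ * Matrix.fromBlocks 0 1 1 0 * M.frame p)
            * M.frameInv p := by rw [hM.ortho]
        _ = (M.frame p * M.frameInv p)ᵀ * Matrix.fromBlocks 0 1 1 0
            * (M.frame p * M.frameInv p) := by rw [Matrix.transpose_mul]; simp only [mul_assoc]
        _ = _ := by rw [hM.ortho.mul_inv]; simp
    calc _ = (M.frameInv p)ᵀ * (Aᵀ * ((M.frame p)ᵀ * Matrix.fromBlocks 0 1 1 0 * M.frame p) * A)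
          * M.frameInv p := by
          rw [h2, Matrix.transpose_mul, Matrix.transpose_mul]; simp only [mul_assoc]
      _ = _ := by rw [hM.ortho, hA.orthogonal, h3]
  equivariant g p := by
    have h1 := h p
    have h2 := h (M.mul g p)
    rw [← hM.push] at h2
    calc 𝒥 (M.mul g p) * M.push g p
        = 𝒥 (M.mul g p) * (M.push g p * M.frame p) * M.frameInv p := by
          simp only [mul_assoc]; rw [hM.ortho.mul_inv, mul_one]
      _ = M.push g p * (M.frame p * A) * M.frameInv p := by rw [h2, mul_assoc (M.push g p)]
      _ = M.push g p * 𝒥 p * (M.frame p * M.frameInv p) := by rw [← h1]; simp only [mul_assoc]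
      _ = _ := by rw [hM.ortho.mul_inv, mul_one]
  integrable s t hs ht hs' ht' p := by
    have hσ := hM.contDiff_frameInv_mulVec hs
    have hτ := hM.contDiff_frameInv_mulVec ht
    have hsq : s = fun q => cplx (M.frame q) *ᵥ (cplx (M.frameInv q) *ᵥ s q) :=
      funext fun q => (hM.frame_inv_mulVec q _).symm
    have htq : t = fun q => cplx (M.frame q) *ᵥ (cplx (M.frameInv q) *ᵥ t q) :=
      funext fun q => (hM.frame_inv_mulVec q _).symm
    have hσK : ∀ q, cplx A *ᵥ (cplx (M.frameInv q) *ᵥ s q)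
        = Complex.I • (cplx (M.frameInv q) *ᵥ s q) := fun q =>
      (hM.eigen_iff h q _).1 (by rw [hM.frame_inv_mulVec]; exact hs' q)
    have hτK : ∀ q, cplx A *ᵥ (cplx (M.frameInv q) *ᵥ t q)
        = Complex.I • (cplx (M.frameInv q) *ᵥ t q) := fun q =>
      (hM.eigen_iff h q _).1 (by rw [hM.frame_inv_mulVec]; exact ht' q)
    have hpd : ∀ {σ : R4 → GC}, ContDiff ℝ ∞ σ → (∀ q, cplx A *ᵥ σ q = Complex.I • σ q) →
        ∀ i, cplx A *ᵥ pd i σ p = Complex.I • pd i σ p := by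
      intro σ hσ hK i
      have hdiff : DifferentiableAt ℝ σ p := (hσ.differentiable (by simp)).differentiableAt
      let Lm : GC →L[ℝ] GC := ((cplx A).mulVecLin.restrictScalars ℝ).toContinuousLinearMap
      have e1 : fderiv ℝ (fun q => Lm (σ q)) p = Lm.comp (fderiv ℝ σ p) :=
        (Lm.hasFDerivAt.comp p hdiff.hasFDerivAt).fderiv
      have e2 : (fun q => Lm (σ q)) = fun q => Complex.I • σ q := funext hK
      rw [e2, fderiv_fun_const_smul hdiff] at e1
      exact (congrArg (fun T => T (Pi.single i 1)) e1).symm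
    rw [hsq, htq, hM.dorfman_frame hσ hτ p fun j => hA.pairing_isotropic
      (frameK_eq_neg_iff.2 (hτK p)) (frameK_eq_neg_iff.2 (hpd hσ hσK j)), hM.eigen_iff h,
      Matrix.mulVec_add, hA.closed _ _ (hσK p) (hτK p), smul_add, Matrix.mulVec_sum, Finset.smul_sum]
    congr 1
    refine Finset.sum_congr rfl fun i _ => ?_
    rw [Matrix.mulVec_sub, Matrix.mulVec_smul, Matrix.mulVec_smul, hpd hσ hσK, hpd hτ hτK, smul_sub,
      smul_comm Complex.I, smul_comm Complex.I]

theorem isFrameCY_iff : IsEquivariantGCY M 𝒥 ↔ IsFrameCY A := by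
  constructor
  · intro hJ
    refine ⟨hM.isFrameGC h hJ.toIsEquivariantGC, ?_⟩
    obtain ⟨ρ, _, h2, h3, h4, h5⟩ := hJ.spinor
    obtain ⟨φ, rfl⟩ := hM.spinor_exists ρ h4
    refine ⟨φ, ?_, fun v hv => ?_, (hM.spinor_closed φ).1 h5⟩
    · rintro rfl
      -- `S` is not assumed linear. The zero form is invariant, so it comes from some ψ, and ψ must
      -- be 0 because non-zero spinors give nowhere vanishing forms; thus `S 0 0 = 0`.
      obtain ⟨ψ, hψ⟩ := hM.spinor_exists 0 fun g p => by simp [pullForm]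
      have hz : (0 : Form) = S 0 ψ := congrFun hψ 0
      by_cases h0 : ψ = 0
      · subst h0
        exact h2 0 hz.symm
      · exact hM.spinor_ne ψ 0 h0 hz.symm
    · exact (hM.spinor_clifford v φ 0).1 (h3 0 _ ((hM.eigen_iff h 0 v).2 hv))
  · rintro ⟨hA, φ, h1, h2, h3⟩
    refine ⟨hM.isEquivariantGC h hA, fun p => S p φ, hM.spinor_smooth φ, fun p => hM.spinor_ne φ p h1,
      fun p v hv => ?_, fun g p => hM.spinor_equivariant g p φ, (hM.spinor_closed φ).2 h3⟩
    have hv' := hM.frame_inv_mulVec p v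
    rw [← hv'] at hv ⊢
    exact (hM.spinor_clifford _ φ p).2 (h2 _ ((hM.eigen_iff h p _).1 hv))

end IsModel

/-! ## The two targets -/

theorem pd_affine {F : Type*} [NormedAddCommGroup F] [NormedSpace ℂ F] (c a b : F) (i : Fin 4)
    (p : R4) : pd i (fun q : R4 => c + ((q 1 : ℂ) • a + (q 3 : ℂ) • b)) p
      = (if i = 1 then a else 0) + if i = 3 then b else 0 := by
  let L : R4 →L[ℝ] F :=
    (Complex.ofRealCLM.comp (ContinuousLinearMap.proj (R := ℝ) (φ := fun _ : Fin 4 => ℝ) 1)).smulRight a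
    + (Complex.ofRealCLM.comp (ContinuousLinearMap.proj (R := ℝ) (φ := fun _ : Fin 4 => ℝ) 3)).smulRight b
  have hL : (fun q : R4 => c + ((q 1 : ℂ) • a + (q 3 : ℂ) • b)) = fun q => c + L q := rfl
  rw [hL, pd, fderiv_const_add, ContinuousLinearMap.fderiv]
  change (((Pi.single i 1 : R4) 1 : ℝ) : ℂ) • a + (((Pi.single i 1 : R4) 3 : ℝ) : ℂ) • b = _
  simp only [Pi.single_apply, eq_comm (a := (1 : Fin 4)), eq_comm (a := (3 : Fin 4))]
  split_ifs <;> simp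

theorem jac_targetY (g p : R4) : targetY.jac g p = 1 := by
  ext i j
  have : targetY.mul g = fun q => g + ContinuousLinearMap.id ℝ R4 q := rfl
  rw [Target.jac, Matrix.of_apply, this, fderiv_const_add, ContinuousLinearMap.fderiv]
  simp [Pi.single_apply, Matrix.one_apply]

theorem isModel_Y : IsModel targetY fun _ φ => φ where
  ortho := isOrthoFrame_Y
  mul_zero p := by simp [targetY]
  push g p := by
    rw [Target.push, jac_targetY]
    simp [targetY]
  smooth a b := contDiff_const
  bracket u v p := by
    have hf : ∀ u : GC, (fun q => cplx (targetY.frame q) *ᵥ u) = fun _ => u := fun u => by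
      funext q
      simp [targetY, cplx_one]
    have hp : cplx (targetY.frame p) = 1 := cplx_one
    rw [hf, hf, dorfman_eq _ (differentiableAt_const _) (differentiableAt_const _), hp,
      Matrix.one_mulVec]
    have hz : ∀ (i : Fin 4) (w : GC), pd i (fun _ : R4 => w) p = 0 := fun i w => by simp [pd]
    funext x
    rcases x with x | x <;> simp [hz, br, targetY, pairing_comm v, pairing_zero_left]
  spinor_smooth φ := contDiff_const
  spinor_ne φ p h := h
  spinor_clifford v φ p := by
    rw [show cplx (targetY.frame p) = 1 from cplx_one, Matrix.one_mulVec]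
  spinor_equivariant g p φ := by
    rw [jac_targetY, pullForm_one]
  spinor_exists ρ hρ := by
    refine ⟨ρ 0, funext fun p => ?_⟩
    have := hρ (-p) p
    rw [jac_targetY, pullForm_one] at this
    rw [← this]
    simp [targetY]
  spinor_closed φ := by
    have hz : ∀ p : R4, twistedD targetY.flux (fun _ => φ) p = wedge 1 (wedge 2 (wedge 3 φ)) :=
      fun p => by
        have : ∀ i : Fin 4, wedge i (pd i (fun _ : R4 => φ) p) = 0 := fun i => by
          rw [show pd i (fun _ : R4 => φ) p = 0 by simp [pd]]
          exact map_zero (wedgeL i)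
        simp [twistedD, this, targetY]
    simp only [hz, forall_const]

theorem frameN_mulVec (y : R4) (u : GC) : cplx (frameN y) *ᵥ u
    = Sum.elim ![u (.inl 0), u (.inl 1), -u (.inr 2), u (.inl 3)]
        ![u (.inr 0), u (.inr 1), -u (.inl 2), u (.inr 3)]
      + ((y 1 : ℂ) • Sum.elim ![0, 0, u (.inl 3) / 2, 0] ![0, 0, 0, u (.inl 2) / 2]
      + (y 3 : ℂ) • Sum.elim ![0, 0, -u (.inl 1) / 2, 0] ![0, -u (.inl 2) / 2, 0, 0]) := by
  funext x
  rcases x with x | x <;> obtain rfl | rfl | rfl | rfl := fin4_cases x <;>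
    simp [Matrix.mulVec, dotProduct, frameN, cplx, Fin.sum_univ_four] <;> ring

theorem smooth_frameN (a b : Ix) : ContDiff ℝ ∞ fun p => frameN p a b := by
  rcases a with a | a <;> rcases b with b | b <;> obtain rfl | rfl | rfl | rfl := fin4_cases a <;>
    obtain rfl | rfl | rfl | rfl := fin4_cases b <;> simp [frameN] <;> fun_prop

/-- T-duality on the level of brackets: the structure constants that come from H on the torus come
here from the commutator of `∂_1 - y³∂_2/2` with `∂_3 + y¹∂_2/2` and from the differential of `β_2`.
-/
theorem bracket_N (u v : GC) (p : R4) : dorfman targetN.flux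
    (fun q => cplx (targetN.frame q) *ᵥ u) (fun q => cplx (targetN.frame q) *ᵥ v) p
      = cplx (targetN.frame p) *ᵥ br u v := by
  have hd : ∀ u : GC, DifferentiableAt ℝ (fun q => cplx (frameN q) *ᵥ u) p := fun u =>
    ((contDiff_mulVec (fun a b => Complex.ofRealCLM.contDiff.comp (smooth_frameN a b))
      contDiff_const).differentiable (by simp)).differentiableAt
  change dorfman 0 (fun q => cplx (frameN q) *ᵥ u) (fun q => cplx (frameN q) *ᵥ v) p
    = cplx (frameN p) *ᵥ br u v
  rw [dorfman_eq _ (hd u) (hd v)]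
  simp only [frameN_mulVec, pd_affine]
  funext x
  rcases x with x | x <;> obtain rfl | rfl | rfl | rfl := fin4_cases x <;>
    simp [Fin.sum_univ_four, pairing, br, eps] <;> ring

/-- The Clifford action, as a linear map. -/
def cliffordL (v : GC) : Module.End ℂ Form :=
  ∑ i, (v (.inl i) • contractL i + v (.inr i) • wedgeL i)

theorem cliffordL_apply (v : GC) (φ : Form) : cliffordL v φ = clifford v φ := by
  simp [cliffordL, clifford_eq]

/-- The shear is the pull-back along left translation by `-p`, which carries the frame at `p` to the
frame at 0. -/
theorem cliffordL_shear (p : R4) (v : GC) :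
    cliffordL (cplx (frameN p) *ᵥ v) * shear ((p 3 : ℂ) / 2) (-(p 1 : ℂ) / 2)
      = shear ((p 3 : ℂ) / 2) (-(p 1 : ℂ) / 2) * cliffordL (cplx (frameN 0) *ᵥ v) := by
  set s := (p 3 : ℂ) / 2 with hs
  set t := -(p 1 : ℂ) / 2 with ht
  have h2 : wedgeL 2 * shear s t
      = shear s t * wedgeL 2 - (s • (shear s t * wedgeL 1) + t • (shear s t * wedgeL 3)) := by
    rw [← wedgeL_two_shear, ← wedgeL_shear s t (by decide), ← wedgeL_shear s t (by decide), add_mul,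
      add_mul, smul_mul_assoc, smul_mul_assoc]
    abel
  have hp3 : (p 3 : ℂ) = 2 * s := by rw [hs]; ring
  have hp1 : (p 1 : ℂ) = -2 * t := by rw [ht]; ring
  simp only [cliffordL, Fin.sum_univ_four, frameN_mulVec, hp3, hp1, add_mul, mul_add, smul_mul_assoc,
    mul_smul_comm, contractL_shear, h2, wedgeL_shear s t (show (0 : Fin 4) ≠ 2 by decide),
    wedgeL_shear s t (show (1 : Fin 4) ≠ 2 by decide),
    wedgeL_shear s t (show (3 : Fin 4) ≠ 2 by decide)]
  simp
  module

/-- The overall sign is that of an odd operator; the minus signs in `β_2` and `α^2` make it the same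
for the exchanged pair as for the other basis vectors. -/
theorem cliffordL_flip (v : GC) :
    cliffordL (cplx (frameN 0) *ᵥ v) * flipTwo = -(flipTwo * cliffordL v) := by
  simp only [cliffordL, Fin.sum_univ_four, frameN_mulVec, add_mul, mul_add, smul_mul_assoc,
    mul_smul_comm, contractL_flip (show (0 : Fin 4) ≠ 2 by decide),
    contractL_flip (show (1 : Fin 4) ≠ 2 by decide), contractL_flip (show (3 : Fin 4) ≠ 2 by decide),
    wedgeL_flip (show (0 : Fin 4) ≠ 2 by decide), wedgeL_flip (show (1 : Fin 4) ≠ 2 by decide),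
    wedgeL_flip (show (3 : Fin 4) ≠ 2 by decide), contractL_two_flip, wedgeL_two_flip]
  simp
  module

theorem flip_injective : Function.Injective flipTwo := fun φ ψ h => by
  have := congrArg flipTwo h
  rwa [← Module.End.mul_apply, ← Module.End.mul_apply, flip_flip] at this

/-- The left-invariant form on `ℝ × Heis` corresponding to a spinor. -/
def spinorN (p : R4) (φ : Form) : Form := shear ((p 3 : ℂ) / 2) (-(p 1 : ℂ) / 2) (flipTwo φ)

theorem spinorN_eq (φ : Form) : (fun p => spinorN p φ)
    = fun p => flipTwo φ + ((p 1 : ℂ) • ((-1 / 2 : ℂ) • wedgeL 3 (contractL 2 (flipTwo φ)))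
      + (p 3 : ℂ) • ((1 / 2 : ℂ) • wedgeL 1 (contractL 2 (flipTwo φ)))) := by
  funext p
  simp only [spinorN, shear, LinearMap.add_apply, Module.End.mul_apply, LinearMap.smul_apply,
    Module.End.one_apply]
  module

/-- The invariant form is affine in y¹ and y³, so its differential is the constant form
-dx¹∧dx³∧ι_2(flipTwo φ). Since ι_2 ∘ flipTwo = ι_2 ∘ dx²∧, contraction with ∂_2 and multiplication
by dx² convert between this and H ∧ φ. -/
theorem closed_N (φ : Form) : (∀ p, twistedD targetN.flux (fun q => spinorN q φ) p = 0) ↔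
    wedge 1 (wedge 2 (wedge 3 φ)) = 0 := by
  have h1 : ∀ p, twistedD targetN.flux (fun q => spinorN q φ) p
      = -(wedgeL 1 * (wedgeL 3 * (contractL 2 * flipTwo))) φ := fun p => by
    have h0 : twistedD targetN.flux (fun q => spinorN q φ) p
        = ∑ i, wedgeL i (pd i (fun q => spinorN q φ) p) := by
      simp [twistedD, targetN]
      rfl
    rw [h0, spinorN_eq]
    simp only [pd_affine, Fin.sum_univ_four]
    have h31 : wedgeL 3 (wedgeL 1 (contractL 2 (flipTwo φ)))
        = -wedgeL 1 (wedgeL 3 (contractL 2 (flipTwo φ))) :=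
      LinearMap.congr_fun (wedgeL_mul 3 1) _
    simp
    rw [h31]
    module
  have h2 : wedge 1 (wedge 2 (wedge 3 φ)) = -(wedgeL 1 * (wedgeL 3 * wedgeL 2)) φ := by
    have : wedgeL 2 (wedgeL 3 φ) = -wedgeL 3 (wedgeL 2 φ) := LinearMap.congr_fun (wedgeL_mul 2 3) φ
    change wedgeL 1 (wedgeL 2 (wedgeL 3 φ)) = -wedgeL 1 (wedgeL 3 (wedgeL 2 φ))
    rw [this, map_neg]
  have h3 : contractL 2 * (wedgeL 1 * (wedgeL 3 * wedgeL 2))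
      = wedgeL 1 * (wedgeL 3 * (contractL 2 * flipTwo)) := by
    rw [contractL_two_flip, flipTwo, add_mul, wedgeL_self, add_zero]
    simp (discharger := decide) only [contractL_wedgeL_ne_assoc, form_mul_neg, neg_neg]
  have h4 : wedgeL 2 * (wedgeL 1 * (wedgeL 3 * (contractL 2 * flipTwo)))
      = wedgeL 1 * (wedgeL 3 * wedgeL 2) := by
    rw [contractL_two_flip, flipTwo, add_mul, wedgeL_self, add_zero]
    simp (discharger := decide) only [contractL_wedgeL_self, form_mul_sub, mul_one, wedgeL_swap,
      wedgeL_swap_assoc, form_mul_neg, neg_neg, wedgeL_self_assoc, mul_zero, sub_zero]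
  simp only [h1, h2, forall_const, neg_eq_zero]
  constructor
  · intro h
    rw [← h4, Module.End.mul_apply, h, map_zero]
  · intro h
    rw [← h3, Module.End.mul_apply, h, map_zero]

theorem isModel_N : IsModel targetN spinorN where
  ortho := isOrthoFrame_N
  mul_zero p := by
    funext i
    obtain rfl | rfl | rfl | rfl := fin4_cases i <;> simp [targetN, kmul]
  push := push_frameN
  smooth := smooth_frameN
  bracket := bracket_N
  spinor_smooth φ := by
    rw [spinorN_eq]
    refine contDiff_const.add (ContDiff.add ?_ ?_) <;>
      exact (Complex.ofRealCLM.contDiff.comp (contDiff_apply ℝ ℝ _)).smul contDiff_const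
  spinor_ne φ p h h' := h <| flip_injective <| shear_injective _ _ <| by
    rw [map_zero, map_zero]
    exact h'
  spinor_clifford v φ p := by
    have : clifford (cplx (frameN p) *ᵥ v) (spinorN p φ) = -spinorN p (clifford v φ) := by
      rw [← cliffordL_apply, spinorN, ← Module.End.mul_apply, cliffordL_shear, Module.End.mul_apply,
        ← Module.End.mul_apply _ flipTwo, cliffordL_flip, ← cliffordL_apply]
      simp [spinorN]
    change clifford (cplx (frameN p) *ᵥ v) (spinorN p φ) = 0 ↔ _
    rw [this, neg_eq_zero]
    constructor
    · intro h
      exact flip_injective <| shear_injective _ _ <| by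
        rw [map_zero, map_zero]
        exact h
    · intro h
      rw [h, spinorN, map_zero, map_zero]
  spinor_equivariant g p φ := by
    rw [jac_targetN, pullForm_jacN, spinorN, spinorN, ← Module.End.mul_apply, shear_mul]
    congr 3
    · simp [targetN, kmul]
      ring
    · simp [targetN, kmul]
      ring
  spinor_exists ρ hρ := by
    refine ⟨flipTwo (ρ 0), funext fun p => ?_⟩
    have h0 : targetN.mul (-p) p = 0 := by
      funext i
      obtain rfl | rfl | rfl | rfl := fin4_cases i <;> simp [targetN, kmul]
      ring
    have := hρ (-p) p
    rw [jac_targetN, pullForm_jacN, h0] at this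
    rw [← this, spinorN, ← Module.End.mul_apply flipTwo, flip_flip]
    simp
  spinor_closed := closed_N

/-- Structures with the same matrix in the frames of two targets. -/
def gcyEquiv {M M' : Target} {S S' : R4 → Form → Form} (hM : IsModel M S) (hM' : IsModel M' S') :
    GCY M ≃ GCY M' where
  toFun J := ⟨fun p => M'.frame p * (M.frameInv 0 * J.1 0 * M.frame 0) * M'.frameInv p,
    (hM'.isFrameCY_iff fun p => by rw [mul_assoc, hM'.ortho.inv_mul, mul_one]).2
      ((hM.isFrameCY_iff (hM.exists_frameMatrix J.2.equivariant)).1 J.2)⟩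
  invFun J := ⟨fun p => M.frame p * (M'.frameInv 0 * J.1 0 * M'.frame 0) * M.frameInv p,
    (hM.isFrameCY_iff fun p => by rw [mul_assoc, hM.ortho.inv_mul, mul_one]).2
      ((hM'.isFrameCY_iff (hM'.exists_frameMatrix J.2.equivariant)).1 J.2)⟩
  left_inv J := Subtype.ext <| by
    have h := hM.eq_of_hasFrameMatrix (hM.exists_frameMatrix J.2.equivariant)
    conv_rhs => rw [h]
    funext p
    have h' := hM'.ortho.inv_mul 0
    simp only [mul_assoc, h', mul_one]
    simp only [← mul_assoc, h', one_mul]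
  right_inv J := Subtype.ext <| by
    have h := hM'.eq_of_hasFrameMatrix (hM'.exists_frameMatrix J.2.equivariant)
    conv_rhs => rw [h]
    funext p
    have h' := hM.ortho.inv_mul 0
    simp only [mul_assoc, h', mul_one]
    simp only [← mul_assoc, h', one_mul]

theorem hasFrameMatrix_gcyEquiv {M M' : Target} {S S' : R4 → Form → Form} (hM : IsModel M S)
    (hM' : IsModel M' S') (J : GCY M) (A : Matrix Ix Ix ℝ) :
    HasFrameMatrix M J.1 A ↔ HasFrameMatrix M' (gcyEquiv hM hM' J).1 A := by
  have h' : HasFrameMatrix M' (gcyEquiv hM hM' J).1 (M.frameInv 0 * J.1 0 * M.frame 0) := fun p => by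
    change M'.frame p * (M.frameInv 0 * J.1 0 * M.frame 0) * M'.frameInv p * M'.frame p = _
    rw [mul_assoc, hM'.ortho.inv_mul, mul_one]
  rw [hM.hasFrameMatrix_iff (hM.exists_frameMatrix J.2.equivariant), hM'.hasFrameMatrix_iff h']

/-! ## Transport of the induced module -/

section Transport

variable {D D' : ZeroModeData} (t : ZeroModes D ≃ₗ[ℂ] ZeroModes D')
  (ht : ∀ u f, t (rho D u f) = rho D' u (t f))

/-- The isomorphism of the modules from which the induced modules are obtained as quotients. -/
def freeEquiv : (ModeAlg ⊗[ℂ] ZeroModes D) ≃ₗ[ModeAlg] (ModeAlg ⊗[ℂ] ZeroModes D') :=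
  TensorProduct.AlgebraTensorModule.congr (LinearEquiv.refl ModeAlg ModeAlg) t

theorem freeEquiv_tmul (a : ModeAlg) (f : ZeroModes D) : freeEquiv t (a ⊗ₜ f) = a ⊗ₜ t f := rfl

include ht in
theorem indRel_map {x : ModeAlg ⊗[ℂ] ZeroModes D} (hx : IndRel D x) : IndRel D' (freeEquiv t x) := by
  cases hx with
  | even_pos u n hn f => exact IndRel.even_pos u n hn (t f)
  | odd_pos u k hk f => exact IndRel.odd_pos u k hk (t f)
  | even_zero u f =>
    rw [map_sub, freeEquiv_tmul, freeEquiv_tmul, ht]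
    exact IndRel.even_zero u (t f)

include ht in
theorem indRel_image : freeEquiv t '' {x | IndRel D x} = {x | IndRel D' x} := by
  ext x
  constructor
  · rintro ⟨y, hy, rfl⟩
    exact indRel_map t ht hy
  · intro hx
    refine ⟨(freeEquiv t).symm x, ?_, (freeEquiv t).apply_symm_apply x⟩
    have h := indRel_map t.symm (fun u f => by rw [t.symm_apply_eq, ht, t.apply_symm_apply]) hx
    exact h

/-- The isomorphism of induced modules given by an isomorphism of zero modes. -/
def indEquiv : Ind D ≃ₗ[ModeAlg] Ind D' :=
  Submodule.Quotient.equiv _ _ (freeEquiv t) (by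
    rw [Submodule.map_span]
    congr 1
    exact indRel_image t ht)

theorem indEquiv_vac (f : ZeroModes D) : indEquiv t ht (vac D f) = vac D' (t f) := rfl

theorem indEquiv_smul (c : ℂ) (v : Ind D) : indEquiv t ht (c • v) = c • indEquiv t ht v := by
  rw [← algebraMap_smul ModeAlg c v, map_smul, algebraMap_smul]

/-- `indEquiv`, as a complex-linear map. -/
def indEquivC : Ind D ≃ₗ[ℂ] Ind D' :=
  { (indEquiv t ht) with map_smul' := indEquiv_smul t ht }

theorem indEquiv_parity {a : ZMod 2} {v : Ind D} (hv : v ∈ parityPart D a) :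
    indEquiv t ht v ∈ parityPart D' a := by
  induction hv using Submodule.span_induction with
  | mem v hv =>
    obtain ⟨l, f, hl, rfl⟩ := hv
    exact Submodule.subset_span ⟨l, t f, hl, by rw [map_smul, indEquiv_vac]⟩
  | zero => rw [map_zero]; exact Submodule.zero_mem _
  | add v w _ _ hv hw => rw [map_add]; exact Submodule.add_mem _ hv hw
  | smul c v _ hv => rw [indEquiv_smul]; exact Submodule.smul_mem _ _ hv

/-- The inverse is again induced from an isomorphism of zero modes, so statements about parity need
only be proved in one direction. -/
theorem indEquiv_symm (v : Ind D') : (indEquiv t ht).symm v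
    = indEquiv t.symm (fun u f => by rw [t.symm_apply_eq, ht, t.apply_symm_apply]) v := by
  rw [LinearEquiv.symm_apply_eq]
  induction v using ind_induction with
  | hvac f => rw [indEquiv_vac, indEquiv_vac, t.apply_symm_apply]
  | hadd v w hv hw => rw [map_add, map_add, ← hv, ← hw]
  | hsmul c v hv => rw [indEquiv_smul, indEquiv_smul, ← hv]
  | hmode x v hv => rw [map_smul, map_smul, ← hv]

theorem indEquiv_parity_iff (a : ZMod 2) (v : Ind D) :
    indEquiv t ht v ∈ parityPart D' a ↔ v ∈ parityPart D a := by
  refine ⟨fun h => ?_, indEquiv_parity t ht⟩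
  have := indEquiv_parity t.symm (fun u f => by rw [t.symm_apply_eq, ht, t.apply_symm_apply]) h
  rwa [← indEquiv_symm t ht, LinearEquiv.symm_apply_apply] at this

theorem indEquiv_pbw (x : Occ →₀ ZeroModes D) : indEquiv t ht (pbw D x)
    = pbw D' (Finsupp.mapRange.linearEquiv t x) := by
  induction x using Finsupp.induction_linear with
  | zero => simp
  | add x y hx hy => rw [map_add, map_add, map_add, map_add, hx, hy]
  | single s f =>
    rw [Finsupp.mapRange.linearEquiv_apply, Finsupp.mapRange_single]
    simp only [pbw, Finsupp.lsum_single]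
    change indEquiv t ht (s.monomial • vac D f) = s.monomial • vac D' (t f)
    rw [map_smul, indEquiv_vac]

include ht in
theorem pbw_bijective_iff : Function.Bijective (pbw D') ↔ Function.Bijective (pbw D) := by
  have h : (indEquiv t ht : Ind D → Ind D') ∘ pbw D
      = pbw D' ∘ (Finsupp.mapRange.linearEquiv t : (Occ →₀ ZeroModes D) ≃ₗ[ℂ] _) :=
    funext (indEquiv_pbw t ht)
  rw [← Function.Bijective.of_comp_iff (pbw D')
    (Finsupp.mapRange.linearEquiv t : (Occ →₀ ZeroModes D) ≃ₗ[ℂ] _).bijective, ← h,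
    Function.Bijective.of_comp_iff' (indEquiv t ht).bijective]

theorem pbwCoord_indEquiv (v : Ind D) : pbwCoord D' (indEquiv t ht v)
    = Finsupp.mapRange.linearEquiv t (pbwCoord D v) := by
  by_cases h : Function.Bijective (pbw D)
  · have h' := (pbw_bijective_iff t ht).2 h
    rw [pbwCoord, pbwCoord, dif_pos h, dif_pos h']
    change (LinearEquiv.ofBijective (pbw D') h').symm (indEquiv t ht v)
      = Finsupp.mapRange.linearEquiv t ((LinearEquiv.ofBijective (pbw D) h).symm v)
    rw [LinearEquiv.symm_apply_eq, LinearEquiv.ofBijective_apply, ← indEquiv_pbw t ht,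
      ← LinearEquiv.ofBijective_apply (hf := h), LinearEquiv.apply_symm_apply]
  -- If `pbw` were not bijective on one side it would not be on the other, and both coordinate maps
  -- would be zero by definition. The comparison thus does not depend on the Poincaré-Birkhoff-Witt
  -- theorem.
  · have h' := fun h' => h ((pbw_bijective_iff t ht).1 h')
    rw [pbwCoord, pbwCoord, dif_neg h, dif_neg h']
    simp

theorem lsum_lsingle_coe [DecidableEq Occ] (D : ZeroModeData) (x : Occ →₀ ZeroModes D) (s : Occ) :
    ((Finsupp.lsum ℂ fun s : Occ => ((Real.sqrt s.weight : ℝ) : ℂ) •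
      (lp.lsingle (E := fun _ : Occ => Lp ℂ 2 zmMeasure) (𝕜 := ℂ) 2 s ∘ₗ zmToLp D)) x : FockL2) s
      = ((Real.sqrt s.weight : ℝ) : ℂ) • zmToLp D (x s) := by
  induction x using Finsupp.induction_linear with
  | zero => simp
  | add x y hx hy =>
    rw [map_add, lp.coeFn_add, Pi.add_apply, hx, hy, Finsupp.add_apply, map_add, smul_add]
  | single r f =>
    rw [Finsupp.lsum_single, LinearMap.smul_apply, lp.coeFn_smul, Pi.smul_apply, LinearMap.comp_apply]
    change _ • (lp.single 2 r (zmToLp D f) : FockL2) s = _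
    by_cases h : s = r
    · subst h
      simp
    · rw [lp.single_apply_ne _ _ _ h, Finsupp.single_eq_of_ne h]
      simp

open Classical in
theorem toFock_coe (D : ZeroModeData) (v : Ind D) (s : Occ) :
    toFock D v s = ((Real.sqrt s.weight : ℝ) : ℂ) • zmToLp D (pbwCoord D v s) :=
  lsum_lsingle_coe D (pbwCoord D v) s

variable (hn : ∀ f, ‖zmToLp D' (t f)‖ = ‖zmToLp D f‖)

include hn in
theorem norm_toFock (v : Ind D) : ‖toFock D' (indEquiv t ht v)‖ = ‖toFock D v‖ := by
  rw [lp.norm_eq_tsum_rpow (by simp), lp.norm_eq_tsum_rpow (by simp)]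
  congr 2
  funext s
  rw [toFock_coe, toFock_coe, pbwCoord_indEquiv, norm_smul, norm_smul]
  simp only [Finsupp.mapRange.linearEquiv_apply, Finsupp.mapRange_apply]
  congr 2
  exact hn _

/-- The induced module as a dense subspace, with a complex-linear inclusion. -/
def toStateL (D : ZeroModeData) : Ind D →ₗ[ℂ] StateSpace D where
  toFun := toState D
  map_add' v w := Subtype.ext (map_add (toFock D) v w)
  map_smul' c v := Subtype.ext (map_smul (toFock D) c v)

theorem denseRange_toState (D : ZeroModeData) : DenseRange (toStateL D) := by
  intro x
  rw [closure_subtype]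
  have : (Subtype.val '' Set.range (toStateL D) : Set FockL2) = LinearMap.range (toFock D) := by
    rw [← Set.range_comp]
    rfl
  rw [this]
  exact x.2

/-- The unitary extension of the isomorphism of induced modules. -/
def stateEquiv : StateSpace D ≃ₗᵢ[ℂ] StateSpace D' :=
  (indEquivC t ht).extendOfIsometry (toStateL D) (toStateL D') (denseRange_toState D)
    (denseRange_toState D') (norm_toFock t ht hn)

theorem stateEquiv_toState (v : Ind D) :
    stateEquiv t ht hn (toState D v) = toState D' (indEquiv t ht v) :=
  LinearEquiv.extendOfIsometry_eq (indEquivC t ht) (toStateL D) (toStateL D') (denseRange_toState D)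
    (denseRange_toState D') (norm_toFock t ht hn) v

/-- Conjugation of an `N = 2` structure by a linear isomorphism. -/
def conjN2 {V W : Type*} [AddCommGroup V] [Module ℂ V] [AddCommGroup W] [Module ℂ W] {c : ℂ}
    (T : V ≃ₗ[ℂ] W) (S : N2Structure c V) : N2Structure c W where
  L n := T.conj (S.L n)
  J n := T.conj (S.J n)
  Gp n := T.conj (S.Gp n)
  Gm n := T.conj (S.Gm n)
  truncated w := by
    obtain ⟨M, hM⟩ := S.truncated (T.symm w)
    refine ⟨M, fun n hn => ?_⟩
    obtain ⟨h1, h2, h3, h4⟩ := hM n hn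
    simp [LinearEquiv.conj_apply_apply, h1, h2, h3, h4]
  LL m n := by
    simpa only [map_sub, map_add, map_neg, map_smul, map_zero, Module.End.mul_eq_comp,
      LinearEquiv.conj_comp, Module.End.one_eq_id, LinearEquiv.conj_id] using congrArg T.conj (S.LL m n)
  LJ m n := by
    simpa only [map_sub, map_add, map_neg, map_smul, map_zero, Module.End.mul_eq_comp,
      LinearEquiv.conj_comp, Module.End.one_eq_id, LinearEquiv.conj_id] using congrArg T.conj (S.LJ m n)
  LGp m n := by
    simpa only [map_sub, map_add, map_neg, map_smul, map_zero, Module.End.mul_eq_comp,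
      LinearEquiv.conj_comp, Module.End.one_eq_id, LinearEquiv.conj_id] using congrArg T.conj (S.LGp m n)
  LGm m n := by
    simpa only [map_sub, map_add, map_neg, map_smul, map_zero, Module.End.mul_eq_comp,
      LinearEquiv.conj_comp, Module.End.one_eq_id, LinearEquiv.conj_id] using congrArg T.conj (S.LGm m n)
  JJ m n := by
    simpa only [map_sub, map_add, map_neg, map_smul, map_zero, Module.End.mul_eq_comp,
      LinearEquiv.conj_comp, Module.End.one_eq_id, LinearEquiv.conj_id] using congrArg T.conj (S.JJ m n)
  JGp m n := by
    simpa only [map_sub, map_add, map_neg, map_smul, map_zero, Module.End.mul_eq_comp,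
      LinearEquiv.conj_comp, Module.End.one_eq_id, LinearEquiv.conj_id] using congrArg T.conj (S.JGp m n)
  JGm m n := by
    simpa only [map_sub, map_add, map_neg, map_smul, map_zero, Module.End.mul_eq_comp,
      LinearEquiv.conj_comp, Module.End.one_eq_id, LinearEquiv.conj_id] using congrArg T.conj (S.JGm m n)
  GpGp m n := by
    simpa only [map_sub, map_add, map_neg, map_smul, map_zero, Module.End.mul_eq_comp,
      LinearEquiv.conj_comp, Module.End.one_eq_id, LinearEquiv.conj_id] using congrArg T.conj (S.GpGp m n)
  GmGm m n := by
    simpa only [map_sub, map_add, map_neg, map_smul, map_zero, Module.End.mul_eq_comp,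
      LinearEquiv.conj_comp, Module.End.one_eq_id, LinearEquiv.conj_id] using congrArg T.conj (S.GmGm m n)
  GpGm m n := by
    simpa only [map_sub, map_add, map_neg, map_smul, map_zero, Module.End.mul_eq_comp,
      LinearEquiv.conj_comp, Module.End.one_eq_id, LinearEquiv.conj_id] using congrArg T.conj (S.GpGm m n)

end Transport

/-! ## Transport of the `N = 2` structures -/

section TransportN2

variable {D D' : ZeroModeData} (t : ZeroModes D ≃ₗ[ℂ] ZeroModes D')
  (ht : ∀ u f, t (rho D u f) = rho D' u (t f))

/-- An additive bijection commutes with `finsum` without any finiteness condition, so only linearity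
over the mode algebra matters. -/
theorem indEquiv_superJ (e e' : Fin 4 → GC) (n : ℤ) (v : Ind D) :
    indEquiv t ht (superJ e e' n v) = superJ e e' n (indEquiv t ht v) := by
  rw [superJ, superJ, map_sum]
  refine Finset.sum_congr rfl fun i _ => ?_
  have := (indEquiv t ht).toAddEquiv.map_finsum fun k : ℤ => if k < 0 then
    od (e' i) k • od (e i) (n - 1 - k) • v else -(od (e i) (n - 1 - k) • od (e' i) k • v)
  refine this.trans (finsum_congr fun k => ?_)
  change indEquiv t ht _ = _
  split_ifs
  · rw [map_smul, map_smul]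
  · rw [map_neg, map_smul, map_smul]

theorem indEquiv_superJodd (e e' : Fin 4 → GC) (k : ℤ) (v : Ind D) :
    indEquiv t ht (superJodd e e' k v) = superJodd e e' k (indEquiv t ht v) := by
  rw [superJodd, superJodd, map_sum]
  refine Finset.sum_congr rfl fun i _ => ?_
  rw [map_sub]
  have h1 := (indEquiv t ht).toAddEquiv.map_finsum fun m : ℤ => if m < 0 then
    ev (e' i) m • od (e i) (k - m) • v else od (e i) (k - m) • ev (e' i) m • v
  have h2 := (indEquiv t ht).toAddEquiv.map_finsum fun l : ℤ => if l < 0 then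
    od (e' i) l • ev (e i) (k - l) • v else ev (e i) (k - l) • od (e' i) l • v
  refine congrArg₂ (· - ·) (h1.trans (finsum_congr fun l => ?_)) (h2.trans (finsum_congr fun l => ?_))
  all_goals
    change indEquiv t ht _ = _
    split_ifs <;> rw [map_smul, map_smul]

theorem conjN2_generatedBy {S : N2Structure 12 (Ind D)} {e e' : Fin 4 → GC}
    (h : S.GeneratedBy e e') : (conjN2 (indEquivC t ht) S).GeneratedBy e e' := by
  have hv : ∀ v, indEquiv t ht ((indEquivC t ht).symm v) = v := fun v =>
    (indEquivC t ht).apply_symm_apply v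
  refine ⟨fun n v => ?_, fun k v => ?_⟩
  · change indEquiv t ht (S.J n ((indEquivC t ht).symm v)) = _
    rw [h.1, indEquiv_superJ, hv]
  · change indEquiv t ht (S.Gm k ((indEquivC t ht).symm v))
      - indEquiv t ht (S.Gp k ((indEquivC t ht).symm v)) = _
    rw [← map_sub, h.2, indEquiv_superJodd, hv]

theorem conjN2_isAttached {S : N2Structure 12 (Ind D)} {M M' : Target}
    {𝒥 𝒥' : R4 → Matrix Ix Ix ℝ} (hd : ∀ e e', IsDualBasis M 𝒥 e e' ↔ IsDualBasis M' 𝒥' e e')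
    (h : IsAttached M 𝒥 S) : IsAttached M' 𝒥' (conjN2 (indEquivC t ht) S) := by
  obtain ⟨⟨e, e', he⟩, h2⟩ := h
  exact ⟨⟨e, e', (hd e e').1 he⟩, fun f f' hf =>
    conjN2_generatedBy t ht (h2 f f' ((hd f f').2 hf))⟩

end TransportN2

/-- Polarization. -/
theorem inner_eq_of_norm_eq {V H H' : Type*} [AddCommGroup V] [Module ℂ V] [NormedAddCommGroup H]
    [InnerProductSpace ℂ H] [NormedAddCommGroup H'] [InnerProductSpace ℂ H'] (S : V →ₗ[ℂ] H)
    (S' : V →ₗ[ℂ] H') (h : ∀ v, ‖S' v‖ = ‖S v‖) (v w : V) :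
    inner ℂ (S' v) (S' w) = inner ℂ (S v) (S w) := by
  rw [inner_eq_sum_norm_sq_div_four, inner_eq_sum_norm_sq_div_four]
  simp only [← map_add, ← map_sub, ← map_smul, h]

/-! ## Fourier series of quasi-periodic functions -/

section FourierSeries

open Real Set

/-- `x ↦ exp (2π√-1 x)`. -/
def ee (x : ℝ) : ℂ := Complex.exp (2 * π * Complex.I * x)

theorem ee_add (x y : ℝ) : ee (x + y) = ee x * ee y := by
  rw [ee, ee, ee, ← Complex.exp_add]
  congr 1
  push_cast
  ring

theorem ee_zero : ee 0 = 1 := by simp [ee]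

theorem ee_int (k : ℤ) : ee k = 1 := by
  rw [ee, Complex.exp_eq_one_iff]
  exact ⟨k, by push_cast; ring⟩

theorem norm_ee (x : ℝ) : ‖ee x‖ = 1 := by
  rw [ee, show 2 * (π : ℂ) * Complex.I * x = ((2 * π * x : ℝ) : ℂ) * Complex.I by push_cast; ring,
    Complex.norm_exp_ofReal_mul_I]

theorem ee_neg_mul (x : ℝ) : ee (-x) * ee x = 1 := by
  rw [← ee_add, neg_add_cancel, ee_zero]

theorem hasDerivAt_ee (x : ℝ) : HasDerivAt ee (2 * π * Complex.I * ee x) x := by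
  have h : HasDerivAt (fun y : ℝ => 2 * (π : ℂ) * Complex.I * y) (2 * π * Complex.I * 1) x :=
    (Complex.ofRealCLM.hasDerivAt (x := x)).const_mul _
  rw [mul_one] at h
  rw [mul_comm]
  exact h.cexp

theorem continuous_ee : Continuous ee :=
  continuous_iff_continuousAt.2 fun x => (hasDerivAt_ee x).continuousAt

/-- The Fourier coefficients of a function with `h (s + 1) = ee α * h s`. -/
def coef (α : ℝ) (m : ℤ) (h : ℝ → ℂ) : ℂ := ∫ s in (0 : ℝ)..1, ee (-(s * (m + α))) * h s

theorem continuous_coef_integrand (α : ℝ) (m : ℤ) {h : ℝ → ℂ} (hh : Continuous h) :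
    Continuous fun s : ℝ => ee (-(s * (m + α))) * h s :=
  (continuous_ee.comp (by fun_prop)).mul hh

theorem norm_coef_le (α : ℝ) (m : ℤ) {h : ℝ → ℂ} {B : ℝ} (hB : ∀ s ∈ Icc (0 : ℝ) 1, ‖h s‖ ≤ B) :
    ‖coef α m h‖ ≤ B := by
  have := intervalIntegral.norm_integral_le_of_norm_le_const (a := (0 : ℝ)) (b := 1) (C := B)
    (f := fun s : ℝ => ee (-(s * (m + α))) * h s) fun s hs => by
      rw [uIoc_of_le zero_le_one] at hs
      rw [norm_mul, norm_ee, one_mul]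
      exact hB s ⟨hs.1.le, hs.2⟩
  simpa [coef] using this

theorem coef_add (α : ℝ) (m : ℤ) {h k : ℝ → ℂ} (hh : Continuous h) (hk : Continuous k) :
    coef α m (fun s => h s + k s) = coef α m h + coef α m k := by
  rw [coef, coef, coef, ← intervalIntegral.integral_add
    ((continuous_coef_integrand α m hh).intervalIntegrable _ _)
    ((continuous_coef_integrand α m hk).intervalIntegrable _ _)]
  simp only [mul_add]

theorem coef_const_mul (α : ℝ) (m : ℤ) (c : ℂ) (h : ℝ → ℂ) :
    coef α m (fun s => c * h s) = c * coef α m h := by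
  rw [coef, coef, ← intervalIntegral.integral_const_mul]
  simp only [mul_left_comm]

/-- Integration by parts. -/
theorem coef_deriv (α : ℝ) (m : ℤ) {h h' : ℝ → ℂ} (hd : ∀ s, HasDerivAt h (h' s) s)
    (hc : Continuous h') (hq : h 1 = ee α * h 0) :
    coef α m h' = 2 * π * Complex.I * (m + α) * coef α m h := by
  have hh : Continuous h := continuous_iff_continuousAt.2 fun s => (hd s).continuousAt
  have hE : ∀ s : ℝ, HasDerivAt (fun s : ℝ => ee (-(s * (m + α))))
      (-(2 * π * Complex.I * (m + α)) * ee (-(s * (m + α)))) s := fun s => by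
    have h1 : HasDerivAt (fun s : ℝ => -(s * (m + α))) (-(1 * (m + α))) s :=
      ((hasDerivAt_id s).mul_const _).neg
    have := (hasDerivAt_ee (-(s * (m + α)))).scomp s h1
    refine this.congr_deriv ?_
    rw [Complex.real_smul]
    push_cast
    ring
  have h1 := intervalIntegral.integral_eq_sub_of_hasDerivAt (a := (0 : ℝ)) (b := 1)
    (fun s _ => (hE s).mul (hd s)) (by
      refine Continuous.intervalIntegrable ?_ _ _
      exact ((continuous_const.mul (continuous_ee.comp (by fun_prop))).mul hh).add
        ((continuous_ee.comp (by fun_prop)).mul hc))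
  -- The quasi-period of `h` cancels the twist of the character, up to exp(-2π√-1 m) = 1, so there
  -- is no boundary term.
  have hz : ee (-(1 * (m + α))) * h 1 - ee (-(0 * (m + α))) * h 0 = 0 := by
    rw [hq, ← mul_assoc, ← ee_add, show -(1 * ((m : ℝ) + α)) + α = ((-m : ℤ) : ℝ) by push_cast; ring,
      ee_int, zero_mul, neg_zero, ee_zero, sub_self]
  have h2 : ∫ s in (0 : ℝ)..1, (-(2 * π * Complex.I * (m + α)) * (ee (-(s * (m + α))) * h s)
      + ee (-(s * (m + α))) * h' s) = 0 := by
    rw [← hz]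
    refine Eq.trans ?_ h1
    simp only [mul_assoc]
  rw [intervalIntegral.integral_add
    (((continuous_coef_integrand α m hh).const_mul _).intervalIntegrable _ _)
    ((continuous_coef_integrand α m hc).intervalIntegrable _ _),
    intervalIntegral.integral_const_mul] at h2
  rw [coef, coef]
  linear_combination h2

/-- The twist by α makes the integrand periodic, so its integral over a period may be started
anywhere. -/
theorem coef_shift (α : ℝ) (m : ℤ) {h : ℝ → ℂ} (hq : ∀ s, h (s + 1) = ee α * h s) (c : ℝ) :
    coef α m (fun s => h (s + c)) = ee (c * (m + α)) * coef α m h := by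
  let k : ℝ → ℂ := fun s => ee (-(s * (m + α))) * h s
  have hk : Function.Periodic k 1 := fun s => by
    simp only [k]
    rw [hq, ← mul_assoc, ← ee_add, show -((s + 1) * ((m : ℝ) + α)) + α
      = -(s * (m + α)) + ((-m : ℤ) : ℝ) by push_cast; ring, ee_add, ee_int, mul_one]
  have h1 : ∀ s : ℝ, ee (-(s * (m + α))) * h (s + c) = ee (c * (m + α)) * k (s + c) := fun s => by
    simp only [k]
    rw [← mul_assoc, ← ee_add]
    congr 2
    ring
  simp only [coef, h1, intervalIntegral.integral_const_mul]
  rw [intervalIntegral.integral_comp_add_right, zero_add, add_comm 1 c,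
    hk.intervalIntegral_add_eq c 0, zero_add]

theorem coef_eq_fourierCoeffOn (α : ℝ) (m : ℤ) (h : ℝ → ℂ) :
    coef α m h = fourierCoeffOn (zero_lt_one' ℝ) (fun s => ee (-(s * α)) * h s) m := by
  rw [fourierCoeffOn_eq_integral, coef, sub_zero, div_one, one_smul]
  refine intervalIntegral.integral_congr fun s _ => ?_
  simp only [smul_eq_mul]
  rw [← mul_assoc, fourier_coe_apply]
  congr 1
  rw [ee, ee, ← Complex.exp_add]
  congr 1
  push_cast
  simp only [sub_zero, div_one]
  ring

/-- Parseval's identity for the untwisted function, which has the same absolute value. -/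
theorem tsum_coef_sq (α : ℝ) {h : ℝ → ℂ} (hh : Continuous h) :
    ∑' m, ‖coef α m h‖ₑ ^ 2 = ∫⁻ s in Icc (0 : ℝ) 1, ‖h s‖ₑ ^ 2 := by
  have hc : Continuous fun s => ee (-(s * α)) * h s := (continuous_ee.comp (by fun_prop)).mul hh
  have hL : MemLp (fun s => ee (-(s * α)) * h s) 2 (volume.restrict (Ioc (0 : ℝ) 1)) := by
    obtain ⟨C, hC⟩ := isCompact_Icc.exists_bound_of_continuousOn (hc.continuousOn (s := Icc (0 : ℝ) 1))
    refine MemLp.of_bound hc.aestronglyMeasurable C ?_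
    rw [ae_restrict_iff' measurableSet_Ioc]
    exact .of_forall fun s hs => hC s ⟨hs.1.le, hs.2⟩
  have h1 := hasSum_sq_fourierCoeffOn (zero_lt_one' ℝ) hL
  simp only [← coef_eq_fourierCoeffOn, sub_zero, inv_one, one_smul, norm_mul, norm_ee, one_mul] at h1
  have h2 : ∀ z : ℂ, ‖z‖ₑ ^ 2 = ENNReal.ofReal (‖z‖ ^ 2) := fun z => by
    rw [ENNReal.ofReal_pow (norm_nonneg _), ofReal_norm]
  simp only [h2]
  rw [← ENNReal.ofReal_tsum_of_nonneg (fun m => by positivity) h1.summable, h1.tsum_eq,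
    intervalIntegral.integral_of_le zero_le_one, restrict_Ioc_eq_restrict_Icc,
    ofReal_integral_eq_lintegral_ofReal]
  · exact ((hh.norm.pow 2).continuousOn.integrableOn_compact isCompact_Icc)
  · exact .of_forall fun s => by positivity

/-- After division by the character of α the function descends to the circle, where absolutely
summable Fourier series converge pointwise. -/
theorem hasSum_coef (α : ℝ) {h : ℝ → ℂ} (hh : Continuous h) (hq : ∀ s, h (s + 1) = ee α * h s)
    (hs : Summable fun m => coef α m h) (x : ℝ) :
    HasSum (fun m : ℤ => ee ((m + α) * x) * coef α m h) (h x) := by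
  let k : ℝ → ℂ := fun s => ee (-(s * α)) * h s
  have hkc : Continuous k := (continuous_ee.comp (by fun_prop)).mul hh
  have hkp : Function.Periodic k 1 := fun s => by
    simp only [k]
    rw [hq, ← mul_assoc, ← ee_add]
    congr 2
    ring
  let K : C(AddCircle (1 : ℝ), ℂ) := ⟨hkp.lift, continuous_coinduced_dom.2 hkc⟩
  have hK : ∀ s : ℝ, K s = k s := fun s => hkp.lift_coe s
  have hcoef : ∀ m, fourierCoeff K m = coef α m h := fun m => by
    rw [fourierCoeff_eq_intervalIntegral _ _ 0, zero_add, div_one, one_smul, coef]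
    refine intervalIntegral.integral_congr fun s _ => ?_
    simp only [hK, k, smul_eq_mul]
    rw [← mul_assoc, fourier_coe_apply]
    congr 1
    rw [ee, ee, ← Complex.exp_add]
    congr 1
    push_cast
    ring
  have h1 := has_pointwise_sum_fourier_series_of_summable (f := K)
    (by rw [show fourierCoeff K = fun m => coef α m h from funext hcoef]; exact hs) (x : AddCircle (1 : ℝ))
  rw [hK] at h1
  have h2 := h1.mul_left (ee (x * α))
  have h3 : ee (x * α) * k x = h x := by
    simp only [k]
    rw [← mul_assoc, ← ee_add, add_neg_cancel, ee_zero, one_mul]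
  rw [h3] at h2
  refine h2.congr_fun fun m => ?_
  rw [hcoef, smul_eq_mul, fourier_coe_apply, mul_left_comm, mul_comm (coef α m h)]
  congr 1
  rw [ee, ee, ← Complex.exp_add]
  congr 1
  push_cast
  ring

theorem continuous_series (θ : ℝ) {c : ℤ → ℂ} (hc : Summable fun n => ‖c n‖) :
    Continuous fun x : ℝ => ∑' n : ℤ, ee ((n + θ) * x) * c n :=
  continuous_tsum (fun n => (continuous_ee.comp (by fun_prop)).mul continuous_const) hc
    fun n x => by rw [norm_mul, norm_ee, one_mul]

/-- The twists cancel, leaving characters of integral frequency n - m. The series may be integrated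
termwise, and only n = m survives. -/
theorem coef_series (θ : ℝ) {c : ℤ → ℂ} (hc : Summable fun n => ‖c n‖) (m : ℤ) :
    coef θ m (fun x => ∑' n : ℤ, ee ((n + θ) * x) * c n) = c m := by
  have h1 : ∀ x : ℝ, ee (-(x * (m + θ))) * ∑' n : ℤ, ee ((n + θ) * x) * c n
      = ∑' n : ℤ, ee (x * (n - m : ℤ)) * c n := fun x => by
    rw [← tsum_mul_left]
    refine tsum_congr fun n => ?_
    rw [← mul_assoc, ← ee_add]
    congr 2
    push_cast
    ring
  simp only [coef, h1]
  have h2 := intervalIntegral.hasSum_intervalIntegral_of_summable_norm (a := (0 : ℝ)) (b := 1)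
    (f := fun n : ℤ => (⟨fun x : ℝ => ee (x * (n - m : ℤ)) * c n,
      (continuous_ee.comp (by fun_prop)).mul continuous_const⟩ : C(ℝ, ℂ))) (by
      refine hc.of_norm_bounded fun n => ?_
      rw [norm_norm, ContinuousMap.norm_le _ (norm_nonneg _)]
      intro x
      change ‖ee (x * (n - m : ℤ)) * c n‖ ≤ _
      rw [norm_mul, norm_ee, one_mul])
  refine h2.tsum_eq.symm.trans ?_
  rw [tsum_eq_single m]
  · simp [ee_zero]
  · intro n hn
    have hnm : ((n - m : ℤ) : ℝ) ≠ 0 := by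
      exact_mod_cast sub_ne_zero.2 hn
    change ∫ x in (0 : ℝ)..1, ee (x * (n - m : ℤ)) * c n = 0
    rw [intervalIntegral.integral_mul_const]
    have hd : ∀ x ∈ uIcc (0 : ℝ) 1, HasDerivAt
        (fun x : ℝ => (2 * π * Complex.I * ((n - m : ℤ) : ℝ) : ℂ)⁻¹ * ee (x * (n - m : ℤ)))
        (ee (x * (n - m : ℤ))) x := fun x _ => by
      have h1 : HasDerivAt (fun s : ℝ => s * ((n - m : ℤ) : ℝ)) (1 * ((n - m : ℤ) : ℝ)) x :=
        (hasDerivAt_id x).mul_const _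
      refine (((hasDerivAt_ee _).scomp x h1).const_mul _).congr_deriv ?_
      have : (((n - m : ℤ) : ℝ) : ℂ) ≠ 0 := by exact_mod_cast hnm
      have hpi := Complex.I_ne_zero
      have hpi' : (π : ℂ) ≠ 0 := by exact_mod_cast pi_ne_zero
      rw [Complex.real_smul]
      push_cast at this ⊢
      field_simp
    rw [intervalIntegral.integral_eq_sub_of_hasDerivAt hd
      ((continuous_ee.comp (by fun_prop)).intervalIntegrable _ _)]
    rw [one_mul, zero_mul, ee_int, ee_zero, sub_self, zero_mul]

/-- Families of functions of one variable with summable suprema. -/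
structure IsNice (Φ : ℤ → ℝ → ℂ) : Prop where
  cont : ∀ n, Continuous (Φ n)
  bound : ∃ B : ℤ → ℝ, Summable B ∧ ∀ n, ∀ s ∈ Icc (0 : ℝ) 1, ‖Φ n s‖ ≤ B n

/-- Fourier coefficients in one variable, followed by Fourier summation in the other. -/
def core (θ α x : ℝ) (m : ℤ) (Φ : ℤ → ℝ → ℂ) : ℂ := ∑' n : ℤ, ee ((n + θ) * x) * coef α m (Φ n)

theorem norm_coef_eq (θ x : ℝ) (n : ℤ) (z : ℂ) : ‖ee ((n + θ) * x) * z‖ = ‖z‖ := by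
  rw [norm_mul, norm_ee, one_mul]

namespace IsNice

variable {Φ Ψ : ℤ → ℝ → ℂ}

theorem summable_coef (h : IsNice Φ) (α : ℝ) (m : ℤ) : Summable fun n => ‖coef α m (Φ n)‖ := by
  obtain ⟨B, hB, hΦ⟩ := h.bound
  exact hB.of_nonneg_of_le (fun n => norm_nonneg _) fun n => norm_coef_le α m (hΦ n)

theorem summable_core (h : IsNice Φ) (θ α x : ℝ) (m : ℤ) :
    Summable fun n : ℤ => ee ((n + θ) * x) * coef α m (Φ n) :=
  ((h.summable_coef α m).congr fun n => (norm_coef_eq θ x n _).symm).of_norm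

theorem continuous_core (h : IsNice Φ) (θ α : ℝ) (m : ℤ) : Continuous fun x => core θ α x m Φ :=
  continuous_series θ (h.summable_coef α m)

theorem core_add (h : IsNice Φ) (h' : IsNice Ψ) (θ α x : ℝ) (m : ℤ) :
    core θ α x m (fun n s => Φ n s + Ψ n s) = core θ α x m Φ + core θ α x m Ψ := by
  rw [core, core, core, ← (h.summable_core θ α x m).tsum_add (h'.summable_core θ α x m)]
  exact tsum_congr fun n => by rw [coef_add α m (h.cont n) (h'.cont n), mul_add]

theorem const_mul (h : IsNice Φ) (c : ℂ) : IsNice fun n s => c * Φ n s := by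
  obtain ⟨B, hB, hΦ⟩ := h.bound
  exact ⟨fun n => continuous_const.mul (h.cont n), fun n => ‖c‖ * B n, hB.mul_left _, fun n s hs => by
    rw [norm_mul]
    exact mul_le_mul_of_nonneg_left (hΦ n s hs) (norm_nonneg _)⟩

/-- The Fourier coefficients of the transform are those of the family. -/
theorem coef_core (h : IsNice Φ) (θ α : ℝ) (m n : ℤ) :
    coef θ n (fun x => core θ α x m Φ) = coef α m (Φ n) :=
  coef_series θ (h.summable_coef α m) n

/-- Fourier inversion. -/
theorem core_core (h : IsNice Φ) {θ α : ℝ} (hq : ∀ n s, Φ n (s + 1) = ee α * Φ n s)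
    (h' : IsNice fun m x => core θ α x m Φ) (n : ℤ) (s : ℝ) :
    core α θ s n (fun m x => core θ α x m Φ) = Φ n s := by
  rw [core]
  -- By `coef_core` this is the absolute summability over m of the Fourier coefficients of `Φ n`,
  -- which is what pointwise inversion requires.
  have hs := h'.summable_coef θ n
  simp only [h.coef_core] at hs ⊢
  exact (hasSum_coef α (h.cont n) (hq n) hs.of_norm s).tsum_eq

/-- Parseval's identity. -/
theorem tsum_core_sq (h : IsNice Φ) (θ α : ℝ) :
    ∑' m : ℤ, ∫⁻ x in Icc (0 : ℝ) 1, ‖core θ α x m Φ‖ₑ ^ 2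
      = ∑' n : ℤ, ∫⁻ s in Icc (0 : ℝ) 1, ‖Φ n s‖ₑ ^ 2 := by
  simp only [← tsum_coef_sq θ (h.continuous_core θ α _), ← tsum_coef_sq α (h.cont _), h.coef_core]
  exact ENNReal.tsum_comm

end IsNice

theorem core_const_mul (θ α x : ℝ) (m : ℤ) (c : ℂ) (Φ : ℤ → ℝ → ℂ) :
    core θ α x m (fun n s => c * Φ n s) = c * core θ α x m Φ := by
  rw [core, core, ← tsum_mul_left]
  exact tsum_congr fun n => by rw [coef_const_mul, mul_left_comm]

theorem core_deriv (θ α x : ℝ) (m : ℤ) {Φ Φ' : ℤ → ℝ → ℂ} (hd : ∀ n s, HasDerivAt (Φ n) (Φ' n s) s)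
    (hc : ∀ n, Continuous (Φ' n)) (hq : ∀ n s, Φ n (s + 1) = ee α * Φ n s) :
    core θ α x m Φ' = 2 * π * Complex.I * (m + α) * core θ α x m Φ := by
  rw [core, core, ← tsum_mul_left]
  refine tsum_congr fun n => ?_
  rw [coef_deriv α m (hd n) (hc n) (by simpa using hq n 0), mul_left_comm]

theorem norm_core_le (θ α x : ℝ) (m : ℤ) {Φ : ℤ → ℝ → ℂ} {B : ℤ → ℝ} (hB : Summable B)
    (h : ∀ n, ∀ s ∈ Icc (0 : ℝ) 1, ‖Φ n s‖ ≤ B n) : ‖core θ α x m Φ‖ ≤ ∑' n, B n :=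
  tsum_of_norm_bounded hB.hasSum fun n => by
    rw [norm_coef_eq]
    exact norm_coef_le α m (h n)

end FourierSeries

/-! ## Rapidly decreasing families of functions -/

open Function (update)

theorem summable_inv_one_add_abs_sq : Summable fun n : ℤ => ((1 + |(n : ℝ)|) ^ 2)⁻¹ := by
  refine Summable.of_norm_bounded_eventually (Real.summable_one_div_int_pow.2 one_lt_two) ?_
  filter_upwards [(Set.finite_singleton (0 : ℤ)).compl_mem_cofinite] with n hn
  have hn : 0 < |(n : ℝ)| := abs_pos.2 (by exact_mod_cast hn)
  rw [norm_inv, Real.norm_of_nonneg (by positivity), ← sq_abs (n : ℝ), one_div]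
  gcongr
  linarith

/-- Faster than polynomial decay in the index, locally uniformly. -/
def Rapid {E : Type*} [NormedAddCommGroup E] (F : ℤ → R4 → E) : Prop :=
  ∀ (k : ℕ) (R : ℝ), ∃ C : ℝ, ∀ (n : ℤ) y, ‖y‖ ≤ R → (1 + |(n : ℝ)|) ^ k * ‖F n y‖ ≤ C

theorem Rapid.add {E : Type*} [NormedAddCommGroup E] {F G : ℤ → R4 → E} (hF : Rapid F)
    (hG : Rapid G) : Rapid fun n y => F n y + G n y := fun k R => by
  obtain ⟨C, hC⟩ := hF k R
  obtain ⟨C', hC'⟩ := hG k R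
  refine ⟨C + C', fun n y hy => ?_⟩
  calc _ ≤ (1 + |(n : ℝ)|) ^ k * (‖F n y‖ + ‖G n y‖) := by gcongr; exact norm_add_le _ _
    _ ≤ _ := by rw [mul_add]; exact add_le_add (hC n y hy) (hC' n y hy)

/-- Linear growth in the index, locally uniformly. -/
def LinearGrowth (P : ℤ → R4 → ℂ) : Prop :=
  ∀ R : ℝ, ∃ C : ℝ, ∀ (n : ℤ) y, ‖y‖ ≤ R → ‖P n y‖ ≤ C * (1 + |(n : ℝ)|)

/-- One order of decay pays for the linear growth. -/
theorem Rapid.mul_left {F P : ℤ → R4 → ℂ} (hF : Rapid F) (hP : LinearGrowth P) :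
    Rapid fun n y => P n y * F n y := fun k R => by
  obtain ⟨C, hC⟩ := hF (k + 1) R
  obtain ⟨C', hC'⟩ := hP R
  refine ⟨|C'| * C, fun n y hy => ?_⟩
  rw [norm_mul]
  calc (1 + |(n : ℝ)|) ^ k * (‖P n y‖ * ‖F n y‖)
      ≤ (1 + |(n : ℝ)|) ^ k * (|C'| * (1 + |(n : ℝ)|) * ‖F n y‖) := by
        gcongr
        exact (hC' n y hy).trans (by gcongr; exact le_abs_self _)
    _ = |C'| * ((1 + |(n : ℝ)|) ^ (k + 1) * ‖F n y‖) := by ring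
    _ ≤ _ := by gcongr; exact hC n y hy

theorem linearGrowth_of_continuous {c : R4 → ℂ} (hc : Continuous c) :
    LinearGrowth fun _ y => c y := fun R => by
  obtain ⟨C, hC⟩ := (isCompact_closedBall (0 : R4) R).exists_bound_of_continuousOn hc.continuousOn
  refine ⟨|C|, fun n y hy => (hC y (by simpa using hy)).trans ?_⟩
  have h0 := abs_nonneg C
  have h1 := abs_nonneg (n : ℝ)
  have h2 := le_abs_self C
  nlinarith

theorem linearGrowth_add {c d : R4 → ℂ} (hc : Continuous c) (hd : Continuous d) :
    LinearGrowth fun n y => n * c y + d y := fun R => by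
  obtain ⟨C, hC⟩ := linearGrowth_of_continuous hc R
  obtain ⟨C', hC'⟩ := linearGrowth_of_continuous hd R
  refine ⟨C + C', fun n y hy => ?_⟩
  have h1 := hC 0 y hy
  have h2 := hC' n y hy
  simp only [Int.cast_zero, abs_zero, add_zero, mul_one] at h1
  have h3 : ‖(n : ℂ)‖ = |(n : ℝ)| := by simp
  calc _ ≤ ‖(n : ℂ) * c y‖ + ‖d y‖ := norm_add_le _ _
    _ ≤ |(n : ℝ)| * C + C' * (1 + |(n : ℝ)|) := by
      rw [norm_mul, h3]
      gcongr
    _ ≤ _ := by nlinarith [norm_nonneg (c y)]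

theorem Rapid.mul_index {F : ℤ → R4 → ℂ} (hF : Rapid F) : Rapid fun n y => n * F n y := by
  simpa using hF.mul_left (linearGrowth_add (c := 1) (d := 0) continuous_const continuous_const)

theorem norm_update_le {y : R4} {s R : ℝ} (hy : ‖y‖ ≤ R) (hs : s ∈ Set.Icc (0 : ℝ) 1) :
    ‖update y 2 s‖ ≤ max R 1 := by
  refine (pi_norm_le_iff_of_nonneg (by positivity)).2 fun i => ?_
  obtain rfl | hi := eq_or_ne i 2
  · simp only [Function.update_self, Real.norm_eq_abs, abs_of_nonneg hs.1]
    exact hs.2.trans (le_max_right _ _)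
  · rw [Function.update_of_ne hi]
    exact (norm_le_pi_norm y i).trans (hy.trans (le_max_left _ _))

/-- Decay along the segment used for Fourier coefficients. -/
theorem Rapid.segment {E : Type*} [NormedAddCommGroup E] {F : ℤ → R4 → E} (hF : Rapid F) (k : ℕ)
    (R : ℝ) : ∃ C : ℝ, 0 ≤ C ∧ ∀ (n : ℤ) y s, ‖y‖ ≤ R → s ∈ Set.Icc (0 : ℝ) 1 →
      ‖F n (update y 2 s)‖ ≤ C * ((1 + |(n : ℝ)|) ^ k)⁻¹ := by
  obtain ⟨C, hC⟩ := hF k (max R 1)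
  refine ⟨max C 0, le_max_right _ _, fun n y s hy hs => ?_⟩
  rw [← div_eq_mul_inv, le_div_iff₀ (by positivity), mul_comm]
  exact (hC n _ (norm_update_le hy hs)).trans (le_max_left _ _)

theorem continuous_update_two (y : R4) : Continuous fun s : ℝ => update y 2 s :=
  continuous_const.update 2 continuous_id

theorem Rapid.isNice {F : ℤ → R4 → ℂ} (hF : Rapid F) (hc : ∀ n, Continuous (F n)) (y : R4) :
    IsNice fun n s => F n (update y 2 s) := by
  obtain ⟨C, -, hC⟩ := hF.segment 2 ‖y‖
  exact ⟨fun n => (hc n).comp (continuous_update_two y), _, summable_inv_one_add_abs_sq.mul_left C,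
    fun n s hs => hC n y s le_rfl hs⟩

/-- Families of smooth functions which decay rapidly in the index with their first derivatives. -/
structure Tame (F : ℤ → R4 → ℂ) : Prop where
  smooth : ∀ n, ContDiff ℝ ∞ (F n)
  rapid : Rapid F
  rapid_fderiv : Rapid fun n => fderiv ℝ (F n)

theorem norm_clm_le (L : R4 →L[ℝ] ℂ) : ‖L‖ ≤ ∑ i, ‖L (Pi.single i 1)‖ := by
  refine L.opNorm_le_bound (Finset.sum_nonneg fun _ _ => norm_nonneg _) fun v => ?_
  conv_lhs => rw [← Finset.univ_sum_single v, map_sum]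
  rw [Finset.sum_mul]
  refine norm_sum_le_of_le _ fun i _ => ?_
  have : (Pi.single i (v i) : R4) = v i • Pi.single i 1 := by
    rw [← Pi.single_smul, smul_eq_mul, mul_one]
  rw [this, map_smul, norm_smul, mul_comm]
  gcongr
  exact norm_le_pi_norm v i

theorem tame_of_pd {F : ℤ → R4 → ℂ} (hs : ∀ n, ContDiff ℝ ∞ (F n)) (hF : Rapid F)
    (hd : ∀ i, Rapid fun n => pd i (F n)) : Tame F := by
  refine ⟨hs, hF, fun k R => ?_⟩
  choose C hC using fun i => hd i k R
  refine ⟨∑ i, C i, fun n y hy => ?_⟩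
  calc _ ≤ (1 + |(n : ℝ)|) ^ k * ∑ i, ‖pd i (F n) y‖ := by gcongr; exact norm_clm_le _
    _ ≤ _ := by
      rw [Finset.mul_sum]
      exact Finset.sum_le_sum fun i _ => hC i n y hy

namespace Tame

variable {F : ℤ → R4 → ℂ}

theorem continuous (hF : Tame F) (n : ℤ) : Continuous (F n) := (hF.smooth n).continuous

theorem continuous_fderiv (hF : Tame F) (n : ℤ) : Continuous (fderiv ℝ (F n)) :=
  (hF.smooth n).continuous_fderiv (by simp)

theorem hasFDerivAt (hF : Tame F) (n : ℤ) (y : R4) : HasFDerivAt (F n) (fderiv ℝ (F n) y) y :=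
  ((hF.smooth n).differentiable (by simp)).differentiableAt.hasFDerivAt

theorem isNice (hF : Tame F) (y : R4) : IsNice fun n s => F n (update y 2 s) :=
  hF.rapid.isNice hF.continuous y

theorem isNice_index (hF : Tame F) (y : R4) : IsNice fun n s => n * F n (update y 2 s) :=
  hF.rapid.mul_index.isNice (fun n => continuous_const.mul (hF.continuous n)) y

theorem isNice_mul (hF : Tame F) (y : R4) : IsNice fun n s => s * F n (update y 2 s) := by
  have h := (hF.rapid.mul_left (linearGrowth_of_continuous (c := fun y => (y 2 : ℂ))
    (by fun_prop))).isNice (fun n => Continuous.mul (by fun_prop) (hF.continuous n)) y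
  simpa using h

theorem isNice_fderiv (hF : Tame F) (y v : R4) :
    IsNice fun n s => fderiv ℝ (F n) (update y 2 s) v := by
  obtain ⟨C, -, hC⟩ := hF.rapid_fderiv.segment 2 ‖y‖
  refine ⟨fun n => ((hF.continuous_fderiv n).comp (continuous_update_two y)).clm_apply
    continuous_const, _, (summable_inv_one_add_abs_sq.mul_left C).mul_right ‖v‖, fun n s hs => ?_⟩
  exact ((fderiv ℝ (F n) (update y 2 s)).le_opNorm v).trans
    (by gcongr; exact hC n y s le_rfl hs)

end Tame

/-! ## Differentiating the partial Fourier transform -/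

section

open Real Set Function

/-- The projection which forgets the coordinate `2`. -/
def forgetTwo : R4 →L[ℝ] R4 :=
  ContinuousLinearMap.id ℝ R4 - (ContinuousLinearMap.proj (R := ℝ) (φ := fun _ : Fin 4 => ℝ) 2).smulRight
    (Pi.single 2 1)

theorem update_two (y : R4) (s : ℝ) : update y 2 s = forgetTwo y + s • Pi.single 2 1 := by
  funext i
  obtain rfl | hi := eq_or_ne i 2
  · simp [forgetTwo]
  · simp [forgetTwo, hi]

theorem forgetTwo_apply (v : R4) : forgetTwo v = update v 2 0 := by
  rw [update_two, zero_smul, add_zero]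

/-- The derivative in `y` of `ee (-(s * (m + a y))) * f (update y 2 s)`. -/
def coefDerivIntegrand (f : R4 → ℂ) (a : R4 →L[ℝ] ℝ) (m : ℤ) (y : R4) (s : ℝ) : R4 →L[ℝ] ℂ :=
  ee (-(s * (m + a y))) • (fderiv ℝ f (update y 2 s)).comp forgetTwo
    + (-(2 * π * Complex.I * s) * (ee (-(s * (m + a y))) * f (update y 2 s)))
      • Complex.ofRealCLM.comp a

theorem continuous_coefDerivIntegrand {f : R4 → ℂ} (hf : ContDiff ℝ ∞ f) (a : R4 →L[ℝ] ℝ) (m : ℤ) :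
    Continuous fun p : R4 × ℝ => coefDerivIntegrand f a m p.1 p.2 := by
  have hu : Continuous fun p : R4 × ℝ => update p.1 2 p.2 := continuous_fst.update 2 continuous_snd
  have he : Continuous fun p : R4 × ℝ => ee (-(p.2 * (m + a p.1))) :=
    continuous_ee.comp
      (continuous_snd.mul (continuous_const.add (a.continuous.comp continuous_fst))).neg
  have h1 : Continuous fun p : R4 × ℝ => (fderiv ℝ f (update p.1 2 p.2)).comp forgetTwo :=
    ((hf.continuous_fderiv (by simp)).comp hu).clm_comp continuous_const
  have hm : Continuous fun p : R4 × ℝ => -(2 * π * Complex.I * (p.2 : ℂ)) :=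
    (continuous_const.mul (Complex.continuous_ofReal.comp continuous_snd)).neg
  have h2 : Continuous fun p : R4 × ℝ =>
      -(2 * π * Complex.I * p.2) * (ee (-(p.2 * (m + a p.1))) * f (update p.1 2 p.2)) :=
    hm.mul (he.mul (hf.continuous.comp hu))
  exact (he.smul h1).add (h2.smul continuous_const)

theorem hasFDerivAt_coef_integrand {f : R4 → ℂ} (hf : ContDiff ℝ ∞ f) (a : R4 →L[ℝ] ℝ) (m : ℤ)
    (y : R4) (s : ℝ) : HasFDerivAt (fun y => ee (-(s * (m + a y))) * f (update y 2 s))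
      (coefDerivIntegrand f a m y s) y := by
  have h1 : HasFDerivAt (fun y : R4 => -(s * (m + a y))) (-(s • a)) y :=
    ((a.hasFDerivAt.const_add (m : ℝ)).const_mul s).neg
  have h2 := (hasDerivAt_ee (-(s * (m + a y)))).hasFDerivAt.comp y h1
  have h3 : HasFDerivAt (fun y : R4 => update y 2 s) forgetTwo y := by
    simp only [update_two]
    exact forgetTwo.hasFDerivAt.add_const _
  have h4 : HasFDerivAt f (fderiv ℝ f (update y 2 s)) (update y 2 s) :=
    (hf.differentiable (by simp)).differentiableAt.hasFDerivAt
  refine (h2.mul (h4.comp y h3)).congr_fderiv ?_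
  ext v
  simp [coefDerivIntegrand]
  ring

theorem hasFDerivAt_coef {f : R4 → ℂ} (hf : ContDiff ℝ ∞ f) (a : R4 →L[ℝ] ℝ) (m : ℤ) (y : R4) :
    HasFDerivAt (fun y => coef (a y) m fun s => f (update y 2 s))
      (∫ s in (0 : ℝ)..1, coefDerivIntegrand f a m y s) y := by
  have hc := continuous_coefDerivIntegrand hf a m
  have hcs : Continuous fun s : ℝ => coefDerivIntegrand f a m y s :=
    hc.comp₂ continuous_const continuous_id
  have hcont : ∀ y : R4, Continuous fun s : ℝ => ee (-(s * (m + a y))) * f (update y 2 s) := fun y =>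
    continuous_coef_integrand _ _ (hf.continuous.comp (continuous_update_two y))
  -- Differentiation under the integral sign: the derivative of the integrand is jointly continuous,
  -- hence bounded on a compact neighbourhood.
  obtain ⟨C, hC⟩ := ((isCompact_closedBall y 1).prod (isCompact_Icc (a := (0 : ℝ)) (b := 1)))
    |>.exists_bound_of_continuousOn hc.continuousOn
  refine intervalIntegral.hasFDerivAt_integral_of_dominated_of_fderiv_le
    (bound := fun _ => C) (F' := coefDerivIntegrand f a m) (Metric.closedBall_mem_nhds y one_pos)
    (.of_forall fun y => (hcont y).aestronglyMeasurable) ((hcont y).intervalIntegrable _ _)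
    hcs.aestronglyMeasurable
    (.of_forall fun s hs x hx => ?_) intervalIntegrable_const
    (.of_forall fun s _ x _ => hasFDerivAt_coef_integrand hf a m x s)
  rw [uIoc_of_le zero_le_one] at hs
  exact hC (x, s) ⟨hx, hs.1.le, hs.2⟩

theorem coefDeriv_apply {f : R4 → ℂ} (hf : ContDiff ℝ ∞ f) (a : R4 →L[ℝ] ℝ) (m : ℤ) (y v : R4) :
    (∫ s in (0 : ℝ)..1, coefDerivIntegrand f a m y s) v
      = coef (a y) m (fun s => fderiv ℝ f (update y 2 s) (update v 2 0))
        + -(2 * π * Complex.I * a v) * coef (a y) m (fun s => s * f (update y 2 s)) := by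
  have hc : Continuous fun s : ℝ => coefDerivIntegrand f a m y s :=
    (continuous_coefDerivIntegrand hf a m).comp₂ continuous_const continuous_id
  have hc1 : Continuous fun s : ℝ => fderiv ℝ f (update y 2 s) (update v 2 0) :=
    ((hf.continuous_fderiv (by simp)).comp (continuous_update_two y)).clm_apply continuous_const
  have hc2 : Continuous fun s : ℝ => s * f (update y 2 s) :=
    Complex.continuous_ofReal.mul (hf.continuous.comp (continuous_update_two y))
  have hc3 : Continuous fun s : ℝ => -(2 * π * Complex.I * a v) * (s * f (update y 2 s)) :=
    continuous_const.mul hc2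
  rw [ContinuousLinearMap.intervalIntegral_apply (hc.intervalIntegrable _ _), ← coef_const_mul,
    ← coef_add _ _ hc1 hc3, coef]
  refine intervalIntegral.integral_congr fun s _ => ?_
  simp [coefDerivIntegrand, forgetTwo_apply]
  ring

theorem norm_coefDeriv_le {F : ℤ → R4 → ℂ} (hF : Tame F) (a : R4 →L[ℝ] ℝ) (k : ℕ) (R : ℝ) :
    ∃ C : ℝ, ∀ (n m : ℤ) y, ‖y‖ ≤ R →
      ‖∫ s in (0 : ℝ)..1, coefDerivIntegrand (F n) a m y s‖ ≤ C * ((1 + |(n : ℝ)|) ^ k)⁻¹ := by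
  obtain ⟨C, h0, hC⟩ := hF.rapid.segment k R
  obtain ⟨C', h0', hC'⟩ := hF.rapid_fderiv.segment k R
  refine ⟨C' * ‖forgetTwo‖ + 2 * π * C * ‖Complex.ofRealCLM.comp a‖, fun n m y hy => ?_⟩
  have := intervalIntegral.norm_integral_le_of_norm_le_const (a := (0 : ℝ)) (b := 1)
    (C := (C' * ‖forgetTwo‖ + 2 * π * C * ‖Complex.ofRealCLM.comp a‖) * ((1 + |(n : ℝ)|) ^ k)⁻¹)
    (f := coefDerivIntegrand (F n) a m y) fun s hs => by
      rw [uIoc_of_le zero_le_one] at hs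
      have hs' : s ∈ Icc (0 : ℝ) 1 := ⟨hs.1.le, hs.2⟩
      have h1 := hC n y s hy hs'
      have h2 := hC' n y s hy hs'
      have h3 : ‖-(2 * π * Complex.I * (s : ℂ))‖ ≤ 2 * π := by
        rw [norm_neg, norm_mul, Complex.norm_real, Real.norm_of_nonneg hs'.1]
        simp only [norm_mul, Complex.norm_I, Complex.norm_ofNat, Complex.norm_real,
          Real.norm_of_nonneg pi_pos.le]
        nlinarith [hs'.2, pi_pos]
      refine (norm_add_le _ _).trans ?_
      rw [norm_smul, norm_ee, one_mul, norm_smul, norm_mul, norm_mul, norm_ee, one_mul, add_mul]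
      refine add_le_add (((fderiv ℝ (F n) (update y 2 s)).opNorm_comp_le _).trans ?_) ?_
      · calc _ ≤ C' * ((1 + |(n : ℝ)|) ^ k)⁻¹ * ‖forgetTwo‖ := by gcongr
          _ = _ := by ring
      · calc _ ≤ 2 * π * (C * ((1 + |(n : ℝ)|) ^ k)⁻¹) * ‖Complex.ofRealCLM.comp a‖ := by gcongr
          _ = _ := by ring
  simpa using this

set_option maxHeartbeats 600000 in
/-- The partial Fourier transform of a tame family is differentiable. -/
theorem Tame.hasFDerivAt_core {F : ℤ → R4 → ℂ} (hF : Tame F) (b a : R4 →L[ℝ] ℝ) (m : ℤ) (y : R4) :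
    ∃ L : R4 →L[ℝ] ℂ, HasFDerivAt
      (fun y => core (b y) (a y) (y 2) m fun n s => F n (update y 2 s)) L y ∧
      ∀ v, L v = 2 * π * Complex.I * (b v) * y 2 *
            core (b y) (a y) (y 2) m (fun n s => F n (update y 2 s))
        + 2 * π * Complex.I * v 2 *
            (core (b y) (a y) (y 2) m (fun n s => n * F n (update y 2 s))
              + b y * core (b y) (a y) (y 2) m (fun n s => F n (update y 2 s)))
        + core (b y) (a y) (y 2) m (fun n s => fderiv ℝ (F n) (update y 2 s) (update v 2 0))
        - 2 * π * Complex.I * a v * core (b y) (a y) (y 2) m (fun n s => s * F n (update y 2 s)) := by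
  let π₂ : R4 →L[ℝ] ℝ := ContinuousLinearMap.proj (R := ℝ) (φ := fun _ : Fin 4 => ℝ) 2
  let e : ℤ → R4 → R4 →L[ℝ] ℂ := fun n y => (2 * π * Complex.I * ee ((n + b y) * y 2)) •
    Complex.ofRealCLM.comp ((n + b y) • π₂ + y 2 • b)
  have he : ∀ (n : ℤ) y, HasFDerivAt (fun y : R4 => ee ((n + b y) * y 2)) (e n y) y := fun n y => by
    have h1 : HasFDerivAt (fun y : R4 => (n + b y) * y 2) ((n + b y) • π₂ + y 2 • b) y :=
      (b.hasFDerivAt.const_add (n : ℝ)).mul π₂.hasFDerivAt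
    refine ((hasDerivAt_ee ((n + b y) * y 2)).hasFDerivAt.comp y h1).congr_fderiv ?_
    ext v
    simp [e]
    ring
  let d : ℤ → R4 → R4 →L[ℝ] ℂ := fun n y => ∫ s in (0 : ℝ)..1, coefDerivIntegrand (F n) a m y s
  let t : ℤ → R4 → R4 →L[ℝ] ℂ := fun n y => ee ((n + b y) * y 2) • d n y
    + coef (a y) m (fun s => F n (update y 2 s)) • e n y
  have ht : ∀ (n : ℤ) y, HasFDerivAt (fun y : R4 => ee ((n + b y) * y 2)
      * coef (a y) m (fun s => F n (update y 2 s))) (t n y) y := fun n y =>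
    (he n y).mul (hasFDerivAt_coef (hF.smooth n) a m y)
  -- Differentiating the character costs a factor growing linearly in n. Decay of order 3 for the
  -- coefficient and of order 2 for its derivative therefore leaves the summable bound of order 2.
  obtain ⟨C, hC⟩ := norm_coefDeriv_le hF a 2 (‖y‖ + 1)
  obtain ⟨C', h0', hC'⟩ := hF.rapid.segment 3 (‖y‖ + 1)
  let K : ℝ := 2 * π * ((1 + ‖b‖ * (‖y‖ + 1)) * ‖π₂‖ + (‖y‖ + 1) * ‖b‖)
  have hbound : ∀ (n : ℤ), ∀ z ∈ Metric.ball (0 : R4) (‖y‖ + 1), ‖t n z‖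
      ≤ (C + C' * K) * ((1 + |(n : ℝ)|) ^ 2)⁻¹ := fun n z hz => by
    have hz : ‖z‖ ≤ ‖y‖ + 1 := by simpa using (Metric.mem_ball.1 hz).le
    have h1 := hC n m z hz
    have h2 : ‖coef (a z) m (fun s => F n (update z 2 s))‖ ≤ C' * ((1 + |(n : ℝ)|) ^ 3)⁻¹ :=
      norm_coef_le _ _ fun s hs => hC' n z s hz hs
    have hz2 : |z 2| ≤ ‖y‖ + 1 := (norm_le_pi_norm z 2).trans hz
    have hbz : |b z| ≤ ‖b‖ * (‖y‖ + 1) := (b.le_opNorm z).trans (by gcongr)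
    have h3 : ‖e n z‖ ≤ K * (1 + |(n : ℝ)|) := by
      have h4 : ‖(2 * π * Complex.I * ee ((n + b z) * z 2) : ℂ)‖ = 2 * π := by
        simp [norm_ee, abs_of_pos pi_pos]
      have h5 : |(n : ℝ) + b z| ≤ (1 + ‖b‖ * (‖y‖ + 1)) * (1 + |(n : ℝ)|) := by
        have h6 := abs_nonneg (n : ℝ)
        have h7 : 0 ≤ ‖b‖ * (‖y‖ + 1) := by positivity
        refine (abs_add_le _ _).trans ?_
        nlinarith
      have h8 : ‖((n : ℝ) + b z) • π₂ + z 2 • b‖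
          ≤ ((1 + ‖b‖ * (‖y‖ + 1)) * ‖π₂‖ + (‖y‖ + 1) * ‖b‖) * (1 + |(n : ℝ)|) := by
        refine (norm_add_le _ _).trans ?_
        rw [norm_smul, norm_smul, Real.norm_eq_abs, Real.norm_eq_abs]
        calc _ ≤ (1 + ‖b‖ * (‖y‖ + 1)) * (1 + |(n : ℝ)|) * ‖π₂‖ + (‖y‖ + 1) * (1 + |(n : ℝ)|) * ‖b‖ := by
              gcongr
              have h6 := abs_nonneg (n : ℝ)
              nlinarith [norm_nonneg y]
          _ = _ := by ring
      simp only [e, norm_smul, h4, K]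
      rw [mul_assoc (2 * π)]
      gcongr
      refine (ContinuousLinearMap.opNorm_comp_le _ _).trans ?_
      rw [Complex.ofRealCLM_norm, one_mul]
      exact h8
    refine (norm_add_le _ _).trans ?_
    rw [norm_smul, norm_smul, norm_ee, one_mul, add_mul]
    refine add_le_add h1 ?_
    calc _ ≤ C' * ((1 + |(n : ℝ)|) ^ 3)⁻¹ * (K * (1 + |(n : ℝ)|)) := by gcongr
      _ = _ := by field_simp
  have hy : y ∈ Metric.ball (0 : R4) (‖y‖ + 1) := by simp
  have hsum : Summable fun n : ℤ => (C + C' * K) * ((1 + |(n : ℝ)|) ^ 2)⁻¹ :=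
    summable_inv_one_add_abs_sq.mul_left _
  have hcore : ∀ {Φ : ℤ → ℝ → ℂ}, IsNice Φ → HasSum
      (fun n : ℤ => ee ((n + b y) * y 2) * coef (a y) m (Φ n)) (core (b y) (a y) (y 2) m Φ) :=
    fun hΦ => (hΦ.summable_core (b y) (a y) (y 2) m).hasSum
  have hsum0 : Summable fun n : ℤ => ee ((n + b y) * y 2)
      * coef (a y) m (fun s => F n (update y 2 s)) := (hF.isNice y).summable_core _ _ _ m
  have hderiv := hasFDerivAt_tsum_of_isPreconnected hsum Metric.isOpen_ball
    (convex_ball _ _).isPreconnected (fun n z _ => ht n z) hbound hy hsum0 hy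
  refine ⟨∑' n, t n y, hderiv, fun v => ?_⟩
  have htsum : Summable fun n => t n y := Summable.of_norm_bounded hsum (fun n => hbound n y hy)
  have h1 : HasSum (fun n => t n y v) ((∑' n, t n y) v) := by
    have h := (ContinuousLinearMap.apply ℝ ℂ v).hasSum htsum.hasSum
    exact h
  refine h1.unique ?_
  -- The four groups come from b in the frequency, from the coordinate 2 in the character, from the
  -- derivative of `F`, and from the twist a in the coefficient. Each is summed separately and
  -- compared term by term.
  have g1 := (hcore (hF.isNice y)).mul_left (2 * π * Complex.I * (b v) * y 2)
  have g2 := ((hcore (hF.isNice_index y)).add ((hcore (hF.isNice y)).mul_left (b y : ℂ))).mul_left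
    (2 * π * Complex.I * v 2)
  have g3 := hcore (hF.isNice_fderiv y (update v 2 0))
  have g4 := (hcore (hF.isNice_mul y)).mul_left (2 * π * Complex.I * a v)
  have g := ((g1.add g2).add g3).sub g4
  refine g.congr_fun fun n => ?_
  have h2 : t n y v = ee ((n + b y) * y 2) * d n y v
      + coef (a y) m (fun s => F n (update y 2 s)) * e n y v := rfl
  have h3 : e n y v = 2 * π * Complex.I * ee ((n + b y) * y 2) * ((n + b y) * v 2 + y 2 * b v) := by
    simp [e, π₂, mul_add]
  have h4 := coefDeriv_apply (hF.smooth n) a m y v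
  rw [h2, h3, h4, coef_const_mul]
  ring

end

/-! ## Basis vectors acting on zero modes -/

section

open Real Function

/-- The bilinear form `(y³ γ¹ - y¹ γ³) / 2`. -/
def areaForm (γ : Z4) : R4 →L[ℝ] ℝ :=
  ((γ 1 : ℝ) / 2) • ContinuousLinearMap.proj (R := ℝ) (φ := fun _ : Fin 4 => ℝ) 3
    - ((γ 3 : ℝ) / 2) • ContinuousLinearMap.proj (R := ℝ) (φ := fun _ : Fin 4 => ℝ) 1

theorem areaForm_apply (γ : Z4) (y : R4) : areaForm γ y = (y 3 * γ 1 - y 1 * γ 3) / 2 := by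
  simp [areaForm]
  ring

theorem areaForm_update (γ : Z4) (n : ℤ) (y : R4) : areaForm (update γ 2 n) y = areaForm γ y := by
  simp [areaForm_apply]

theorem areaForm_apply_update (γ : Z4) (y : R4) (s : ℝ) :
    areaForm γ (update y 2 s) = areaForm γ y := by
  simp [areaForm_apply]

theorem fderiv_apply_eq_pd (g : R4 → ℂ) (y v : R4) : fderiv ℝ g y v = ∑ i, v i * pd i g y := by
  conv_lhs => rw [← Finset.univ_sum_single v, map_sum]
  refine Finset.sum_congr rfl fun i _ => ?_
  have : (Pi.single i (v i) : R4) = v i • Pi.single i 1 := by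
    rw [← Pi.single_smul, smul_eq_mul, mul_one]
  rw [this, map_smul, Complex.real_smul, pd]

theorem dataY_op_inr (i : Fin 4) (f : Amb) (γ : Z4) (y : R4) :
    dataY.op (.inr i) f γ y = -(2 * π * Complex.I * γ i) * f γ y := by
  rw [ZeroModeData.op, fderiv_apply_eq_pd]
  obtain rfl | rfl | rfl | rfl := fin4_cases i <;>
    simp [dataY, targetY, Matrix.one_apply, Fin.sum_univ_four]

theorem dataY_op_inl (i : Fin 4) (f : Amb) (γ : Z4) (y : R4) :
    dataY.op (.inl i) f γ y = pd i (f γ) y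
      + π * Complex.I * (∑ j, ∑ k, (eps i j k : ℂ) * y j * γ k) * f γ y := by
  rw [ZeroModeData.op, fderiv_apply_eq_pd]
  obtain rfl | rfl | rfl | rfl := fin4_cases i <;>
    simp [dataY, targetY, Matrix.one_apply, Fin.sum_univ_four]

theorem dataN_vec_inl (i : Fin 4) (f : R4 → ℂ) (y : R4) :
    fderiv ℝ f y (dataN.vec (.inl i) y)
      = ![pd 0 f y, pd 1 f y - y 3 / 2 * pd 2 f y, 0, pd 3 f y + y 1 / 2 * pd 2 f y] i := by
  rw [fderiv_apply_eq_pd]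
  obtain rfl | rfl | rfl | rfl := fin4_cases i <;>
    simp [dataN, frameN, Fin.sum_univ_four] <;> ring

theorem dataN_pot_inl (i : Fin 4) (γ : Z4) (y : R4) :
    dataN.pot (.inl i) γ y
      = if i = 2 then 2 * π * Complex.I * (γ 2 + 2 * (areaForm γ y : ℝ)) else 0 := by
  obtain rfl | rfl | rfl | rfl := fin4_cases i <;>
    simp [dataN, frameN, Fin.sum_univ_four, entries, kmul, latN, areaForm_apply] <;> ring

theorem dataN_op_inl (i : Fin 4) (hi : i ≠ 2) (f : Amb) (γ : Z4) (y : R4) :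
    dataN.op (.inl i) f γ y
      = ![pd 0 (f γ) y, pd 1 (f γ) y - y 3 / 2 * pd 2 (f γ) y, 0,
          pd 3 (f γ) y + y 1 / 2 * pd 2 (f γ) y] i := by
  rw [ZeroModeData.op, dataN_vec_inl, dataN_pot_inl, if_neg hi, zero_mul, add_zero]

theorem dataN_op_inl_two (f : Amb) (γ : Z4) (y : R4) :
    dataN.op (.inl 2) f γ y = 2 * π * Complex.I * (γ 2 + 2 * (areaForm γ y : ℝ)) * f γ y := by
  rw [ZeroModeData.op, dataN_vec_inl, dataN_pot_inl, if_pos rfl]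
  simp

theorem dataN_op_inr (i : Fin 4) (hi : i ≠ 2) (f : Amb) (γ : Z4) (y : R4) :
    dataN.op (.inr i) f γ y = -(2 * π * Complex.I * γ i) * f γ y := by
  rw [ZeroModeData.op, fderiv_apply_eq_pd]
  obtain rfl | rfl | rfl | rfl := fin4_cases i <;>
    simp [dataN, frameN, Fin.sum_univ_four, entries, kmul, latN] at hi ⊢

theorem dataN_op_inr_two (f : Amb) (γ : Z4) (y : R4) :
    dataN.op (.inr 2) f γ y = -pd 2 (f γ) y := by
  rw [ZeroModeData.op, fderiv_apply_eq_pd]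
  simp [dataN, frameN, Fin.sum_univ_four, entries, kmul, latN]

/-- What the partial Fourier transform needs to know about the action of the basis vectors:
quasi-periodicity in the coordinate `2`, multiplication operators which force decay in the winding
`2`, and the expression of partial derivatives by basis vectors. -/
structure IsRegular (D : ZeroModeData) (a b : ℝ) : Prop where
  quasiPeriodic : ∀ f, D.Good f → ∀ γ y,
    f γ (update y 2 (y 2 + 1)) = ee (a * areaForm γ y) * f γ y
  mul : ∃ (x : Ix) (z : ℂ), 1 ≤ ‖z‖ ∧ ∀ f γ y,
    D.op x f γ y = z * ((γ 2 + 2 * b * areaForm γ y : ℝ) : ℂ) * f γ y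
  pd_eq : ∀ i, ∃ (x : Ix) (c : R4 → ℂ) (q : Z4 → R4 → ℂ), ContDiff ℝ ∞ c ∧
    (∀ γ, ContDiff ℝ ∞ (q γ)) ∧ (∀ γ, LinearGrowth fun n => q (update γ 2 n)) ∧
    ∀ f γ y, pd i (f γ) y = D.op x f γ y + c y * D.op (.inr 2) f γ y + q γ y * f γ y

theorem one_le_norm_two_pi_I : 1 ≤ ‖(2 * π * Complex.I : ℂ)‖ := by
  have := pi_gt_three
  simp only [norm_mul, Complex.norm_I, Complex.norm_ofNat, Complex.norm_real,
    Real.norm_of_nonneg pi_pos.le]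
  linarith

/-- On Y the twist by `areaForm` sits in the quasi-period of the coordinate 2, while the winding
acts undisturbed. -/
theorem isRegular_Y : IsRegular dataY 1 0 where
  quasiPeriodic f hf γ y := by
    have h := hf.equivariant (Pi.single 2 1) γ y
    have h1 : dataY.act (Pi.single 2 1) y = update y 2 (y 2 + 1) := by
      funext i
      obtain rfl | hi := eq_or_ne i 2
      · simp [dataY, add_comm]
      · simp [dataY, hi]
    have h2 : dataY.phase (Pi.single 2 1) γ y = ee (1 * areaForm γ y) := by
      simp [dataY, ee, Fin.sum_univ_four, eps, areaForm_apply]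
      congr 1
      ring
    rwa [h1, h2] at h
  mul := ⟨.inr 2, -(2 * π * Complex.I), by rw [norm_neg]; exact one_le_norm_two_pi_I, fun f γ y => by
    rw [dataY_op_inr]
    simp⟩
  pd_eq i := by
    refine ⟨.inl i, 0, fun γ y => -(π * Complex.I * (∑ j, ∑ k, (eps i j k : ℂ) * y j * γ k)),
      contDiff_const, fun γ => ?_, fun γ => ?_, fun f γ y => ?_⟩
    · have h : ∀ j : Fin 4, ContDiff ℝ ∞ fun y : R4 => (y j : ℂ) := fun j =>
        Complex.ofRealCLM.contDiff.comp (contDiff_apply ℝ ℝ j)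
      exact (contDiff_const.mul (ContDiff.sum fun j _ => ContDiff.sum fun k _ =>
        (contDiff_const.mul (h j)).mul contDiff_const)).neg
    -- The winding 2 enters the connection linearly, and its part k = 2 is split off as the
    -- coefficient of `n`.
    · have h := (linearGrowth_add (c := fun y => -(π * Complex.I * ∑ j, (eps i j 2 : ℂ) * y j))
        (d := fun y => -(π * Complex.I * ∑ j, ∑ k, if k = 2 then 0 else (eps i j k : ℂ) * y j * γ k))
        (by fun_prop) (by
          refine (continuous_const.mul (continuous_finsetSum _ fun j _ =>
            continuous_finsetSum _ fun k _ => ?_)).neg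
          split_ifs
          · exact continuous_const
          · fun_prop))
      convert h using 3 with n y
      simp [Fin.sum_univ_four]
      ring
    · rw [dataY_op_inl]
      simp only [Pi.zero_apply]
      ring

/-- On N functions are periodic in the coordinate 2, and the twist appears in the entry of y⁻¹γy by
which `β_2` acts. The parameters are those of Y exchanged. -/
theorem isRegular_N : IsRegular dataN 0 1 where
  quasiPeriodic f hf γ y := by
    have h := hf.equivariant (Pi.single 2 1) γ y
    have h1 : dataN.act (Pi.single 2 1) y = update y 2 (y 2 + 1) := by
      funext i
      obtain rfl | rfl | rfl | rfl := fin4_cases i <;> simp [dataN, kmul, latN, add_comm]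
    have h2 : dataN.conj (Pi.single 2 1) γ = γ := by
      funext i
      obtain rfl | rfl | rfl | rfl := fin4_cases i <;> simp [dataN]
    rw [h1, h2] at h
    rw [h, zero_mul, ee_zero]
    rfl
  mul := ⟨.inl 2, 2 * π * Complex.I, one_le_norm_two_pi_I, fun f γ y => by
    rw [dataN_op_inl_two]
    simp⟩
  pd_eq i := by
    have hc : ∀ (j : Fin 4) (c : ℂ), ContDiff ℝ ∞ fun y : R4 => c * (y j : ℂ) := fun j c =>
      contDiff_const.mul (Complex.ofRealCLM.contDiff.comp (contDiff_apply ℝ ℝ j))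
    have h0 : ∀ γ : Z4, LinearGrowth fun n => (0 : Z4 → R4 → ℂ) (update γ 2 n) := fun γ =>
      linearGrowth_of_continuous (c := 0) continuous_const
    obtain rfl | rfl | rfl | rfl := fin4_cases i
    · refine ⟨.inl 0, 0, 0, contDiff_const, fun γ => contDiff_const, h0, fun f γ y => ?_⟩
      rw [dataN_op_inl 0 (by decide)]
      simp
    · refine ⟨.inl 1, fun y => -(1 / 2) * y 3, 0, hc 3 _, fun γ => contDiff_const, h0,
        fun f γ y => ?_⟩
      rw [dataN_op_inl 1 (by decide), dataN_op_inr_two]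
      simp
      ring
    · refine ⟨.inr 2, fun y => -2, 0, contDiff_const, fun γ => contDiff_const, h0, fun f γ y => ?_⟩
      rw [dataN_op_inr_two]
      simp
      ring
    · refine ⟨.inl 3, fun y => 1 / 2 * y 1, 0, hc 1 _, fun γ => contDiff_const, h0,
        fun f γ y => ?_⟩
      rw [dataN_op_inl 3 (by decide), dataN_op_inr_two]
      simp
      ring

end

/-! ## The partial Fourier transform of zero modes -/

section

open Real Function

variable {D D' : ZeroModeData} {a b : ℝ} {f : Amb}

theorem op_mem_zeroModes (hf : f ∈ ZeroModes D) (x : Ix) : D.op x f ∈ ZeroModes D :=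
  (rhoBasis D x ⟨f, hf⟩).2

/-- Applying the multiplication operator k times yields a bounded family, so κ^k ‖f‖ is bounded for
every k. The bound is uniform in the point and in all windings. -/
theorem IsRegular.decay (hD : IsRegular D a b) (hf : f ∈ ZeroModes D) (k : ℕ) :
    ∃ C : ℝ, ∀ γ y, (1 + |γ 2 + 2 * b * areaForm γ y|) ^ k * ‖f γ y‖ ≤ C := by
  obtain ⟨x, z, hz, hx⟩ := hD.mul
  have hw : ∀ γ y, D.word (List.replicate k x) f γ y
      = (z * ((γ 2 + 2 * b * areaForm γ y : ℝ) : ℂ)) ^ k * f γ y := fun γ y => by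
    induction k with
    | zero => simp [ZeroModeData.word]
    | succ k ih =>
      have : D.word (List.replicate (k + 1) x) f = D.op x (D.word (List.replicate k x) f) := rfl
      rw [this, hx, ih, pow_succ']
      ring
  obtain ⟨C, hC⟩ := (hf (List.replicate k x)).bounded
  obtain ⟨C', hC'⟩ := (hf []).bounded
  refine ⟨2 ^ k * (C' + C), fun γ y => ?_⟩
  have h1 := hC γ y
  have h2 : ‖f γ y‖ ≤ C' := hC' γ y
  rw [hw, norm_mul, norm_pow, norm_mul, Complex.norm_real, Real.norm_eq_abs] at h1
  set κ := |γ 2 + 2 * b * areaForm γ y| with hκ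
  have hκ0 : 0 ≤ κ := abs_nonneg _
  -- 1 + κ is at most 2 or at most 2κ, according to whether κ ≤ 1.
  have h3 : (1 + κ) ^ k ≤ 2 ^ k * (1 + κ ^ k) := by
    rw [mul_add, mul_one, ← mul_pow]
    obtain h | h := le_total κ 1
    · have : (1 + κ) ^ k ≤ 2 ^ k := by gcongr; linarith
      have : 0 ≤ (2 * κ) ^ k := by positivity
      linarith
    · have : (1 + κ) ^ k ≤ (2 * κ) ^ k := by gcongr; linarith
      have : (0 : ℝ) ≤ 2 ^ k := by positivity
      linarith
  calc (1 + κ) ^ k * ‖f γ y‖ ≤ 2 ^ k * (1 + κ ^ k) * ‖f γ y‖ := by gcongr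
    _ = 2 ^ k * (‖f γ y‖ + κ ^ k * ‖f γ y‖) := by ring
    _ ≤ 2 ^ k * (C' + (‖z‖ * κ) ^ k * ‖f γ y‖) := by
      gcongr
      exact le_mul_of_one_le_left hκ0 hz
    _ ≤ _ := by gcongr

/-- For fixed γ the shift `2 * b * areaForm γ y` is bounded on balls, so decay in the shifted
winding is decay in `n`. -/
theorem IsRegular.rapid (hD : IsRegular D a b) (hf : f ∈ ZeroModes D) (γ : Z4) :
    Rapid fun n => f (update γ 2 n) := fun k R => by
  obtain ⟨C, hC⟩ := hD.decay hf k
  let r : ℝ := |2 * b| * (‖areaForm γ‖ * |R|)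
  refine ⟨(1 + r) ^ k * C, fun n y hy => ?_⟩
  have h1 := hC (update γ 2 n) y
  rw [areaForm_update, update_self] at h1
  have h2 : |2 * b * areaForm γ y| ≤ r := by
    rw [abs_mul]
    have := (areaForm γ).le_opNorm y
    rw [Real.norm_eq_abs] at this
    refine mul_le_mul_of_nonneg_left (this.trans ?_) (abs_nonneg _)
    gcongr
    exact hy.trans (le_abs_self R)
  have h3 : 1 + |(n : ℝ)| ≤ (1 + r) * (1 + |n + 2 * b * areaForm γ y|) := by
    have h4 : |(n : ℝ)| ≤ |n + 2 * b * areaForm γ y| + |2 * b * areaForm γ y| := by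
      have := abs_sub (n + 2 * b * areaForm γ y) (2 * b * areaForm γ y)
      rwa [add_sub_cancel_right] at this
    have h5 := abs_nonneg (n + 2 * b * areaForm γ y)
    have h6 : 0 ≤ r := (abs_nonneg _).trans h2
    nlinarith
  calc _ ≤ ((1 + r) * (1 + |n + 2 * b * areaForm γ y|)) ^ k * ‖f (update γ 2 n) y‖ := by gcongr
    _ = (1 + r) ^ k * ((1 + |n + 2 * b * areaForm γ y|) ^ k * ‖f (update γ 2 n) y‖) := by
      rw [mul_pow, mul_assoc]
    _ ≤ _ := by
      have h6 : 0 ≤ r := (abs_nonneg _).trans h2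
      exact mul_le_mul_of_nonneg_left h1 (by positivity)

theorem IsRegular.tame (hD : IsRegular D a b) (hf : f ∈ ZeroModes D) (γ : Z4) :
    Tame fun n => f (update γ 2 n) :=
  tame_of_pd (fun n => (hf []).smooth _) (hD.rapid hf γ) fun i => by
    obtain ⟨x, c, q, hc, -, hq, h⟩ := hD.pd_eq i
    have h1 : (fun n : ℤ => pd i (f (update γ 2 n))) = fun n y =>
        (D.op x f (update γ 2 n) y + c y * D.op (.inr 2) f (update γ 2 n) y)
          + q (update γ 2 n) y * f (update γ 2 n) y := by
      funext n y
      exact h f _ y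
    rw [h1]
    exact ((hD.rapid (op_mem_zeroModes hf x) γ).add ((hD.rapid (op_mem_zeroModes hf _) γ).mul_left
      (linearGrowth_of_continuous hc.continuous))).add ((hD.rapid hf γ).mul_left (hq γ))

/-- `core` with the parameters of the partial Fourier transform at `γ`, `y`. -/
def fiberCore (a b : ℝ) (γ : Z4) (y : R4) (Φ : ℤ → ℝ → ℂ) : ℂ :=
  core (b * areaForm γ y) (a * areaForm γ y) (y 2) (γ 2) Φ

/-- The partial Fourier transform in the coordinate `2` and the winding `2`. -/
def partialFourier (a b : ℝ) (f : Amb) : Amb := fun γ y =>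
  fiberCore a b γ y fun n s => f (update γ 2 n) (update y 2 s)

theorem fiberCore_const_mul (γ : Z4) (y : R4) (c : ℂ) (Φ : ℤ → ℝ → ℂ) :
    fiberCore a b γ y (fun n s => c * Φ n s) = c * fiberCore a b γ y Φ :=
  core_const_mul _ _ _ _ _ _

theorem fiberCore_add {Φ Ψ : ℤ → ℝ → ℂ} (h : IsNice Φ) (h' : IsNice Ψ) (γ : Z4) (y : R4) :
    fiberCore a b γ y (fun n s => Φ n s + Ψ n s) = fiberCore a b γ y Φ + fiberCore a b γ y Ψ :=
  h.core_add h' _ _ _ _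

theorem IsRegular.isNice (hD : IsRegular D a b) (hf : f ∈ ZeroModes D) (γ : Z4) (y : R4) :
    IsNice fun n s => f (update γ 2 n) (update y 2 s) :=
  (hD.tame hf γ).isNice y

theorem IsRegular.quasiPeriodic_update (hD : IsRegular D a b) (hf : f ∈ ZeroModes D) (γ : Z4)
    (y : R4) (n : ℤ) (s : ℝ) : f (update γ 2 n) (update y 2 (s + 1))
      = ee (a * areaForm γ y) * f (update γ 2 n) (update y 2 s) := by
  have h := hD.quasiPeriodic f (hf []) (update γ 2 n) (update y 2 s)
  rwa [update_self, update_idem, areaForm_update, areaForm_apply_update] at h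

theorem partialFourier_add (hD : IsRegular D a b) {g : Amb} (hf : f ∈ ZeroModes D)
    (hg : g ∈ ZeroModes D) :
    partialFourier a b (f + g) = partialFourier a b f + partialFourier a b g := by
  funext γ y
  exact fiberCore_add (hD.isNice hf γ y) (hD.isNice hg γ y) γ y

theorem partialFourier_smul (c : ℂ) :
    partialFourier a b (c • f) = c • partialFourier a b f := by
  funext γ y
  exact fiberCore_const_mul γ y c _

theorem IsRegular.isNice_pd (hD : IsRegular D a b) (hf : f ∈ ZeroModes D) (i : Fin 4) (γ : Z4)
    (y : R4) : IsNice fun n s => pd i (f (update γ 2 n)) (update y 2 s) :=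
  (hD.tame hf γ).isNice_fderiv y (Pi.single i 1)

/-- Integration by parts. -/
theorem IsRegular.fiberCore_pd_two (hD : IsRegular D a b) (hf : f ∈ ZeroModes D) (γ : Z4) (y : R4) :
    fiberCore a b γ y (fun n s => pd 2 (f (update γ 2 n)) (update y 2 s))
      = 2 * π * Complex.I * (γ 2 + ((a * areaForm γ y : ℝ) : ℂ)) * partialFourier a b f γ y := by
  refine core_deriv _ _ _ _ (fun n s => ?_) (fun n => (hD.isNice_pd hf 2 γ y).cont n)
    fun n s => hD.quasiPeriodic_update hf γ y n s
  have h1 := (hD.tame hf γ).hasFDerivAt n (update y 2 s)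
  have h2 : HasDerivAt (fun s : ℝ => update y 2 s) (Pi.single 2 1) s := hasDerivAt_update y 2 s
  exact h1.comp_hasDerivAt s h2

theorem IsRegular.hasFDerivAt_partialFourier (hD : IsRegular D a b) (hf : f ∈ ZeroModes D) (γ : Z4)
    (y : R4) : ∃ L : R4 →L[ℝ] ℂ, HasFDerivAt (partialFourier a b f γ) L y ∧
      ∀ v, L v = 2 * π * Complex.I * ((b * areaForm γ v : ℝ) : ℂ) * y 2 * partialFourier a b f γ y
        + 2 * π * Complex.I * v 2 *
            (fiberCore a b γ y (fun n s => n * f (update γ 2 n) (update y 2 s))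
              + ((b * areaForm γ y : ℝ) : ℂ) * partialFourier a b f γ y)
        + fiberCore a b γ y
            (fun n s => fderiv ℝ (f (update γ 2 n)) (update y 2 s) (update v 2 0))
        - 2 * π * Complex.I * ((a * areaForm γ v : ℝ) : ℂ)
            * fiberCore a b γ y (fun n s => s * f (update γ 2 n) (update y 2 s)) :=
  (hD.tame hf γ).hasFDerivAt_core (b • areaForm γ) (a • areaForm γ) (γ 2) y

theorem IsRegular.differentiable_partialFourier (hD : IsRegular D a b) (hf : f ∈ ZeroModes D)
    (γ : Z4) : Differentiable ℝ (partialFourier a b f γ) := fun y =>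
  (hD.hasFDerivAt_partialFourier hf γ y).choose_spec.1.differentiableAt

/-- The counterpart of integration by parts: the derivative acts on the character and brings down
its frequency, the winding plus the twist. -/
theorem IsRegular.pd_two_partialFourier (hD : IsRegular D a b) (hf : f ∈ ZeroModes D) (γ : Z4)
    (y : R4) : pd 2 (partialFourier a b f γ) y = 2 * π * Complex.I *
      (fiberCore a b γ y (fun n s => n * f (update γ 2 n) (update y 2 s))
        + ((b * areaForm γ y : ℝ) : ℂ) * partialFourier a b f γ y) := by
  obtain ⟨L, hL, h⟩ := hD.hasFDerivAt_partialFourier hf γ y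
  have h0 : update (Pi.single 2 1 : R4) 2 0 = 0 := by
    funext i
    obtain rfl | hi := eq_or_ne i 2
    · simp
    · simp [hi]
  have hz : fiberCore a b γ y (fun _ _ => (0 : ℂ)) = 0 := by
    simpa using fiberCore_const_mul (a := a) (b := b) γ y 0 0
  rw [pd, hL.fderiv, h, h0]
  simp [areaForm_apply, hz]

theorem IsRegular.pd_partialFourier (hD : IsRegular D a b) (hf : f ∈ ZeroModes D) {i : Fin 4}
    (hi : i ≠ 2) (γ : Z4) (y : R4) : pd i (partialFourier a b f γ) y
      = 2 * π * Complex.I * ((b * areaForm γ (Pi.single i 1) : ℝ) : ℂ) * y 2 * partialFourier a b f γ y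
        + fiberCore a b γ y (fun n s => pd i (f (update γ 2 n)) (update y 2 s))
        - 2 * π * Complex.I * ((a * areaForm γ (Pi.single i 1) : ℝ) : ℂ)
            * fiberCore a b γ y (fun n s => s * f (update γ 2 n) (update y 2 s)) := by
  obtain ⟨L, hL, h⟩ := hD.hasFDerivAt_partialFourier hf γ y
  have h0 : update (Pi.single i 1 : R4) 2 0 = Pi.single i 1 := by
    rw [update_eq_self_iff, Pi.single_eq_of_ne hi.symm]
  have h2 : (Pi.single i 1 : R4) 2 = 0 := Pi.single_eq_of_ne hi.symm _
  rw [pd, hL.fderiv, h, h0, h2]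
  simp only [pd]
  simp

/-- Bootstrapping: partial derivatives of `τ f` are combinations, with smooth coefficients, of
transforms of other zero modes. Differentiability of all transforms thus improves to any order by
induction. -/
theorem contDiff_of_intertwine {a' b' : ℝ} (hD' : IsRegular D' a' b') (τ : Amb → Amb)
    (hτ : ∀ f ∈ ZeroModes D, ∀ x, D'.op x (τ f) = τ (D.op x f))
    (hd : ∀ f ∈ ZeroModes D, ∀ γ, Differentiable ℝ (τ f γ)) (hf : f ∈ ZeroModes D) (γ : Z4) :
    ContDiff ℝ ∞ (τ f γ) := by
  rw [contDiff_infty]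
  intro n
  induction n generalizing f with
  | zero => exact contDiff_zero.2 (hd f hf γ).continuous
  | succ n ih =>
    have hle : ((n : ℕ) : WithTop ℕ∞) ≤ (⊤ : ℕ∞) := by exact_mod_cast le_top
    push_cast
    rw [contDiff_succ_iff_fderiv_apply]
    refine ⟨hd f hf γ, by simp, fun v => ?_⟩
    simp only [fderiv_apply_eq_pd]
    refine ContDiff.sum fun i _ => contDiff_const.mul ?_
    obtain ⟨x, c, q, hc, hq, -, h⟩ := hD'.pd_eq i
    have h1 : pd i (τ f γ) = fun y => τ (D.op x f) γ y + c y * τ (D.op (.inr 2) f) γ y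
        + q γ y * τ f γ y := by
      funext y
      rw [h, hτ f hf, hτ f hf]
    rw [h1]
    exact ((ih (op_mem_zeroModes hf x)).add ((hc.of_le hle).mul (ih (op_mem_zeroModes hf _)))).add
      (((hq γ).of_le hle).mul (ih hf))

theorem mem_zeroModes_of_intertwine (τ : Amb → Amb)
    (hτ : ∀ f ∈ ZeroModes D, ∀ x, D'.op x (τ f) = τ (D.op x f))
    (hg : ∀ f ∈ ZeroModes D, D'.Good (τ f)) (hf : f ∈ ZeroModes D) : τ f ∈ ZeroModes D' := by
  have hw : ∀ w : List Ix, D.word w f ∈ ZeroModes D ∧ D'.word w (τ f) = τ (D.word w f) := fun w => by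
    induction w with
    | nil => exact ⟨hf, rfl⟩
    | cons x w ih =>
      refine ⟨op_mem_zeroModes ih.1 x, ?_⟩
      change D'.op x (D'.word w (τ f)) = τ (D.op x (D.word w f))
      rw [ih.2, hτ _ ih.1]
  intro w
  rw [(hw w).2]
  exact hg _ (hw w).1

end

/-! ## The partial Fourier transform intertwines the basis vectors -/

section

open Real Function

variable {f : Amb}

theorem IsRegular.isNice_index {D : ZeroModeData} {a b : ℝ} (hD : IsRegular D a b)
    (hf : f ∈ ZeroModes D) (γ : Z4) (y : R4) :
    IsNice fun n s => n * f (update γ 2 n) (update y 2 s) :=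
  (hD.tame hf γ).isNice_index y

theorem IsRegular.isNice_mul {D : ZeroModeData} {a b : ℝ} (hD : IsRegular D a b)
    (hf : f ∈ ZeroModes D) (γ : Z4) (y : R4) :
    IsNice fun n s => s * f (update γ 2 n) (update y 2 s) :=
  (hD.tame hf γ).isNice_mul y

theorem IsNice.add {Φ Ψ : ℤ → ℝ → ℂ} (h : IsNice Φ) (h' : IsNice Ψ) :
    IsNice fun n s => Φ n s + Ψ n s := by
  obtain ⟨B, hB, hΦ⟩ := h.bound
  obtain ⟨B', hB', hΨ⟩ := h'.bound
  exact ⟨fun n => (h.cont n).add (h'.cont n), _, hB.add hB', fun n s hs =>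
    (norm_add_le _ _).trans (add_le_add (hΦ n s hs) (hΨ n s hs))⟩

/-- `∂_2` becomes multiplication by γ² + a, and the winding becomes `∂_2`. For `β_1` and `β_3` the
connection on Y contains a term in x², which is reproduced by differentiating the twist a in the
Fourier coefficient. -/
theorem dataN_op_partialFourier (hf : f ∈ ZeroModes dataY) (x : Ix) :
    dataN.op x (partialFourier 1 0 f) = partialFourier 1 0 (dataY.op x f) := by
  funext γ y
  have h0 := isRegular_Y.isNice hf γ y
  have hpd := fun i => isRegular_Y.isNice_pd hf i γ y
  have hidx := isRegular_Y.isNice_index hf γ y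
  have hmul := isRegular_Y.isNice_mul hf γ y
  have hR : partialFourier 1 0 (dataY.op x f) γ y
      = fiberCore 1 0 γ y fun n s => dataY.op x f (update γ 2 n) (update y 2 s) := rfl
  have hF : partialFourier 1 0 f γ y
      = fiberCore 1 0 γ y fun n s => f (update γ 2 n) (update y 2 s) := rfl
  rw [hR]
  rcases x with i | i <;> obtain rfl | rfl | rfl | rfl := fin4_cases i
  · have h : ∀ (n : ℤ) (s : ℝ), dataY.op (.inl 0) f (update γ 2 n) (update y 2 s)
        = pd 0 (f (update γ 2 n)) (update y 2 s) := fun n s => by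
      rw [dataY_op_inl]
      simp [eps]
    simp only [h]
    rw [dataN_op_inl 0 (by decide)]
    simp [isRegular_Y.pd_partialFourier hf, areaForm_apply]
  · have h : ∀ (n : ℤ) (s : ℝ), dataY.op (.inl 1) f (update γ 2 n) (update y 2 s)
        = (pd 1 (f (update γ 2 n)) (update y 2 s)
          + π * Complex.I * γ 3 * (s * f (update γ 2 n) (update y 2 s)))
          + -(π * Complex.I * y 3) * (n * f (update γ 2 n) (update y 2 s)) := fun n s => by
      rw [dataY_op_inl]
      simp [Fin.sum_univ_four, eps]
      ring
    simp only [h]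
    rw [fiberCore_add ((hpd 1).add (hmul.const_mul _)) (hidx.const_mul _),
      fiberCore_add (hpd 1) (hmul.const_mul _), fiberCore_const_mul, fiberCore_const_mul,
      dataN_op_inl 1 (by decide)]
    simp [isRegular_Y.pd_partialFourier hf, isRegular_Y.pd_two_partialFourier hf, areaForm_apply]
    ring
  · have h : ∀ (n : ℤ) (s : ℝ), dataY.op (.inl 2) f (update γ 2 n) (update y 2 s)
        = pd 2 (f (update γ 2 n)) (update y 2 s)
          + 2 * π * Complex.I * (areaForm γ y : ℝ) * f (update γ 2 n) (update y 2 s) := fun n s => by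
      rw [dataY_op_inl]
      simp only [Fin.sum_univ_four, eps, areaForm_apply]
      simp
      ring_nf
      simp
    simp only [h]
    rw [fiberCore_add (hpd 2) (h0.const_mul _), fiberCore_const_mul, isRegular_Y.fiberCore_pd_two hf,
      dataN_op_inl_two, hF]
    push_cast
    ring
  · have h : ∀ (n : ℤ) (s : ℝ), dataY.op (.inl 3) f (update γ 2 n) (update y 2 s)
        = (pd 3 (f (update γ 2 n)) (update y 2 s)
          + -(π * Complex.I * γ 1) * (s * f (update γ 2 n) (update y 2 s)))
          + π * Complex.I * y 1 * (n * f (update γ 2 n) (update y 2 s)) := fun n s => by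
      rw [dataY_op_inl]
      simp [Fin.sum_univ_four, eps]
      ring
    simp only [h]
    rw [fiberCore_add ((hpd 3).add (hmul.const_mul _)) (hidx.const_mul _),
      fiberCore_add (hpd 3) (hmul.const_mul _), fiberCore_const_mul, fiberCore_const_mul,
      dataN_op_inl 3 (by decide)]
    simp [isRegular_Y.pd_partialFourier hf, isRegular_Y.pd_two_partialFourier hf, areaForm_apply]
    ring
  · have h : ∀ (n : ℤ) (s : ℝ), dataY.op (.inr 0) f (update γ 2 n) (update y 2 s)
        = -(2 * π * Complex.I * γ 0) * f (update γ 2 n) (update y 2 s) := fun n s => by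
      rw [dataY_op_inr, update_of_ne (by decide)]
    simp only [h]
    rw [fiberCore_const_mul, dataN_op_inr 0 (by decide), hF]
  · have h : ∀ (n : ℤ) (s : ℝ), dataY.op (.inr 1) f (update γ 2 n) (update y 2 s)
        = -(2 * π * Complex.I * γ 1) * f (update γ 2 n) (update y 2 s) := fun n s => by
      rw [dataY_op_inr, update_of_ne (by decide)]
    simp only [h]
    rw [fiberCore_const_mul, dataN_op_inr 1 (by decide), hF]
  · have h : ∀ (n : ℤ) (s : ℝ), dataY.op (.inr 2) f (update γ 2 n) (update y 2 s)
        = -(2 * π * Complex.I) * (n * f (update γ 2 n) (update y 2 s)) := fun n s => by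
      rw [dataY_op_inr, update_self]
      ring
    simp only [h]
    rw [fiberCore_const_mul, dataN_op_inr_two, isRegular_Y.pd_two_partialFourier hf]
    push_cast
    ring
  · have h : ∀ (n : ℤ) (s : ℝ), dataY.op (.inr 3) f (update γ 2 n) (update y 2 s)
        = -(2 * π * Complex.I * γ 3) * f (update γ 2 n) (update y 2 s) := fun n s => by
      rw [dataY_op_inr, update_of_ne (by decide)]
    simp only [h]
    rw [fiberCore_const_mul, dataN_op_inr 3 (by decide), hF]

/-- In this direction the twist sits in the frequency of the character. Differentiating it in the
directions 1 and 3 gives a term in y² that cancels the corresponding part of the connection on Y. -/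
theorem dataY_op_partialFourier (hf : f ∈ ZeroModes dataN) (x : Ix) :
    dataY.op x (partialFourier 0 1 f) = partialFourier 0 1 (dataN.op x f) := by
  funext γ y
  have h0 := isRegular_N.isNice hf γ y
  have hpd := fun i => isRegular_N.isNice_pd hf i γ y
  have hidx := isRegular_N.isNice_index hf γ y
  have hR : partialFourier 0 1 (dataN.op x f) γ y
      = fiberCore 0 1 γ y fun n s => dataN.op x f (update γ 2 n) (update y 2 s) := rfl
  have hF : partialFourier 0 1 f γ y
      = fiberCore 0 1 γ y fun n s => f (update γ 2 n) (update y 2 s) := rfl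
  rw [hR]
  rcases x with i | i <;> obtain rfl | rfl | rfl | rfl := fin4_cases i
  · have h : ∀ (n : ℤ) (s : ℝ), dataN.op (.inl 0) f (update γ 2 n) (update y 2 s)
        = pd 0 (f (update γ 2 n)) (update y 2 s) := fun n s => by
      rw [dataN_op_inl 0 (by decide)]
      simp
    simp only [h]
    rw [dataY_op_inl]
    simp [isRegular_N.pd_partialFourier hf, areaForm_apply, Fin.sum_univ_four, eps]
  · have h : ∀ (n : ℤ) (s : ℝ), dataN.op (.inl 1) f (update γ 2 n) (update y 2 s)
        = pd 1 (f (update γ 2 n)) (update y 2 s)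
          + -(y 3 / 2 : ℂ) * pd 2 (f (update γ 2 n)) (update y 2 s) := fun n s => by
      rw [dataN_op_inl 1 (by decide)]
      simp
      ring
    simp only [h]
    rw [fiberCore_add (hpd 1) ((hpd 2).const_mul _), fiberCore_const_mul,
      isRegular_N.fiberCore_pd_two hf, dataY_op_inl]
    simp [isRegular_N.pd_partialFourier hf, areaForm_apply, Fin.sum_univ_four, eps]
    ring
  · have h : ∀ (n : ℤ) (s : ℝ), dataN.op (.inl 2) f (update γ 2 n) (update y 2 s)
        = 2 * π * Complex.I * (n * f (update γ 2 n) (update y 2 s))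
          + 4 * π * Complex.I * (areaForm γ y : ℝ) * f (update γ 2 n) (update y 2 s) := fun n s => by
      rw [dataN_op_inl_two, areaForm_update, areaForm_apply_update, update_self]
      ring
    simp only [h]
    rw [fiberCore_add (hidx.const_mul _) (h0.const_mul _), fiberCore_const_mul, fiberCore_const_mul,
      dataY_op_inl, isRegular_N.pd_two_partialFourier hf, hF]
    simp [areaForm_apply, Fin.sum_univ_four, eps]
    ring
  · have h : ∀ (n : ℤ) (s : ℝ), dataN.op (.inl 3) f (update γ 2 n) (update y 2 s)
        = pd 3 (f (update γ 2 n)) (update y 2 s)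
          + (y 1 / 2 : ℂ) * pd 2 (f (update γ 2 n)) (update y 2 s) := fun n s => by
      rw [dataN_op_inl 3 (by decide)]
      simp
    simp only [h]
    rw [fiberCore_add (hpd 3) ((hpd 2).const_mul _), fiberCore_const_mul,
      isRegular_N.fiberCore_pd_two hf, dataY_op_inl]
    simp [isRegular_N.pd_partialFourier hf, areaForm_apply, Fin.sum_univ_four, eps]
    ring
  · have h : ∀ (n : ℤ) (s : ℝ), dataN.op (.inr 0) f (update γ 2 n) (update y 2 s)
        = -(2 * π * Complex.I * γ 0) * f (update γ 2 n) (update y 2 s) := fun n s => by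
      rw [dataN_op_inr 0 (by decide), update_of_ne (by decide)]
    simp only [h]
    rw [fiberCore_const_mul, dataY_op_inr, hF]
  · have h : ∀ (n : ℤ) (s : ℝ), dataN.op (.inr 1) f (update γ 2 n) (update y 2 s)
        = -(2 * π * Complex.I * γ 1) * f (update γ 2 n) (update y 2 s) := fun n s => by
      rw [dataN_op_inr 1 (by decide), update_of_ne (by decide)]
    simp only [h]
    rw [fiberCore_const_mul, dataY_op_inr, hF]
  · have h : ∀ (n : ℤ) (s : ℝ), dataN.op (.inr 2) f (update γ 2 n) (update y 2 s)
        = -1 * pd 2 (f (update γ 2 n)) (update y 2 s) := fun n s => by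
      rw [dataN_op_inr_two, neg_one_mul]
    simp only [h]
    rw [fiberCore_const_mul, isRegular_N.fiberCore_pd_two hf, dataY_op_inr]
    simp
  · have h : ∀ (n : ℤ) (s : ℝ), dataN.op (.inr 3) f (update γ 2 n) (update y 2 s)
        = -(2 * π * Complex.I * γ 3) * f (update γ 2 n) (update y 2 s) := fun n s => by
      rw [dataN_op_inr 3 (by decide), update_of_ne (by decide)]
    simp only [h]
    rw [fiberCore_const_mul, dataY_op_inr, hF]

end

/-! ## Equivariance and boundedness of the partial Fourier transform -/

section

open Real Function

variable {f : Amb}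

theorem coef_congr {α α' : ℝ} {m m' : ℤ} {h h' : ℝ → ℂ} (c : ℝ)
    (H : ∀ s : ℝ, ee (-(s * (m' + α'))) * h' s = ee c * (ee (-(s * (m + α))) * h s)) :
    coef α' m' h' = ee c * coef α m h := by
  simp only [coef, H]
  exact intervalIntegral.integral_const_mul _ _

/-- Conjugation changes γ² by an integer and a by minus half of it, so γ² + a changes by one half.
The quasi-periodicity factor of `f` under the translation by `lam` compensates this. -/
theorem partialFourier_equivariant_Y (hf : dataY.Good f) (δ γ : Z4) (y : R4) :
    partialFourier 1 0 f (dataN.conj δ γ) (dataN.act δ y) = partialFourier 1 0 f γ y := by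
  -- The coordinate 2 is integrated out, so only the other components translate `f`. The component
  -- δ² acts on the character and disappears because n δ² is an integer.
  let lam : Z4 := ![δ 0, δ 1, 0, δ 3]
  have hγ : ∀ n, update (dataN.conj δ γ) 2 n = update γ 2 n := fun n => by
    funext i
    obtain rfl | rfl | rfl | rfl := fin4_cases i <;> simp [dataN]
  have hy : ∀ s, update (dataN.act δ y) 2 s = dataY.act lam (update y 2 s) := fun s => by
    funext i
    obtain rfl | rfl | rfl | rfl := fin4_cases i <;> simp [dataN, dataY, kmul, latN, lam]
  -- The part proportional to `n` corrects the coordinate 2 of the translated point in the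
  -- character; the part proportional to `s` corrects the frequency.
  have hp : ∀ (n : ℤ) (s : ℝ), dataY.phase lam (update γ 2 n) (update y 2 s)
      = ee (n * (y 2 + δ 2) - n * dataN.act δ y 2
        + s * ((δ 1 * γ 3 - δ 3 * γ 1) / 2)) := fun n s => by
    simp [dataY, dataN, ee, Fin.sum_univ_four, eps, kmul, latN, lam]
    congr 1
    ring
  have hA : areaForm (dataN.conj δ γ) (dataN.act δ y)
      = areaForm γ y - (δ 1 * γ 3 - δ 3 * γ 1) / 2 := by
    simp [areaForm_apply, dataN, kmul, latN]
    ring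
  have h2 : dataN.conj δ γ 2 = γ 2 + (δ 1 * γ 3 - δ 3 * γ 1) := rfl
  refine tsum_congr fun n => ?_
  simp only [hγ, hy]
  rw [coef_congr (α := 1 * areaForm γ y) (m := γ 2)
    (h := fun s => f (update γ 2 n) (update y 2 s)) (n * (y 2 + δ 2) - n * dataN.act δ y 2) fun s => ?_,
    ← mul_assoc, ← ee_add]
  · congr 1
    rw [show ((n : ℝ) + 0 * areaForm (dataN.conj δ γ) (dataN.act δ y)) * dataN.act δ y 2
      + (n * (y 2 + δ 2) - n * dataN.act δ y 2) = (n + 0 * areaForm γ y) * y 2 + ((n * δ 2 : ℤ) : ℝ) by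
        push_cast; ring, ee_add, ee_int, mul_one]
  · have he : f (update γ 2 n) (dataY.act lam (update y 2 s)) = _ :=
      hf.equivariant lam (update γ 2 n) (update y 2 s)
    rw [he, hp, ← mul_assoc, ← mul_assoc, ← ee_add, ← ee_add, hA, h2]
    congr 2
    push_cast
    ring

/-- Invariance on N shifts the winding 2 by `k` and the coordinate 2 by `c`. The first is absorbed
by reindexing the sum, the second by `coef_shift`, and the resulting characters make up the phase on
Y. -/
theorem partialFourier_equivariant_N (hf : dataN.Good f) (lam γ : Z4) (y : R4) :
    partialFourier 0 1 f γ (dataY.act lam y)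
      = dataY.phase lam γ y * partialFourier 0 1 f γ y := by
  let δ : Z4 := ![lam 0, lam 1, 0, lam 3]
  let k : ℤ := lam 1 * γ 3 - lam 3 * γ 1
  let c : ℝ := -(lam 1 * lam 3 / 2) + (lam 1 * y 3 - lam 3 * y 1) / 2
  have hγ : ∀ n, dataN.conj δ (update γ 2 n) = update γ 2 (n + k) := fun n => by
    funext i
    obtain rfl | rfl | rfl | rfl := fin4_cases i <;> simp [dataN, δ, k]
  have hy : ∀ s, dataN.act δ (update y 2 s) = update (dataY.act lam y) 2 (s + c) := fun s => by
    funext i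
    obtain rfl | rfl | rfl | rfl := fin4_cases i <;> simp [dataN, dataY, kmul, latN, δ, c]
    ring
  have hf' : ∀ (n : ℤ) (s : ℝ), f (update γ 2 (n + k)) (update (dataY.act lam y) 2 (s + c))
      = f (update γ 2 n) (update y 2 s) := fun n s => by
    have h := hf.equivariant δ (update γ 2 n) (update y 2 s)
    rw [hγ, hy] at h
    rw [h]
    exact one_mul _
  have hcoef : ∀ n : ℤ, coef (0 * areaForm γ (dataY.act lam y)) (γ 2)
      (fun s => f (update γ 2 (n + k)) (update (dataY.act lam y) 2 s))
        = ee (-(c * γ 2)) * coef (0 * areaForm γ y) (γ 2) (fun s => f (update γ 2 n) (update y 2 s)) :=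
    fun n => by
      have h := coef_shift 0 (γ 2) (h := fun s => f (update γ 2 (n + k)) (update (dataY.act lam y) 2 s))
        (fun s => by
          have h := isRegular_N.quasiPeriodic f hf (update γ 2 (n + k)) (update (dataY.act lam y) 2 s)
          rwa [update_self, update_idem, zero_mul] at h) c
      simp only [hf', add_zero] at h
      rw [zero_mul, zero_mul, h, ← mul_assoc, ee_neg_mul, one_mul]
  have hA : areaForm γ (dataY.act lam y) = areaForm γ y - k / 2 := by
    simp [areaForm_apply, dataY, k]
    ring
  have h2 : dataY.act lam y 2 = lam 2 + y 2 := rfl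
  have hp : dataY.phase lam γ y = ee (k / 2 * y 2 + areaForm γ y * lam 2 - c * γ 2
      + (γ 1 * lam 2 * lam 3 + γ 3 * lam 1 * lam 2) / 2) := by
    simp [dataY, ee, Fin.sum_univ_four, eps, areaForm_apply, c, k]
    congr 1
    ring
  rw [partialFourier, fiberCore, core, partialFourier, fiberCore, core, ← tsum_mul_left,
    ← (Equiv.addRight k).tsum_eq]
  refine tsum_congr fun n => ?_
  rw [Equiv.coe_addRight, hcoef, ← mul_assoc, ← mul_assoc, hA, h2, hp, ← ee_add, ← ee_add]
  congr 1
  -- The two exponents differ by the integer n λ² - γ¹ λ² λ³.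
  rw [show (((n + k : ℤ) : ℝ) + 1 * (areaForm γ y - k / 2)) * (lam 2 + y 2) + -(c * γ 2)
    = k / 2 * y 2 + areaForm γ y * lam 2 - c * γ 2
      + (γ 1 * lam 2 * lam 3 + γ 3 * lam 1 * lam 2) / 2 + (n + 1 * areaForm γ y) * y 2
      + ((n * lam 2 - γ 1 * lam 2 * lam 3 : ℤ) : ℝ) by simp only [k]; push_cast; ring, ee_add, ee_int,
    mul_one]

/-- Local decay in `n` does not suffice, since the bound must be uniform in γ and y. The uniform
`decay` is centred at -2ba, so the sum is recentred at an integer near this point. -/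
theorem IsRegular.bounded_partialFourier {D : ZeroModeData} {a b : ℝ} (hD : IsRegular D a b)
    (hf : f ∈ ZeroModes D) : ∃ C : ℝ, ∀ γ y, ‖partialFourier a b f γ y‖ ≤ C := by
  obtain ⟨C, hC⟩ := hD.decay hf 2
  have hC0 : 0 ≤ C := le_trans (by positivity) (hC 0 0)
  refine ⟨∑' n : ℤ, 4 * C * ((1 + |(n : ℝ)|) ^ 2)⁻¹, fun γ y => ?_⟩
  -- Rounding changes the centre by less than 1, which costs a factor 2 in 1 + |n + x| and hence 4
  -- in its square.
  let j : ℤ := ⌊2 * b * areaForm γ y⌋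
  have hs : Summable fun n : ℤ => 4 * C * ((1 + |(n : ℝ)|) ^ 2)⁻¹ :=
    summable_inv_one_add_abs_sq.mul_left _
  rw [← (Equiv.addRight j).tsum_eq]
  refine norm_core_le _ _ _ _ ((Equiv.addRight j).summable_iff.2 hs) fun n s _ => ?_
  have h1 := hC (update γ 2 n) (update y 2 s)
  rw [areaForm_update, areaForm_apply_update, update_self] at h1
  set x := 2 * b * areaForm γ y with hx
  have h2 : 1 + |((n + j : ℤ) : ℝ)| ≤ 2 * (1 + |n + x|) := by
    have h3 : |((n + j : ℤ) : ℝ)| ≤ |n + x| + |Int.fract x| := by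
      have := abs_sub (n + x) (Int.fract x)
      have h4 : ((n + j : ℤ) : ℝ) = n + x - Int.fract x := by
        rw [Int.fract]
        push_cast
        ring
      rwa [← h4] at this
    rw [Int.abs_fract] at h3
    have := Int.fract_lt_one x
    have := abs_nonneg (n + x)
    linarith
  rw [Equiv.coe_addRight, ← div_eq_mul_inv, le_div_iff₀ (by positivity)]
  calc _ ≤ ‖f (update γ 2 n) (update y 2 s)‖ * (2 * (1 + |n + x|)) ^ 2 := by gcongr
    _ = 4 * ((1 + |n + x|) ^ 2 * ‖f (update γ 2 n) (update y 2 s)‖) := by ring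
    _ ≤ _ := by linarith

/-- The partial Fourier transforms for the two targets are inverse to each other. -/
theorem IsRegular.partialFourier_partialFourier {D D' : ZeroModeData} {a b : ℝ}
    (hD : IsRegular D a b) (hD' : IsRegular D' b a) (hf : f ∈ ZeroModes D)
    (hf' : partialFourier a b f ∈ ZeroModes D') :
    partialFourier b a (partialFourier a b f) = f := by
  funext γ y
  have h1 := hD'.isNice hf' γ y
  -- `areaForm` involves neither the winding 2 nor the coordinate 2, so the transform acts within a
  -- fibre with constant parameters, and one-variable inversion applies.
  have hfib : (fun n s => partialFourier a b f (update γ 2 n) (update y 2 s))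
      = fun m x => core (b * areaForm γ y) (a * areaForm γ y) x m
          fun n s => f (update γ 2 n) (update y 2 s) := by
    funext m x
    simp only [partialFourier, fiberCore, areaForm_update, areaForm_apply_update, update_idem,
      update_self]
  rw [hfib] at h1
  have h2 := (hD.isNice hf γ y).core_core
    (fun n s => hD.quasiPeriodic_update hf γ y n s) h1 (γ 2) (y 2)
  rw [update_eq_self, update_eq_self] at h2
  rw [← h2]
  conv_lhs => rw [partialFourier, fiberCore, hfib]

end

/-! ## The partial Fourier transform preserves norms -/

section

open Real Function

/-- Isolates the sum over the winding 2, in which the fibrewise Parseval identity takes place. The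
inserted 0 is a placeholder that `update` overwrites. -/
theorem lintegral_zmMeasure {F : Z4 → R4 → ℝ≥0∞} (hF : ∀ γ, Measurable (F γ)) :
    ∫⁻ x, F x.1 x.2 ∂zmMeasure = ∑' c : Fin 3 → ℤ,
      ∫⁻ y, ∑' n : ℤ, F (update (Fin.insertNth 2 0 c : Z4) 2 n) y
        ∂Measure.pi fun _ : Fin 4 => (volume : Measure ℝ).restrict (Set.Icc 0 1) := by
  have hm : Measurable fun x : Z4 × R4 => F x.1 x.2 := measurable_from_prod_countable_right hF
  have hμ : (volume : Measure R4).restrict (Set.Icc 0 1)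
      = Measure.pi fun _ : Fin 4 => (volume : Measure ℝ).restrict (Set.Icc 0 1) := by
    rw [← Measure.restrict_pi_pi, ← volume_pi, ← Set.pi_univ_Icc]
    rfl
  rw [zmMeasure, lintegral_prod _ hm.aemeasurable, lintegral_count, hμ,
    ← (Fin.insertNthEquiv (fun _ : Fin 4 => ℤ) 2).tsum_eq, ENNReal.tsum_prod', ENNReal.tsum_comm]
  refine tsum_congr fun c => ?_
  rw [lintegral_tsum fun n => (hF _).aemeasurable]
  refine tsum_congr fun n => ?_
  rw [Fin.update_insertNth]
  rfl

/-- By Tonelli's theorem it is enough to compare after summing over the winding 2 and integrating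
over the coordinate 2. -/
theorem lintegral_zmMeasure_congr {F G : Z4 → R4 → ℝ≥0∞} (hF : ∀ γ, Measurable (F γ))
    (hG : ∀ γ, Measurable (G γ))
    (h : ∀ γ y, ∑' n : ℤ, ∫⁻ s in Set.Icc (0 : ℝ) 1, F (update γ 2 n) (update y 2 s)
      = ∑' n : ℤ, ∫⁻ s in Set.Icc (0 : ℝ) 1, G (update γ 2 n) (update y 2 s)) :
    ∫⁻ x, F x.1 x.2 ∂zmMeasure = ∫⁻ x, G x.1 x.2 ∂zmMeasure := by
  rw [lintegral_zmMeasure hF, lintegral_zmMeasure hG]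
  refine tsum_congr fun c => ?_
  refine lintegral_eq_of_lmarginal_eq {2} (Measurable.tsum fun n => hF _)
    (Measurable.tsum fun n => hG _) ?_
  rw [lmarginal_singleton, lmarginal_singleton]
  funext y
  have hu : Measurable fun s : ℝ => update y 2 s := measurable_update y
  exact (lintegral_tsum fun n => ((hF _).comp hu).aemeasurable).trans
    ((h _ y).trans (lintegral_tsum fun n => ((hG _).comp hu).aemeasurable).symm)

variable {D : ZeroModeData} {a b : ℝ} {f : Amb}

theorem IsRegular.lintegral_partialFourier (hD : IsRegular D a b) (hf : f ∈ ZeroModes D) :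
    ∫⁻ x, ‖partialFourier a b f x.1 x.2‖ₑ ^ 2 ∂zmMeasure
      = ∫⁻ x : Z4 × R4, ‖f x.1 x.2‖ₑ ^ 2 ∂zmMeasure := by
  refine lintegral_zmMeasure_congr (F := fun γ y => ‖partialFourier a b f γ y‖ₑ ^ 2)
    (G := fun γ y => ‖f γ y‖ₑ ^ 2)
    (fun γ => ((hD.differentiable_partialFourier hf γ).continuous.measurable.enorm).pow_const 2)
    (fun γ => (((hf []).smooth γ).continuous.measurable.enorm).pow_const 2) fun γ y => ?_
  rw [← (hD.isNice hf γ y).tsum_core_sq (b * areaForm γ y) (a * areaForm γ y)]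
  simp only [partialFourier, fiberCore, areaForm_update, areaForm_apply_update, update_idem,
    update_self]

theorem eLpNorm_two_zmMeasure (g : Z4 × R4 → ℂ) :
    eLpNorm g 2 zmMeasure = (∫⁻ x, ‖g x‖ₑ ^ 2 ∂zmMeasure) ^ (1 / 2 : ℝ) := by
  rw [eLpNorm_eq_lintegral_rpow_enorm_toReal two_ne_zero ENNReal.ofNat_ne_top]
  simp

theorem IsRegular.eLpNorm_partialFourier (hD : IsRegular D a b) (hf : f ∈ ZeroModes D) :
    eLpNorm (fun x : Z4 × R4 => partialFourier a b f x.1 x.2) 2 zmMeasure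
      = eLpNorm (fun x : Z4 × R4 => f x.1 x.2) 2 zmMeasure := by
  rw [eLpNorm_two_zmMeasure, eLpNorm_two_zmMeasure, hD.lintegral_partialFourier hf]

theorem IsRegular.memLp_partialFourier (hD : IsRegular D a b) (hf : f ∈ ZeroModes D) :
    MemLp (fun x : Z4 × R4 => partialFourier a b f x.1 x.2) 2 zmMeasure := by
  refine ⟨Measurable.aestronglyMeasurable (measurable_from_prod_countable_right fun γ =>
    (hD.differentiable_partialFourier hf γ).continuous.measurable), ?_⟩
  rw [hD.eLpNorm_partialFourier hf]
  exact (hf []).memLp.2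

theorem partialFourier_mem_zeroModes_N (hf : f ∈ ZeroModes dataY) :
    partialFourier 1 0 f ∈ ZeroModes dataN :=
  mem_zeroModes_of_intertwine _ (fun _ hf x => dataN_op_partialFourier hf x) (fun _ hf =>
    ⟨contDiff_of_intertwine isRegular_N _ (fun _ hf x => dataN_op_partialFourier hf x)
      (fun _ hf γ => isRegular_Y.differentiable_partialFourier hf γ) hf,
    fun δ γ y => (partialFourier_equivariant_Y (hf []) δ γ y).trans (one_mul _).symm,
    isRegular_Y.bounded_partialFourier hf, isRegular_Y.memLp_partialFourier hf⟩) hf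

theorem partialFourier_mem_zeroModes_Y (hf : f ∈ ZeroModes dataN) :
    partialFourier 0 1 f ∈ ZeroModes dataY :=
  mem_zeroModes_of_intertwine _ (fun _ hf x => dataY_op_partialFourier hf x) (fun _ hf =>
    ⟨contDiff_of_intertwine isRegular_Y _ (fun _ hf x => dataY_op_partialFourier hf x)
      (fun _ hf γ => isRegular_N.differentiable_partialFourier hf γ) hf,
    fun δ γ y => partialFourier_equivariant_N (hf []) δ γ y,
    isRegular_N.bounded_partialFourier hf, isRegular_N.memLp_partialFourier hf⟩) hf

/-- The partial Fourier transform, as an isomorphism of the spaces of zero modes. -/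
def zeroModesEquiv : ZeroModes dataY ≃ₗ[ℂ] ZeroModes dataN where
  toFun f := ⟨partialFourier 1 0 f.1, partialFourier_mem_zeroModes_N f.2⟩
  invFun f := ⟨partialFourier 0 1 f.1, partialFourier_mem_zeroModes_Y f.2⟩
  map_add' f g := Subtype.ext (partialFourier_add isRegular_Y f.2 g.2)
  map_smul' c _ := Subtype.ext (partialFourier_smul c)
  left_inv f := Subtype.ext
    (isRegular_Y.partialFourier_partialFourier isRegular_N f.2 (partialFourier_mem_zeroModes_N f.2))
  right_inv f := Subtype.ext
    (isRegular_N.partialFourier_partialFourier isRegular_Y f.2 (partialFourier_mem_zeroModes_Y f.2))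

theorem zeroModesEquiv_rho (u : GC) (f : ZeroModes dataY) :
    zeroModesEquiv (rho dataY u f) = rho dataN u (zeroModesEquiv f) := by
  simp only [rho, LinearMap.sum_apply, LinearMap.smul_apply, map_sum, map_smul]
  refine Finset.sum_congr rfl fun x _ => congrArg _ (Subtype.ext ?_)
  exact (dataN_op_partialFourier f.2 x).symm

theorem exists_zeroModes_equiv : ∃ t : ZeroModes dataY ≃ₗ[ℂ] ZeroModes dataN,
    (∀ u f, t (rho dataY u f) = rho dataN u (t f)) ∧
      ∀ f, ‖zmToLp dataN (t f)‖ = ‖zmToLp dataY f‖ := by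
  refine ⟨zeroModesEquiv, zeroModesEquiv_rho, fun f => ?_⟩
  refine (Lp.norm_toLp _ ((zeroModesEquiv f).2 []).memLp).trans
    (Eq.trans ?_ (Lp.norm_toLp _ (f.2 []).memLp).symm)
  exact congrArg ENNReal.toReal (isRegular_Y.eLpNorm_partialFourier f.2)

end

end MirrorKT

end

/-! ### Assembling the isomorphisms -/

open MirrorKT

theorem mainTheorem4 :
    ∃ (t : MirrorKT.ZeroModes MirrorKT.dataY ≃ₗ[ℂ] MirrorKT.ZeroModes MirrorKT.dataN)
      (T : MirrorKT.Ind MirrorKT.dataY ≃ₗ[MirrorKT.ModeAlg] MirrorKT.Ind MirrorKT.dataN)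
      (U : MirrorKT.StateSpace MirrorKT.dataY ≃ₗᵢ[ℂ] MirrorKT.StateSpace MirrorKT.dataN)
      (Φ : MirrorKT.GCY MirrorKT.targetY ≃ MirrorKT.GCY MirrorKT.targetN),
      -- (a) the identification is unitary, on zero modes and on the Hilbert spaces of states,
      -- and compatible with the module structures and parity
      ((∀ u f, t (MirrorKT.rho MirrorKT.dataY u f) = MirrorKT.rho MirrorKT.dataN u (t f)) ∧
        (∀ f g, inner ℂ (MirrorKT.zmToLp MirrorKT.dataN (t f)) (MirrorKT.zmToLp MirrorKT.dataN (t g))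
          = inner ℂ (MirrorKT.zmToLp MirrorKT.dataY f) (MirrorKT.zmToLp MirrorKT.dataY g)) ∧
        (∀ f, T (MirrorKT.vac MirrorKT.dataY f) = MirrorKT.vac MirrorKT.dataN (t f)) ∧
        (∀ a v, T v ∈ MirrorKT.parityPart MirrorKT.dataN a ↔
          v ∈ MirrorKT.parityPart MirrorKT.dataY a) ∧
        (∀ v, U (MirrorKT.toState MirrorKT.dataY v) = MirrorKT.toState MirrorKT.dataN (T v))) ∧
      -- (b) the bijection is the one given by the framings
      (∀ 𝒥 A, MirrorKT.HasFrameMatrix MirrorKT.targetY 𝒥.1 A ↔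
        MirrorKT.HasFrameMatrix MirrorKT.targetN (Φ 𝒥).1 A) ∧
      -- (c) corresponding structures have attached `N = 2` structures, which are intertwined
      (∀ 𝒥, ∃ (SY : MirrorKT.N2Structure 12 (MirrorKT.Ind MirrorKT.dataY))
          (SN : MirrorKT.N2Structure 12 (MirrorKT.Ind MirrorKT.dataN)),
        MirrorKT.IsAttached MirrorKT.targetY 𝒥.1 SY ∧
        MirrorKT.IsAttached MirrorKT.targetN (Φ 𝒥).1 SN ∧
        ∀ n v, T (SY.L n v) = SN.L n (T v) ∧ T (SY.J n v) = SN.J n (T v) ∧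
          T (SY.Gp n v) = SN.Gp n (T v) ∧ T (SY.Gm n v) = SN.Gm n (T v)) := by
  obtain ⟨t, ht, hn⟩ := exists_zeroModes_equiv
  refine ⟨t, indEquiv t ht, stateEquiv t ht hn, gcyEquiv isModel_Y isModel_N,
    ⟨ht, inner_eq_of_norm_eq (zmToLp dataY) (zmToLp dataN ∘ₗ t.toLinearMap) hn, fun f => rfl,
      indEquiv_parity_iff t ht, stateEquiv_toState t ht hn⟩,
    hasFrameMatrix_gcyEquiv isModel_Y isModel_N, fun 𝒥 => ?_⟩
  have hY := isModel_Y.exists_frameMatrix 𝒥.2.equivariant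
  have hN := (hasFrameMatrix_gcyEquiv isModel_Y isModel_N 𝒥 _).1 hY
  obtain ⟨S, hS⟩ := (isModel_Y.isFrameGC hY 𝒥.2.toIsEquivariantGC).exists_isAttached isOrthoFrame_Y hY
    dataY
  -- The structure on N is the conjugate of the one on Y, so the intertwining is automatic. It is
  -- attached to the image of 𝒥 because both sides have the same dual bases and T commutes with the
  -- modes of the super-field.
  refine ⟨S, conjN2 (indEquivC t ht) S, hS, conjN2_isAttached t ht (fun e e' => ?_) hS, fun n v => ?_⟩
  · rw [isDualBasis_iff isOrthoFrame_Y hY, isDualBasis_iff isOrthoFrame_N hN]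
  · have h : ∀ X : Module.End ℂ (Ind dataY),
        indEquiv t ht (X v) = (indEquivC t ht).conj X (indEquiv t ht v) := fun X => by
      have hv : (indEquivC t ht).symm (indEquiv t ht v) = v := (indEquivC t ht).symm_apply_apply v
      rw [LinearEquiv.conj_apply_apply, hv]
      rfl
    exact ⟨h _, h _, h _, h _⟩
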